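/- **Model.** There are $k\ge 1$ sites and a coordinator. A stream of items $(e_1,w_1),\dots,(e_n,w_n)$, $n\ge 1$, with positive integer weights arrives one item at a time, each item at one of the sites; the stream and its partition among the sites are chosen by an adversary. When an item arrives, its site may send messages to the coordinator; the coordinator then handles them in FIFO order and may send messages to the sites, which handle them before the next item arrives. Each message consists of a constant number of machine words. Every processor is a word RAM in which arithmetic on machine words and drawing a uniformly random integer below a given word take unit time. A machine word has $b$ bits, where $b\ge c\log_2(2ksnW)$ for an absolute constant $c$ (so that identifiers, weights, $k$ and $s$ fit in a word), and $W=w_1+\dots+w_n$ is the total weight received so far. The programs are fixed; $k$, $s$, $b$, and at each site its index, are given to them as input. A *weighted random sample with replacement* of size $s\ge 1$ from the items received so far consists of $s$ independent draws, each of which is the item $(e_j,w_j)$ (each occurrence being regarded as a different item) with probability $w_j/W$. **Statement.** There is a distributed algorithm and an absolute constant $C$ such that for all $k,s\ge 1$ and all streams, after each item has been handled, the coordinator's memory holds a weighted random sample with replacement of size $s$ from all items received so far, and: * the coordinator never uses more than $C s$ words of memory, and no site ever uses more than $C$ words; * if $W\ge 2$, the expected number of messages sent so far (in both directions) is at most $$B:=C\,(k+s\log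 s)\,\frac{\log W}{\log(2+k/s)};$$ * if $W\ge 2$, the expected total running time of the coordinator so far is at most $B$; * if $W\ge 2$, the expected running time of all sites so far, divided by the number $n$ of items received, is at most $$C\Bigl(1+\frac1n\,(k+s\log s)\,\frac{\log W}{\log(2+k/s)}\Bigr).$$ -/

import Mathlib

open scoped ENNReal Topology

noncomputable section

namespace DistSampling

/-! ## A randomized word RAM

A processor has a memory of cells addressed by natural numbers; every cell holds one machine word,
that is a natural number `< 2 ^ b`, where `b` is the word length.  A program is a fixed finite text.
-/

/-- Binary operations on machine words. -/
inductive BinOp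
  | add | sub | mul | div | mod | shl | shr | lt | eq

/-- Value of a binary operation before it is reduced to a machine word
(subtraction is truncated at zero, division by zero gives zero, comparisons give `0` or `1`). -/
def BinOp.eval : BinOp → ℕ → ℕ → ℕ
  | .add, x, y => x + y
  | .sub, x, y => x - y
  | .mul, x, y => x * y
  | .div, x, y => x / y
  | .mod, x, y => x % y
  | .shl, x, y => x * 2 ^ y
  | .shr, x, y => x / 2 ^ y
  | .lt, x, y => if x < y then 1 else 0
  | .eq, x, y => if x = y then 1 else 0

/-- Programs.  The arguments of type `ℕ` are fixed cell addresses (except `v` in `const`).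
The payload of a `send` lists the cells whose contents are transmitted; since it is part of the
program text, every message has a constant number of words. -/
inductive Cmd
  /-- do nothing -/
  | skip
  /-- `mem[a] := v` -/
  | const (a v : ℕ)
  /-- `mem[a] := mem[x] o mem[y]` -/
  | op (o : BinOp) (a x y : ℕ)
  /-- `mem[a] := mem[mem[x]]` -/
  | load (a x : ℕ)
  /-- `mem[mem[a]] := mem[x]` -/
  | store (a x : ℕ)
  /-- `mem[a] :=` a fresh uniformly random number in `{0, …, mem[x] - 1}` -/
  | rand (a x : ℕ)
  /-- transmit one message; the coordinator sends it to the site whose index is `mem[dest]`,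
  a site always sends to the coordinator -/
  | send (dest : ℕ) (payload : List ℕ)
  /-- sequential composition -/
  | seq (p q : Cmd)
  /-- if `mem[x] ≠ 0` then `p` else `q` -/
  | branch (x : ℕ) (p q : Cmd)
  /-- while `mem[x] ≠ 0` do `p` -/
  | loop (x : ℕ) (p : Cmd)

/-- Memory contents. -/
abbrev Mem := ℕ → ℕ

/-- Write a word into a cell. -/
def Mem.write (b : ℕ) (m : Mem) (a v : ℕ) : Mem := Function.update m a (v % 2 ^ b)

/-- A uniformly random element of `{0, …, M - 1}` (and `0` if `M = 0`). -/
def uniformBelow (M : ℕ) : PMF ℕ :=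
  if h : 0 < M then PMF.uniformOfFinset (Finset.range M) ⟨0, Finset.mem_range.2 h⟩ else PMF.pure 0

/-- Outcome of one instruction: the new memory, the commands that remain to be executed, and the
message that was sent, if any, as a pair (content of the destination cell, payload). -/
structure Outcome where
  mem : Mem
  code : List Cmd
  out : Option (ℕ × List ℕ)

/-- Execution of one instruction `c` with word length `b`, memory `m` and remaining commands `K`. -/
def exec (b : ℕ) (m : Mem) (K : List Cmd) : Cmd → PMF Outcome
  | .skip => PMF.pure ⟨m, K, none⟩
  | .const a v => PMF.pure ⟨m.write b a v, K, none⟩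
  | .op o a x y => PMF.pure ⟨m.write b a (o.eval (m x) (m y)), K, none⟩
  | .load a x => PMF.pure ⟨m.write b a (m (m x)), K, none⟩
  | .store a x => PMF.pure ⟨m.write b (m a) (m x), K, none⟩
  | .rand a x => (uniformBelow (m x)).map fun v => ⟨m.write b a v, K, none⟩
  | .send dest payload => PMF.pure ⟨m, K, some (m dest, payload.map m)⟩
  | .seq p q => PMF.pure ⟨m, p :: q :: K, none⟩
  | .branch x p q => PMF.pure ⟨m, (if m x ≠ 0 then p else q) :: K, none⟩
  | .loop x p => PMF.pure ⟨m, if m x ≠ 0 then p :: .loop x p :: K else K, none⟩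

/-! ## The continuous distributed streaming model -/

/-- A distributed algorithm: the program that a site runs when it observes an item, the program that
a site runs when it receives a message of the coordinator, the program that the coordinator runs
when it receives a message of a site, and the address in the coordinator's memory at which the
sample is kept. -/
structure Protocol where
  onItem : Cmd
  onReply : Cmd
  onMsg : Cmd
  sampleAddr : ℕ

/-- The arrival of the item `(ident, weight)` at one of the `k` sites. -/
structure Arrival (k : ℕ) where
  site : Fin k
  ident : ℕ
  weight : ℕ

/-- The two halves of a round: the coordinator works off the messages of the sites, then the sites
work off the messages of the coordinator. -/
inductive Phase
  | coordinator | sites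

/-- Global state.  The processor `none` is the coordinator and `some i` is site `i`. -/
structure State (k : ℕ) where
  /-- memories of all processors -/
  mem : Option (Fin k) → Mem
  /-- number of instructions executed so far by each processor -/
  time : Option (Fin k) → ℕ
  /-- the processor that is currently working -/
  active : Option (Fin k)
  /-- the commands that this processor still has to execute -/
  code : List Cmd
  phase : Phase
  /-- messages in transit to the coordinator, in FIFO order -/
  up : List (List ℕ)
  /-- messages in transit to the sites, in FIFO order -/
  down : List (Fin k × List ℕ)
  /-- the items that have not arrived yet -/
  todo : List (Arrival k)
  /-- number of messages sent so far, in both directions -/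
  sent : ℕ

/-- Put an incoming item or message into the cells `4, 5, 6, …`. -/
def Mem.receive (m : Mem) (l : List ℕ) : Mem :=
  fun a => if 4 ≤ a then l.getD (a - 4) (m a) else m a

/-- Initially the cells `0, 1, 2` of every processor hold the number `k` of sites, the sample size
`s` and the word length `b`; cell `3` of a site holds its own index; all other cells are zero. -/
def initMem (k s b : ℕ) (p : Option (Fin k)) : Mem
  | 0 => k % 2 ^ b
  | 1 => s % 2 ^ b
  | 2 => b % 2 ^ b
  | 3 => p.elim 0 fun i => (i : ℕ) % 2 ^ b
  | _ => 0

/-- The state before the first item of the stream `σ` arrives. -/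
def State.init (k s b : ℕ) (σ : List (Arrival k)) : State k where
  mem := initMem k s b
  time := fun _ => 0
  active := none
  code := []
  phase := .sites
  up := []
  down := []
  todo := σ
  sent := 0

/-- Hand a message of the active processor over to the network.  A message to a nonexistent site is
lost, but counted. -/
def State.transmit {k : ℕ} (g : State k) : Option (ℕ × List ℕ) → State k
  | none => g
  | some (d, l) =>
    match g.active with
    | some _ => { g with up := g.up ++ [l], sent := g.sent + 1 }
    | none =>
      { g with
        down := if h : d < k then g.down ++ [(⟨d, h⟩, l)] else g.down
        sent := g.sent + 1 }

/-- Processor `p` receives the words `l` and starts the program `c`. -/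
def State.start {k : ℕ} (g : State k) (p : Option (Fin k)) (l : List ℕ) (c : Cmd) : State k :=
  { g with mem := Function.update g.mem p ((g.mem p).receive l), active := p, code := [c] }

/-- What happens when no processor is working.  In each round one item arrives at its site, which
may send messages; then the coordinator handles all messages of the sites; then the sites handle
all messages of the coordinator; then the next item arrives.  (A message that a site sends in
reply to the coordinator is handled in the next round.) -/
def State.dispatch {k : ℕ} (P : Protocol) (g : State k) : State k :=
  match g.phase with
  | .coordinator =>
    match g.up with
    | l :: u => { g with up := u }.start none l P.onMsg
    | [] => { g with phase := .sites }
  | .sites =>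
    match g.down with
    | (i, l) :: d => { g with down := d }.start (some i) l P.onReply
    | [] =>
      match g.todo with
      | a :: σ =>
        { g with todo := σ, phase := .coordinator }.start (some a.site) [a.ident, a.weight] P.onItem
      | [] => g

/-- One step of the system: the active processor executes one instruction (which costs it one unit
of time), or, if it has nothing left to do, the next event takes place. -/
def State.step {k : ℕ} (P : Protocol) (b : ℕ) (g : State k) : PMF (State k) :=
  match g.code with
  | c :: K =>
    (exec b (g.mem g.active) K c).map fun o =>
      { g with
        mem := Function.update g.mem g.active o.mem
        time := Function.update g.time g.active (g.time g.active + 1)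
        code := o.code }.transmit o.out
  | [] => PMF.pure (g.dispatch P)

/-- Law of the global state after `N` steps on the stream `σ`. -/
def run {k : ℕ} (P : Protocol) (s b : ℕ) (σ : List (Arrival k)) : ℕ → PMF (State k)
  | 0 => PMF.pure (State.init k s b σ)
  | N + 1 => (run P s b σ N).bind (State.step P b)

/-- All items have arrived and their rounds are completed (no further step changes the state). -/
def State.Done {k : ℕ} (g : State k) : Prop :=
  g.code = [] ∧ g.phase = .sites ∧ g.down = [] ∧ g.todo = []

/-- The sample in the coordinator's memory: `s` items `(identifier, weight)`. -/
def State.sample {k : ℕ} (P : Protocol) (s : ℕ) (g : State k) : Fin s → ℕ × ℕ :=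
  fun i => (g.mem none (P.sampleAddr + 2 * i), g.mem none (P.sampleAddr + 2 * i + 1))

/-- Expectation of a nonnegative quantity. -/
def expect {α : Type*} (p : PMF α) (f : α → ℝ≥0∞) : ℝ≥0∞ := ∑' x, p x * f x

/-! ## Weighted sampling with replacement -/

/-- Total weight of a stream. -/
def totalWeight {k : ℕ} (σ : List (Arrival k)) : ℕ := (σ.map fun a => a.weight).sum

/-- Probability that a single weighted random sample from `σ` is the item `x`: each occurrence in
the stream is chosen with probability proportional to its weight. -/
def singleProb {k : ℕ} (σ : List (Arrival k)) (x : ℕ × ℕ) : ℝ≥0∞ :=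
  (σ.map fun a => if (a.ident, a.weight) = x then (a.weight : ℝ≥0∞) / totalWeight σ else 0).sum

/-- Probability that `s` independent single weighted random samples from `σ` are `x 0, x 1, …`. -/
def swrProb {k : ℕ} (σ : List (Arrival k)) (s : ℕ) (x : Fin s → ℕ × ℕ) : ℝ≥0∞ :=
  ∏ i, singleProb σ (x i)

/-- `(k + s log s) · log W / log (2 + k / s)`. -/
def messageBound (k s W : ℕ) : ℝ :=
  ((k : ℝ) + s * Real.log s) * (Real.log W / Real.log (2 + (k : ℝ) / s))

end DistSampling

end

open DistSampling Filter

noncomputable section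
namespace DistSampling

set_option linter.unusedSimpArgs false

/-! ## Expectations and averages -/

/-! Give every unit of weight, for every one of the `s` slots, an independent score uniform in `1,
…, M`, and let each slot hold a uniformly chosen unit among those of maximal score. Since the number
of tied units is stored with the slot, ties are broken exactly: the held unit is uniform over all
units, and the slots are independent (`expect_chain`, `streamVal_prod`). A unit matters to a slot
only if its score reaches the current maximum. So once the maximum of a slot exceeds `M - M / R`, a
trial has an effect only with probability at most `1 / R`, and long runs of trials can be skipped
without changing the law.

The inverse rate in epoch `j` is `R j = ρ ^ j`. Epoch `j` is entered when at most `lmax = s / 2 ^ ρ`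
slots, the laggards, are below the score needed for rate `1 / R j`, and none is below the score
needed for the higher rate `1 / Rv j`, where `Rv j` is about `R j / lam` and `lam` is a power of two
with `s < 2 ^ lam`. Laggards are tried at the rate `1 / Rv j`, all other slots at `1 / R j`, so a
unit of weight causes at most `D / R j` hits in expectation, with `D = s + lmax * lam`. Tolerating
laggards avoids waiting for the slowest slot; being so few, they cost little.

Geometric skips must be drawn exactly with uniform integers only. Draw `U` uniform below `R` and
accept it with probability `(1 - 1 / R) ^ U`: acceptance makes trial `U` the first hit, rejection
means that the next `min N R` trials all miss (`avg_skip`). The coin of that bias comes from the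
alternating binomial expansion (`vn_spec`). A site only draws one `U` for each of the two groups of
slots. If both lie beyond its numbers of trials, nothing can be hit and the item is dropped;
otherwise it forwards the item with both draws, and the coordinator completes the experiment. Trials
of units of one item commute (`trials_perm`), so their order is free.

Cost is amortized against `hpot`, the sum of `1 / R j` over the epochs `j` such that the slots are
not yet fit for epoch `j + 1`. Work in epoch `j` costs `O(D / R j)` per unit and is charged to
`hpot`; the last piece of an epoch, the recomputation and the broadcast are charged to the change of
epoch. By Markov's inequality, after `T` units the slots are unfit for epoch `j` with probability at
most `2 ^ ρ (1 - 1 / R j) ^ T + 2 ^ lam (1 - 1 / Rv j) ^ T`. Summing over `T` gives `sum_hbound_le`;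
a second application of Markov's inequality bounds the number of epochs (`expect_law_epochs`). With
`J = ⌊log_ρ W⌋` and `ρ` about `(k / s) ^ (1/4)`, `D * ρ ^ 2` is `O(k + s log s)` and `log (2 + k /
s) ≤ 5 log ρ`, which yields the claimed bound (`totalCost_le`).

Everything is read off from one inequality, `stream_spec`, for the expected price of a run plus an
expected final reward. Suitable prices give the bounds for time and messages. With prices zero and
an indicator as reward it bounds the probability of every set of final samples from above; as the
bounds for `{x}` and its complement add up to one and the run terminates almost surely, they are
attained in the limit. The indicator of a memory violation gets the bound zero. -/

theorem expect_pure {α : Type*} (a : α) (f : α → ℝ≥0∞) : expect (PMF.pure a) f = f a := by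
  unfold expect
  rw [tsum_eq_single a]
  · simp
  · intro x hx
    simp [PMF.pure_apply, hx]

theorem expect_bind {α β : Type*} (p : PMF α) (q : α → PMF β) (f : β → ℝ≥0∞) :
    expect (p.bind q) f = expect p fun a => expect (q a) f := by
  unfold expect
  simp only [PMF.bind_apply, ← ENNReal.tsum_mul_right, ← ENNReal.tsum_mul_left]
  rw [ENNReal.tsum_comm]
  simp only [mul_assoc]

theorem expect_map {α β : Type*} (p : PMF α) (g : α → β) (f : β → ℝ≥0∞) :
    expect (p.map g) f = expect p fun a => f (g a) := by
  rw [PMF.map, expect_bind]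
  simp [Function.comp, expect_pure]

theorem expect_add {α : Type*} (p : PMF α) (f g : α → ℝ≥0∞) :
    expect p (fun a => f a + g a) = expect p f + expect p g := by
  unfold expect
  simp [mul_add, ENNReal.tsum_add]

theorem expect_const {α : Type*} (p : PMF α) (c : ℝ≥0∞) : expect p (fun _ => c) = c := by
  unfold expect
  rw [ENNReal.tsum_mul_right, p.tsum_coe, one_mul]

theorem expect_const_mul {α : Type*} (p : PMF α) (c : ℝ≥0∞) (f : α → ℝ≥0∞) :
    expect p (fun a => c * f a) = c * expect p f := by
  unfold expect
  rw [← ENNReal.tsum_mul_left]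
  exact tsum_congr fun a => by ring

theorem expect_mono_supp {α : Type*} (p : PMF α) {f g : α → ℝ≥0∞}
    (h : ∀ a ∈ p.support, f a ≤ g a) : expect p f ≤ expect p g := by
  unfold expect
  refine ENNReal.tsum_le_tsum fun a => ?_
  by_cases ha : a ∈ p.support
  · gcongr
    exact h a ha
  · rw [PMF.mem_support_iff, not_not] at ha
    simp [ha]

theorem expect_mono {α : Type*} (p : PMF α) {f g : α → ℝ≥0∞} (h : ∀ a, f a ≤ g a) :
    expect p f ≤ expect p g := expect_mono_supp p fun a _ => h a

/-- Average of `f 0, …, f (n - 1)`. -/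
def avg (n : ℕ) (f : ℕ → ℝ≥0∞) : ℝ≥0∞ := (n : ℝ≥0∞)⁻¹ * ∑ v ∈ Finset.range n, f v

theorem avg_mono {n : ℕ} {f g : ℕ → ℝ≥0∞} (h : ∀ v < n, f v ≤ g v) : avg n f ≤ avg n g := by
  unfold avg
  gcongr with v hv
  exact h v (Finset.mem_range.1 hv)

theorem avg_congr {n : ℕ} {f g : ℕ → ℝ≥0∞} (h : ∀ v < n, f v = g v) : avg n f = avg n g :=
  le_antisymm (avg_mono fun v hv => (h v hv).le) (avg_mono fun v hv => (h v hv).ge)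

theorem avg_add (n : ℕ) (f g : ℕ → ℝ≥0∞) : avg n (fun v => f v + g v) = avg n f + avg n g := by
  unfold avg
  rw [Finset.sum_add_distrib, mul_add]

theorem avg_const_mul (n : ℕ) (c : ℝ≥0∞) (f : ℕ → ℝ≥0∞) :
    avg n (fun v => c * f v) = c * avg n f := by
  unfold avg
  rw [← Finset.mul_sum]
  ring

theorem inv_mul_cancel_nat {n : ℕ} (hn : 0 < n) : (n : ℝ≥0∞)⁻¹ * n = 1 :=
  ENNReal.inv_mul_cancel (by exact_mod_cast hn.ne') (ENNReal.natCast_ne_top n)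

theorem avg_const {n : ℕ} (hn : 0 < n) (c : ℝ≥0∞) : avg n (fun _ => c) = c := by
  unfold avg
  rw [Finset.sum_const, Finset.card_range, nsmul_eq_mul, ← mul_assoc, inv_mul_cancel_nat hn, one_mul]

theorem avg_const_le (n : ℕ) (c : ℝ≥0∞) : avg n (fun _ => c) ≤ c := by
  rcases Nat.eq_zero_or_pos n with rfl | hn
  · simp [avg]
  · exact (avg_const hn c).le

theorem avg_comm (n m : ℕ) (f : ℕ → ℕ → ℝ≥0∞) :
    avg n (fun u => avg m fun v => f u v) = avg m fun v => avg n fun u => f u v := by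
  unfold avg
  simp only [Finset.mul_sum]
  rw [Finset.sum_comm]
  exact Finset.sum_congr rfl fun _ _ => Finset.sum_congr rfl fun _ _ => by ring

theorem avg_ite {n t : ℕ} (htn : t ≤ n) (A B : ℝ≥0∞) :
    avg n (fun v => if v < t then A else B) =
      (t : ℝ≥0∞) / n * A + ((n - t : ℕ) : ℝ≥0∞) / n * B := by
  unfold avg
  rw [← Finset.sum_range_add_sum_Ico _ htn]
  have h1 : ∑ v ∈ Finset.range t, (if v < t then A else B) = t * A := by
    rw [Finset.sum_congr rfl fun v hv => if_pos (Finset.mem_range.1 hv)]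
    simp
  have h2 : ∑ v ∈ Finset.Ico t n, (if v < t then A else B) = (n - t : ℕ) * B := by
    rw [Finset.sum_congr rfl fun v hv => if_neg (not_lt.2 (Finset.mem_Ico.1 hv).1)]
    simp
  rw [h1, h2, div_eq_mul_inv, div_eq_mul_inv]
  ring

theorem expect_uniformBelow (n : ℕ) (f : ℕ → ℝ≥0∞) :
    expect (uniformBelow n) f = avg (max n 1) f := by
  unfold uniformBelow
  split_ifs with h
  · have hm : max n 1 = n := by omega
    have hne : (Finset.range n).Nonempty := ⟨0, Finset.mem_range.2 h⟩
    rw [hm]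
    change expect (PMF.uniformOfFinset (Finset.range n) hne) f = _
    unfold expect avg
    rw [tsum_eq_sum (s := Finset.range n)]
    · rw [Finset.mul_sum]
      refine Finset.sum_congr rfl fun v hv => ?_
      rw [PMF.uniformOfFinset_apply_of_mem _ hv, Finset.card_range]
    · intro v hv
      rw [PMF.uniformOfFinset_apply_of_notMem _ hv, zero_mul]
  · have hm : n = 0 := by omega
    subst hm
    rw [expect_pure]
    simp [avg]

/-! ## Expected costs and rewards of the system -/

/-- Price of the message that an instruction may send. -/
def sendCost (μ : ℝ≥0∞) : Cmd → ℝ≥0∞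
  | .send _ _ => μ
  | _ => 0

/-- Price of one step: `α` for the coordinator and for a message, `β` for a site and for an event. -/
def stepCost {k : ℕ} (α β : ℝ≥0∞) (g : State k) : ℝ≥0∞ :=
  match g.code with
  | c :: _ => g.active.elim α (fun _ => β) + sendCost α c
  | [] => open Classical in if g.Done then 0 else β

/-- Expected price of the first `N` steps plus expected final reward. -/
def val {k : ℕ} (P : Protocol) (b : ℕ) (α β : ℝ≥0∞) (F : State k → ℝ≥0∞) :
    ℕ → State k → ℝ≥0∞
  | 0, g => F g
  | N + 1, g => stepCost α β g + expect (g.step P b) (val P b α β F N)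

/-- A supremum instead of a limit, so that no monotonicity in `N` is needed and every bound holds
uniformly in the number of steps. -/
def totalVal {k : ℕ} (P : Protocol) (b : ℕ) (α β : ℝ≥0∞) (F : State k → ℝ≥0∞) (g : State k) :
    ℝ≥0∞ := ⨆ N, val P b α β F N g

/-- The hypothesis on `F` takes care of the term `N = 0`, in which the reward is collected before
the step; all other terms unfold by definition. -/
theorem totalVal_le {k : ℕ} (P : Protocol) (b : ℕ) (α β : ℝ≥0∞) (F : State k → ℝ≥0∞)
    (g : State k) (hF : F g ≤ expect (g.step P b) F) :
    totalVal P b α β F g ≤ stepCost α β g + expect (g.step P b) (totalVal P b α β F) := by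
  refine iSup_le fun N => ?_
  cases N with
  | zero =>
    refine hF.trans (le_add_left (expect_mono _ fun g' => ?_))
    exact le_iSup (fun N => val P b α β F N g') 0
  | succ N =>
    refine add_le_add le_rfl (expect_mono _ fun g' => ?_)
    exact le_iSup (fun N => val P b α β F N g') N

theorem step_of_done {k : ℕ} {P : Protocol} {b : ℕ} {g : State k} (h : g.Done) :
    g.step P b = PMF.pure g := by
  obtain ⟨h1, h2, h3, h4⟩ := h
  unfold State.step
  rw [h1]
  simp only [State.dispatch, h2, h3, h4]

theorem val_of_done {k : ℕ} {P : Protocol} {b : ℕ} {α β : ℝ≥0∞} {F : State k → ℝ≥0∞}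
    {g : State k} (h : g.Done) (N : ℕ) : val P b α β F N g = F g := by
  induction N with
  | zero => rfl
  | succ N ih =>
    have : stepCost α β g = 0 := by
      unfold stepCost
      rw [h.1]
      simp [h]
    rw [val, step_of_done h, expect_pure, ih, this, zero_add]

/-- `val` peels off the first step whereas `run` appends the last one; this moves the last step into
the reward, so that the two recursions can be compared. -/
theorem val_succ {k : ℕ} (P : Protocol) (b : ℕ) (α β : ℝ≥0∞) (F : State k → ℝ≥0∞) (N : ℕ)
    (g : State k) : val P b α β F (N + 1) g =
      val P b α β (fun g => stepCost α β g + expect (g.step P b) F) N g := by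
  induction N generalizing g with
  | zero => rfl
  | succ N ih =>
    rw [val, funext ih]
    rfl

theorem expect_run_succ {k : ℕ} (P : Protocol) (s b : ℕ) (σ : List (Arrival k)) (N : ℕ)
    (F : State k → ℝ≥0∞) :
    expect (run P s b σ (N + 1)) F = expect (run P s b σ N) fun g => expect (g.step P b) F := by
  rw [run, expect_bind]

/-- A quantity whose expected growth is bounded by the step price is bounded by the total value. -/
theorem expect_run_add_le_val {k : ℕ} (P : Protocol) (s b : ℕ) (σ : List (Arrival k)) (α β : ℝ≥0∞)
    (G : ℕ → State k → ℝ≥0∞) (h0 : G 0 (State.init k s b σ) = 0)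
    (hG : ∀ N g, expect (g.step P b) (G (N + 1)) ≤ stepCost α β g + G N g)
    (F : State k → ℝ≥0∞) (N : ℕ) :
    expect (run P s b σ N) (fun g => F g + G N g) ≤ val P b α β F N (State.init k s b σ) := by
  induction N generalizing F with
  | zero => rw [run, expect_pure, h0, add_zero, val]
  | succ N ih =>
    rw [expect_run_succ, val_succ]
    refine le_trans (expect_mono _ fun g => ?_) (ih _)
    rw [expect_add]
    calc _ ≤ expect (g.step P b) F + (stepCost α β g + G N g) := by gcongr; exact hG N g
      _ = _ := by ring

theorem expect_run_le_val {k : ℕ} (P : Protocol) (s b : ℕ) (σ : List (Arrival k)) (α β : ℝ≥0∞)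
    (F : State k → ℝ≥0∞) (N : ℕ) :
    expect (run P s b σ N) F ≤ val P b α β F N (State.init k s b σ) := by
  have := expect_run_add_le_val P s b σ α β (fun _ _ => 0) rfl (fun _ g => by simp [expect_const]) F N
  simpa using this

/-- With unit prices every step of an unfinished run costs at least one, and finished states are
absorbing. So `N` times the indicator of being unfinished grows no faster than the price, which is
Markov's inequality for the running time. -/
theorem expect_notDone_le {k : ℕ} (P : Protocol) (s b : ℕ) (σ : List (Arrival k)) (N : ℕ) :
    N * expect (run P s b σ N) (Set.indicator {g | ¬ g.Done} 1) ≤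
      val P b 1 1 0 N (State.init k s b σ) := by
  classical
  have := expect_run_add_le_val P s b σ 1 1
    (fun N g => N * Set.indicator {g | ¬ g.Done} 1 g) (by simp) (fun N g => ?_) 0 N
  · rw [← expect_const_mul]
    simpa using this
  · rw [expect_const_mul]
    by_cases h : g.Done
    · rw [step_of_done h, expect_pure]
      simp [h]
    · have h1 : expect (g.step P b) (Set.indicator {g | ¬ g.Done} 1) ≤ 1 := by
        refine (expect_mono _ (g := fun _ => 1) fun g' => ?_).trans (expect_const _ _).le
        exact Set.indicator_le_self _ _ _
      have h2 : 1 ≤ stepCost 1 1 g := by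
        unfold stepCost
        split
        · refine le_add_right ?_
          cases g.active <;> simp
        · simp [h]
      calc _ ≤ ((N + 1 : ℕ) : ℝ≥0∞) * 1 := by gcongr
        _ = 1 + N * 1 := by push_cast; ring
        _ ≤ _ := by
          gcongr
          simp [h]

theorem exec_out {b : ℕ} {m : Mem} {K : List Cmd} {c : Cmd} {o : Outcome}
    (h : o ∈ (exec b m K c).support) (μ : ℝ≥0∞) :
    sendCost μ c = o.out.elim 0 fun _ => μ := by
  cases c <;> simp only [exec, PMF.support_pure, Set.mem_singleton_iff, PMF.support_map,
    Set.mem_image] at h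
  case rand => obtain ⟨v, -, rfl⟩ := h; rfl
  all_goals subst h; rfl

/-- Weighted count of instructions and messages. -/
def expense {k : ℕ} (α β : ℝ≥0∞) (g : State k) : ℝ≥0∞ :=
  α * g.time none + β * (∑ i : Fin k, g.time (some i) : ℕ) + α * g.sent

theorem transmit_time {k : ℕ} (g : State k) (o : Option (ℕ × List ℕ)) :
    (g.transmit o).time = g.time := by
  rcases o with _ | ⟨d, l⟩
  · rfl
  · unfold State.transmit
    cases h : g.active <;> rfl

theorem transmit_sent {k : ℕ} (g : State k) (o : Option (ℕ × List ℕ)) :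
    (g.transmit o).sent = g.sent + o.elim 0 fun _ => 1 := by
  rcases o with _ | ⟨d, l⟩
  · rfl
  · unfold State.transmit
    cases h : g.active <;> rfl

theorem dispatch_time_sent {k : ℕ} (P : Protocol) (g : State k) :
    (g.dispatch P).time = g.time ∧ (g.dispatch P).sent = g.sent := by
  unfold State.dispatch
  split <;> (try split) <;> (try split) <;> exact ⟨rfl, rfl⟩

theorem sum_update_time {k : ℕ} (t : Option (Fin k) → ℕ) (i : Fin k) :
    ∑ j : Fin k, Function.update t (some i) (t (some i) + 1) (some j) =
      (∑ j : Fin k, t (some j)) + 1 := by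
  rw [← Finset.add_sum_erase _ _ (Finset.mem_univ i),
    ← Finset.add_sum_erase (a := i) _ (fun j => t (some j)) (Finset.mem_univ i),
    Finset.sum_congr rfl (g := fun j => t (some j))]
  · simp; ring
  · intro j hj
    rw [Function.update_of_ne]
    simpa using (Finset.mem_erase.1 hj).1

theorem expect_expense_step {k : ℕ} (P : Protocol) (b : ℕ) (α β : ℝ≥0∞) (g : State k) :
    expect (g.step P b) (expense α β) ≤ stepCost α β g + expense α β g := by
  unfold State.step stepCost
  rcases hc : g.code with _ | ⟨c, K⟩
  · simp only [expect_pure]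
    unfold expense
    rw [(dispatch_time_sent P g).1, (dispatch_time_sent P g).2]
    exact le_add_left le_rfl
  · simp only [expect_map]
    refine le_trans (expect_mono_supp _ fun o ho => ?_) (expect_const _ _).le
    have hs := exec_out ho α
    rw [hs]
    unfold expense
    rw [transmit_time, transmit_sent]
    simp only
    rcases hact : g.active with _ | i
    · rcases o.out with _ | x <;> simp <;> ring_nf <;> rfl
    · rw [sum_update_time]
      rcases o.out with _ | x <;> simp <;> ring_nf <;> rfl

theorem expect_expense_le {k : ℕ} (P : Protocol) (s b : ℕ) (σ : List (Arrival k)) (α β : ℝ≥0∞)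
    (N : ℕ) :
    expect (run P s b σ N) (expense α β) ≤ val P b α β 0 N (State.init k s b σ) := by
  have := expect_run_add_le_val P s b σ α β (fun _ => expense α β)
    (by simp [expense, State.init]) (fun _ g => expect_expense_step P b α β g) 0 N
  simpa using this


/-! ## A program logic for one processor -/

/-- All cells from address `L` on are zero. -/
def Zero (L : ℕ) (m : Mem) : Prop := ∀ a, L ≤ a → m a = 0

/-- `ψ m o K` bounds the expected future cost when a processor with memory `m`, which has already
sent the messages `o`, still has to execute `K`; an instruction costs `τ` and a message `μ`. -/
structure Loc (b : ℕ) (τ μ : ℝ≥0∞) (L : ℕ)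
    (ψ : Mem → List (ℕ × List ℕ) → List Cmd → ℝ≥0∞) : Prop where
  step : ∀ m o c K, Zero L m → ψ m o (c :: K) ≤
    τ + sendCost μ c + expect (exec b m K c) fun r => ψ r.mem (o ++ r.out.toList) r.code

/-- Allows a potential to be carried through a program segment, and to be exchanged where the epoch
changes. -/
theorem Loc.add_const {b : ℕ} {τ μ : ℝ≥0∞} {L : ℕ}
    {ψ : Mem → List (ℕ × List ℕ) → List Cmd → ℝ≥0∞} (h : Loc b τ μ L ψ) (x : ℝ≥0∞) :
    Loc b τ μ L fun m o K => ψ m o K + x where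
  step m o c K hz := by
    rw [expect_add, expect_const, ← add_assoc]
    gcongr
    exact h.step m o c K hz

/-- `x` exceeds `y` by at most the price of `n` instructions. -/
def LeT (τ : ℝ≥0∞) (n : ℕ) (x y : ℝ≥0∞) : Prop := x ≤ n * τ + y

theorem LeT.trans {τ x y z : ℝ≥0∞} {n m : ℕ} (h : LeT τ n x y) (h' : LeT τ m y z) :
    LeT τ (n + m) x z := by
  unfold LeT at *
  calc x ≤ n * τ + (m * τ + z) := h.trans (by gcongr)
    _ = _ := by push_cast; ring

theorem LeT.mono {τ x y : ℝ≥0∞} {n m : ℕ} (h : LeT τ n x y) (hnm : n ≤ m) : LeT τ m x y := by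
  unfold LeT at *
  exact h.trans (by gcongr)

theorem LeT.trans_le {τ x y z : ℝ≥0∞} {n : ℕ} (h : LeT τ n x y) (h' : y ≤ z) : LeT τ n x z :=
  le_trans (b := n * τ + y) h (by gcongr)

theorem LeT.le {τ x y : ℝ≥0∞} {n : ℕ} (h : LeT τ n x y) : x ≤ n * τ + y := h

theorem LeT.avg {τ : ℝ≥0∞} {n N : ℕ} {f g : ℕ → ℝ≥0∞} (h : ∀ v < N, LeT τ n (f v) (g v)) :
    LeT τ n (avg N f) (avg N g) := by
  unfold LeT
  refine (avg_mono h).trans ?_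
  rw [avg_add]
  gcongr
  exact avg_const_le _ _

/-- Sequential composition of a list of commands. -/
def block : List Cmd → Cmd
  | [] => .skip
  | c :: l => .seq c (block l)

/-- Instructions without randomness that write into a fixed cell below `64`. -/
def isReg : Cmd → Bool
  | .const a _ => a < 64
  | .op _ a _ _ => a < 64
  | .load a _ => a < 64
  | _ => false

def destCell : Cmd → ℕ
  | .const a _ => a
  | .op _ a _ _ => a
  | .load a _ => a
  | _ => 0

def assign (b : ℕ) : Cmd → Mem → Mem
  | .const a v, m => m.write b a v
  | .op o a x y, m => m.write b a (o.eval (m x) (m y))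
  | .load a x, m => m.write b a (m (m x))
  | _, m => m

/-- Memory after the execution of a list of instructions. -/
def runSeg (b : ℕ) : List Cmd → Mem → Mem
  | [], m => m
  | c :: l, m => runSeg b l (assign b c m)

theorem Zero.write {L b : ℕ} {m : Mem} (h : Zero L m) {a v : ℕ} (ha : a < L) :
    Zero L (m.write b a v) := by
  intro x hx
  rw [Mem.write, Function.update_of_ne (by omega)]
  exact h x hx

theorem Zero.assign {L b : ℕ} {m : Mem} (h : Zero L m) {c : Cmd} (hc : isReg c = true)
    (hL : 64 ≤ L) : Zero L (assign b c m) := by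
  cases c <;> simp only [isReg, decide_eq_true_eq, Bool.false_eq_true] at hc
  all_goals exact h.write (by omega)

theorem Zero.runSeg {L b : ℕ} {m : Mem} (h : Zero L m) {l : List Cmd} (hc : l.all isReg = true)
    (hL : 64 ≤ L) : Zero L (runSeg b l m) := by
  induction l generalizing m with
  | nil => exact h
  | cons c l ih =>
    rw [List.all_cons, Bool.and_eq_true] at hc
    exact ih (h.assign hc.1 hL) hc.2

theorem runSeg_frame {b : ℕ} {m : Mem} {l : List Cmd} {x : ℕ} (hx : x ∉ l.map destCell) :
    runSeg b l m x = m x := by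
  induction l generalizing m with
  | nil => rfl
  | cons c l ih =>
    simp only [List.map_cons, List.mem_cons, not_or] at hx
    rw [runSeg, ih hx.2]
    cases c <;> simp only [assign, Mem.write] <;> first | rfl | exact Function.update_of_ne hx.1 _ _

section Rules

variable {b : ℕ} {τ μ : ℝ≥0∞} {L : ℕ} {ψ : Mem → List (ℕ × List ℕ) → List Cmd → ℝ≥0∞}
  (h : Loc b τ μ L ψ) {m : Mem} {o : List (ℕ × List ℕ)} {K : List Cmd}

include h

theorem Loc.skip (hz : Zero L m) : LeT τ 1 (ψ m o (.skip :: K)) (ψ m o K) := by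
  have := h.step m o .skip K hz
  simpa [LeT, exec, expect_pure, sendCost] using this

theorem Loc.seq {p q : Cmd} (hz : Zero L m) :
    LeT τ 1 (ψ m o (.seq p q :: K)) (ψ m o (p :: q :: K)) := by
  have := h.step m o (.seq p q) K hz
  simpa [LeT, exec, expect_pure, sendCost] using this

theorem Loc.cons {c : Cmd} {l : List Cmd} (hz : Zero L m) :
    LeT τ 1 (ψ m o (block (c :: l) :: K)) (ψ m o (c :: block l :: K)) := h.seq hz

theorem Loc.nil (hz : Zero L m) : LeT τ 1 (ψ m o (block [] :: K)) (ψ m o K) := h.skip hz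

theorem Loc.assign {c : Cmd} (hc : isReg c = true) (hz : Zero L m) :
    LeT τ 1 (ψ m o (c :: K)) (ψ (assign b c m) o K) := by
  have := h.step m o c K hz
  cases c <;> simp only [isReg, Bool.false_eq_true] at hc
  all_goals simpa [LeT, exec, expect_pure, sendCost, DistSampling.assign] using this

theorem Loc.store {a x : ℕ} (hz : Zero L m) :
    LeT τ 1 (ψ m o (.store a x :: K)) (ψ (m.write b (m a) (m x)) o K) := by
  have := h.step m o (.store a x) K hz
  simpa [LeT, exec, expect_pure, sendCost] using this

theorem Loc.rand {a x : ℕ} (hz : Zero L m) :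
    LeT τ 1 (ψ m o (.rand a x :: K)) (avg (max (m x) 1) fun v => ψ (m.write b a v) o K) := by
  have := h.step m o (.rand a x) K hz
  simpa [LeT, exec, expect_map, expect_uniformBelow, sendCost] using this

theorem Loc.send {d : ℕ} {l : List ℕ} (hz : Zero L m) :
    LeT τ 1 (ψ m o (.send d l :: K)) (μ + ψ m (o ++ [(m d, l.map m)]) K) := by
  have := h.step m o (.send d l) K hz
  simpa [LeT, exec, expect_pure, sendCost, add_assoc] using this

theorem Loc.branch_pos {x : ℕ} {p q : Cmd} (hz : Zero L m) (hx : m x ≠ 0) :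
    LeT τ 1 (ψ m o (.branch x p q :: K)) (ψ m o (p :: K)) := by
  have := h.step m o (.branch x p q) K hz
  simpa [LeT, exec, expect_pure, sendCost, hx] using this

theorem Loc.branch_neg {x : ℕ} {p q : Cmd} (hz : Zero L m) (hx : m x = 0) :
    LeT τ 1 (ψ m o (.branch x p q :: K)) (ψ m o (q :: K)) := by
  have := h.step m o (.branch x p q) K hz
  simpa [LeT, exec, expect_pure, sendCost, hx] using this

theorem Loc.loop_pos {x : ℕ} {p : Cmd} (hz : Zero L m) (hx : m x ≠ 0) :
    LeT τ 1 (ψ m o (.loop x p :: K)) (ψ m o (p :: .loop x p :: K)) := by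
  have := h.step m o (.loop x p) K hz
  simpa [LeT, exec, expect_pure, sendCost, hx] using this

theorem Loc.loop_neg {x : ℕ} {p : Cmd} (hz : Zero L m) (hx : m x = 0) :
    LeT τ 1 (ψ m o (.loop x p :: K)) (ψ m o K) := by
  have := h.step m o (.loop x p) K hz
  simpa [LeT, exec, expect_pure, sendCost, hx] using this

theorem Loc.regs {l : List Cmd} (hl : l.all isReg = true) (hL : 64 ≤ L) (hz : Zero L m) :
    LeT τ (2 * l.length + 1) (ψ m o (block l :: K)) (ψ (runSeg b l m) o K) := by
  induction l generalizing m with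
  | nil => exact h.nil hz
  | cons c l ih =>
    rw [List.all_cons, Bool.and_eq_true] at hl
    have := ((h.cons (c := c) (l := l) (o := o) (K := K) hz).trans (h.assign hl.1 hz)).trans
      (ih hl.2 (hz.assign hl.1 hL))
    exact this.mono (by simp; omega)

/-- A deterministic segment at the head of a block. -/
theorem Loc.seg {l rest : List Cmd} (hl : l.all isReg = true) (hL : 64 ≤ L) (hz : Zero L m) :
    LeT τ (2 * l.length + 2) (ψ m o (block (block l :: rest) :: K))
      (ψ (runSeg b l m) o (block rest :: K)) :=
  ((h.cons hz).trans (h.regs hl hL hz)).mono (by omega)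

theorem Loc.seg_last {l : List Cmd} (hl : l.all isReg = true) (hL : 64 ≤ L) (hz : Zero L m) :
    LeT τ (2 * l.length + 3) (ψ m o (block [block l] :: K)) (ψ (runSeg b l m) o K) :=
  ((h.seg hl hL hz).trans (h.nil (hz.runSeg hl hL))).mono (by omega)

theorem Loc.bstore {a x : ℕ} {rest : List Cmd} (hz : Zero L m) :
    LeT τ 2 (ψ m o (block (.store a x :: rest) :: K))
      (ψ (m.write b (m a) (m x)) o (block rest :: K)) :=
  (h.cons hz).trans (h.store hz)

theorem Loc.brand {a x : ℕ} {rest : List Cmd} (hz : Zero L m) :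
    LeT τ 2 (ψ m o (block (.rand a x :: rest) :: K))
      (avg (max (m x) 1) fun v => ψ (m.write b a v) o (block rest :: K)) :=
  (h.cons hz).trans (h.rand hz)

end Rules


/-! ## The ideal process

Every unit of weight has for each of the `s` slots an independent uniformly random score in
`1, …, M`; a slot holds an item that is uniformly chosen among the units of maximal score.
-/

/-- A slot: the sampled item, its score and the number of units that have this score. -/
structure Slot where
  id : ℕ
  w : ℕ
  y : ℕ
  c : ℕ

/-- Number of units of maximal score after a unit of score `z ≥ t.y` has arrived. -/
def Slot.ties (t : Slot) (z : ℕ) : ℕ := (if t.y = z then t.c else 0) + 1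

/-- The slot `t` after the arrival of a unit of score `z ≥ t.y`; it is replaced if `r = 0`. -/
def Slot.next (e w z : ℕ) (t : Slot) (r : ℕ) : Slot :=
  if r = 0 then ⟨e, w, z, t.ties z⟩ else ⟨t.id, t.w, z, t.ties z⟩

/-- Arrival of a unit of score `z` of the item `(e, w)`. -/
def hitS (e w z : ℕ) (t : Slot) : PMF Slot :=
  if z < t.y then PMF.pure t else (uniformBelow (t.ties z)).map (t.next e w z)

/-- Arrival of a unit whose score is uniform in `M - X + 1, …, M`. -/
def unitS (M e w X : ℕ) (t : Slot) : PMF Slot :=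
  (uniformBelow X).bind fun r => hitS e w (M - r) t

/-- Arrival of a unit at slot `i`, with a score among the `X` largest. -/
def hitA (M e w X i : ℕ) (a : ℕ → Slot) : PMF (ℕ → Slot) :=
  (unitS M e w X (a i)).map (Function.update a i)

/-- Arrivals of units at the slots of a list. -/
def trials (M e w : ℕ) : List ℕ → (ℕ → Slot) → PMF (ℕ → Slot)
  | [], a => PMF.pure a
  | i :: l, a => (hitA M e w M i a).bind (trials M e w l)

theorem trials_append (M e w : ℕ) (l l' : List ℕ) (a : ℕ → Slot) :
    trials M e w (l ++ l') a = (trials M e w l a).bind (trials M e w l') := by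
  induction l generalizing a with
  | nil => simp [trials, PMF.pure_bind]
  | cons i l ih =>
    simp only [List.cons_append, trials, PMF.bind_bind]
    congr 1
    funext a'
    exact ih a'

/-- Trials at different slots are independent; two trials at the same slot have literally the same
law, since both units belong to the same item. -/
theorem hitA_comm (M e w X i j : ℕ) (a : ℕ → Slot) :
    (hitA M e w X i a).bind (hitA M e w X j) = (hitA M e w X j a).bind (hitA M e w X i) := by
  by_cases hij : i = j
  · rw [hij]
  · unfold hitA
    simp only [PMF.map, PMF.bind_bind, Function.comp_def, PMF.pure_bind]
    simp only [Function.update_of_ne (Ne.symm hij), Function.update_of_ne hij]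
    rw [PMF.bind_comm]
    congr 1
    funext t
    congr 1
    funext t'
    rw [Function.update_comm hij]

/-- The coordinator serves the laggards first, then the other slots in permuted order, whereas the
ideal process is defined unit by unit; this identifies the two. -/
theorem trials_perm (M e w : ℕ) {l l' : List ℕ} (h : l.Perm l') (a : ℕ → Slot) :
    trials M e w l a = trials M e w l' a := by
  induction h generalizing a with
  | nil => rfl
  | cons i _ ih =>
    simp only [trials]
    congr 1
    funext a'
    exact ih a'
  | swap i j l =>
    simp only [trials, ← PMF.bind_bind]
    rw [hitA_comm]
  | trans _ _ ih1 ih2 => rw [ih1, ih2]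

/-- Scores only grow. -/
theorem hitS_support {e w z : ℕ} {t t' : Slot} (h : t' ∈ (hitS e w z t).support) :
    (t' = t ∧ z < t.y) ∨ (t.y ≤ z ∧ ∃ r, t' = t.next e w z r) := by
  unfold hitS at h
  split_ifs at h with hz
  · left
    exact ⟨by simpa using h, hz⟩
  · right
    rw [PMF.support_map] at h
    obtain ⟨r, -, rfl⟩ := h
    exact ⟨not_lt.1 hz, r, rfl⟩

theorem Slot.next_y (e w z : ℕ) (t : Slot) (r : ℕ) : (t.next e w z r).y = z := by
  unfold Slot.next; split_ifs <;> rfl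

theorem Slot.next_c (e w z : ℕ) (t : Slot) (r : ℕ) : (t.next e w z r).c = t.ties z := by
  unfold Slot.next; split_ifs <;> rfl

theorem Slot.ties_le (t : Slot) (z : ℕ) : t.ties z ≤ t.c + 1 := by
  unfold Slot.ties; split_ifs <;> omega

theorem unitS_support {M e w X : ℕ} {t t' : Slot} (h : t' ∈ (unitS M e w X t).support) :
    t.y ≤ t'.y ∧ t'.y ≤ max t.y M ∧ t'.c ≤ t.c + 1 := by
  unfold unitS at h
  rw [PMF.mem_support_bind_iff] at h
  obtain ⟨r, -, hr⟩ := h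
  rcases hitS_support hr with ⟨rfl, -⟩ | ⟨hz, r', rfl⟩
  · exact ⟨le_rfl, le_max_left _ _, by omega⟩
  · rw [Slot.next_y, Slot.next_c]
    exact ⟨hz, le_max_of_le_right (by omega), Slot.ties_le _ _⟩

theorem hitA_support {M e w X i : ℕ} {a a' : ℕ → Slot} (h : a' ∈ (hitA M e w X i a).support)
    (j : ℕ) : (a j).y ≤ (a' j).y := by
  unfold hitA at h
  rw [PMF.support_map] at h
  obtain ⟨t, ht, rfl⟩ := h
  by_cases hj : j = i
  · subst hj
    simpa using (unitS_support ht).1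
  · simp [Function.update_of_ne hj]

theorem trials_support {M e w : ℕ} {l : List ℕ} {a a' : ℕ → Slot}
    (h : a' ∈ (trials M e w l a).support) (j : ℕ) : (a j).y ≤ (a' j).y := by
  induction l generalizing a with
  | nil =>
    simp only [trials, PMF.support_pure, Set.mem_singleton_iff] at h
    rw [h]
  | cons i l ih =>
    rw [trials, PMF.mem_support_bind_iff] at h
    obtain ⟨a1, h1, h2⟩ := h
    exact (hitA_support h1 j).trans (ih h2)

/-! ## Skipping -/

/-- Probability `1 - 1 / R`. -/
def stay (R : ℕ) : ℝ≥0∞ := ((R - 1 : ℕ) : ℝ≥0∞) / R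

theorem inv_add_stay {R : ℕ} (hR : 0 < R) : (R : ℝ≥0∞)⁻¹ + stay R = 1 := by
  unfold stay
  have : (R : ℝ≥0∞)⁻¹ + ((R - 1 : ℕ) : ℝ≥0∞) / R = (R : ℝ≥0∞)⁻¹ * (1 + (R - 1 : ℕ)) := by
    rw [div_eq_mul_inv]; ring
  have h1 : (1 : ℝ≥0∞) + (R - 1 : ℕ) = R := by exact_mod_cast Nat.add_sub_cancel' hR
  rw [this, h1, inv_mul_cancel_nat hR]

theorem stay_le_one {R : ℕ} (hR : 0 < R) : stay R ≤ 1 := by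
  rw [← inv_add_stay hR]
  exact le_add_left le_rfl

/-- The slot has a score that units outside the `M / R` largest scores do not reach. -/
def Covered (M R : ℕ) (t : Slot) : Prop := R = 1 ∨ M < t.y + M / R

theorem expect_unitS {M e w X : ℕ} (hX : 0 < X) (t : Slot) (f : Slot → ℝ≥0∞) :
    expect (unitS M e w X t) f = avg X fun r => expect (hitS e w (M - r) t) f := by
  rw [unitS, expect_bind, expect_uniformBelow, max_eq_left (by omega : 1 ≤ X)]

/-- A uniform score belongs to the `M / R` largest ones with probability exactly `1 / R`, as `R`
divides `M`. Any other score is at most `M - M / R`, hence below the score of a covered slot, and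
changes nothing. -/
theorem expect_unitS_covered {M e w R : ℕ} (hR : 0 < R) (hM : 0 < M) (hd : R ∣ M) {t : Slot}
    (ht : Covered M R t) (f : Slot → ℝ≥0∞) :
    expect (unitS M e w M t) f =
      (R : ℝ≥0∞)⁻¹ * expect (unitS M e w (M / R) t) f + stay R * f t := by
  obtain ⟨X, rfl⟩ := hd
  have hX : 0 < X := Nat.pos_of_mul_pos_left hM
  rw [Nat.mul_div_cancel_left _ hR, expect_unitS hM, expect_unitS hX]
  rcases ht with rfl | ht
  · simp [stay]
  rw [Nat.mul_div_cancel_left _ hR] at ht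
  unfold avg
  have hXR : X ≤ R * X := Nat.le_mul_of_pos_left X hR
  rw [← Finset.sum_range_add_sum_Ico _ hXR]
  have h2 : ∑ r ∈ Finset.Ico X (R * X), expect (hitS e w (R * X - r) t) f =
      ((R - 1 : ℕ) : ℝ≥0∞) * X * f t := by
    rw [Finset.sum_congr rfl (g := fun _ => f t)]
    · rw [Finset.sum_const, Nat.card_Ico, nsmul_eq_mul, ← Nat.cast_mul, Nat.sub_mul, one_mul]
    · intro r hr
      rw [Finset.mem_Ico] at hr
      rw [hitS, if_pos (by omega), expect_pure]
  have hX0 : (X : ℝ≥0∞) ≠ 0 := by exact_mod_cast hX.ne'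
  have hXt : (X : ℝ≥0∞) ≠ ∞ := ENNReal.natCast_ne_top X
  have hR0 : (R : ℝ≥0∞) ≠ 0 := by exact_mod_cast hR.ne'
  rw [h2, Nat.cast_mul, ENNReal.mul_inv (Or.inl hR0) (Or.inr hX0), mul_add, mul_assoc, stay,
    div_eq_mul_inv]
  congr 1
  calc (R : ℝ≥0∞)⁻¹ * (X : ℝ≥0∞)⁻¹ * (((R - 1 : ℕ) : ℝ≥0∞) * X * f t) =
      ((X : ℝ≥0∞)⁻¹ * X) * (((R - 1 : ℕ) : ℝ≥0∞) * (R : ℝ≥0∞)⁻¹ * f t) := by ring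
    _ = _ := by rw [inv_mul_cancel_nat hX, one_mul]

theorem expect_hitA_covered {M e w R i : ℕ} (hR : 0 < R) (hM : 0 < M) (hd : R ∣ M)
    {a : ℕ → Slot} (ht : Covered M R (a i)) (f : (ℕ → Slot) → ℝ≥0∞) :
    expect (hitA M e w M i a) f =
      (R : ℝ≥0∞)⁻¹ * expect (hitA M e w (M / R) i a) f + stay R * f a := by
  unfold hitA
  rw [expect_map, expect_map, expect_unitS_covered hR hM hd ht]
  simp

/-- The first `n` of `N` Bernoulli trials are split according to the position `U` of the first hit;
`Y` is the value of the remaining trials and `A` the value after a hit. -/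
theorem unroll {R : ℕ} (A Y : ℕ → ℝ≥0∞)
    (hY : ∀ n, Y (n + 1) = (R : ℝ≥0∞)⁻¹ * A n + stay R * Y n) {n N : ℕ} (hn : n ≤ N) :
    ∑ U ∈ Finset.range n, (R : ℝ≥0∞)⁻¹ * stay R ^ U * A (N - U - 1) + stay R ^ n * Y (N - n) =
      Y N := by
  induction n with
  | zero => simp
  | succ n ih =>
    rw [← ih (by omega), Finset.sum_range_succ]
    obtain ⟨d, hd⟩ : ∃ d, N - n = d + 1 := ⟨N - n - 1, by omega⟩
    rw [hd, hY, show N - (n + 1) = d by omega, show d + 1 - 1 = d by omega, pow_succ]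
    ring

/-- The first hit is one of the first `n` trials or none of them is a hit: `unroll` with constant
values. -/
theorem sum_stay {R : ℕ} (hR : 0 < R) (n : ℕ) :
    ∑ U ∈ Finset.range n, (R : ℝ≥0∞)⁻¹ * stay R ^ U + stay R ^ n = 1 := by
  have := unroll (R := R) (fun _ => 1) (fun _ => 1) (fun n => by
    rw [mul_one, mul_one, inv_add_stay hR]) (le_refl n)
  simpa using this

theorem stay_pow_le_one {R : ℕ} (hR : 0 < R) (n : ℕ) : stay R ^ n ≤ 1 :=
  pow_le_one₀ (zero_le) (stay_le_one hR)

/-- Exactness of rejection sampling. A draw `U < min N R` is accepted with probability `stay R ^ U`,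
so it is the first hit with the geometric weight; all remaining mass is that of `min N R` misses in
a row. -/
theorem avg_skip {R : ℕ} (hR : 0 < R) (N : ℕ) (A : ℕ → ℝ≥0∞) (Z : ℝ≥0∞) :
    avg R (fun U => if U < N then stay R ^ U * A U + (1 - stay R ^ U) * Z else Z) =
      ∑ U ∈ Finset.range (min N R), (R : ℝ≥0∞)⁻¹ * stay R ^ U * A U +
        stay R ^ (min N R) * Z := by
  set n := min N R with hn
  have hnR : n ≤ R := min_le_right _ _
  -- Mass of the rejected draws below `n` plus that of the draws from `n` on. Comparing with
  -- `sum_stay` needs a finite term to cancel.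
  have h1 : ∑ U ∈ Finset.range n, (R : ℝ≥0∞)⁻¹ * (1 - stay R ^ U) +
      (R : ℝ≥0∞)⁻¹ * (R - n : ℕ) = stay R ^ n := by
    have hfin : ∑ U ∈ Finset.range n, (R : ℝ≥0∞)⁻¹ * stay R ^ U ≠ ∞ := by
      refine ne_top_of_le_ne_top ENNReal.one_ne_top (b := 1) ?_
      rw [← sum_stay hR n]
      exact le_add_right le_rfl
    rw [← ENNReal.add_right_inj hfin, sum_stay hR n, ← add_assoc, ← Finset.sum_add_distrib]
    rw [Finset.sum_congr rfl (g := fun _ => (R : ℝ≥0∞)⁻¹)]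
    · rw [Finset.sum_const, Finset.card_range, nsmul_eq_mul, mul_comm, ← mul_add, ← Nat.cast_add,
        Nat.add_sub_cancel' hnR, inv_mul_cancel_nat hR]
    · intro U _
      rw [← mul_add, add_tsub_cancel_of_le (stay_pow_le_one hR U), mul_one]
  unfold avg
  rw [← Finset.sum_range_add_sum_Ico _ hnR, ← h1]
  rw [Finset.sum_congr rfl (g := fun U => stay R ^ U * A U + (1 - stay R ^ U) * Z)
    (s₁ := Finset.range n)]
  · rw [Finset.sum_congr rfl (g := fun U => Z) (s₁ := Finset.Ico n R)]
    · rw [Finset.sum_const, Nat.card_Ico, nsmul_eq_mul, Finset.sum_add_distrib, mul_add, mul_add,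
        add_mul, Finset.mul_sum, Finset.mul_sum, Finset.sum_mul]
      simp only [mul_assoc, add_assoc]
    · intro U hU
      rw [Finset.mem_Ico] at hU
      rw [if_neg (by omega)]
  · intro U hU
    rw [Finset.mem_range] at hU
    rw [if_pos (by omega)]

theorem stay_pow_self_le {R : ℕ} (hR : 0 < R) : stay R ^ R ≤ 2⁻¹ := by
  have h1 : stay R = ENNReal.ofReal (1 - 1 / (R : ℝ)) := by
    have hR' : (0 : ℝ) < R := by exact_mod_cast hR
    unfold stay
    rw [← ENNReal.ofReal_natCast, ← ENNReal.ofReal_natCast, ← ENNReal.ofReal_div_of_pos hR',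
      Nat.cast_sub hR, Nat.cast_one, sub_div, div_self hR'.ne']
  have hR1 : (1 : ℝ) ≤ R := by exact_mod_cast hR
  have h0 : (0 : ℝ) ≤ 1 - 1 / R := by
    rw [sub_nonneg, div_le_one (by linarith)]; exact hR1
  rw [h1, ← ENNReal.ofReal_pow h0]
  have h2 : (1 - 1 / (R : ℝ)) ^ R ≤ 2⁻¹ := by
    -- From `1 - x ≤ exp (-x)` the power is at most `exp (-1)`, which is below one half.
    have h3 : (1 - 1 / (R : ℝ)) ≤ Real.exp (-(1 / R)) := by
      have := Real.add_one_le_exp (-(1 / (R : ℝ))); linarith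
    calc (1 - 1 / (R : ℝ)) ^ R ≤ Real.exp (-(1 / R)) ^ R := by gcongr
      _ = Real.exp (-1) := by
        rw [← Real.exp_nat_mul]; congr 1; field_simp
      _ ≤ 2⁻¹ := by
        rw [Real.exp_neg]
        have := Real.exp_one_gt_d9
        gcongr; linarith
  calc _ ≤ ENNReal.ofReal 2⁻¹ := ENNReal.ofReal_le_ofReal h2
    _ = _ := by rw [ENNReal.ofReal_inv_of_pos (by norm_num)]; norm_num

/-- Bound for the expected cost of `n` trials at rate `1 / R`, if an attempt costs `c`. -/
def skipCost (c : ℝ≥0∞) (R n : ℕ) : ℝ≥0∞ := if n = 0 then 0 else c * (1 + 2 * n * (R : ℝ≥0∞)⁻¹)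

theorem skipCost_le (c : ℝ≥0∞) (R n : ℕ) : skipCost c R n ≤ c * (1 + 2 * n * (R : ℝ≥0∞)⁻¹) := by
  unfold skipCost; split_ifs <;> simp

/-- The affine function `c * (1 + 2 * n / R)` satisfies the recursion of `unroll` with a surplus of
`2 * c` for each hit, and this surplus pays for the attempts. If `N > R`, an attempt hits with
probability at least one half, so the expected surplus is at least `c`; if `N ≤ R`, a miss ends the
trials and refunds the constant `c`. -/
theorem skip_cost {R : ℕ} (hR : 0 < R) {N : ℕ} (hN : 0 < N) (c : ℝ≥0∞) :
    c + (∑ U ∈ Finset.range (min N R), (R : ℝ≥0∞)⁻¹ * stay R ^ U * skipCost c R (N - U - 1) +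
        stay R ^ (min N R) * skipCost c R (N - R)) ≤ skipCost c R N := by
  set B : ℕ → ℝ≥0∞ := fun n => c * (1 + 2 * n * (R : ℝ≥0∞)⁻¹) with hB
  have hBN : skipCost c R N = B N := by rw [skipCost, if_neg hN.ne']
  set n := min N R with hn
  have key := unroll (R := R) (fun m => B m + 2 * c) B (fun m => by
    simp only [hB]
    calc c * (1 + 2 * ((m + 1 : ℕ) : ℝ≥0∞) * (R : ℝ≥0∞)⁻¹) =
        1 * (c * (1 + 2 * m * (R : ℝ≥0∞)⁻¹)) + 2 * c * (R : ℝ≥0∞)⁻¹ := by push_cast; ring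
      _ = _ := by rw [← inv_add_stay hR]; ring) (n := n) (N := N) (min_le_left _ _)
  rw [hBN, ← key]
  have hS := sum_stay hR n
  set S := ∑ U ∈ Finset.range n, (R : ℝ≥0∞)⁻¹ * stay R ^ U with hSdef
  have hsplit : ∑ U ∈ Finset.range n, (R : ℝ≥0∞)⁻¹ * stay R ^ U * (B (N - U - 1) + 2 * c) =
      ∑ U ∈ Finset.range n, (R : ℝ≥0∞)⁻¹ * stay R ^ U * B (N - U - 1) + S * (2 * c) := by
    rw [hSdef, Finset.sum_mul, ← Finset.sum_add_distrib]
    exact Finset.sum_congr rfl fun U _ => by ring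
  rw [hsplit]
  have hle : ∑ U ∈ Finset.range n, (R : ℝ≥0∞)⁻¹ * stay R ^ U * skipCost c R (N - U - 1) ≤
      ∑ U ∈ Finset.range n, (R : ℝ≥0∞)⁻¹ * stay R ^ U * B (N - U - 1) := by
    gcongr
    exact skipCost_le _ _ _
  have hend : c + stay R ^ n * skipCost c R (N - R) ≤ S * (2 * c) + stay R ^ n * B (N - n) := by
    rcases le_or_gt N R with h | h
    · have hnN : n = N := min_eq_left h
      rw [skipCost, if_pos (by omega), mul_zero, add_zero, hnN, Nat.sub_self]
      simp only [hB]
      rw [hnN] at hS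
      calc c = (S + stay R ^ N) * c := by rw [hS, one_mul]
        _ ≤ S * (2 * c) + stay R ^ N * c := by
          rw [add_mul]
          gcongr
          exact le_mul_of_one_le_left (zero_le) (by norm_num)
        _ = _ := by simp
    · have hnR : n = R := min_eq_right h.le
      rw [hnR]
      gcongr
      · rw [hnR] at hS
        have h2 : 2⁻¹ ≤ S := by
          have hp := stay_pow_self_le hR
          have : (2 : ℝ≥0∞)⁻¹ + 2⁻¹ ≤ S + 2⁻¹ := by
            rw [ENNReal.inv_two_add_inv_two, ← hS]
            gcongr
          exact (ENNReal.add_le_add_iff_right (by simp)).1 this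
        calc c = 2⁻¹ * (2 * c) := by
              rw [← mul_assoc, ENNReal.inv_mul_cancel (by simp) (by simp), one_mul]
          _ ≤ _ := by gcongr
      · exact skipCost_le _ _ _
  calc _ = ∑ U ∈ Finset.range n, (R : ℝ≥0∞)⁻¹ * stay R ^ U * skipCost c R (N - U - 1) +
        (c + stay R ^ n * skipCost c R (N - R)) := by ring
    _ ≤ ∑ U ∈ Finset.range n, (R : ℝ≥0∞)⁻¹ * stay R ^ U * B (N - U - 1) +
        (S * (2 * c) + stay R ^ n * B (N - n)) := by gcongr
    _ = _ := by ring


/-! ## The programs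

Cells of the coordinator: `3` flag and constant `1`, `4 … 7` message, `8` modulus `M` of the scores,
`9` growth `ρ` of the inverse rate per epoch, `10` ratio `λ` of the two rates, `11` allowed number
of laggards, `12` current number of laggards, `13` inverse rate `R`, `14` inverse rate of the
laggards, `16, 17` score thresholds of the next epoch, `18, 19` number of slots below them,
`20, 21, 22` base addresses of the scores, the multiplicities and the slot permutation.
-/

/-- Sets cell `29` to `1` with probability `(1 - 1 / mem[25]) ^ mem[24]` and to `0` otherwise. -/
def vnHead : List Cmd := [.op .add 30 28 3, .op .mul 30 30 25]
def vnTail : List Cmd := [.op .sub 31 24 28, .op .lt 29 30 31, .op .add 28 28 29]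
def vnBody : Cmd := block [block vnHead, .rand 30 30, block vnTail]
def vnInit : List Cmd := [.const 28 0, .const 29 1]
def vnEnd : List Cmd := [.const 30 2, .op .mod 28 28 30, .const 30 0, .op .eq 29 28 30]
def vnCmd : Cmd := block [block vnInit, .loop 29 vnBody, block vnEnd]

/-- The loop moves from counter `j` to `j + 1` with probability `(U - j) / ((j + 1) R)`, the ratio
of consecutive terms of `∑ (U choose j) / R ^ j`. So the counter reaches `j` with probability `(U
choose j) / R ^ j`, and its final value is even with probability equal to the alternating sum `(1 -
1 / R) ^ U`. The number `g j` is the probability that a loop at counter `j` stops at a value of the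
same parity as `j`. -/
theorem exists_alternating (U R : ℕ) (hU : U < R) : ∃ g : ℕ → ℝ, g 0 = (1 - 1 / (R : ℝ)) ^ U ∧
    ∀ j ≤ U, 0 ≤ g j ∧ g j ≤ 1 ∧ g j = 1 - ((U - j : ℕ) : ℝ) / ((j + 1) * R) * g (j + 1) := by
  have hR : (0 : ℝ) < R := by exact_mod_cast (by omega : 0 < R)
  set a : ℕ → ℝ := fun j => (U.choose j : ℝ) / (R : ℝ) ^ j with ha
  set A : ℕ → ℝ := fun j => ∑ i ∈ Finset.range (U + 1 - j), (-1 : ℝ) ^ i * a (j + i) with hA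
  have hapos : ∀ j ≤ U, 0 < a j := fun j hj => by
    have : (0 : ℝ) < U.choose j := by exact_mod_cast Nat.choose_pos hj
    simp only [ha]; positivity
  have hrec : ∀ j ≤ U, A j = a j - A (j + 1) := fun j hj => by
    simp only [hA]
    rw [show U + 1 - j = (U + 1 - (j + 1)) + 1 by omega, Finset.sum_range_succ']
    rw [pow_zero, one_mul, add_zero, add_comm, sub_eq_add_neg, ← Finset.sum_neg_distrib]
    congr 1
    refine Finset.sum_congr rfl fun i _ => ?_
    rw [pow_succ, show j + (i + 1) = j + 1 + i by ring]
    ring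
  have hratio : ∀ j ≤ U, a (j + 1) = a j * (((U - j : ℕ) : ℝ) / ((j + 1) * R)) := fun j hj => by
    have h1 : ((U.choose (j + 1) : ℕ) : ℝ) * (j + 1) = U.choose j * (U - j : ℕ) := by
      exact_mod_cast Nat.choose_succ_right_eq U j
    have hj1 : (0 : ℝ) < j + 1 := by positivity
    simp only [ha]
    rw [pow_succ, div_mul_div_comm, div_eq_div_iff (by positivity) (by positivity)]
    linear_combination ((R : ℝ) ^ j * R) * h1
  have hstep : ∀ j ≤ U, A j / a j =
      1 - ((U - j : ℕ) : ℝ) / ((j + 1) * R) * (A (j + 1) / a (j + 1)) := fun j hj => by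
    rcases eq_or_lt_of_le hj with rfl | hlt
    · have : A (j + 1) = 0 := by simp [hA]
      rw [hrec j hj, this, sub_zero, div_self (hapos j hj).ne']
      simp
    · have h0 := (hapos j hj).ne'
      have hp : (0 : ℝ) < (U - j : ℕ) := by exact_mod_cast (by omega : 0 < U - j)
      have hj1 : (0 : ℝ) < (j + 1 : ℝ) * R := by positivity
      rw [hrec j hj, hratio j hj, sub_div, div_self h0]
      congr 1
      field_simp
  -- Backward induction: `x ↦ 1 - p * x` preserves the unit interval when `0 ≤ p ≤ 1`, and `U < R`
  -- gives `p ≤ 1`.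
  have hbd : ∀ d, ∀ j ≤ U, U - j = d → 0 ≤ A j / a j ∧ A j / a j ≤ 1 := by
    intro d
    induction d with
    | zero =>
      intro j hj hd
      have := hstep j hj
      rw [hd] at this
      rw [this]; norm_num
    | succ d ih =>
      intro j hj hd
      obtain ⟨h0, h1⟩ := ih (j + 1) (by omega) (by omega)
      have hp0 : (0 : ℝ) ≤ ((U - j : ℕ) : ℝ) / ((j + 1) * R) := by positivity
      have hp1 : ((U - j : ℕ) : ℝ) / ((j + 1) * R) ≤ 1 := by
        rw [div_le_one (by positivity)]
        have : U - j ≤ (j + 1) * R := by nlinarith [Nat.sub_le U j]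
        exact_mod_cast this
      rw [hstep j hj]
      constructor
      · nlinarith [mul_le_one₀ hp1 h0 h1]
      · nlinarith [mul_nonneg hp0 h0]
  refine ⟨fun j => A j / a j, ?_, fun j hj => ⟨(hbd _ j hj rfl).1, (hbd _ j hj rfl).2, hstep j hj⟩⟩
  have ha0 : a 0 = 1 := by simp [ha]
  simp only [ha0, div_one]
  simp only [hA, ha]
  rw [sub_eq_add_neg, add_comm (1 : ℝ), add_pow]
  refine Finset.sum_congr rfl fun i _ => ?_
  have hpow : (-(1 / (R : ℝ))) ^ i = (-1) ^ i * ((R : ℝ) ^ i)⁻¹ := by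
    rw [neg_pow, one_div, inv_pow]
  rw [one_pow, mul_one, zero_add, hpow]
  ring

theorem ofReal_stay_pow {R : ℕ} (hR : 0 < R) (U : ℕ) :
    ENNReal.ofReal ((1 - 1 / (R : ℝ)) ^ U) = stay R ^ U := by
  have h1 : stay R = ENNReal.ofReal (1 - 1 / (R : ℝ)) := by
    have hR' : (0 : ℝ) < R := by exact_mod_cast hR
    unfold stay
    rw [← ENNReal.ofReal_natCast, ← ENNReal.ofReal_natCast, ← ENNReal.ofReal_div_of_pos hR',
      Nat.cast_sub hR, Nat.cast_one, sub_div, div_self hR'.ne']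
  have hR1 : (1 : ℝ) ≤ R := by exact_mod_cast hR
  have h0 : (0 : ℝ) ≤ 1 - 1 / R := by
    rw [sub_nonneg, div_le_one (by linarith)]; exact hR1
  rw [h1, ENNReal.ofReal_pow h0]

theorem ofReal_one_sub_stay_pow {R : ℕ} (hR : 0 < R) (U : ℕ) :
    ENNReal.ofReal (1 - (1 - 1 / (R : ℝ)) ^ U) = 1 - stay R ^ U := by
  have hR1 : (1 : ℝ) ≤ R := by exact_mod_cast hR
  have h0 : (0 : ℝ) ≤ 1 - 1 / R := by
    rw [sub_nonneg, div_le_one (by linarith)]; exact hR1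
  rw [ENNReal.ofReal_sub _ (by positivity), ofReal_stay_pow hR, ENNReal.ofReal_one]

/-! ### Exact coins of bias `(1 - 1 / R) ^ U` in constant expected time -/

section VN

variable {b : ℕ} {τ μ : ℝ≥0∞} {L : ℕ} {ψ : Mem → List (ℕ × List ℕ) → List Cmd → ℝ≥0∞}
  (h : Loc b τ μ L ψ) {o : List (ℕ × List ℕ)} {K : List Cmd}

include h

/-- Induction on the distance of the counter from `U`. The hypothesis `U < R` keeps `(j + 1) * R`
below `R * R`, so that no product overflows. The continuation `Q` may depend only on the parity of
the counter. -/
theorem vn_loop (hL : 64 ≤ L) {U R : ℕ} (hU : U < R) (hb : R * R < 2 ^ b) {m₀ : Mem}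
    (h3 : m₀ 3 = 1) (h24 : m₀ 24 = U) (h25 : m₀ 25 = R) (Q : ℕ → ℝ≥0∞)
    (hQ : ∀ j, Q (j + 2) = Q j)
    (hK : ∀ m', Zero L m' → (∀ x, x ∉ [28, 29, 30, 31] → m' x = m₀ x) →
      ∀ j ≤ U, m' 28 = j → ψ m' o K ≤ Q j)
    (g : ℕ → ℝ) (hg : ∀ j ≤ U, 0 ≤ g j ∧ g j ≤ 1 ∧
      g j = 1 - ((U - j : ℕ) : ℝ) / ((j + 1) * R) * g (j + 1)) (d : ℕ) :
    ∀ j ≤ U, U - j = d → ∀ m, Zero L m → (∀ x, x ∉ [28, 29, 30, 31] → m x = m₀ x) →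
      m 28 = j → m 29 = 1 → ψ m o (.loop 29 vnBody :: K) ≤
        (if j = 0 then 60 else 40) * τ +
          (ENNReal.ofReal (g j) * Q j + ENNReal.ofReal (1 - g j) * Q (j + 1)) := by
  have hR0 : 0 < R := by omega
  induction d with
  | zero => ?_
  | succ d ih => ?_
  all_goals
    intro j hj hd m hz hm h28 h29
    have e3 : m 3 = 1 := by rw [hm 3 (by decide), h3]
    have e24 : m 24 = U := by rw [hm 24 (by decide), h24]
    have e25 : m 25 = R := by rw [hm 25 (by decide), h25]
    have hjR : (j + 1) * R ≤ R * R := Nat.mul_le_mul_right _ (by omega)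
    have hn : (j + 1) * R < 2 ^ b := by omega
    have hRR : R ≤ R * R := Nat.le_mul_of_pos_left R hR0
    have hn1 : j + 1 < 2 ^ b := by omega
    have hn0 : 1 < 2 ^ b := by omega
    have hUj : U - j < 2 ^ b := by omega
    set n := (j + 1) * R with hndef
    have hn' : 0 < n := by positivity
    set m1 := runSeg b vnHead m with hm1
    have hz1 : Zero L m1 := hz.runSeg (by decide) hL
    have h130 : m1 30 = n := by
      simp [hm1, vnHead, runSeg, assign, Mem.write, BinOp.eval, Function.update, e3, e25, h28,
        Nat.mod_eq_of_lt, hn1, ← hndef, hn]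
    have hfr1 : ∀ x, x ∉ [30, 30] → m1 x = m x := fun x hx => runSeg_frame hx
    have hstep1 : LeT τ 18 (ψ m o (.loop 29 vnBody :: K)) (avg n fun v =>
        ψ (runSeg b vnTail (m1.write b 30 v)) o (.loop 29 vnBody :: K)) := by
      have s1 := h.loop_pos (o := o) (K := K) (p := vnBody) hz (x := 29) (by rw [h29]; decide)
      have s2 := h.seg (l := vnHead) (rest := [.rand 30 30, block vnTail]) (o := o)
        (K := .loop 29 vnBody :: K) (by decide) hL hz
      have s3 := h.brand (a := 30) (x := 30) (rest := [block vnTail]) (o := o)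
        (K := .loop 29 vnBody :: K) hz1
      rw [h130, max_eq_left (by omega)] at s3
      refine (((s1.trans s2).trans s3).trans (LeT.avg fun v hv =>
        h.seg_last (l := vnTail) (by decide) hL (hz1.write (by omega)))).mono (by decide)
    have hval : ∀ v < n, let m2 := runSeg b vnTail (m1.write b 30 v)
        Zero L m2 ∧ (∀ x, x ∉ [28, 29, 30, 31] → m2 x = m₀ x) ∧
        m2 28 = j + (if v < U - j then 1 else 0) ∧ m2 29 = (if v < U - j then 1 else 0) := by
      intro v hv m2
      have hvb : v < 2 ^ b := by omega
      refine ⟨(hz1.write (by omega)).runSeg (by decide) hL, fun x hx => ?_, ?_, ?_⟩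
      · rw [← hm x hx, ← hfr1 x (by simp at hx ⊢; omega)]
        refine (runSeg_frame (by simp [vnTail, destCell] at hx ⊢; omega)).trans ?_
        rw [Mem.write, Function.update_of_ne (by simp at hx; omega)]
      all_goals
        have f28 : m1 28 = j := by rw [hfr1 28 (by decide), h28]
        have f24 : m1 24 = U := by rw [hfr1 24 (by decide), e24]
        by_cases hc : v < U - j
        all_goals
          have hj2 : j < 2 ^ b := by omega
          simp [m2, vnTail, runSeg, assign, Mem.write, BinOp.eval, Function.update, f24, f28,
            Nat.mod_eq_of_lt, hvb, hc, hUj, hn0, hn1, hj2]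
    have hexit : ∀ m2, Zero L m2 → (∀ x, x ∉ [28, 29, 30, 31] → m2 x = m₀ x) → m2 28 = j →
        m2 29 = 0 → ψ m2 o (.loop 29 vnBody :: K) ≤ τ + Q j := by
      intro m2 a1 a2 a3 a4
      have := (h.loop_neg (p := vnBody) (o := o) (K := K) a1 a4).trans_le (hK m2 a1 a2 j hj a3)
      simpa [LeT] using this
    have hg' := hg j hj
  · have hUj0 : U - j = 0 := hd
    have hgj : g j = 1 := by rw [hg'.2.2, hUj0]; simp
    refine hstep1.le.trans ?_
    have : avg n (fun v => ψ (runSeg b vnTail (m1.write b 30 v)) o (.loop 29 vnBody :: K)) ≤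
        τ + Q j := by
      refine (avg_mono fun v hv => ?_).trans (avg_const_le n _)
      obtain ⟨a1, a2, a3, a4⟩ := hval v hv
      rw [hUj0] at a3 a4
      exact hexit _ a1 a2 (by simpa using a3) (by simpa using a4)
    refine (add_le_add le_rfl this).trans ?_
    rw [hgj]
    simp only [ENNReal.ofReal_one, one_mul, sub_self, ENNReal.ofReal_zero, zero_mul, add_zero]
    rw [← add_assoc]
    gcongr
    calc ((18 : ℕ) : ℝ≥0∞) * τ + τ = 19 * τ := by push_cast; ring
      _ ≤ _ := by gcongr; split_ifs <;> norm_num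
  · refine hstep1.le.trans ?_
    set t := U - j with ht
    have htn : t ≤ n := by
      rw [hndef]
      calc U - j ≤ R := by omega
        _ ≤ _ := Nat.le_mul_of_pos_left R (by omega)
    have h1 : avg n (fun v => ψ (runSeg b vnTail (m1.write b 30 v)) o (.loop 29 vnBody :: K)) ≤
        avg n (fun v => if v < t then 40 * τ + (ENNReal.ofReal (g (j + 1)) * Q (j + 1) +
          ENNReal.ofReal (1 - g (j + 1)) * Q j) else τ + Q j) := by
      refine avg_mono fun v hv => ?_
      obtain ⟨a1, a2, a3, a4⟩ := hval v hv
      split_ifs at a3 a4 ⊢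
      · have := ih (j + 1) (by omega) (by omega) _ a1 a2 a3 a4
        rwa [if_neg (by omega), hQ] at this
      · exact hexit _ a1 a2 a3 a4
    refine (add_le_add le_rfl h1).trans ?_
    rw [avg_ite htn]
    have hj1 : j + 1 ≤ U := by omega
    obtain ⟨b0, b1, -⟩ := hg (j + 1) hj1
    have hnr : (0 : ℝ) < n := by exact_mod_cast hn'
    set p : ℝ := (t : ℝ) / n with hp
    have hp0 : 0 ≤ p := by positivity
    have hp1 : p ≤ 1 := by rw [hp, div_le_one hnr]; exact_mod_cast htn
    have hpe : (t : ℝ≥0∞) / n = ENNReal.ofReal p := by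
      rw [hp, ENNReal.ofReal_div_of_pos hnr, ENNReal.ofReal_natCast, ENNReal.ofReal_natCast]
    have hpe' : ((n - t : ℕ) : ℝ≥0∞) / n = ENNReal.ofReal (1 - p) := by
      rw [show 1 - p = ((n - t : ℕ) : ℝ) / n by
        rw [Nat.cast_sub htn, sub_div, div_self hnr.ne'],
        ENNReal.ofReal_div_of_pos hnr, ENNReal.ofReal_natCast, ENNReal.ofReal_natCast]
    have hgj : g j = 1 - p * g (j + 1) := by
      rw [hg'.2.2, hp, hndef]; push_cast; rfl
    rw [hpe, hpe', hgj]
    have hq : ENNReal.ofReal (1 - p * g (j + 1)) =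
        ENNReal.ofReal p * ENNReal.ofReal (1 - g (j + 1)) + ENNReal.ofReal (1 - p) := by
      rw [← ENNReal.ofReal_mul hp0, ← ENNReal.ofReal_add (by nlinarith) (by linarith)]
      congr 1; ring
    have hq' : ENNReal.ofReal (1 - (1 - p * g (j + 1))) =
        ENNReal.ofReal p * ENNReal.ofReal (g (j + 1)) := by
      rw [← ENNReal.ofReal_mul hp0]; congr 1; ring
    rw [hq, hq']
    have hcost : ((18 : ℕ) : ℝ≥0∞) * τ + (ENNReal.ofReal p * (40 * τ) + ENNReal.ofReal (1 - p) * τ) ≤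
        (if j = 0 then 60 else 40) * τ := by
      have h1p : ENNReal.ofReal (1 - p) ≤ 1 := ENNReal.ofReal_le_one.2 (by linarith)
      split_ifs with hj0
      · have : ENNReal.ofReal p ≤ 1 := ENNReal.ofReal_le_one.2 hp1
        calc _ ≤ 18 * τ + (1 * (40 * τ) + 1 * τ) := by push_cast; gcongr
          _ = 59 * τ := by ring
          _ ≤ _ := by gcongr; norm_num
      -- From counter `1` on the loop continues with probability at most one half, so the constant
      -- `40` reproduces itself; only the first round needs the larger constant `60`.
      · have hph : p ≤ 1 / 2 := by
          rw [hp, div_le_div_iff₀ hnr two_pos]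
          have : t * 2 ≤ 1 * n := by
            rw [hndef]
            have : 2 ≤ j + 1 := by omega
            nlinarith [Nat.sub_le U j]
          exact_mod_cast this
        have : ENNReal.ofReal p ≤ 2⁻¹ := by
          calc _ ≤ ENNReal.ofReal (1 / 2) := ENNReal.ofReal_le_ofReal hph
            _ = _ := by rw [one_div, ENNReal.ofReal_inv_of_pos two_pos]; norm_num
        calc _ ≤ 18 * τ + (2⁻¹ * (2 * (20 * τ)) + 1 * τ) := by
              push_cast
              rw [← mul_assoc 2, show (2 : ℝ≥0∞) * 20 = 40 by norm_num]
              gcongr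
          _ = 39 * τ := by
            rw [← mul_assoc, ENNReal.inv_mul_cancel (by simp) (by simp)]; ring
          _ ≤ _ := by gcongr; norm_num
    calc _ = ((18 : ℕ) : ℝ≥0∞) * τ +
          (ENNReal.ofReal p * (40 * τ) + ENNReal.ofReal (1 - p) * τ) +
          ((ENNReal.ofReal p * ENNReal.ofReal (1 - g (j + 1)) + ENNReal.ofReal (1 - p)) * Q j +
          ENNReal.ofReal p * ENNReal.ofReal (g (j + 1)) * Q (j + 1)) := by ring
      _ ≤ _ := by gcongr

theorem vn_spec (hL : 64 ≤ L) {U R : ℕ} (hU : U < R) (hb : R * R < 2 ^ b) (hb2 : 2 < 2 ^ b)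
    {m : Mem} (hz : Zero L m) (h3 : m 3 = 1) (h24 : m 24 = U) (h25 : m 25 = R) (q1 q0 : ℝ≥0∞)
    (hK1 : ∀ m', Zero L m' → (∀ x, x ∉ [28, 29, 30, 31] → m' x = m x) → m' 29 = 1 →
      ψ m' o K ≤ q1)
    (hK0 : ∀ m', Zero L m' → (∀ x, x ∉ [28, 29, 30, 31] → m' x = m x) → m' 29 = 0 →
      ψ m' o K ≤ q0) :
    ψ m o (vnCmd :: K) ≤ 80 * τ + (stay R ^ U * q1 + (1 - stay R ^ U) * q0) := by
  have hR0 : 0 < R := by omega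
  obtain ⟨g, hg0, hg⟩ := exists_alternating U R hU
  -- The `11` units of time are those of the final parity test and the return.
  set Q : ℕ → ℝ≥0∞ := fun j => 11 * τ + if j % 2 = 0 then q1 else q0 with hQ
  set m1 := runSeg b vnInit m with hm1
  have hz1 : Zero L m1 := hz.runSeg (by decide) hL
  have hfr : ∀ x, x ∉ [28, 29] → m1 x = m x := fun x hx => runSeg_frame hx
  have hn0 : 1 < 2 ^ b := by omega
  have s0 := h.seg (l := vnInit) (rest := [.loop 29 vnBody, block vnEnd]) (o := o) (K := K)
    (by decide) hL hz
  have s1 := h.cons (c := .loop 29 vnBody) (l := [block vnEnd]) (o := o) (K := K) hz1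
  have hl := vn_loop h (o := o) (K := block [block vnEnd] :: K) hL hU hb (m₀ := m1)
    (by rw [hfr 3 (by decide), h3]) (by rw [hfr 24 (by decide), h24])
    (by rw [hfr 25 (by decide), h25]) Q (fun j => by simp [hQ])
    (fun m' hz' hm' j hj h28 => by
      set m2 := runSeg b vnEnd m' with hm2
      have hz2 : Zero L m2 := hz'.runSeg (by decide) hL
      have hfr2 : ∀ x, x ∉ [28, 29, 30, 31] → m2 x = m x := fun x hx => by
        rw [hm2, runSeg_frame (by simp [vnEnd, destCell] at hx ⊢; omega), hm' x hx,
          hfr x (by simp at hx ⊢; omega)]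
      have hjb : j % 2 < 2 ^ b := by omega
      have h29 : m2 29 = if j % 2 = 0 then 1 else 0 := by
        split_ifs with hc <;>
        simp [hm2, vnEnd, runSeg, assign, Mem.write, BinOp.eval, Function.update, h28,
            Nat.mod_eq_of_lt, hb2, hc, hn0]
        have hc : j % 2 = 1 := by omega
        have hb0 : b ≠ 0 := by rintro rfl; simp at hb2
        simp [hc, hb0]
      have se := h.seg_last (l := vnEnd) (o := o) (K := K) (by decide) hL hz'
      have hfin : ψ m2 o K ≤ if j % 2 = 0 then q1 else q0 := by
        split_ifs at h29 ⊢
        · exact hK1 m2 hz2 hfr2 h29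
        · exact hK0 m2 hz2 hfr2 h29
      have := (se.trans_le hfin).mono (m := 11) (by decide)
      simpa [LeT, hQ] using this) g hg U 0 (by omega) rfl m1 hz1 (fun x _ => rfl)
    (by simp [hm1, vnInit, runSeg, assign, Mem.write, Function.update])
    (by simp [hm1, vnInit, runSeg, assign, Mem.write, Nat.mod_eq_of_lt hn0])
  rw [hg0, ofReal_stay_pow hR0, ofReal_one_sub_stay_pow hR0] at hl
  have := ((s0.trans s1).trans_le hl).le
  refine this.trans ?_
  have hsum : stay R ^ U + (1 - stay R ^ U) = 1 := add_tsub_cancel_of_le (stay_pow_le_one hR0 U)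
  simp only [hQ, if_true, Nat.zero_mod, zero_add, one_ne_zero, if_false,
    Nat.one_mod]
  calc _ = ((2 * vnInit.length + 2 + 1 : ℕ) : ℝ≥0∞) * τ + (60 * τ +
        ((stay R ^ U + (1 - stay R ^ U)) * (11 * τ) +
        (stay R ^ U * q1 + (1 - stay R ^ U) * q0))) := by ring
    _ = 78 * τ + (stay R ^ U * q1 + (1 - stay R ^ U) * q0) := by
        rw [hsum]; simp [vnInit]; ring
    _ ≤ _ := by gcongr; norm_num

end VN


/-- Parameters of the algorithm. -/
structure Par where
  k : ℕ
  s : ℕ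
  b : ℕ
  M : ℕ
  ρ : ℕ
  lam : ℕ
  lmax : ℕ

/-- All rates are powers of two, so that they divide `M`. The bounds on words exclude overflow:
`bMM` in the coin, `bMρ` in the computation of the thresholds of the next epoch, `bs` for addresses.
-/
structure Par.Ok (Γ : Par) : Prop where
  hk : 1 ≤ Γ.k
  hs : 1 ≤ Γ.s
  hM : ∃ n, Γ.M = 2 ^ n
  hρ : ∃ q, 1 ≤ q ∧ Γ.ρ = 2 ^ q
  hlam : ∃ l, Γ.lam = 2 ^ l
  hslam : Γ.s < 2 ^ Γ.lam
  hlmax : Γ.lmax = Γ.s / 2 ^ Γ.ρ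
  bMM : Γ.M * Γ.M < 2 ^ Γ.b
  bMρ : Γ.M * Γ.ρ + Γ.M + 1 < 2 ^ Γ.b
  bs : 64 + 5 * Γ.s < 2 ^ Γ.b
  bk : Γ.k < 2 ^ Γ.b
  blam : Γ.lam < 2 ^ Γ.b

/-- Inverse rate in epoch `j`. -/
def Par.R (Γ : Par) (j : ℕ) : ℕ := Γ.ρ ^ j

/-- Inverse rate for the laggards in epoch `j`. -/
def Par.Rv (Γ : Par) (j : ℕ) : ℕ := (if Γ.R j < Γ.lam then 1 else 0) + Γ.R j / Γ.lam

/-- Number of laggards in epoch `j`. -/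
def Par.ell (Γ : Par) (j : ℕ) : ℕ := if j = 0 then 0 else Γ.lmax

/-- Smallest score that covers a slot at rate `1 / X`. -/
def thr (M X : ℕ) : ℕ := M - M / X + 1

def cntLt (s : ℕ) (a : ℕ → Slot) (T : ℕ) : ℕ := {i ∈ Finset.range s | (a i).y < T}.card

/-- Both sides are sums, so that the natural subtraction performed by the program is justified by
cancelling. -/
theorem cntLt_update {s i : ℕ} (hi : i < s) (a : ℕ → Slot) (t : Slot) (T : ℕ) :
    cntLt s (Function.update a i t) T + (if (a i).y < T then 1 else 0) =
      cntLt s a T + if t.y < T then 1 else 0 := by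
  unfold cntLt
  rw [Finset.card_filter, Finset.card_filter, ← Finset.add_sum_erase _ _ (Finset.mem_range.2 hi),
    ← Finset.add_sum_erase (a := i) _ (fun j => if (a j).y < T then 1 else 0)
      (Finset.mem_range.2 hi),
    Finset.sum_congr rfl (g := fun j => if (a j).y < T then 1 else 0)]
  · simp only [Function.update_self]; ring
  · intro j hj
    rw [Function.update_of_ne (Finset.ne_of_mem_erase hj)]

theorem cntLt_le (s : ℕ) (a : ℕ → Slot) (T : ℕ) : cntLt s a T ≤ s := by
  unfold cntLt
  exact (Finset.card_filter_le _ _).trans (by simp)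

theorem cntLt_pos {s i : ℕ} (hi : i < s) {a : ℕ → Slot} {T : ℕ} (h : (a i).y < T) :
    0 < cntLt s a T :=
  Finset.card_pos.2 ⟨i, Finset.mem_filter.2 ⟨Finset.mem_range.2 hi, h⟩⟩

/-- The memory of the coordinator represents the slots `a` in epoch `j`. -/
structure Rep (Γ : Par) (j : ℕ) (a : ℕ → Slot) (π : ℕ → ℕ) (m : Mem) : Prop where
  zero : Zero (64 + 5 * Γ.s) m
  c0 : m 0 = Γ.k
  c1 : m 1 = Γ.s
  c3 : m 3 = 1
  c8 : m 8 = Γ.M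
  c9 : m 9 = Γ.ρ
  c10 : m 10 = Γ.lam
  c11 : m 11 = Γ.lmax
  c12 : m 12 = Γ.ell j
  c13 : m 13 = Γ.R j
  c14 : m 14 = Γ.Rv j
  c16 : m 16 = thr Γ.M (Γ.R (j + 1))
  c17 : m 17 = thr Γ.M (Γ.Rv (j + 1))
  c18 : m 18 = cntLt Γ.s a (thr Γ.M (Γ.R (j + 1)))
  c19 : m 19 = cntLt Γ.s a (thr Γ.M (Γ.Rv (j + 1)))
  c20 : m 20 = 64 + 2 * Γ.s
  c21 : m 21 = 64 + 3 * Γ.s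
  c22 : m 22 = 64 + 4 * Γ.s
  id : ∀ i < Γ.s, m (64 + 2 * i) = (a i).id
  w : ∀ i < Γ.s, m (64 + 2 * i + 1) = (a i).w
  y : ∀ i < Γ.s, m (64 + 2 * Γ.s + i) = (a i).y
  c : ∀ i < Γ.s, m (64 + 3 * Γ.s + i) = (a i).c
  p : ∀ i < Γ.s, m (64 + 4 * Γ.s + i) = π i

/-- Cells that the representation refers to. -/
def Pers (x : ℕ) : Prop := x < 4 ∨ (8 ≤ x ∧ x < 15) ∨ (16 ≤ x ∧ x ≤ 22) ∨ 64 ≤ x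

theorem Rep.congr {Γ : Par} {j : ℕ} {a : ℕ → Slot} {π : ℕ → ℕ} {m m' : Mem}
    (h : Rep Γ j a π m) (hm : ∀ x, Pers x → m' x = m x) : Rep Γ j a π m' where
  zero x hx := by rw [hm x (by unfold Pers; omega), h.zero x hx]
  c0 := by rw [hm _ (by unfold Pers; omega), h.c0]
  c1 := by rw [hm _ (by unfold Pers; omega), h.c1]
  c3 := by rw [hm _ (by unfold Pers; omega), h.c3]
  c8 := by rw [hm _ (by unfold Pers; omega), h.c8]
  c9 := by rw [hm _ (by unfold Pers; omega), h.c9]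
  c10 := by rw [hm _ (by unfold Pers; omega), h.c10]
  c11 := by rw [hm _ (by unfold Pers; omega), h.c11]
  c12 := by rw [hm _ (by unfold Pers; omega), h.c12]
  c13 := by rw [hm _ (by unfold Pers; omega), h.c13]
  c14 := by rw [hm _ (by unfold Pers; omega), h.c14]
  c16 := by rw [hm _ (by unfold Pers; omega), h.c16]
  c17 := by rw [hm _ (by unfold Pers; omega), h.c17]
  c18 := by rw [hm _ (by unfold Pers; omega), h.c18]
  c19 := by rw [hm _ (by unfold Pers; omega), h.c19]
  c20 := by rw [hm _ (by unfold Pers; omega), h.c20]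
  c21 := by rw [hm _ (by unfold Pers; omega), h.c21]
  c22 := by rw [hm _ (by unfold Pers; omega), h.c22]
  id i hi := by rw [hm _ (by unfold Pers; omega), h.id i hi]
  w i hi := by rw [hm _ (by unfold Pers; omega), h.w i hi]
  y i hi := by rw [hm _ (by unfold Pers; omega), h.y i hi]
  c i hi := by rw [hm _ (by unfold Pers; omega), h.c i hi]
  p i hi := by rw [hm _ (by unfold Pers; omega), h.p i hi]

theorem Rep.update {Γ : Par} {j : ℕ} {a : ℕ → Slot} {π : ℕ → ℕ} {m m' : Mem}
    (h : Rep Γ j a π m) {i : ℕ} (hi : i < Γ.s) {t : Slot}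
    (hm : ∀ x, Pers x → x ≠ 18 → x ≠ 19 → x ≠ 64 + 2 * i → x ≠ 64 + 2 * i + 1 →
      x ≠ 64 + 2 * Γ.s + i → x ≠ 64 + 3 * Γ.s + i → m' x = m x)
    (h18 : m' 18 = cntLt Γ.s (Function.update a i t) (thr Γ.M (Γ.R (j + 1))))
    (h19 : m' 19 = cntLt Γ.s (Function.update a i t) (thr Γ.M (Γ.Rv (j + 1))))
    (hid : m' (64 + 2 * i) = t.id) (hw : m' (64 + 2 * i + 1) = t.w)
    (hy : m' (64 + 2 * Γ.s + i) = t.y) (hc : m' (64 + 3 * Γ.s + i) = t.c) :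
    Rep Γ j (Function.update a i t) π m' where
  zero x hx := by rw [hm x (by unfold Pers; omega) (by omega) (by omega) (by omega) (by omega)
    (by omega) (by omega), h.zero x hx]
  c0 := by rw [hm _ (by unfold Pers; omega), h.c0] <;> omega
  c1 := by rw [hm _ (by unfold Pers; omega), h.c1] <;> omega
  c3 := by rw [hm _ (by unfold Pers; omega), h.c3] <;> omega
  c8 := by rw [hm _ (by unfold Pers; omega), h.c8] <;> omega
  c9 := by rw [hm _ (by unfold Pers; omega), h.c9] <;> omega
  c10 := by rw [hm _ (by unfold Pers; omega), h.c10] <;> omega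
  c11 := by rw [hm _ (by unfold Pers; omega), h.c11] <;> omega
  c12 := by rw [hm _ (by unfold Pers; omega), h.c12] <;> omega
  c13 := by rw [hm _ (by unfold Pers; omega), h.c13] <;> omega
  c14 := by rw [hm _ (by unfold Pers; omega), h.c14] <;> omega
  c16 := by rw [hm _ (by unfold Pers; omega), h.c16] <;> omega
  c17 := by rw [hm _ (by unfold Pers; omega), h.c17] <;> omega
  c18 := h18
  c19 := h19
  c20 := by rw [hm _ (by unfold Pers; omega), h.c20] <;> omega
  c21 := by rw [hm _ (by unfold Pers; omega), h.c21] <;> omega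
  c22 := by rw [hm _ (by unfold Pers; omega), h.c22] <;> omega
  id l hl := by
    by_cases hli : l = i
    · subst hli; simpa using hid
    · rw [hm _ (by unfold Pers; omega), h.id l hl, Function.update_of_ne hli] <;> omega
  w l hl := by
    by_cases hli : l = i
    · subst hli; simpa using hw
    · rw [hm _ (by unfold Pers; omega), h.w l hl, Function.update_of_ne hli] <;> omega
  y l hl := by
    by_cases hli : l = i
    · subst hli; simpa using hy
    · rw [hm _ (by unfold Pers; omega), h.y l hl, Function.update_of_ne hli] <;> omega
  c l hl := by
    by_cases hli : l = i
    · subst hli; simpa using hc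
    · rw [hm _ (by unfold Pers; omega), h.c l hl, Function.update_of_ne hli] <;> omega
  p l hl := by rw [hm _ (by unfold Pers; omega), h.p l hl] <;> omega

/-- All slots are fit for epoch `j`. -/
def Adv (Γ : Par) (j : ℕ) (a : ℕ → Slot) : Prop :=
  cntLt Γ.s a (thr Γ.M (Γ.R j)) ≤ Γ.lmax ∧ cntLt Γ.s a (thr Γ.M (Γ.Rv j)) = 0

theorem cntLt_anti {s T : ℕ} {a a' : ℕ → Slot} (h : ∀ i, (a i).y ≤ (a' i).y) :
    cntLt s a' T ≤ cntLt s a T := by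
  unfold cntLt
  refine Finset.card_le_card fun i hi => ?_
  rw [Finset.mem_filter] at hi ⊢
  exact ⟨hi.1, (h i).trans_lt hi.2⟩

theorem Adv.mono {Γ : Par} {j : ℕ} {a a' : ℕ → Slot} (ha : Adv Γ j a)
    (h : ∀ i, (a i).y ≤ (a' i).y) : Adv Γ j a' :=
  ⟨(cntLt_anti h).trans ha.1, Nat.le_zero.1 ((cntLt_anti h).trans ha.2.le)⟩

/-- Invariant of the slots within an epoch; `Q` bounds the multiplicities. -/
structure Inv (Γ : Par) (j : ℕ) (a : ℕ → Slot) (π : ℕ → ℕ) (Q : ℕ) : Prop where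
  hR : Γ.R j ≤ Γ.M
  perm : ((List.range Γ.s).map π).Perm (List.range Γ.s)
  cov : ∀ q, Γ.ell j ≤ q → q < Γ.s → Covered Γ.M (Γ.R j) (a (π q))
  covv : ∀ i < Γ.s, Covered Γ.M (Γ.Rv j) (a i)
  bot : j = 0 ∨ Adv Γ j a
  hy : ∀ i < Γ.s, (a i).y ≤ Γ.M
  hc : ∀ i < Γ.s, (a i).c ≤ Q

theorem Inv.lt {Γ : Par} {j : ℕ} {a : ℕ → Slot} {π : ℕ → ℕ} {Q : ℕ} (h : Inv Γ j a π Q) {q : ℕ}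
    (hq : q < Γ.s) : π q < Γ.s :=
  List.mem_range.1 (h.perm.subset (List.mem_map.2 ⟨q, List.mem_range.2 hq, rfl⟩))

theorem Covered.mono {M R : ℕ} {t t' : Slot} (h : Covered M R t) (hy : t.y ≤ t'.y) :
    Covered M R t' := by
  rcases h with h | h
  · exact Or.inl h
  · exact Or.inr (by omega)

/-- Coverage survives because scores never decrease; a hit raises the multiplicity of a slot by at
most one, so the total number of trials bounds all multiplicities. -/
theorem Inv.hit {Γ : Par} {j : ℕ} {a a' : ℕ → Slot} {π : ℕ → ℕ} {Q : ℕ} (h : Inv Γ j a π Q)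
    {e w X i : ℕ} (ha : a' ∈ (hitA Γ.M e w X i a).support) : Inv Γ j a' π (Q + 1) where
  hR := h.hR
  perm := h.perm
  cov q hq hqs := (h.cov q hq hqs).mono (hitA_support ha _)
  covv i hi := (h.covv i hi).mono (hitA_support ha _)
  bot := h.bot.imp_right fun hA => hA.mono (hitA_support ha)
  hy l hl := by
    unfold hitA at ha
    rw [PMF.support_map] at ha
    obtain ⟨t, ht, rfl⟩ := ha
    by_cases hli : l = i
    · subst hli
      have := (unitS_support ht).2.1
      have := h.hy l hl
      simp only [Function.update_self]
      omega
    · rw [Function.update_of_ne hli]; exact h.hy l hl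
  hc l hl := by
    unfold hitA at ha
    rw [PMF.support_map] at ha
    obtain ⟨t, ht, rfl⟩ := ha
    by_cases hli : l = i
    · subst hli
      have := (unitS_support ht).2.2
      have := h.hc l hl
      simp only [Function.update_self]
      omega
    · rw [Function.update_of_ne hli]; exact (h.hc l hl).trans (Nat.le_succ _)

theorem Inv.mono {Γ : Par} {j : ℕ} {a : ℕ → Slot} {π : ℕ → ℕ} {Q Q' : ℕ} (h : Inv Γ j a π Q)
    (hQ : Q ≤ Q') : Inv Γ j a π Q' :=
  { h with hc := fun i hi => (h.hc i hi).trans hQ }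

/-- Arrival of a unit at the slot with position `mem[27] + mem[23] % mem[26]`. -/
def hitAddr : List Cmd := [.op .mod 30 23 26, .op .add 30 30 27, .op .add 30 30 22, .load 30 30,
  .op .add 33 30 20, .op .add 34 30 21, .op .add 35 30 30, .const 36 64, .op .add 35 35 36,
  .op .add 36 35 3, .op .div 37 8 25]
def hitScore : List Cmd := [.op .sub 37 8 37, .load 38 33, .op .lt 39 37 38]
def hitTies : List Cmd := [.op .eq 39 37 38, .load 40 34, .op .mul 40 40 39, .op .add 40 40 3]
def hitCount : List Cmd := [.op .lt 39 38 16, .op .lt 41 37 16, .op .add 18 18 41,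
  .op .sub 18 18 39, .op .lt 39 38 17, .op .lt 41 37 17, .op .add 19 19 41, .op .sub 19 19 39]
def hitWrite : Cmd := block [.store 35 4, .store 36 5]
def hitUpd : Cmd := block [block hitTies, .store 34 40, .store 33 37, block hitCount, .rand 40 40,
  .branch 40 .skip hitWrite]
def hitCmd : Cmd := block [block hitAddr, .rand 37 37, block hitScore, .branch 39 .skip hitUpd]

/-! ### Execution of a single hit -/

section Hit

variable {Γ : Par} {τ μ : ℝ≥0∞} {ψ : Mem → List (ℕ × List ℕ) → List Cmd → ℝ≥0∞}
  (h : Loc Γ.b τ μ (64 + 5 * Γ.s) ψ) {o : List (ℕ × List ℕ)} {K : List Cmd}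

include h

/-- The case in which the new score is at least the old one. The multiplicity and score are stored
first, then both threshold counters are corrected, and the item is overwritten only if a draw below
the new multiplicity is zero. -/
theorem hit_upd_spec (hΓ : Γ.Ok) {j : ℕ} {a : ℕ → Slot} {π : ℕ → ℕ} {Q : ℕ} (hI : Inv Γ j a π Q)
    (hQ : Q + 1 < 2 ^ Γ.b) {m : Mem} (hm : Rep Γ j a π m) {e w i z : ℕ}
    (h4 : m 4 = e) (h5 : m 5 = w) (he : e < 2 ^ Γ.b) (hw : w < 2 ^ Γ.b) (hi : i < Γ.s)
    (h33 : m 33 = 64 + 2 * Γ.s + i) (h34 : m 34 = 64 + 3 * Γ.s + i) (h35 : m 35 = 64 + 2 * i)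
    (h36 : m 36 = 64 + 2 * i + 1) (h37 : m 37 = z) (h38 : m 38 = (a i).y) (hz : (a i).y ≤ z)
    (hzM : z ≤ Γ.M) (f : (ℕ → Slot) → ℝ≥0∞)
    (hK : ∀ a' m', a' ∈ ((hitS e w z (a i)).map (Function.update a i)).support →
      Rep Γ j a' π m' → (∀ x < 64, (x ≤ 27 ∧ x ≠ 18 ∧ x ≠ 19) ∨ 42 ≤ x → m' x = m x) →
      ψ m' o K ≤ f a') :
    ψ m o (hitUpd :: K) ≤
      50 * τ + expect ((hitS e w z (a i)).map (Function.update a i)) f := by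
  have hL : 64 ≤ 64 + 5 * Γ.s := by omega
  have bs := hΓ.bs
  have hci := hI.hc i hi
  set c' := (a i).ties z with hc'
  have hc'Q : c' ≤ Q + 1 := (Slot.ties_le _ _).trans (by omega)
  have hc'0 : 0 < c' := Nat.succ_pos _
  have hM1 : Γ.M < 2 ^ Γ.b := by have := hΓ.bMρ; omega
  have h1b : 1 < 2 ^ Γ.b := by omega
  -- the number of ties
  set m1 := runSeg Γ.b hitTies m with hm1
  have hz1 : Zero (64 + 5 * Γ.s) m1 := hm.zero.runSeg (by decide) hL
  have fr1 : ∀ x, x ≠ 39 → x ≠ 40 → m1 x = m x := fun x hx hx' =>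
    runSeg_frame (by simp [hitTies, destCell]; omega)
  have h140 : m1 40 = c' := by
    have e1 : m (64 + 3 * Γ.s + i) = (a i).c := hm.c i hi
    have e2 : (a i).c < 2 ^ Γ.b := by omega
    have e3 : (a i).c + 1 < 2 ^ Γ.b := by omega
    have e4 : ¬ (64 + 3 * Γ.s + i = 39) := by omega
    by_cases hyz : (a i).y = z
    · have : c' = (a i).c + 1 := by rw [hc', Slot.ties, if_pos hyz]
      simp [hm1, hitTies, runSeg, assign, Mem.write, BinOp.eval, Function.update_apply, h34, e1, h37,
        h38, hyz, e4, hm.c3, Nat.mod_eq_of_lt, e2, e3, h1b, this]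
    · have : c' = 1 := by rw [hc', Slot.ties, if_neg hyz]
      simp [hm1, hitTies, runSeg, assign, Mem.write, BinOp.eval, Function.update_apply, h34, e1, h37,
        h38, Ne.symm hyz, e4, hm.c3, Nat.mod_eq_of_lt, e2, h1b, this]
  have s1 := h.seg (l := hitTies) (rest := [.store 34 40, .store 33 37, block hitCount,
    .rand 40 40, .branch 40 .skip hitWrite]) (o := o) (K := K) (by decide) hL hm.zero
  -- the two stores
  set m2 := m1.write Γ.b (m1 34) (m1 40) with hm2
  have s2 := h.bstore (a := 34) (x := 40) (rest := [.store 33 37, block hitCount,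
    .rand 40 40, .branch 40 .skip hitWrite]) (o := o) (K := K) hz1
  rw [← hm2] at s2
  have h134 : m1 34 = 64 + 3 * Γ.s + i := by rw [fr1 34 (by omega) (by omega), h34]
  have hz2 : Zero (64 + 5 * Γ.s) m2 := hz1.write (by omega)
  have fr2 : ∀ x, x ≠ 64 + 3 * Γ.s + i → m2 x = m1 x := fun x hx => by
    rw [hm2, Mem.write, Function.update_of_ne (by omega)]
  have h2c : m2 (64 + 3 * Γ.s + i) = c' := by
    rw [hm2, Mem.write, h134, Function.update_self, h140, Nat.mod_eq_of_lt (by omega)]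
  set m3 := m2.write Γ.b (m2 33) (m2 37) with hm3
  have s3 := h.bstore (a := 33) (x := 37) (rest := [block hitCount,
    .rand 40 40, .branch 40 .skip hitWrite]) (o := o) (K := K) hz2
  rw [← hm3] at s3
  have h233 : m2 33 = 64 + 2 * Γ.s + i := by
    rw [fr2 33 (by omega), fr1 33 (by omega) (by omega), h33]
  have h237 : m2 37 = z := by
    rw [fr2 37 (by omega), fr1 37 (by omega) (by omega), h37]
  have hz3 : Zero (64 + 5 * Γ.s) m3 := hz2.write (by omega)
  have fr3 : ∀ x, x ≠ 64 + 2 * Γ.s + i → m3 x = m2 x := fun x hx => by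
    rw [hm3, Mem.write, Function.update_of_ne (by omega)]
  have h3y : m3 (64 + 2 * Γ.s + i) = z := by
    rw [hm3, Mem.write, h233, Function.update_self, h237, Nat.mod_eq_of_lt (by omega)]
  have fr3' : ∀ x < 64, x ≠ 39 → x ≠ 40 → m3 x = m x := fun x hx hx1 hx2 => by
    rw [fr3 x (by omega), fr2 x (by omega), fr1 x hx1 hx2]
  -- the counters
  set m4 := runSeg Γ.b hitCount m3 with hm4
  have hz4 : Zero (64 + 5 * Γ.s) m4 := hz3.runSeg (by decide) hL
  have s4 := h.seg (l := hitCount) (rest := [.rand 40 40, .branch 40 .skip hitWrite]) (o := o)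
    (K := K) (by decide) hL hz3
  have fr4 : ∀ x, x ≠ 18 → x ≠ 19 → x ≠ 39 → x ≠ 41 → m4 x = m3 x := fun x h1 h2 h3 h4 =>
    runSeg_frame (by simp [hitCount, destCell]; omega)
  have hcnt : ∀ t : Slot, t.y = z →
      m4 18 = cntLt Γ.s (Function.update a i t) (thr Γ.M (Γ.R (j + 1))) ∧
      m4 19 = cntLt Γ.s (Function.update a i t) (thr Γ.M (Γ.Rv (j + 1))) := by
    intro t ht
    have u1 := cntLt_update hi a t (thr Γ.M (Γ.R (j + 1)))
    have u2 := cntLt_update hi a t (thr Γ.M (Γ.Rv (j + 1)))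
    have l1 := cntLt_le Γ.s a (thr Γ.M (Γ.R (j + 1)))
    have l2 := cntLt_le Γ.s a (thr Γ.M (Γ.Rv (j + 1)))
    have l1' := cntLt_le Γ.s (Function.update a i t) (thr Γ.M (Γ.R (j + 1)))
    have l2' := cntLt_le Γ.s (Function.update a i t) (thr Γ.M (Γ.Rv (j + 1)))
    have v38 : m3 38 = (a i).y := by rw [fr3' 38 (by omega) (by omega) (by omega), h38]
    have v37 : m3 37 = z := by rw [fr3' 37 (by omega) (by omega) (by omega), h37]
    have v16 : m3 16 = thr Γ.M (Γ.R (j + 1)) := by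
      rw [fr3' 16 (by omega) (by omega) (by omega), hm.c16]
    have v17 : m3 17 = thr Γ.M (Γ.Rv (j + 1)) := by
      rw [fr3' 17 (by omega) (by omega) (by omega), hm.c17]
    have v18 : m3 18 = cntLt Γ.s a (thr Γ.M (Γ.R (j + 1))) := by
      rw [fr3' 18 (by omega) (by omega) (by omega), hm.c18]
    have v19 : m3 19 = cntLt Γ.s a (thr Γ.M (Γ.Rv (j + 1))) := by
      rw [fr3' 19 (by omega) (by omega) (by omega), hm.c19]
    rw [ht] at u1 u2
    -- Comparison results are at most one and survive the reduction modulo the word size.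
    have b1 : ∀ p : Prop, ∀ [Decidable p], (if p then 1 else 0) % 2 ^ Γ.b = if p then 1 else 0 := by
      intro p _
      apply Nat.mod_eq_of_lt
      split_ifs <;> omega
    have r1 : m4 18 = ((cntLt Γ.s a (thr Γ.M (Γ.R (j + 1))) +
        (if z < thr Γ.M (Γ.R (j + 1)) then 1 else 0)) % 2 ^ Γ.b -
        (if (a i).y < thr Γ.M (Γ.R (j + 1)) then 1 else 0)) % 2 ^ Γ.b := by
      simp only [hm4, hitCount, runSeg, assign, Mem.write, BinOp.eval, Function.update_apply,
        v38, v37, v16, v18, b1]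
      simp [v38, v37, v16, v18, b1]
    have r2 : m4 19 = ((cntLt Γ.s a (thr Γ.M (Γ.Rv (j + 1))) +
        (if z < thr Γ.M (Γ.Rv (j + 1)) then 1 else 0)) % 2 ^ Γ.b -
        (if (a i).y < thr Γ.M (Γ.Rv (j + 1)) then 1 else 0)) % 2 ^ Γ.b := by
      simp only [hm4, hitCount, runSeg, assign, Mem.write, BinOp.eval, Function.update_apply,
        v38, v37, v17, v19, b1]
      simp [v38, v37, v17, v19, b1]
    have hs := hΓ.hs
    constructor
    · rw [r1, ← u1, Nat.mod_eq_of_lt (a := _ + _) (by split_ifs <;> omega), Nat.add_sub_cancel,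
        Nat.mod_eq_of_lt (by omega)]
    · rw [r2, ← u2, Nat.mod_eq_of_lt (a := _ + _) (by split_ifs <;> omega), Nat.add_sub_cancel,
        Nat.mod_eq_of_lt (by omega)]
  -- the decision
  have h440 : m4 40 = c' := by
    rw [fr4 40 (by omega) (by omega) (by omega) (by omega), fr3 40 (by omega), fr2 40 (by omega),
      h140]
  have s5 := h.brand (a := 40) (x := 40) (rest := [.branch 40 .skip hitWrite]) (o := o) (K := K) hz4
  rw [h440, max_eq_left (by omega)] at s5
  have hexp : expect ((hitS e w z (a i)).map (Function.update a i)) f =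
      avg c' fun r => f (Function.update a i ((a i).next e w z r)) := by
    rw [expect_map, hitS, if_neg (by omega), expect_map, expect_uniformBelow, ← hc',
      max_eq_left (by omega)]
  have hsup : ∀ r < c', Function.update a i ((a i).next e w z r) ∈
      ((hitS e w z (a i)).map (Function.update a i)).support := by
    intro r hr
    rw [hitS, if_neg (by omega), PMF.support_map, PMF.support_map]
    refine ⟨_, ⟨r, ?_, rfl⟩, rfl⟩
    rw [uniformBelow, dif_pos (by omega)]
    exact (PMF.mem_support_uniformOfFinset_iff _ _).2 (Finset.mem_range.2 hr)
  have hfin : ∀ r < c', LeT τ 8 (ψ (m4.write Γ.b 40 r) o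
      (block [.branch 40 .skip hitWrite] :: K)) (f (Function.update a i ((a i).next e w z r))) := by
    intro r hr
    set m5 := m4.write Γ.b 40 r with hm5
    have hz5 : Zero (64 + 5 * Γ.s) m5 := hz4.write (by omega)
    have fr5 : ∀ x, x ≠ 40 → m5 x = m4 x := fun x hx => by
      rw [hm5, Mem.write, Function.update_of_ne hx]
    have h540 : m5 40 = r := by
      rw [hm5, Mem.write, Function.update_self, Nat.mod_eq_of_lt (by omega)]
    have fr5' : ∀ x, x ≠ 18 → x ≠ 19 → x ≠ 39 → x ≠ 40 → x ≠ 41 → x ≠ 64 + 2 * Γ.s + i →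
        x ≠ 64 + 3 * Γ.s + i → m5 x = m x := by
      intro x x1 x2 x3 x4 x5 x6 x7
      rw [fr5 x x4, fr4 x x1 x2 x3 x5, fr3 x x6, fr2 x x7, fr1 x x3 x4]
    have h5y : m5 (64 + 2 * Γ.s + i) = z := by
      rw [fr5 _ (by omega), fr4 _ (by omega) (by omega) (by omega) (by omega), h3y]
    have h5c : m5 (64 + 3 * Γ.s + i) = c' := by
      rw [fr5 _ (by omega), fr4 _ (by omega) (by omega) (by omega) (by omega), fr3 _ (by omega),
        h2c]
    have s6 := h.cons (c := .branch 40 .skip hitWrite) (l := []) (o := o) (K := K) hz5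
    obtain ⟨q18, q19⟩ := hcnt ((a i).next e w z r) (Slot.next_y _ _ _ _ _)
    rcases Nat.eq_zero_or_pos r with hr0 | hr0
    · have s7 := h.branch_neg (x := 40) (p := .skip) (q := hitWrite) (o := o)
        (K := block [] :: K) hz5 (by rw [h540, hr0])
      have s8 := h.bstore (a := 35) (x := 4) (rest := [.store 36 5]) (o := o)
        (K := block [] :: K) hz5
      have e35 : m5 35 = 64 + 2 * i := by
        rw [fr5' 35 (by omega) (by omega) (by omega) (by omega) (by omega) (by omega) (by omega),
          h35]
      have e4 : m5 4 = e := by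
        rw [fr5' 4 (by omega) (by omega) (by omega) (by omega) (by omega) (by omega) (by omega), h4]
      rw [e35, e4] at s8
      set m6 := m5.write Γ.b (64 + 2 * i) e with hm6
      have hz6 : Zero (64 + 5 * Γ.s) m6 := hz5.write (by omega)
      have fr6 : ∀ x, x ≠ 64 + 2 * i → m6 x = m5 x := fun x hx => by
        rw [hm6, Mem.write, Function.update_of_ne hx]
      have s9 := h.bstore (a := 36) (x := 5) (rest := []) (o := o) (K := block [] :: K) hz6
      have e36 : m6 36 = 64 + 2 * i + 1 := by
        rw [fr6 36 (by omega), fr5' 36 (by omega) (by omega) (by omega) (by omega) (by omega)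
          (by omega) (by omega), h36]
      have e5 : m6 5 = w := by
        rw [fr6 5 (by omega), fr5' 5 (by omega) (by omega) (by omega) (by omega) (by omega)
          (by omega) (by omega), h5]
      rw [e36, e5] at s9
      set m7 := m6.write Γ.b (64 + 2 * i + 1) w with hm7
      have hz7 : Zero (64 + 5 * Γ.s) m7 := hz6.write (by omega)
      have fr7 : ∀ x, x ≠ 64 + 2 * i + 1 → m7 x = m6 x := fun x hx => by
        rw [hm7, Mem.write, Function.update_of_ne hx]
      have s10 := h.nil (o := o) (K := block [] :: K) hz7
      have s11 := h.nil (o := o) (K := K) hz7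
      have hrep : Rep Γ j (Function.update a i ((a i).next e w z r)) π m7 := by
        refine hm.update hi (fun x hx n1 n2 n3 n4 n5 n6 => ?_) ?_ ?_ ?_ ?_ ?_ ?_
        · unfold Pers at hx
          rw [fr7 x n4, fr6 x n3, fr5' x n1 n2 (by omega) (by omega) (by omega) n5 n6]
        · rw [fr7 _ (by omega), fr6 _ (by omega), fr5 _ (by omega), q18]
        · rw [fr7 _ (by omega), fr6 _ (by omega), fr5 _ (by omega), q19]
        · rw [fr7 _ (by omega), hm6, Mem.write, Function.update_self, Nat.mod_eq_of_lt he,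
            Slot.next, if_pos hr0]
        · rw [hm7, Mem.write, Function.update_self, Nat.mod_eq_of_lt hw, Slot.next, if_pos hr0]
        · rw [fr7 _ (by omega), fr6 _ (by omega), h5y, Slot.next_y]
        · rw [fr7 _ (by omega), fr6 _ (by omega), h5c, Slot.next_c]
      refine ((((((s6.trans s7).trans s8).trans s9).trans s10).trans s11).trans_le
        (hK _ m7 (hsup r hr) hrep fun x hx hx' => ?_)).mono (by decide)
      rw [fr7 x (by omega), fr6 x (by omega), fr5' x (by omega) (by omega) (by omega) (by omega)
        (by omega) (by omega) (by omega)]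
    · have s7 := h.branch_pos (x := 40) (p := .skip) (q := hitWrite) (o := o)
        (K := block [] :: K) hz5 (by rw [h540]; omega)
      have s8 := h.skip (o := o) (K := block [] :: K) hz5
      have s9 := h.nil (o := o) (K := K) hz5
      have hrep : Rep Γ j (Function.update a i ((a i).next e w z r)) π m5 := by
        refine hm.update hi (fun x hx n1 n2 n3 n4 n5 n6 => ?_) ?_ ?_ ?_ ?_ ?_ ?_
        · unfold Pers at hx
          rw [fr5' x n1 n2 (by omega) (by omega) (by omega) n5 n6]
        · rw [fr5 _ (by omega), q18]
        · rw [fr5 _ (by omega), q19]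
        · rw [fr5' _ (by omega) (by omega) (by omega) (by omega) (by omega) (by omega) (by omega),
            hm.id i hi, Slot.next, if_neg (by omega)]
        · rw [fr5' _ (by omega) (by omega) (by omega) (by omega) (by omega) (by omega) (by omega),
            hm.w i hi, Slot.next, if_neg (by omega)]
        · rw [h5y, Slot.next_y]
        · rw [h5c, Slot.next_c]
      refine ((((s6.trans s7).trans s8).trans s9).trans_le
        (hK _ m5 (hsup r hr) hrep fun x hx hx' => ?_)).mono (by decide)
      rw [fr5' x (by omega) (by omega) (by omega) (by omega) (by omega) (by omega) (by omega)]
  have := (((((s1.trans s2).trans s3).trans s4).trans s5).trans (LeT.avg hfin)).mono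
    (m := 50) (by decide)
  rw [hexp]
  exact this.le.trans (by norm_num)

/-- Given that a trial at rate `1 / R` is a hit, the score is uniform among the `M / R` largest
ones; drawing `r` below `M / R` and taking `M - r` realizes this. -/
theorem hit_spec (hΓ : Γ.Ok) {j : ℕ} {a : ℕ → Slot} {π : ℕ → ℕ} {Q : ℕ} (hI : Inv Γ j a π Q)
    (hQ : Q + 1 < 2 ^ Γ.b) {m : Mem} (hm : Rep Γ j a π m) {e w n cnt off R : ℕ}
    (h4 : m 4 = e) (h5 : m 5 = w) (he : e < 2 ^ Γ.b) (hw : w < 2 ^ Γ.b)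
    (h23 : m 23 = n) (h25 : m 25 = R) (h26 : m 26 = cnt) (h27 : m 27 = off)
    (hR : 0 < R) (hRM : R ≤ Γ.M) (hq : off + n % cnt < Γ.s) (f : (ℕ → Slot) → ℝ≥0∞)
    (hK : ∀ a' m', a' ∈ (hitA Γ.M e w (Γ.M / R) (π (off + n % cnt)) a).support →
      Rep Γ j a' π m' → (∀ x < 64, (x ≤ 27 ∧ x ≠ 18 ∧ x ≠ 19) ∨ 42 ≤ x → m' x = m x) →
      ψ m' o K ≤ f a') :
    ψ m o (hitCmd :: K) ≤
      100 * τ + expect (hitA Γ.M e w (Γ.M / R) (π (off + n % cnt)) a) f := by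
  have hL : 64 ≤ 64 + 5 * Γ.s := by omega
  have bs := hΓ.bs
  have hM1 : Γ.M < 2 ^ Γ.b := by have := hΓ.bMρ; omega
  set q := off + n % cnt with hqdef
  set i := π q with hidef
  have hi : i < Γ.s := hI.lt hq
  set X := Γ.M / R with hX
  have hX0 : 0 < X := Nat.div_pos hRM hR
  have hXM : X ≤ Γ.M := Nat.div_le_self _ _
  set m1 := runSeg Γ.b hitAddr m with hm1
  have hz1 : Zero (64 + 5 * Γ.s) m1 := hm.zero.runSeg (by decide) hL
  have fr1 : ∀ x, x < 30 ∨ 42 ≤ x → m1 x = m x := fun x hx =>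
    runSeg_frame (by simp [hitAddr, destCell]; omega)
  have vals : m1 33 = 64 + 2 * Γ.s + i ∧ m1 34 = 64 + 3 * Γ.s + i ∧ m1 35 = 64 + 2 * i ∧
      m1 36 = 64 + 2 * i + 1 ∧ m1 37 = X := by
    have e1 : n % cnt < 2 ^ Γ.b := by omega
    have e2 : n % cnt + off = q := by omega
    have e3 : q + (64 + 4 * Γ.s) = 64 + 4 * Γ.s + q := by omega
    have e4 : 64 + 4 * Γ.s + q < 2 ^ Γ.b := by omega
    have e5 : q < 2 ^ Γ.b := by omega
    have e6 := hm.p q hq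
    rw [← hidef] at e6
    have e7 : i < 2 ^ Γ.b := by omega
    have e8 : i + (64 + 2 * Γ.s) = 64 + 2 * Γ.s + i := by omega
    have e9 : i + (64 + 3 * Γ.s) = 64 + 3 * Γ.s + i := by omega
    have e10 : i + i + 64 = 64 + 2 * i := by omega
    have e11 : 64 + 2 * Γ.s + i < 2 ^ Γ.b := by omega
    have e12 : 64 + 3 * Γ.s + i < 2 ^ Γ.b := by omega
    have e13 : 64 + 2 * i < 2 ^ Γ.b := by omega
    have e14 : 64 + 2 * i + 1 < 2 ^ Γ.b := by omega
    have e15 : i + i < 2 ^ Γ.b := by omega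
    have e16 : 64 < 2 ^ Γ.b := by omega
    have e17 : X < 2 ^ Γ.b := by omega
    refine ⟨?_, ?_, ?_, ?_, ?_⟩ <;>
    simp only [hm1, hitAddr, runSeg, assign, Mem.write, BinOp.eval, Function.update_apply,
      reduceIte, h23, h25, h26, h27, hm.c22, hm.c20, hm.c21, hm.c8, hm.c3, Nat.reduceEqDiff,
      Nat.mod_eq_of_lt e1, e2, Nat.mod_eq_of_lt e5, e3,
      Nat.mod_eq_of_lt e4, e6, Nat.mod_eq_of_lt e7,
      e8, e9, Nat.mod_eq_of_lt e11, Nat.mod_eq_of_lt e12, Nat.mod_eq_of_lt e13, e10,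
      Nat.mod_eq_of_lt e14, Nat.mod_eq_of_lt e15, Nat.mod_eq_of_lt e16, ← hX,
      Nat.mod_eq_of_lt e17]
    all_goals
      have e18 : ∀ c < 64, (64 + 4 * Γ.s + q = c) = False := fun c hc => by simp; omega
      simp [e18, e6, Nat.mod_eq_of_lt, e7, e8, e9, e10, e11, e12, e13, e14, e15, e16]
  obtain ⟨v33, v34, v35, v36, v37⟩ := vals
  have s1 := h.seg (l := hitAddr) (rest := [.rand 37 37, block hitScore,
    .branch 39 .skip hitUpd]) (o := o) (K := K) (by decide) hL hm.zero
  have s2 := h.brand (a := 37) (x := 37) (rest := [block hitScore, .branch 39 .skip hitUpd])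
    (o := o) (K := K) hz1
  rw [v37, max_eq_left (by omega)] at s2
  have hexp : expect (hitA Γ.M e w X i a) f = avg X fun r =>
      expect ((hitS e w (Γ.M - r) (a i)).map (Function.update a i)) f := by
    rw [hitA, expect_map, expect_unitS hX0]
    simp only [expect_map]
  have hfin : ∀ r < X, LeT τ 70 (ψ (m1.write Γ.b 37 r) o
      (block [block hitScore, .branch 39 .skip hitUpd] :: K))
      (expect ((hitS e w (Γ.M - r) (a i)).map (Function.update a i)) f) := by
    intro r hr
    set m2 := m1.write Γ.b 37 r with hm2
    have hz2 : Zero (64 + 5 * Γ.s) m2 := hz1.write (by omega)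
    have fr2 : ∀ x, x ≠ 37 → m2 x = m1 x := fun x hx => by
      rw [hm2, Mem.write, Function.update_of_ne hx]
    have h237 : m2 37 = r := by
      rw [hm2, Mem.write, Function.update_self, Nat.mod_eq_of_lt (by omega)]
    set m3 := runSeg Γ.b hitScore m2 with hm3
    have hz3 : Zero (64 + 5 * Γ.s) m3 := hz2.runSeg (by decide) hL
    have fr3 : ∀ x, x ≠ 37 → x ≠ 38 → x ≠ 39 → m3 x = m2 x := fun x h1 h2 h3 =>
      runSeg_frame (by simp [hitScore, destCell]; omega)
    have hyi := hI.hy i hi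
    have f8 : m2 8 = Γ.M := by rw [fr2 8 (by omega), fr1 8 (by omega), hm.c8]
    have f33 : m2 33 = 64 + 2 * Γ.s + i := by rw [fr2 33 (by omega), v33]
    have fy : m2 (64 + 2 * Γ.s + i) = (a i).y := by
      rw [fr2 _ (by omega), fr1 _ (by omega), hm.y i hi]
    have g37 : m3 37 = Γ.M - r := by
      simp [hm3, hitScore, runSeg, assign, Mem.write, BinOp.eval, f8, h237,
        Nat.mod_eq_of_lt (show Γ.M - r < 2 ^ Γ.b by omega)]
    have hne : ¬ (64 + 2 * Γ.s + i = 37) := by omega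
    have g38 : m3 38 = (a i).y := by
      simp [hm3, hitScore, runSeg, assign, Mem.write, BinOp.eval, Function.update_apply, f33, hne,
        fy, Nat.mod_eq_of_lt (show (a i).y < 2 ^ Γ.b by omega)]
    have g39 : m3 39 = (if Γ.M - r < (a i).y then 1 else 0) % 2 ^ Γ.b := by
      simp [hm3, hitScore, runSeg, assign, Mem.write, BinOp.eval, Function.update_apply, f33, hne,
        fy, Nat.mod_eq_of_lt (show (a i).y < 2 ^ Γ.b by omega), f8, h237,
        Nat.mod_eq_of_lt (show Γ.M - r < 2 ^ Γ.b by omega)]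
    have s3 := h.seg (l := hitScore) (rest := [.branch 39 .skip hitUpd]) (o := o) (K := K)
      (by decide) hL hz2
    have s4 := h.cons (c := .branch 39 .skip hitUpd) (l := []) (o := o) (K := K) hz3
    have fr3' : ∀ x, x < 30 ∨ 42 ≤ x → m3 x = m x := fun x hx => by
      rw [fr3 x (by omega) (by omega) (by omega), fr2 x (by omega), fr1 x hx]
    have hrep3 : Rep Γ j a π m3 := hm.congr fun x hx => fr3' x (by unfold Pers at hx; omega)
    have hsupp : ∀ a', a' ∈ ((hitS e w (Γ.M - r) (a i)).map (Function.update a i)).support →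
        a' ∈ (hitA Γ.M e w X i a).support := by
      intro a' ha'
      rw [hitA, PMF.support_map] at *
      obtain ⟨t, ht, rfl⟩ := ha'
      refine ⟨t, ?_, rfl⟩
      rw [unitS, PMF.mem_support_bind_iff]
      refine ⟨r, ?_, ht⟩
      rw [uniformBelow, dif_pos hX0]
      exact (PMF.mem_support_uniformOfFinset_iff _ _).2 (Finset.mem_range.2 hr)
    by_cases hlt : Γ.M - r < (a i).y
    · rw [if_pos hlt, Nat.mod_eq_of_lt (by omega)] at g39
      have s5 := h.branch_pos (x := 39) (p := .skip) (q := hitUpd) (o := o) (K := block [] :: K)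
        hz3 (by rw [g39]; decide)
      have s6 := h.skip (o := o) (K := block [] :: K) hz3
      have s7 := h.nil (o := o) (K := K) hz3
      have hpure : (hitS e w (Γ.M - r) (a i)).map (Function.update a i) = PMF.pure a := by
        rw [hitS, if_pos hlt, PMF.pure_map, Function.update_eq_self]
      have hka := hK a m3 (hsupp a (by rw [hpure]; simp)) hrep3 fun x hx hx' => fr3' x (by omega)
      rw [hpure, expect_pure]
      exact (((((s3.trans s4).trans s5).trans s6).trans s7).trans_le hka).mono (by decide)
    · rw [if_neg hlt, Nat.zero_mod] at g39
      have s5 := h.branch_neg (x := 39) (p := .skip) (q := hitUpd) (o := o) (K := block [] :: K)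
        hz3 g39
      have s6 := hit_upd_spec h (o := o) (K := block [] :: K) hΓ hI hQ hrep3 (e := e) (w := w)
        (i := i) (z := Γ.M - r) (by rw [fr3' 4 (by omega), h4]) (by rw [fr3' 5 (by omega), h5])
        he hw hi (by rw [fr3 33 (by omega) (by omega) (by omega), f33])
        (by rw [fr3 34 (by omega) (by omega) (by omega), fr2 34 (by omega), v34])
        (by rw [fr3 35 (by omega) (by omega) (by omega), fr2 35 (by omega), v35])
        (by rw [fr3 36 (by omega) (by omega) (by omega), fr2 36 (by omega), v36])
        g37 g38 (by omega) (by omega) (fun a' => τ + f a')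
        (fun a' m' ha' hr' hf' => by
          have := (h.nil (o := o) (K := K) hr'.zero).trans_le (hK a' m' (hsupp a' ha') hr'
            fun x hx hx' => by rw [hf' x hx hx', fr3' x (by omega)])
          simpa [LeT] using this)
      rw [expect_add, expect_const, ← add_assoc] at s6
      have s6' : LeT τ 51 (ψ m3 o (hitUpd :: block [] :: K))
          (expect ((hitS e w (Γ.M - r) (a i)).map (Function.update a i)) f) := by
        unfold LeT
        refine s6.trans (le_of_eq ?_)
        push_cast; ring
      exact (((s3.trans s4).trans s5).trans s6').mono (by decide)
  have := ((s1.trans s2).trans (LeT.avg hfin)).mono (m := 100) (by decide)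
  rw [hexp]
  exact this.le.trans (by norm_num)

end Hit


/-- `mem[23]` trials at rate `1 / mem[25]` at the `mem[26]` positions from `mem[27]` on; cell `24`
holds a random number below `mem[25]`. -/
def skipHit : Cmd := block [block [.op .sub 23 23 24, .op .sub 23 23 3], hitCmd]
def skipMiss : Cmd := block [.op .sub 23 23 25]
def skipBody : Cmd := block [block [.op .lt 29 24 23], .branch 29 vnCmd .skip,
  .branch 29 skipHit skipMiss, .rand 24 25]
def skipCmd : Cmd := .loop 23 skipBody

/-- Slots of `N` trials, in the order in which they are performed. -/
def trialList (π : ℕ → ℕ) (off cnt N : ℕ) : List ℕ :=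
  ((List.range N).map fun n => π (off + n % cnt)).reverse

theorem trialList_succ (π : ℕ → ℕ) (off cnt N : ℕ) :
    trialList π off cnt (N + 1) = π (off + N % cnt) :: trialList π off cnt N := by
  simp [trialList, List.range_succ]

/-- State of the coordinator before `N` trials; `m₀` is the memory at the beginning. -/
structure SkipSt (Γ : Par) (j : ℕ) (e w R cnt off N Q : ℕ) (a : ℕ → Slot) (π : ℕ → ℕ)
    (m₀ m : Mem) : Prop where
  rep : Rep Γ j a π m
  inv : Inv Γ j a π Q
  cov : ∀ n < cnt, Covered Γ.M R (a (π (off + n)))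
  h23 : m 23 = N
  h25 : m 25 = R
  h26 : m 26 = cnt
  h27 : m 27 = off
  fr : ∀ x < 64, (x ≤ 22 ∧ x ≠ 18 ∧ x ≠ 19) ∨ 42 ≤ x → m x = m₀ x

/-! ### Runs of trials performed by skips -/

section Skip

variable {Γ : Par} {τ μ : ℝ≥0∞} {ψ : Mem → List (ℕ × List ℕ) → List Cmd → ℝ≥0∞}
  (h : Loc Γ.b τ μ (64 + 5 * Γ.s) ψ) {o : List (ℕ × List ℕ)} {K : List Cmd}

include h

theorem skip_zero {j e w R cnt off Q : ℕ} {a : ℕ → Slot} {π : ℕ → ℕ} {m₀ m : Mem}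
    (hm : SkipSt Γ j e w R cnt off 0 Q a π m₀ m) (f : (ℕ → Slot) → ℝ≥0∞)
    (hK : ∀ a' m', SkipSt Γ j e w R cnt off 0 Q a' π m₀ m' → ψ m' o K ≤ f a') :
    ψ m o (skipCmd :: K) ≤ τ + f a := by
  have := (h.loop_neg (x := 23) (p := skipBody) (o := o) (K := K) hm.rep.zero hm.h23).trans_le
    (hK a m hm)
  exact this.le.trans (by simp)

/-- Strong induction on the number of remaining trials. The draw `U` is already in memory, because
the first one comes from the site; every later attempt begins with a fresh draw, over which
`avg_skip` averages. Trials are indexed downwards, so a hit after `U` misses concerns trial `N - U -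
1`. -/
theorem skip_spec (hΓ : Γ.Ok) {j e w R cnt off : ℕ} {π : ℕ → ℕ} {m₀ : Mem} {Qf : ℕ}
    (h4 : m₀ 4 = e) (h5 : m₀ 5 = w) (he : e < 2 ^ Γ.b) (hw : w < 2 ^ Γ.b) (hR : 0 < R)
    (hRM : R ≤ Γ.M) (hd : R ∣ Γ.M) (hcnt : 0 < cnt) (hoff : off + cnt ≤ Γ.s)
    (hQf : Qf < 2 ^ Γ.b) (f : (ℕ → Slot) → ℝ≥0∞)
    (hK : ∀ a' m', SkipSt Γ j e w R cnt off 0 Qf a' π m₀ m' → ψ m' o K ≤ f a') (N : ℕ) :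
    ∀ a Q m U, SkipSt Γ j e w R cnt off N Q a π m₀ m → Q + N ≤ Qf → m 24 = U → U < R →
      ψ m o (skipCmd :: K) ≤ if N = 0 then τ + f a else 250 * τ +
        (if U < N then
          stay R ^ U * (skipCost (250 * τ) R (N - U - 1) +
            expect (hitA Γ.M e w (Γ.M / R) (π (off + (N - U - 1) % cnt)) a) fun a' =>
              expect (trials Γ.M e w (trialList π off cnt (N - U - 1)) a') fun a' => τ + f a') +
          (1 - stay R ^ U) * (skipCost (250 * τ) R (N - R) +
            expect (trials Γ.M e w (trialList π off cnt (N - R)) a) fun a' => τ + f a')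
        else skipCost (250 * τ) R (N - R) +
            expect (trials Γ.M e w (trialList π off cnt (N - R)) a) fun a' => τ + f a') := by
  have hM0 : 0 < Γ.M := lt_of_lt_of_le hR hRM
  have hL : 64 ≤ 64 + 5 * Γ.s := by omega
  have bs := hΓ.bs
  have hRR : R * R < 2 ^ Γ.b := lt_of_le_of_lt (Nat.mul_le_mul hRM hRM) hΓ.bMM
  have hRb : R < 2 ^ Γ.b := lt_of_le_of_lt (Nat.le_mul_of_pos_left R hR) hRR
  set F : (ℕ → Slot) → ℝ≥0∞ := fun a' => τ + f a' with hF
  set Y : ℕ → (ℕ → Slot) → ℝ≥0∞ := fun n a => skipCost (250 * τ) R n +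
    expect (trials Γ.M e w (trialList π off cnt n) a) F with hY
  induction N using Nat.strong_induction_on with
  | _ N ih =>
  intro a Q m U hm hQN h24 hU
  rcases Nat.eq_zero_or_pos N with rfl | hN
  · rw [if_pos rfl]
    refine skip_zero h hm f fun a' m' hm' => hK a' m' ?_
    exact { hm' with inv := hm'.inv.mono (by omega) }
  rw [if_neg hN.ne']
  -- after a fresh draw
  have fresh : ∀ n < N, ∀ a Q m, SkipSt Γ j e w R cnt off n Q a π m₀ m → Q + n ≤ Qf →
      LeT τ 3 (ψ m o (block [.rand 24 25] :: skipCmd :: K)) (Y n a) := by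
    intro n hn a Q m hm hQn
    have s1 := h.brand (a := 24) (x := 25) (rest := []) (o := o) (K := skipCmd :: K) hm.rep.zero
    rw [hm.h25, max_eq_left (by omega)] at s1
    have hst : ∀ U, SkipSt Γ j e w R cnt off n Q a π m₀ (m.write Γ.b 24 U) := fun U => by
      have hne : ∀ x, x ≠ 24 → m.write Γ.b 24 U x = m x := fun x hx => by
        rw [Mem.write, Function.update_of_ne hx]
      exact {
        rep := hm.rep.congr fun x hx => hne x (by unfold Pers at hx; omega)
        inv := hm.inv
        cov := hm.cov
        h23 := by rw [hne 23 (by omega), hm.h23]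
        h25 := by rw [hne 25 (by omega), hm.h25]
        h26 := by rw [hne 26 (by omega), hm.h26]
        h27 := by rw [hne 27 (by omega), hm.h27]
        fr := fun x hx hx' => by rw [hne x (by omega), hm.fr x hx hx'] }
    have s2 : LeT τ 3 (ψ m o (block [.rand 24 25] :: skipCmd :: K))
        (avg R fun U => ψ (m.write Γ.b 24 U) o (skipCmd :: K)) :=
      s1.trans (LeT.avg fun U _ => h.nil (hst U).rep.zero)
    refine s2.trans_le ?_
    have hv : ∀ U < R, (m.write Γ.b 24 U) 24 = U := fun U hU => by
      rw [Mem.write, Function.update_self, Nat.mod_eq_of_lt (by omega)]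
    have hle := avg_mono fun U (hU : U < R) => ih n hn a Q _ U (hst U) hQn (hv U hU) hU
    refine hle.trans ?_
    rcases Nat.eq_zero_or_pos n with rfl | hn0
    · simp only [if_true]
      refine (avg_const_le _ _).trans (le_of_eq ?_)
      simp [hY, skipCost, trialList, trials, expect_pure, hF]
    · simp only [if_neg hn0.ne']
      rw [avg_add, avg_const hR]
      have := avg_skip hR n (fun U => skipCost (250 * τ) R (n - U - 1) +
            expect (hitA Γ.M e w (Γ.M / R) (π (off + (n - U - 1) % cnt)) a) fun a' =>
              expect (trials Γ.M e w (trialList π off cnt (n - U - 1)) a') F) (Y (n - R) a)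
      simp only [hY] at this
      rw [this]
      -- The ideal trials satisfy the recursion of `unroll` because the slots concerned are covered
      -- at rate `1 / R`.
      have hun := unroll (R := R)
        (fun n => expect (hitA Γ.M e w (Γ.M / R) (π (off + n % cnt)) a) fun a' =>
              expect (trials Γ.M e w (trialList π off cnt n) a') F)
        (fun n => expect (trials Γ.M e w (trialList π off cnt n) a) F) (fun n => by
          rw [trialList_succ, trials, expect_bind,
            expect_hitA_covered hR hM0 hd (hm.cov _ (Nat.mod_lt _ hcnt))])
        (n := min n R) (N := n) (min_le_left _ _)
      have hco := skip_cost hR hn0 (250 * τ)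
      have hmin : n - min n R = n - R := by omega
      rw [hmin] at hun
      simp only [hY]
      rw [← hun]
      refine le_trans (le_of_eq ?_) (add_le_add_left hco _)
      simp only [mul_add, Finset.sum_add_distrib]
      ring
  -- the two ways in which an attempt ends
  have miss : ∀ m', SkipSt Γ j e w R cnt off N Q a π m₀ m' → m' 29 = 0 →
      LeT τ 20 (ψ m' o (block [.branch 29 skipHit skipMiss, .rand 24 25] :: skipCmd :: K))
        (Y (N - R) a) := by
    intro m' hm' h29
    have s1 := h.cons (c := .branch 29 skipHit skipMiss) (l := [.rand 24 25]) (o := o)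
      (K := skipCmd :: K) hm'.rep.zero
    have s2 := h.branch_neg (x := 29) (p := skipHit) (q := skipMiss) (o := o)
      (K := block [.rand 24 25] :: skipCmd :: K) hm'.rep.zero h29
    have s3 := h.regs (l := [.op .sub 23 23 25]) (o := o)
      (K := block [.rand 24 25] :: skipCmd :: K) (by decide) hL hm'.rep.zero
    set m2 := runSeg Γ.b [.op .sub 23 23 25] m' with hm2
    have hne : ∀ x, x ≠ 23 → m2 x = m' x := fun x hx =>
      runSeg_frame (by simp [destCell]; omega)
    have hNb : N - R < 2 ^ Γ.b := by omega
    have hst : SkipSt Γ j e w R cnt off (N - R) Q a π m₀ m2 := {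
        rep := hm'.rep.congr fun x hx => hne x (by unfold Pers at hx; omega)
        inv := hm'.inv
        cov := hm'.cov
        h23 := by
          simp [hm2, runSeg, assign, Mem.write, BinOp.eval, hm'.h23, hm'.h25,
            Nat.mod_eq_of_lt hNb]
        h25 := by rw [hne 25 (by omega), hm'.h25]
        h26 := by rw [hne 26 (by omega), hm'.h26]
        h27 := by rw [hne 27 (by omega), hm'.h27]
        fr := fun x hx hx' => by rw [hne x (by omega), hm'.fr x hx hx'] }
    exact (((s1.trans s2).trans s3).trans (fresh (N - R) (by omega) a Q m2 hst (by omega))).mono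
      (by decide)
  have hit : ∀ m', SkipSt Γ j e w R cnt off N Q a π m₀ m' → m' 24 = U → U < N → m' 29 = 1 →
      LeT τ 120 (ψ m' o (block [.branch 29 skipHit skipMiss, .rand 24 25] :: skipCmd :: K))
        (skipCost (250 * τ) R (N - U - 1) +
            expect (hitA Γ.M e w (Γ.M / R) (π (off + (N - U - 1) % cnt)) a) fun a' =>
              expect (trials Γ.M e w (trialList π off cnt (N - U - 1)) a') F) := by
    intro m' hm' h24' hUN h29
    have s1 := h.cons (c := .branch 29 skipHit skipMiss) (l := [.rand 24 25]) (o := o)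
      (K := skipCmd :: K) hm'.rep.zero
    have s2 := h.branch_pos (x := 29) (p := skipHit) (q := skipMiss) (o := o)
      (K := block [.rand 24 25] :: skipCmd :: K) hm'.rep.zero (by rw [h29]; decide)
    have s3 := h.seg (l := [.op .sub 23 23 24, .op .sub 23 23 3]) (rest := [hitCmd]) (o := o)
      (K := block [.rand 24 25] :: skipCmd :: K) (by decide) hL hm'.rep.zero
    set m2 := runSeg Γ.b [.op .sub 23 23 24, .op .sub 23 23 3] m' with hm2
    have hne : ∀ x, x ≠ 23 → m2 x = m' x := fun x hx =>
      runSeg_frame (by simp [destCell]; omega)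
    have hNb : N - U < 2 ^ Γ.b := by omega
    have hNb' : N - U - 1 < 2 ^ Γ.b := by omega
    have h223 : m2 23 = N - U - 1 := by
      simp [hm2, runSeg, assign, Mem.write, BinOp.eval, hm'.h23, h24', hm'.rep.c3,
        Nat.mod_eq_of_lt hNb, Nat.mod_eq_of_lt hNb']
    have hrep2 : Rep Γ j a π m2 := hm'.rep.congr fun x hx => hne x (by unfold Pers at hx; omega)
    have s4 := h.cons (c := hitCmd) (l := []) (o := o)
      (K := block [.rand 24 25] :: skipCmd :: K) hrep2.zero
    have hfr : ∀ x < 64, (x ≤ 22 ∧ x ≠ 18 ∧ x ≠ 19) ∨ 42 ≤ x → m2 x = m₀ x := fun x hx hx' => by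
      rw [hne x (by omega), hm'.fr x hx hx']
    have hmod := Nat.mod_lt (N - U - 1) hcnt
    have s5 := hit_spec h hΓ hm'.inv (by omega) hrep2 (e := e) (w := w) (n := N - U - 1)
      (cnt := cnt) (off := off) (R := R) (o := o)
      (K := block [] :: block [.rand 24 25] :: skipCmd :: K)
      (by rw [hfr 4 (by omega) (by omega), h4]) (by rw [hfr 5 (by omega) (by omega), h5]) he hw h223
      (by rw [hne 25 (by omega), hm'.h25]) (by rw [hne 26 (by omega), hm'.h26])
      (by rw [hne 27 (by omega), hm'.h27]) hR hRM (by omega)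
      (fun a' => 4 * τ + Y (N - U - 1) a') (fun a' m3 ha' hrep3 hfr3 => by
        have hst : SkipSt Γ j e w R cnt off (N - U - 1) (Q + 1) a' π m₀ m3 := {
          rep := hrep3
          inv := hm'.inv.hit ha'
          cov := fun n hn => (hm'.cov n hn).mono (hitA_support ha' _)
          h23 := by rw [hfr3 23 (by omega) (by omega), h223]
          h25 := by rw [hfr3 25 (by omega) (by omega), hne 25 (by omega), hm'.h25]
          h26 := by rw [hfr3 26 (by omega) (by omega), hne 26 (by omega), hm'.h26]
          h27 := by rw [hfr3 27 (by omega) (by omega), hne 27 (by omega), hm'.h27]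
          fr := fun x hx hx' => by rw [hfr3 x hx (by omega), hfr x hx hx'] }
        have := (h.nil (o := o) (K := block [.rand 24 25] :: skipCmd :: K) hrep3.zero).trans
          (fresh (N - U - 1) (by omega) a' (Q + 1) m3 hst (by omega))
        exact this.le.trans (by norm_num))
    have s5' : LeT τ 104 (ψ m2 o (hitCmd :: block [] :: block [.rand 24 25] :: skipCmd :: K))
        (skipCost (250 * τ) R (N - U - 1) +
            expect (hitA Γ.M e w (Γ.M / R) (π (off + (N - U - 1) % cnt)) a) fun a' =>
              expect (trials Γ.M e w (trialList π off cnt (N - U - 1)) a') F) := by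
      refine s5.trans (le_of_eq ?_)
      rw [expect_add, expect_const]
      simp only [hY]
      rw [expect_add, expect_const]
      push_cast
      ring
    exact ((((s1.trans s2).trans s3).trans s4).trans s5').mono (by decide)
  -- the attempt
  have s1 := h.loop_pos (x := 23) (p := skipBody) (o := o) (K := K) hm.rep.zero
    (by rw [hm.h23]; omega)
  have s2 := h.seg (l := [.op .lt 29 24 23]) (rest := [.branch 29 vnCmd .skip,
    .branch 29 skipHit skipMiss, .rand 24 25]) (o := o) (K := skipCmd :: K) (by decide) hL
    hm.rep.zero
  set m1 := runSeg Γ.b [.op .lt 29 24 23] m with hm1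
  have hne : ∀ x, x ≠ 29 → m1 x = m x := fun x hx => runSeg_frame (by simp [destCell]; omega)
  have hst1 : ∀ m2 : Mem, (∀ x, x ∉ [28, 29, 30, 31] → m2 x = m1 x) →
      SkipSt Γ j e w R cnt off N Q a π m₀ m2 := fun m2 hf => by
    have hne' : ∀ x, x < 28 ∨ 31 < x → m2 x = m x := fun x hx => by
      rw [hf x (by simp; omega), hne x (by omega)]
    exact {
        rep := hm.rep.congr fun x hx => hne' x (by unfold Pers at hx; omega)
        inv := hm.inv
        cov := hm.cov
        h23 := by rw [hne' 23 (by omega), hm.h23]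
        h25 := by rw [hne' 25 (by omega), hm.h25]
        h26 := by rw [hne' 26 (by omega), hm.h26]
        h27 := by rw [hne' 27 (by omega), hm.h27]
        fr := fun x hx hx' => by rw [hne' x (by omega), hm.fr x hx hx'] }
  have hz1 : Zero (64 + 5 * Γ.s) m1 := hm.rep.zero.runSeg (by decide) hL
  have s3 := h.cons (c := .branch 29 vnCmd .skip) (l := [.branch 29 skipHit skipMiss, .rand 24 25])
    (o := o) (K := skipCmd :: K) hz1
  have h129 : m1 29 = (if U < N then 1 else 0) % 2 ^ Γ.b := by
    simp [hm1, runSeg, assign, Mem.write, BinOp.eval, h24, hm.h23]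
  by_cases hUN : U < N
  · rw [if_pos hUN, Nat.mod_eq_of_lt (by omega)] at h129
    rw [if_pos hUN]
    have s4 := h.branch_pos (x := 29) (p := vnCmd) (q := .skip) (o := o)
      (K := block [.branch 29 skipHit skipMiss, .rand 24 25] :: skipCmd :: K) hz1
      (by rw [h129]; decide)
    set A := skipCost (250 * τ) R (N - U - 1) +
            expect (hitA Γ.M e w (Γ.M / R) (π (off + (N - U - 1) % cnt)) a) fun a' =>
              expect (trials Γ.M e w (trialList π off cnt (N - U - 1)) a') F with hA
    have s5 := vn_spec h (o := o)
      (K := block [.branch 29 skipHit skipMiss, .rand 24 25] :: skipCmd :: K) hL hU hRR (by omega)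
      hz1 (by rw [hne 3 (by omega), hm.rep.c3]) (by rw [hne 24 (by omega), h24])
      (by rw [hne 25 (by omega), hm.h25]) (120 * τ + A) (120 * τ + Y (N - R) a)
      (fun m' _ hf h29 => (hit m' (hst1 m' hf)
        (by rw [hf 24 (by decide), hne 24 (by omega), h24]) hUN h29).le.trans (by norm_num))
      (fun m' _ hf h29 => ((miss m' (hst1 m' hf) h29).mono (m := 120) (by omega)).le.trans
        (by norm_num))
    have hsum : stay R ^ U + (1 - stay R ^ U) = 1 := add_tsub_cancel_of_le (stay_pow_le_one hR U)
    refine ((((s1.trans s2).trans s3).trans s4).trans_le s5).le.trans ?_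
    calc _ = ((1 + (2 * [Cmd.op BinOp.lt 29 24 23].length + 2) + 1 + 1 : ℕ) : ℝ≥0∞) * τ +
          (80 * τ + ((stay R ^ U + (1 - stay R ^ U)) * (120 * τ) +
            (stay R ^ U * A + (1 - stay R ^ U) * Y (N - R) a))) := by ring
      _ = 207 * τ + (stay R ^ U * A + (1 - stay R ^ U) * Y (N - R) a) := by
        rw [hsum]; simp; ring
      _ ≤ _ := by gcongr; norm_num
  · rw [if_neg hUN, Nat.zero_mod] at h129
    rw [if_neg hUN]
    have s4 := h.branch_neg (x := 29) (p := vnCmd) (q := .skip) (o := o)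
      (K := block [.branch 29 skipHit skipMiss, .rand 24 25] :: skipCmd :: K) hz1 h129
    have s5 := h.skip (o := o)
      (K := block [.branch 29 skipHit skipMiss, .rand 24 25] :: skipCmd :: K) hz1
    have s6 := miss m1 (hst1 m1 fun x _ => rfl) h129
    exact (((((s1.trans s2).trans s3).trans s4).trans s5).trans s6).mono (m := 250) (by decide)
      |>.le.trans (by norm_num; exact le_rfl)

end Skip


/-! ## Skipping, split into cost and effect -/

/-- Effect of `N` trials at rate `1 / R`, the first skip being `U`. -/
def skipVal (M e w R cnt off : ℕ) (π : ℕ → ℕ) (N U : ℕ) (F : (ℕ → Slot) → ℝ≥0∞) (a : ℕ → Slot) :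
    ℝ≥0∞ :=
  if U < N then
    stay R ^ U * expect (hitA M e w (M / R) (π (off + (N - U - 1) % cnt)) a) (fun a' =>
      expect (trials M e w (trialList π off cnt (N - U - 1)) a') F) +
    (1 - stay R ^ U) * expect (trials M e w (trialList π off cnt (N - R)) a) F
  else expect (trials M e w (trialList π off cnt (N - R)) a) F

/-- Cost of `N` trials at rate `1 / R` after the first attempt, the first skip being `U`. -/
def skipExp (c : ℝ≥0∞) (R N U : ℕ) : ℝ≥0∞ :=
  if U < N then stay R ^ U * skipCost c R (N - U - 1) + (1 - stay R ^ U) * skipCost c R (N - R)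
  else skipCost c R (N - R)

theorem stay_split {R : ℕ} (hR : 0 < R) (U : ℕ) (x : ℝ≥0∞) :
    stay R ^ U * x + (1 - stay R ^ U) * x = x := by
  rw [← add_mul, add_tsub_cancel_of_le (stay_pow_le_one hR U), one_mul]

theorem skipVal_add_const {M e w R cnt off : ℕ} (hR : 0 < R) (π : ℕ → ℕ) (N U : ℕ)
    (F : (ℕ → Slot) → ℝ≥0∞) (a : ℕ → Slot) (x : ℝ≥0∞) :
    skipVal M e w R cnt off π N U (fun a => x + F a) a =
      x + skipVal M e w R cnt off π N U F a := by
  unfold skipVal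
  simp only [expect_add, expect_const]
  split_ifs
  · nth_rewrite 3 [← stay_split hR U x]
    ring
  · rfl

/-- If the draw lies beyond the last trial, all trials miss: from `N ≤ U < R` the truncated
difference `N - R` is zero. This is what lets a site stay silent. -/
theorem skipVal_of_le {M e w R cnt off : ℕ} (π : ℕ → ℕ) {N U : ℕ} (h : N ≤ U) (hU : U < R)
    (F : (ℕ → Slot) → ℝ≥0∞) (a : ℕ → Slot) : skipVal M e w R cnt off π N U F a = F a := by
  rw [skipVal, if_neg (by omega), show N - R = 0 by omega]
  simp [trialList, trials, expect_pure]

theorem skipExp_of_le (c : ℝ≥0∞) {R N U : ℕ} (h : N ≤ U) (hU : U < R) : skipExp c R N U = 0 := by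
  rw [skipExp, if_neg (by omega), show N - R = 0 by omega]
  simp [skipCost]

/-- A uniform first draw restores exactly the law of the trials without skips. The hypothesis on
`cnt` admits an empty group of laggards. -/
theorem avg_skipVal {M e w R cnt off : ℕ} (hR : 0 < R) (hM : 0 < M) (hd : R ∣ M) {π : ℕ → ℕ}
    {a : ℕ → Slot} (hcov : ∀ n < cnt, Covered M R (a (π (off + n)))) {N : ℕ}
    (hN : N ≠ 0 → 0 < cnt) (F : (ℕ → Slot) → ℝ≥0∞) :
    avg R (fun U => skipVal M e w R cnt off π N U F a) =
      expect (trials M e w (trialList π off cnt N) a) F := by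
  rcases Nat.eq_zero_or_pos N with rfl | hN0
  · rw [avg_congr (g := fun _ => F a) fun U hU => skipVal_of_le π (by omega) hU F a, avg_const hR]
    simp [trialList, trials, expect_pure]
  · have hcnt := hN hN0.ne'
    unfold skipVal
    rw [avg_skip hR N (fun U => expect (hitA M e w (M / R) (π (off + (N - U - 1) % cnt)) a) fun a' =>
      expect (trials M e w (trialList π off cnt (N - U - 1)) a') F)]
    have hun := unroll (R := R)
        (fun n => expect (hitA M e w (M / R) (π (off + n % cnt)) a) fun a' =>
              expect (trials M e w (trialList π off cnt n) a') F)
        (fun n => expect (trials M e w (trialList π off cnt n) a) F) (fun n => by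
          rw [trialList_succ, trials, expect_bind,
            expect_hitA_covered hR hM hd (hcov _ (Nat.mod_lt _ hcnt))])
        (n := min N R) (N := N) (min_le_left _ _)
    rw [← hun, show N - min N R = N - R by omega]

/-- `skip_cost` after cancelling the price of the first attempt. That price is accounted for
separately, because a site that stays silent saves it. -/
theorem avg_skipExp {c : ℝ≥0∞} (hc : c ≠ ∞) {R : ℕ} (hR : 0 < R) (N : ℕ) :
    avg R (skipExp c R N) ≤ c * (2 * N * (R : ℝ≥0∞)⁻¹) := by
  rcases Nat.eq_zero_or_pos N with rfl | hN0
  · rw [avg_congr (g := fun _ => 0) fun U hU => skipExp_of_le c (by omega) hU, avg_const hR]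
    exact zero_le
  · have := skip_cost hR hN0 c
    have hN : skipCost c R N = c + c * (2 * N * (R : ℝ≥0∞)⁻¹) := by
      rw [skipCost, if_neg hN0.ne', mul_add, mul_one]
    rw [← avg_skip hR N (fun U => skipCost c R (N - U - 1)), hN,
      ENNReal.add_le_add_iff_left hc] at this
    exact this

theorem avg_lt_le {R : ℕ} (N : ℕ) (c : ℝ≥0∞) :
    avg R (fun U => if U < N then c else 0) ≤ c * (N * (R : ℝ≥0∞)⁻¹) := by
  unfold avg
  rw [← Finset.sum_filter, Finset.sum_const, nsmul_eq_mul]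
  have : ({U ∈ Finset.range R | U < N}.card : ℝ≥0∞) ≤ N := by
    have h : {U ∈ Finset.range R | U < N}.card ≤ (Finset.range N).card :=
      Finset.card_le_card fun U hU => Finset.mem_range.2 (Finset.mem_filter.1 hU).2
    rw [Finset.card_range] at h
    exact_mod_cast h
  calc _ ≤ (R : ℝ≥0∞)⁻¹ * (N * c) := by gcongr
    _ = _ := by ring

theorem expect_avg {α : Type*} (p : PMF α) (n : ℕ) (f : ℕ → α → ℝ≥0∞) :
    avg n (fun v => expect p (f v)) = expect p fun a => avg n fun v => f v a := by
  unfold avg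
  rw [expect_const_mul]
  congr 1
  unfold expect
  simp only [Finset.mul_sum]
  rw [Summable.tsum_finsetSum fun _ _ => ENNReal.summable]

/-! ## Rates -/

section Rates

variable {Γ : Par} (hΓ : Γ.Ok)
include hΓ

theorem Par.Ok.ρ_two : 2 ≤ Γ.ρ := by
  obtain ⟨q, hq, h⟩ := hΓ.hρ
  rw [h]
  exact Nat.le_self_pow (by omega) 2

theorem Par.Ok.R_two (j : ℕ) : ∃ n, Γ.R j = 2 ^ n := by
  obtain ⟨q, -, h⟩ := hΓ.hρ
  exact ⟨q * j, by rw [Par.R, h, pow_mul]⟩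

theorem Par.Ok.R_pos (j : ℕ) : 0 < Γ.R j := by
  obtain ⟨n, h⟩ := hΓ.R_two j
  rw [h]; positivity

/-- When `R j < lam` the quotient is zero and the correction makes the rate one; otherwise both are
powers of two and the division is exact. -/
theorem Par.Ok.Rv_two (j : ℕ) : (∃ n, Γ.Rv j = 2 ^ n) ∧ Γ.Rv j ≤ Γ.R j ∧ Γ.R j ≤ Γ.Rv j * Γ.lam := by
  obtain ⟨n, h⟩ := hΓ.R_two j
  obtain ⟨l, hl⟩ := hΓ.hlam
  unfold Par.Rv
  by_cases hlt : Γ.R j < Γ.lam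
  · rw [if_pos hlt, Nat.div_eq_of_lt hlt]
    exact ⟨⟨0, rfl⟩, hΓ.R_pos j, by omega⟩
  · rw [if_neg hlt, h, hl] at *
    have hln : l ≤ n := (Nat.pow_le_pow_iff_right (by norm_num : 1 < 2)).1 (by omega)
    rw [Nat.pow_div hln (by norm_num), zero_add]
    refine ⟨⟨_, rfl⟩, Nat.pow_le_pow_right (by norm_num) (by omega), ?_⟩
    rw [← pow_add]
    exact Nat.pow_le_pow_right (by norm_num) (by omega)

theorem Par.Ok.Rv_pos (j : ℕ) : 0 < Γ.Rv j := by
  obtain ⟨n, h⟩ := (hΓ.Rv_two j).1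
  rw [h]; positivity

theorem Par.Ok.two_dvd {R : ℕ} (hR : ∃ n, R = 2 ^ n) (hRM : R ≤ Γ.M) : R ∣ Γ.M := by
  obtain ⟨n, rfl⟩ := hR
  obtain ⟨m, hm⟩ := hΓ.hM
  rw [hm] at hRM ⊢
  exact Nat.pow_dvd_pow 2 ((Nat.pow_le_pow_iff_right (by norm_num : 1 < 2)).1 hRM)

/-- Since `ρ ≥ 2`, at most a quarter of the slots may be laggards; in particular the other group is
never empty. -/
theorem Par.Ok.lmax_lt : 4 * Γ.lmax ≤ Γ.s := by
  rw [hΓ.hlmax]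
  have h4 : 4 ≤ 2 ^ Γ.ρ := by
    calc 4 = 2 ^ 2 := rfl
      _ ≤ _ := Nat.pow_le_pow_right (by norm_num) hΓ.ρ_two
  calc _ ≤ 2 ^ Γ.ρ * (Γ.s / 2 ^ Γ.ρ) := Nat.mul_le_mul h4 le_rfl
    _ ≤ _ := Nat.mul_div_le _ _

theorem Par.Ok.ell_lt (j : ℕ) : Γ.ell j < Γ.s := by
  have := hΓ.lmax_lt
  have := hΓ.hs
  unfold Par.ell
  split_ifs <;> omega

end Rates

/-! ### The trials of one piece: laggards, then the other slots -/

section Stages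

variable {Γ : Par} {τ μ : ℝ≥0∞} {ψ : Mem → List (ℕ × List ℕ) → List Cmd → ℝ≥0∞}
  (h : Loc Γ.b τ μ (64 + 5 * Γ.s) ψ) {o : List (ℕ × List ℕ)} {K : List Cmd}

include h

/-- `skip_spec` with the price separated from the effect, so that the two can be averaged
independently. -/
theorem skip_split (hΓ : Γ.Ok) {j e w R cnt off : ℕ} {π : ℕ → ℕ} {m₀ : Mem} {Q N : ℕ}
    (h4 : m₀ 4 = e) (h5 : m₀ 5 = w) (he : e < 2 ^ Γ.b) (hw : w < 2 ^ Γ.b) (hR : 0 < R)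
    (hRM : R ≤ Γ.M) (hd : R ∣ Γ.M) (hcnt : N ≠ 0 → 0 < cnt) (hoff : off + cnt ≤ Γ.s)
    (hQ : Q + N < 2 ^ Γ.b) (f : (ℕ → Slot) → ℝ≥0∞)
    (hK : ∀ a' m', SkipSt Γ j e w R cnt off 0 (Q + N) a' π m₀ m' → ψ m' o K ≤ f a')
    {a : ℕ → Slot} {m : Mem} {U : ℕ} (hm : SkipSt Γ j e w R cnt off N Q a π m₀ m) (h24 : m 24 = U)
    (hU : U < R) :
    ψ m o (skipCmd :: K) ≤ 251 * τ + skipExp (250 * τ) R N U +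
      skipVal Γ.M e w R cnt off π N U f a := by
  rcases Nat.eq_zero_or_pos N with rfl | hN
  · rw [skipVal_of_le π (by omega) hU]
    refine (skip_zero h hm f hK).trans (add_le_add_left ?_ _)
    exact le_add_right (le_mul_of_one_le_left zero_le (by norm_num))
  · refine (skip_spec h hΓ h4 h5 he hw hR hRM hd (hcnt hN.ne') hoff hQ f hK N a Q m U hm le_rfl h24
      hU).trans (le_of_eq ?_)
    rw [if_neg hN.ne', skipExp, skipVal]
    simp only [expect_add, expect_const]
    split_ifs
    · have h1 := stay_split hR U τ
      generalize expect (hitA _ _ _ _ _ _) _ = x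
      generalize expect (trials _ _ _ _ _) _ = y
      generalize skipCost _ _ _ = z at *
      generalize skipCost _ _ _ = z' at *
      calc _ = 250 * τ + (stay R ^ U * τ + (1 - stay R ^ U) * τ) + (stay R ^ U * z +
            (1 - stay R ^ U) * z') + (stay R ^ U * x + (1 - stay R ^ U) * y) := by ring
        _ = _ := by rw [h1]; ring
    · ring

/-- Preparation of the trials of the laggards and of the other slots. -/
def lagPrep : List Cmd := [.op .sub 44 42 13, .op .sub 43 42 44, .op .mul 23 12 43, .const 27 0,
  .op .add 24 6 27, .op .add 25 14 27, .op .add 26 12 27]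
def mainPrep : List Cmd := [.op .sub 26 1 12, .op .mul 23 26 43, .const 27 0,
  .op .add 24 7 27, .op .add 25 13 27, .op .add 27 12 27]

/-- A piece consists of `w' = min n (R j)` units: the epoch is reconsidered at least once every `R
j` units, so an outdated high rate is not kept through a heavy item. The inner `skipVal` is the
reward of the first stage. -/
theorem stages_spec (hΓ : Γ.Ok) {j e w n Q UA UB w' : ℕ} {π : ℕ → ℕ} {a : ℕ → Slot} {m : Mem}
    (hm : Rep Γ j a π m) (hI : Inv Γ j a π Q) (h4 : m 4 = e) (h5 : m 5 = w) (he : e < 2 ^ Γ.b)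
    (hw : w < 2 ^ Γ.b) (h42 : m 42 = n) (h6 : m 6 = UA) (h7 : m 7 = UB) (hUA : UA < Γ.Rv j)
    (hUB : UB < Γ.R j) (hn : n < 2 ^ Γ.b) (hw' : w' = min n (Γ.R j))
    (hQ : Q + Γ.s * w' < 2 ^ Γ.b) {rest : List Cmd}
    (f : (ℕ → Slot) → ℝ≥0∞)
    (hK : ∀ a' m', Rep Γ j a' π m' → Inv Γ j a' π (Q + Γ.s * w') → m' 44 = n - Γ.R j →
      (∀ x < 64, (x ≤ 7 ∨ 45 ≤ x) → m' x = m x) → ψ m' o (block rest :: K) ≤ f a') :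
    ψ m o (block (block lagPrep :: skipCmd :: block mainPrep :: skipCmd :: rest) :: K) ≤
      540 * τ + skipExp (250 * τ) (Γ.Rv j) (Γ.ell j * w') UA +
        skipExp (250 * τ) (Γ.R j) ((Γ.s - Γ.ell j) * w') UB +
        skipVal Γ.M e w (Γ.Rv j) (Γ.ell j) 0 π (Γ.ell j * w') UA
          (skipVal Γ.M e w (Γ.R j) (Γ.s - Γ.ell j) (Γ.ell j) π ((Γ.s - Γ.ell j) * w') UB f) a := by
  have hL : 64 ≤ 64 + 5 * Γ.s := by omega
  have bs := hΓ.bs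
  have hell := hΓ.ell_lt j
  obtain ⟨hv1, hv2, -⟩ := hΓ.Rv_two j
  have hRM := hI.hR
  have hM1 : Γ.M < 2 ^ Γ.b := by have := hΓ.bMρ; omega
  set ℓ := Γ.ell j with hℓ
  have hsplit : ℓ * w' + (Γ.s - ℓ) * w' = Γ.s * w' := by
    rw [← add_mul, Nat.add_sub_cancel' hell.le]
  have hnw : n - (n - Γ.R j) = w' := by omega
  -- the laggards
  set m1 := runSeg Γ.b lagPrep m with hm1
  have hz1 : Zero (64 + 5 * Γ.s) m1 := hm.zero.runSeg (by decide) hL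
  have fr1 : ∀ x, x < 23 ∨ x = 42 ∨ 45 ≤ x → m1 x = m x := fun x hx =>
    runSeg_frame (by simp [lagPrep, destCell]; omega)
  have b1 : n - Γ.R j < 2 ^ Γ.b := by omega
  have b2 : w' < 2 ^ Γ.b := by omega
  have b3 : ℓ * w' < 2 ^ Γ.b := by omega
  have b4 : UA < 2 ^ Γ.b := by omega
  have b5 : Γ.Rv j < 2 ^ Γ.b := by omega
  have b6 : ℓ < 2 ^ Γ.b := by omega
  have vals : m1 44 = n - Γ.R j ∧ m1 43 = w' ∧ m1 23 = ℓ * w' ∧ m1 24 = UA ∧ m1 25 = Γ.Rv j ∧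
      m1 26 = ℓ ∧ m1 27 = 0 := by
    refine ⟨?_, ?_, ?_, ?_, ?_, ?_, ?_⟩ <;>
    simp [hm1, lagPrep, runSeg, assign, Mem.write, BinOp.eval, h42, h6, hm.c13, hm.c12, hm.c14,
      Nat.mod_eq_of_lt, b1, hnw, b2, ← hℓ, b3, b4, b5, b6]
  obtain ⟨v44, v43, v23, v24, v25, v26, v27⟩ := vals
  have s1 := h.seg (l := lagPrep) (rest := skipCmd :: block mainPrep :: skipCmd :: rest) (o := o)
    (K := K) (by decide) hL hm.zero
  have s2 := h.cons (c := skipCmd) (l := block mainPrep :: skipCmd :: rest) (o := o)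
    (K := K) hz1
  have hst1 : SkipSt Γ j e w (Γ.Rv j) ℓ 0 (ℓ * w') Q a π m1 m1 := {
    rep := hm.congr fun x hx => by
      unfold Pers at hx
      rcases hx with hx | hx | hx | hx
      · exact fr1 x (by omega)
      · exact fr1 x (by omega)
      · exact fr1 x (by omega)
      · exact fr1 x (by omega)
    inv := hI
    cov := fun q hq => hI.covv _ (hI.lt (by omega))
    h23 := v23, h25 := v25, h26 := v26, h27 := v27
    fr := fun x _ _ => rfl }
  -- the other slots
  have stage2 : ∀ (a1 : ℕ → Slot) (m2 : Mem), SkipSt Γ j e w (Γ.Rv j) ℓ 0 0 (Q + ℓ * w') a1 π m1 m2 →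
      ψ m2 o (block (block mainPrep :: skipCmd :: rest) :: K) ≤
        (266 * τ + skipExp (250 * τ) (Γ.R j) ((Γ.s - ℓ) * w') UB) +
        skipVal Γ.M e w (Γ.R j) (Γ.s - ℓ) ℓ π ((Γ.s - ℓ) * w') UB f a1 := by
    intro a1 m2 hst2
    have hrep2 := hst2.rep
    set m3 := runSeg Γ.b mainPrep m2 with hm3
    have hz3 : Zero (64 + 5 * Γ.s) m3 := hrep2.zero.runSeg (by decide) hL
    have fr3 : ∀ x, x < 23 ∨ 28 ≤ x → m3 x = m2 x := fun x hx =>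
      runSeg_frame (by simp [mainPrep, destCell]; omega)
    have c1 : Γ.s - ℓ < 2 ^ Γ.b := by omega
    have c2 : (Γ.s - ℓ) * w' < 2 ^ Γ.b := by omega
    have c3 : UB < 2 ^ Γ.b := by omega
    have c4 : Γ.R j < 2 ^ Γ.b := by omega
    have e7 : m2 7 = UB := by rw [hst2.fr 7 (by omega) (by omega), fr1 7 (by omega), h7]
    have e43 : m2 43 = w' := by rw [hst2.fr 43 (by omega) (by omega), v43]
    have vals : m3 23 = (Γ.s - ℓ) * w' ∧ m3 24 = UB ∧ m3 25 = Γ.R j ∧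
        m3 26 = Γ.s - ℓ ∧ m3 27 = ℓ := by
      refine ⟨?_, ?_, ?_, ?_, ?_⟩ <;>
      simp [hm3, mainPrep, runSeg, assign, Mem.write, BinOp.eval, hrep2.c1, hrep2.c12, ← hℓ, e43,
        e7, hrep2.c13, Nat.mod_eq_of_lt, c1, c2, c3, c4, b6]
    obtain ⟨u23, u24, u25, u26, u27⟩ := vals
    have t1 := h.seg (l := mainPrep) (rest := skipCmd :: rest) (o := o)
      (K := K) (by decide) hL hrep2.zero
    have t2 := h.cons (c := skipCmd) (l := rest) (o := o) (K := K) hz3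
    have hst3 : SkipSt Γ j e w (Γ.R j) (Γ.s - ℓ) ℓ ((Γ.s - ℓ) * w') (Q + ℓ * w') a1 π m3 m3 := {
      rep := hrep2.congr fun x hx => by
        unfold Pers at hx
        rcases hx with hx | hx | hx | hx
        · exact fr3 x (by omega)
        · exact fr3 x (by omega)
        · exact fr3 x (by omega)
        · exact fr3 x (by omega)
      inv := hst2.inv
      cov := fun q hq => hst2.inv.cov _ (by omega) (by omega)
      h23 := u23, h25 := u25, h26 := u26, h27 := u27
      fr := fun x _ _ => rfl }
    have fr3' : ∀ x < 64, x ≤ 7 ∨ 42 ≤ x → m3 x = m1 x := fun x hx hx' => by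
      rw [fr3 x (by omega), hst2.fr x hx (by omega)]
    have t3 := skip_split h (o := o) (K := block rest :: K) hΓ
      (by rw [fr3' 4 (by omega) (by omega), fr1 4 (by omega), h4])
      (by rw [fr3' 5 (by omega) (by omega), fr1 5 (by omega), h5]) he hw (hΓ.R_pos j) hRM
      (hΓ.two_dvd (hΓ.R_two j) hRM) (fun _ => by omega) (by omega) (by omega) f
      (fun a' m' hm' => hK a' m' hm'.rep (by
        have := hm'.inv
        rwa [add_assoc, hsplit] at this) (by
        rw [hm'.fr 44 (by omega) (by omega), fr3' 44 (by omega) (by omega), v44])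
        fun x hx hx' => by
          rw [hm'.fr x hx (by omega), fr3' x hx (by omega), fr1 x (by omega)]) hst3 u24 hUB
    refine ((t1.trans t2).trans_le t3).le.trans (le_of_eq ?_)
    simp only [mainPrep, List.length_cons, List.length_nil]
    push_cast
    ring
  have s3 := skip_split h (o := o) (K := block (block mainPrep :: skipCmd :: rest) :: K) hΓ
    (by rw [fr1 4 (by omega), h4]) (by rw [fr1 5 (by omega), h5]) he hw (hΓ.Rv_pos j)
    (by omega) (hΓ.two_dvd hv1 (by omega)) (fun h0 => Nat.pos_of_ne_zero fun h1 => h0 (by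
      rw [h1, zero_mul])) (by omega) (by omega) _ stage2 hst1 v24 hUA
  rw [skipVal_add_const (hΓ.Rv_pos j)] at s3
  refine ((s1.trans s2).trans_le s3).le.trans ?_
  generalize skipVal _ _ _ _ _ _ _ _ _ _ _ = v
  calc _ = 534 * τ + skipExp (250 * τ) (Γ.Rv j) (ℓ * w') UA +
        skipExp (250 * τ) (Γ.R j) ((Γ.s - ℓ) * w') UB + v := by
        simp only [lagPrep, List.length_cons, List.length_nil]
        push_cast
        ring
    _ ≤ _ := by gcongr; norm_num

end Stages


/-! ## Recomputing thresholds and the order of the slots -/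

/-- The part of the representation that does not depend on the epoch. -/
structure Core (Γ : Par) (a : ℕ → Slot) (m : Mem) : Prop where
  zero : Zero (64 + 5 * Γ.s) m
  c0 : m 0 = Γ.k
  c1 : m 1 = Γ.s
  c3 : m 3 = 1
  c8 : m 8 = Γ.M
  c9 : m 9 = Γ.ρ
  c10 : m 10 = Γ.lam
  c11 : m 11 = Γ.lmax
  c20 : m 20 = 64 + 2 * Γ.s
  c21 : m 21 = 64 + 3 * Γ.s
  c22 : m 22 = 64 + 4 * Γ.s
  id : ∀ i < Γ.s, m (64 + 2 * i) = (a i).id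
  w : ∀ i < Γ.s, m (64 + 2 * i + 1) = (a i).w
  y : ∀ i < Γ.s, m (64 + 2 * Γ.s + i) = (a i).y
  c : ∀ i < Γ.s, m (64 + 3 * Γ.s + i) = (a i).c

theorem Rep.core {Γ : Par} {j : ℕ} {a : ℕ → Slot} {π : ℕ → ℕ} {m : Mem} (h : Rep Γ j a π m) :
    Core Γ a m :=
  ⟨h.zero, h.c0, h.c1, h.c3, h.c8, h.c9, h.c10, h.c11, h.c20, h.c21, h.c22, h.id, h.w, h.y, h.c⟩

theorem Core.congr {Γ : Par} {a : ℕ → Slot} {m m' : Mem} (h : Core Γ a m)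
    (hz : Zero (64 + 5 * Γ.s) m')
    (hm : ∀ x, x < 4 ∨ (8 ≤ x ∧ x ≤ 11) ∨ (20 ≤ x ∧ x ≤ 22) ∨ (64 ≤ x ∧ x < 64 + 4 * Γ.s) →
      m' x = m x) : Core Γ a m' where
  zero := hz
  c0 := by rw [hm _ (by omega), h.c0]
  c1 := by rw [hm _ (by omega), h.c1]
  c3 := by rw [hm _ (by omega), h.c3]
  c8 := by rw [hm _ (by omega), h.c8]
  c9 := by rw [hm _ (by omega), h.c9]
  c10 := by rw [hm _ (by omega), h.c10]
  c11 := by rw [hm _ (by omega), h.c11]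
  c20 := by rw [hm _ (by omega), h.c20]
  c21 := by rw [hm _ (by omega), h.c21]
  c22 := by rw [hm _ (by omega), h.c22]
  id i hi := by rw [hm _ (by omega), h.id i hi]
  w i hi := by rw [hm _ (by omega), h.w i hi]
  y i hi := by rw [hm _ (by omega), h.y i hi]
  c i hi := by rw [hm _ (by omega), h.c i hi]

/-- Number of slots `i, …, s - 1` with score below `T`. -/
def cntFrom (s : ℕ) (a : ℕ → Slot) (T i : ℕ) : ℕ := {l ∈ Finset.Ico i s | (a l).y < T}.card

theorem cntFrom_zero (s : ℕ) (a : ℕ → Slot) (T : ℕ) : cntFrom s a T 0 = cntLt s a T := by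
  rw [cntFrom, cntLt, Finset.range_eq_Ico]

theorem cntFrom_self (s : ℕ) (a : ℕ → Slot) (T : ℕ) : cntFrom s a T s = 0 := by simp [cntFrom]

theorem cntFrom_eq {s i : ℕ} (hi : i < s) (a : ℕ → Slot) (T : ℕ) :
    cntFrom s a T i = cntFrom s a T (i + 1) + if (a i).y < T then 1 else 0 := by
  unfold cntFrom
  rw [Finset.card_filter, Finset.card_filter, Finset.sum_eq_sum_Ico_succ_bot hi, add_comm]

theorem cntFrom_le (s : ℕ) (a : ℕ → Slot) (T i : ℕ) : cntFrom s a T i ≤ s - i := by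
  unfold cntFrom
  exact (Finset.card_filter_le _ _).trans (by simp)

theorem perm_of_surj {s : ℕ} {π : ℕ → ℕ} (h : ∀ l < s, ∃ q < s, π q = l) :
    ((List.range s).map π).Perm (List.range s) := by
  have h1 : (List.range s).Subperm ((List.range s).map π) := by
    refine List.subperm_of_subset List.nodup_range fun l hl => ?_
    obtain ⟨q, hq, rfl⟩ := h l (List.mem_range.1 hl)
    exact List.mem_map.2 ⟨q, List.mem_range.2 hq, rfl⟩
  exact (h1.perm_of_length_le (by simp)).symm

def thrCmd : List Cmd := [.op .lt 30 13 10, .op .div 14 13 10, .op .add 14 30 14,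
  .op .div 15 8 13, .op .sub 15 8 15, .op .add 15 15 3, .op .mul 30 13 9,
  .op .div 16 8 30, .op .sub 16 8 16, .op .add 16 16 3,
  .op .lt 31 30 10, .op .div 32 30 10, .op .add 31 31 32,
  .op .div 17 8 31, .op .sub 17 8 17, .op .add 17 17 3,
  .const 30 0, .op .add 31 1 30, .op .add 32 1 30, .const 18 0, .const 19 0]
def refPlace : List Cmd := [.op .sub 32 32 3, .op .add 33 20 32, .load 34 33, .op .lt 35 34 15,
  .op .sub 37 3 35, .op .sub 31 31 37, .op .mul 36 30 35, .op .mul 38 31 37, .op .add 36 36 38,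
  .op .add 36 36 22]
def refCount : List Cmd := [.op .add 30 30 35, .op .lt 35 34 16, .op .add 18 18 35,
  .op .lt 35 34 17, .op .add 19 19 35]
def refBody : Cmd := block [block refPlace, .store 36 32, block refCount]
def checkCmd : List Cmd := [.op .lt 29 11 18, .op .add 29 29 19, .const 30 0, .op .eq 29 29 30]
def refreshCmd : Cmd := block [block thrCmd, .loop 32 refBody, block checkCmd]

/-- State of the coordinator when the slots `i, …, s - 1` have been placed. -/
structure RefSt (Γ : Par) (j : ℕ) (a : ℕ → Slot) (i : ℕ) (m₀ m : Mem) : Prop where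
  core : Core Γ a m
  c15 : m 15 = thr Γ.M (Γ.R j)
  c16 : m 16 = thr Γ.M (Γ.R (j + 1))
  c17 : m 17 = thr Γ.M (Γ.Rv (j + 1))
  c18 : m 18 = cntFrom Γ.s a (thr Γ.M (Γ.R (j + 1))) i
  c19 : m 19 = cntFrom Γ.s a (thr Γ.M (Γ.Rv (j + 1))) i
  c30 : m 30 = cntFrom Γ.s a (thr Γ.M (Γ.R j)) i
  c31 : m 31 = i + cntFrom Γ.s a (thr Γ.M (Γ.R j)) i
  c32 : m 32 = i
  place : ∀ l, i ≤ l → l < Γ.s → ∃ q < Γ.s, m (64 + 4 * Γ.s + q) = l ∧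
    ((a l).y < thr Γ.M (Γ.R j) → q < cntFrom Γ.s a (thr Γ.M (Γ.R j)) i) ∧
    (thr Γ.M (Γ.R j) ≤ (a l).y → i + cntFrom Γ.s a (thr Γ.M (Γ.R j)) i ≤ q)
  fr : ∀ x < 64, x ≤ 14 ∨ 42 ≤ x → m x = m₀ x

section Refresh

variable {Γ : Par} {τ μ : ℝ≥0∞} {ψ : Mem → List (ℕ × List ℕ) → List Cmd → ℝ≥0∞}
  (h : Loc Γ.b τ μ (64 + 5 * Γ.s) ψ) {o : List (ℕ × List ℕ)} {K : List Cmd}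

include h

/-- One step of a partition from both ends. Slots below the threshold fill positions `0, 1, …`, the
others fill positions from `s - 1` downwards, and cell `31` holds the first position of the upper
block. Selecting the position arithmetically by `t ∈ {0, 1}` avoids a branch. -/
theorem ref_body_spec (hΓ : Γ.Ok) {j i : ℕ} {a : ℕ → Slot} {m₀ m : Mem}
    (hy : ∀ i < Γ.s, (a i).y ≤ Γ.M) (hi : i < Γ.s) (hm : RefSt Γ j a (i + 1) m₀ m) {X : ℝ≥0∞}
    (hK : ∀ m', RefSt Γ j a i m₀ m' → ψ m' o K ≤ X) :
    LeT τ 40 (ψ m o (refBody :: K)) X := by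
  have hL : 64 ≤ 64 + 5 * Γ.s := by omega
  have bs := hΓ.bs
  have hM1 : Γ.M < 2 ^ Γ.b := by have := hΓ.bMρ; omega
  have hyi := hy i hi
  have hc := hm.core
  set T := thr Γ.M (Γ.R j) with hT
  set T1 := thr Γ.M (Γ.R (j + 1)) with hT1
  set T2 := thr Γ.M (Γ.Rv (j + 1)) with hT2
  have e0 := cntFrom_eq hi a T
  have e1 := cntFrom_eq hi a T1
  have e2 := cntFrom_eq hi a T2
  have l0 := cntFrom_le Γ.s a T i
  have l1 := cntFrom_le Γ.s a T1 i
  have l2 := cntFrom_le Γ.s a T2 i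
  set f := cntFrom Γ.s a T (i + 1) with hf
  obtain ⟨t, ht, ht1⟩ : ∃ t, (if (a i).y < T then 1 else 0) = t ∧ t ≤ 1 :=
    ⟨_, rfl, by split_ifs <;> omega⟩
  rw [ht] at e0
  set g := i + f + t with hg
  set q := f * t + g * (1 - t) with hq
  have hqv : ((a i).y < T → q = f) ∧ (T ≤ (a i).y → q = i + f) := by
    constructor
    · intro hlt
      rw [if_pos hlt] at ht
      simp [hq, ← ht]
    · intro hlt
      rw [if_neg (by omega)] at ht
      simp [hq, hg, ← ht]
  have hqs : q < Γ.s := by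
    have := cntFrom_le Γ.s a T (i + 1)
    rcases lt_or_ge (a i).y T with h1 | h1
    · have := hqv.1 h1; omega
    · have := hqv.2 h1; omega
  set m1 := runSeg Γ.b refPlace m with hm1
  have hz1 : Zero (64 + 5 * Γ.s) m1 := hc.zero.runSeg (by decide) hL
  have fr1 : ∀ x, x < 31 ∨ 39 ≤ x → m1 x = m x := fun x hx =>
    runSeg_frame (by simp [refPlace, destCell]; omega)
  have vals : m1 31 = g ∧ m1 32 = i ∧ m1 34 = (a i).y ∧ m1 35 = t ∧
      m1 36 = 64 + 4 * Γ.s + q := by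
    have b1 : i < 2 ^ Γ.b := by omega
    have b2 : 64 + 2 * Γ.s + i < 2 ^ Γ.b := by omega
    have b3 : (a i).y < 2 ^ Γ.b := by omega
    have b4 : t < 2 ^ Γ.b := by omega
    have b5 : 1 - t < 2 ^ Γ.b := by omega
    have b6 : i + 1 + f - (1 - t) = g := by omega
    have b7 : g < 2 ^ Γ.b := by omega
    have b8 : f * t < 2 ^ Γ.b := by
      have : f * t ≤ f * 1 := Nat.mul_le_mul_left _ ht1
      omega
    have b9 : g * (1 - t) < 2 ^ Γ.b := by
      have : g * (1 - t) ≤ g * 1 := Nat.mul_le_mul_left _ (by omega)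
      omega
    have b10 : f * t + g * (1 - t) < 2 ^ Γ.b := by rw [← hq]; omega
    have b11 : f * t + g * (1 - t) + (64 + 4 * Γ.s) = 64 + 4 * Γ.s + q := by
      rw [← hq]; omega
    have b12 : 64 + 4 * Γ.s + q < 2 ^ Γ.b := by omega
    have b13 : ¬ (64 + 2 * Γ.s + i = 33) ∧ ¬ (64 + 2 * Γ.s + i = 32) := by omega
    have b14 := hc.y i hi
    have b15 := hm.c31
    have b16 := hm.c30
    rw [← hf] at b15 b16
    have b17 : i + 1 - 1 = i := rfl
    refine ⟨?_, ?_, ?_, ?_, ?_⟩ <;>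
    simp [hm1, refPlace, runSeg, assign, Mem.write, BinOp.eval, Function.update_apply,
      hm.c32, hc.c3, Nat.mod_eq_of_lt, b1, b2, b3, hc.c20, b13, b14, hm.c15, ← hT, ht, b4, b5, b15,
      b6, b7, b16, b8, b9, b10, hc.c22, b11, b12]
  obtain ⟨v31, v32, v34, v35, v36⟩ := vals
  have s1 := h.seg (l := refPlace) (rest := [.store 36 32, block refCount]) (o := o)
    (K := K) (by decide) hL hc.zero
  have s2 := h.bstore (a := 36) (x := 32) (rest := [block refCount]) (o := o) (K := K) hz1
  rw [v36, v32] at s2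
  set m2 := m1.write Γ.b (64 + 4 * Γ.s + q) i with hm2
  have hz2 : Zero (64 + 5 * Γ.s) m2 := hz1.write (by omega)
  have fr2 : ∀ x, x ≠ 64 + 4 * Γ.s + q → m2 x = m1 x := fun x hx => by
    rw [hm2, Mem.write, Function.update_of_ne hx]
  have h2q : m2 (64 + 4 * Γ.s + q) = i := by
    rw [hm2, Mem.write, Function.update_self, Nat.mod_eq_of_lt (by omega)]
  have s3 := h.seg_last (l := refCount) (o := o) (K := K) (by decide) hL hz2
  set m3 := runSeg Γ.b refCount m2 with hm3
  have hz3 : Zero (64 + 5 * Γ.s) m3 := hz2.runSeg (by decide) hL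
  have fr3 : ∀ x, x ≠ 18 → x ≠ 19 → x ≠ 30 → x ≠ 35 → m3 x = m2 x := fun x h1 h2 h3 h4 =>
    runSeg_frame (by simp [refCount, destCell]; omega)
  have fr3' : ∀ x, x ≠ 18 → x ≠ 19 → x < 30 ∨ 39 ≤ x → x ≠ 64 + 4 * Γ.s + q → m3 x = m x :=
    fun x h1 h2 h3 h4 => by
      rw [fr3 x h1 h2 (by omega) (by omega), fr2 x h4, fr1 x (by omega)]
  have f2 : ∀ x < 64, m2 x = m1 x := fun x hx => fr2 x (by omega)
  have vals : m3 30 = cntFrom Γ.s a T i ∧ m3 18 = cntFrom Γ.s a T1 i ∧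
      m3 19 = cntFrom Γ.s a T2 i := by
    have d30 : m2 30 = f := by rw [f2 _ (by omega), fr1 _ (by omega), hm.c30]
    have d35 : m2 35 = t := by rw [f2 _ (by omega), v35]
    have d34 : m2 34 = (a i).y := by rw [f2 _ (by omega), v34]
    have d16 : m2 16 = T1 := by rw [f2 _ (by omega), fr1 _ (by omega), hm.c16]
    have d17 : m2 17 = T2 := by rw [f2 _ (by omega), fr1 _ (by omega), hm.c17]
    have d18 : m2 18 = cntFrom Γ.s a T1 (i + 1) := by
      rw [f2 _ (by omega), fr1 _ (by omega), hm.c18]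
    have d19 : m2 19 = cntFrom Γ.s a T2 (i + 1) := by
      rw [f2 _ (by omega), fr1 _ (by omega), hm.c19]
    obtain ⟨t1, ht1', ht1''⟩ : ∃ t, (if (a i).y < T1 then 1 else 0) = t ∧ t ≤ 1 :=
      ⟨_, rfl, by split_ifs <;> omega⟩
    obtain ⟨t2, ht2', ht2''⟩ : ∃ t, (if (a i).y < T2 then 1 else 0) = t ∧ t ≤ 1 :=
      ⟨_, rfl, by split_ifs <;> omega⟩
    rw [ht1'] at e1
    rw [ht2'] at e2
    have g1 : t1 < 2 ^ Γ.b := by omega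
    have g2 : t2 < 2 ^ Γ.b := by omega
    have g3 : cntFrom Γ.s a T i < 2 ^ Γ.b := by omega
    have g4 : cntFrom Γ.s a T1 i < 2 ^ Γ.b := by omega
    have g5 : cntFrom Γ.s a T2 i < 2 ^ Γ.b := by omega
    refine ⟨?_, ?_, ?_⟩ <;>
    simp [hm3, refCount, runSeg, assign, Mem.write, BinOp.eval, d30, d35, d34, d16, d17, d18, d19,
      ht1', ht2', Nat.mod_eq_of_lt, g1, g2, ← e0, ← e1, ← e2, g3, g4, g5]
  obtain ⟨w30, w18, w19⟩ := vals
  refine (((s1.trans s2).trans s3).trans_le (hK m3 ?_)).mono (by decide)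
  exact {
    core := hc.congr hz3 fun x hx => fr3' x (by omega) (by omega) (by omega) (by omega)
    c15 := by rw [fr3' _ (by omega) (by omega) (by omega) (by omega), hm.c15]
    c16 := by rw [fr3' _ (by omega) (by omega) (by omega) (by omega), hm.c16]
    c17 := by rw [fr3' _ (by omega) (by omega) (by omega) (by omega), hm.c17]
    c18 := w18
    c19 := w19
    c30 := w30
    c31 := by
      rw [fr3 _ (by omega) (by omega) (by omega) (by omega), f2 _ (by omega), v31]
      change g = i + cntFrom Γ.s a T i
      omega
    c32 := by rw [fr3 _ (by omega) (by omega) (by omega) (by omega), f2 _ (by omega), v32]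
    place := fun l hl hls => by
      rw [← hT]
      rcases hl.eq_or_lt with rfl | hl
      · refine ⟨q, hqs, ?_, fun hlt => ?_, fun hge => ?_⟩
        · rw [fr3 _ (by omega) (by omega) (by omega) (by omega), h2q]
        · rw [hqv.1 hlt]; rw [if_pos hlt] at ht; omega
        · rw [hqv.2 hge]; rw [if_neg (by omega)] at ht; omega
      · obtain ⟨q', hq', p1, p2, p3⟩ := hm.place l hl hls
        rw [← hT, ← hf] at p2 p3
        -- The positions used before lie below `f` or from `i + 1 + f` on, whereas `q` is `f` or `i
        -- + f`. A slot of the same group is thus separated by the free ends, a slot of the other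
        -- group by the gap.
        have hne : q' ≠ q := by
          rcases lt_or_ge (a l).y T with h1 | h1 <;> rcases lt_or_ge (a i).y T with h2 | h2
          · have := p2 h1; rw [hqv.1 h2]; omega
          · have := p2 h1; rw [hqv.2 h2]; omega
          · have := p3 h1; rw [hqv.1 h2]; omega
          · have := p3 h1; rw [hqv.2 h2]; omega
        refine ⟨q', hq', ?_, fun hlt => ?_, fun hge => ?_⟩
        · rw [fr3' _ (by omega) (by omega) (by omega) (by omega), p1]
        · have := p2 hlt; omega
        · have := p3 hge; omega
    fr := fun x hx hx' => by
      rw [fr3' x (by omega) (by omega) (by omega) (by omega), hm.fr x hx hx'] }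

theorem ref_loop_spec (hΓ : Γ.Ok) {j i : ℕ} {a : ℕ → Slot} {m₀ m : Mem}
    (hy : ∀ i < Γ.s, (a i).y ≤ Γ.M) (hi : i ≤ Γ.s) (hm : RefSt Γ j a i m₀ m) {X : ℝ≥0∞}
    (hK : ∀ m', RefSt Γ j a 0 m₀ m' → ψ m' o K ≤ X) :
    LeT τ (41 * i + 1) (ψ m o (.loop 32 refBody :: K)) X := by
  induction i generalizing m with
  | zero => exact (h.loop_neg (p := refBody) hm.core.zero hm.c32).trans_le (hK m hm)
  | succ i ih =>
    have s1 := h.loop_pos (x := 32) (p := refBody) (o := o) (K := K) hm.core.zero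
      (by rw [hm.c32]; omega)
    have s2 := ref_body_spec h hΓ hy (by omega) hm (o := o) (K := .loop 32 refBody :: K)
      (X := (41 * i + 1 : ℕ) * τ + X) fun m' hm' => (ih (by omega) hm').le
    have := (s1.trans s2).trans (show LeT τ (41 * i + 1) _ X from le_rfl)
    exact this.mono (by omega)

theorem check_spec (hΓ : Γ.Ok) {j : ℕ} {a : ℕ → Slot} {π : ℕ → ℕ} {m : Mem}
    (hm : Rep Γ j a π m) {rest : List Cmd} :
    ∃ m', LeT τ 10 (ψ m o (block (block checkCmd :: rest) :: K)) (ψ m' o (block rest :: K)) ∧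
      Rep Γ j a π m' ∧ (∀ x, x ≠ 29 → x ≠ 30 → m' x = m x) ∧
      (Adv Γ (j + 1) a → m' 29 = 1) ∧ (¬ Adv Γ (j + 1) a → m' 29 = 0) := by
  have hL : 64 ≤ 64 + 5 * Γ.s := by omega
  have bs := hΓ.bs
  have fr : ∀ x, x ≠ 29 → x ≠ 30 → runSeg Γ.b checkCmd m x = m x := fun x h1 h2 =>
    runSeg_frame (by simp [checkCmd, destCell]; omega)
  refine ⟨runSeg Γ.b checkCmd m, h.seg (l := checkCmd) (rest := rest) (by decide) hL hm.zero,
    hm.congr fun x hx => fr x (by unfold Pers at hx; omega) (by unfold Pers at hx; omega),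
    fr, ?_⟩
  have l1 := cntLt_le Γ.s a (thr Γ.M (Γ.R (j + 1)))
  have l2 := cntLt_le Γ.s a (thr Γ.M (Γ.Rv (j + 1)))
  have b0 : 1 < 2 ^ Γ.b := by omega
  unfold Adv
  set c1 := cntLt Γ.s a (thr Γ.M (Γ.R (j + 1)))
  set c2 := cntLt Γ.s a (thr Γ.M (Γ.Rv (j + 1)))
  by_cases h1 : Γ.lmax < c1
  · have b1 : 1 + c2 < 2 ^ Γ.b := by omega
    have b2 : ¬ (c1 ≤ Γ.lmax) := by omega
    simp [checkCmd, runSeg, assign, Mem.write, BinOp.eval, hm.c11, hm.c18, hm.c19,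
      Nat.mod_eq_of_lt, b0, b1, h1, b2, c1, c2]
  · have b1 : c2 < 2 ^ Γ.b := by omega
    have b2 : c1 ≤ Γ.lmax := by omega
    by_cases h2 : c2 = 0
    · simp [checkCmd, runSeg, assign, Mem.write, BinOp.eval, hm.c11, hm.c18, hm.c19,
        Nat.mod_eq_of_lt, b0, b1, h1, b2, c1, c2, h2]
    · simp [checkCmd, runSeg, assign, Mem.write, BinOp.eval, hm.c11, hm.c18, hm.c19,
        Nat.mod_eq_of_lt, b0, b1, h1, b2, c1, c2, h2]

/-- The permutation puts all slots below the threshold of epoch `j` first, so every position from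
their number on is covered at rate `1 / R j`. The counters refer to the thresholds of epoch `j + 1`,
which makes the test for advancing a constant number of operations. -/
theorem refresh_spec (hΓ : Γ.Ok) {j : ℕ} {a : ℕ → Slot} {m : Mem}
    (hy : ∀ i < Γ.s, (a i).y ≤ Γ.M) (hm : Core Γ a m) (h12 : m 12 = Γ.ell j)
    (h13 : m 13 = Γ.R j) (hRM : Γ.R j ≤ Γ.M) {X : ℝ≥0∞}
    (hK : ∀ π m', Rep Γ j a π m' → ((List.range Γ.s).map π).Perm (List.range Γ.s) →
      (∀ q, cntLt Γ.s a (thr Γ.M (Γ.R j)) ≤ q → q < Γ.s → thr Γ.M (Γ.R j) ≤ (a (π q)).y) →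
      (∀ x < 64, x ≤ 7 ∨ 42 ≤ x → m' x = m x) →
      (Adv Γ (j + 1) a → m' 29 = 1) → (¬ Adv Γ (j + 1) a → m' 29 = 0) → ψ m' o K ≤ X) :
    LeT τ (110 * Γ.s) (ψ m o (refreshCmd :: K)) X := by
  have hL : 64 ≤ 64 + 5 * Γ.s := by omega
  have bs := hΓ.bs
  have hs := hΓ.hs
  have hM1 : Γ.M * Γ.ρ + Γ.M + 1 < 2 ^ Γ.b := hΓ.bMρ
  have hRρ : Γ.R j * Γ.ρ ≤ Γ.M * Γ.ρ := Nat.mul_le_mul_right _ hRM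
  have hR1 : Γ.R (j + 1) = Γ.R j * Γ.ρ := pow_succ _ _
  have hlam : 0 < Γ.lam := by obtain ⟨l, hl⟩ := hΓ.hlam; rw [hl]; positivity
  have s1 := h.seg (l := thrCmd) (rest := [.loop 32 refBody, block checkCmd]) (o := o)
    (K := K) (by decide) hL hm.zero
  set m1 := runSeg Γ.b thrCmd m with hm1
  have hz1 : Zero (64 + 5 * Γ.s) m1 := hm.zero.runSeg (by decide) hL
  have fr1 : ∀ x, x ≤ 13 ∨ (20 ≤ x ∧ x < 30) ∨ 33 ≤ x → m1 x = m x := fun x hx =>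
    runSeg_frame (by simp [thrCmd, destCell]; omega)
  have hd1 : Γ.M / Γ.R j ≤ Γ.M := Nat.div_le_self _ _
  have hv := (hΓ.Rv_two j).2.1
  have hv' := (hΓ.Rv_two (j + 1)).2.1
  have vals : m1 14 = Γ.Rv j ∧ m1 15 = thr Γ.M (Γ.R j) ∧ m1 16 = thr Γ.M (Γ.R (j + 1)) ∧
      m1 17 = thr Γ.M (Γ.Rv (j + 1)) ∧ m1 18 = 0 ∧ m1 19 = 0 ∧ m1 30 = 0 ∧ m1 31 = Γ.s ∧
      m1 32 = Γ.s := by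
    obtain ⟨t, ht, ht1⟩ : ∃ t, (if Γ.R j < Γ.lam then 1 else 0) = t ∧ t ≤ 1 :=
      ⟨_, rfl, by split_ifs <;> omega⟩
    obtain ⟨t', ht', ht1'⟩ : ∃ t, (if Γ.R (j + 1) < Γ.lam then 1 else 0) = t ∧ t ≤ 1 :=
      ⟨_, rfl, by split_ifs <;> omega⟩
    have ev : Γ.Rv j = t + Γ.R j / Γ.lam := by rw [Par.Rv, ht]
    have ev' : Γ.Rv (j + 1) = t' + Γ.R (j + 1) / Γ.lam := by rw [Par.Rv, ht']
    rw [hR1] at ev' ht' hv'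
    have q1 : Γ.R j / Γ.lam ≤ Γ.R j := Nat.div_le_self _ _
    have q2 : Γ.R j * Γ.ρ / Γ.lam ≤ Γ.R j * Γ.ρ := Nat.div_le_self _ _
    have q3 : Γ.M / (Γ.R j * Γ.ρ) ≤ Γ.M := Nat.div_le_self _ _
    have q4 : Γ.M / Γ.Rv (j + 1) ≤ Γ.M := Nat.div_le_self _ _
    rw [hR1, thr, thr, thr]
    have b18 : Γ.M + 1 < 2 ^ Γ.b := by omega
    have b17 : Γ.M < 2 ^ Γ.b := by omega
    have b0 : t < 2 ^ Γ.b := by omega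
    have b1 : t' < 2 ^ Γ.b := by omega
    have b2 : Γ.R j / Γ.lam < 2 ^ Γ.b := by omega
    have b3 : Γ.R j * Γ.ρ / Γ.lam < 2 ^ Γ.b := by omega
    have b4 : Γ.R j * Γ.ρ < 2 ^ Γ.b := by omega
    have b5 : Γ.Rv j < 2 ^ Γ.b := by omega
    have b6 : Γ.Rv (j + 1) < 2 ^ Γ.b := by omega
    have b7 : Γ.M / Γ.R j < 2 ^ Γ.b := by omega
    have b8 : Γ.M - Γ.M / Γ.R j < 2 ^ Γ.b := lt_of_le_of_lt (Nat.sub_le _ _) b17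
    have b9 : Γ.M - Γ.M / Γ.R j + 1 < 2 ^ Γ.b :=
      lt_of_le_of_lt (Nat.succ_le_succ (Nat.sub_le _ _)) b18
    have b10 : Γ.M / (Γ.R j * Γ.ρ) < 2 ^ Γ.b := by omega
    have b11 : Γ.M - Γ.M / (Γ.R j * Γ.ρ) < 2 ^ Γ.b := lt_of_le_of_lt (Nat.sub_le _ _) b17
    have b12 : Γ.M - Γ.M / (Γ.R j * Γ.ρ) + 1 < 2 ^ Γ.b :=
      lt_of_le_of_lt (Nat.succ_le_succ (Nat.sub_le _ _)) b18
    have b13 : Γ.M / Γ.Rv (j + 1) < 2 ^ Γ.b := by omega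
    have b14 : Γ.M - Γ.M / Γ.Rv (j + 1) < 2 ^ Γ.b := lt_of_le_of_lt (Nat.sub_le _ _) b17
    have b15 : Γ.M - Γ.M / Γ.Rv (j + 1) + 1 < 2 ^ Γ.b :=
      lt_of_le_of_lt (Nat.succ_le_succ (Nat.sub_le _ _)) b18
    have b16 : Γ.s < 2 ^ Γ.b := by omega
    refine ⟨?_, ?_, ?_, ?_, ?_, ?_, ?_, ?_, ?_⟩ <;>
    simp only [hm1, thrCmd, runSeg, assign, Mem.write, BinOp.eval, Function.update_apply, hm.c8,
      hm.c9, hm.c10, h13, hm.c3, hm.c1, reduceIte, Nat.reduceEqDiff, ht, ht', Nat.mod_eq_of_lt b0,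
      Nat.mod_eq_of_lt b1, Nat.mod_eq_of_lt b2, Nat.mod_eq_of_lt b3, Nat.mod_eq_of_lt b4, ← ev,
      ← ev', Nat.mod_eq_of_lt b5, Nat.mod_eq_of_lt b6, Nat.mod_eq_of_lt b7, Nat.mod_eq_of_lt b8,
      Nat.mod_eq_of_lt b9, Nat.mod_eq_of_lt b10, Nat.mod_eq_of_lt b11, Nat.mod_eq_of_lt b12,
      Nat.mod_eq_of_lt b13, Nat.mod_eq_of_lt b14, Nat.mod_eq_of_lt b15, Nat.zero_mod, Nat.add_zero,
      Nat.mod_eq_of_lt b16]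
  obtain ⟨v14, v15, v16, v17, v18, v19, v30, v31, v32⟩ := vals
  have hst1 : RefSt Γ j a Γ.s m1 m1 := {
    core := hm.congr hz1 fun x hx => fr1 x (by omega)
    c15 := v15, c16 := v16, c17 := v17
    c18 := by rw [v18, cntFrom_self], c19 := by rw [v19, cntFrom_self]
    c30 := by rw [v30, cntFrom_self], c31 := by rw [v31, cntFrom_self, add_zero], c32 := v32
    place := fun l hl hls => by omega
    fr := fun x _ _ => rfl }
  have s2 := h.cons (c := .loop 32 refBody) (l := [block checkCmd]) (o := o) (K := K) hz1
  have s3 := ref_loop_spec h hΓ hy le_rfl hst1 (o := o) (K := block [block checkCmd] :: K)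
    (X := 11 * τ + X) (fun m2 hm2 => by
      have hinj : ((List.range Γ.s).map fun q => m2 (64 + 4 * Γ.s + q)).Perm (List.range Γ.s) :=
        perm_of_surj fun l hl => by
          obtain ⟨q, hq, h1, -⟩ := hm2.place l (Nat.zero_le _) hl
          exact ⟨q, hq, h1⟩
      have hrep : Rep Γ j a (fun q => m2 (64 + 4 * Γ.s + q)) m2 := {
        zero := hm2.core.zero, c0 := hm2.core.c0, c1 := hm2.core.c1, c3 := hm2.core.c3
        c8 := hm2.core.c8, c9 := hm2.core.c9, c10 := hm2.core.c10, c11 := hm2.core.c11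
        c12 := by rw [hm2.fr 12 (by omega) (by omega), fr1 12 (by omega), h12]
        c13 := by rw [hm2.fr 13 (by omega) (by omega), fr1 13 (by omega), h13]
        c14 := by rw [hm2.fr 14 (by omega) (by omega), v14]
        c16 := hm2.c16, c17 := hm2.c17
        c18 := by rw [hm2.c18, cntFrom_zero], c19 := by rw [hm2.c19, cntFrom_zero]
        c20 := hm2.core.c20, c21 := hm2.core.c21, c22 := hm2.core.c22
        id := hm2.core.id, w := hm2.core.w, y := hm2.core.y, c := hm2.core.c
        p := fun _ _ => rfl }
      obtain ⟨m3, t1, hrep3, fr3, p1, p2⟩ := check_spec h hΓ hrep (o := o) (K := K) (rest := [])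
      refine ((t1.trans (h.nil hrep3.zero)).trans_le (hK _ m3 hrep3 hinj ?_ ?_ p1 p2)).le
      -- A slot below the threshold was placed at some position below the count; as positions
      -- determine slots injectively, that position is `q`.
      · intro q hq hqs
        by_contra hlt
        have hnd := hinj.nodup_iff.2 List.nodup_range
        have hl : m2 (64 + 4 * Γ.s + q) < Γ.s := List.mem_range.1 (hinj.subset
          (List.mem_map.2 ⟨q, List.mem_range.2 hqs, rfl⟩))
        obtain ⟨q', hq', h1, h2, -⟩ := hm2.place _ (Nat.zero_le _) hl
        have := h2 (by omega)
        rw [cntFrom_zero] at this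
        have := List.inj_on_of_nodup_map hnd (List.mem_range.2 hq') (List.mem_range.2 hqs) h1
        omega
      · intro x hx hx'
        rw [fr3 x (by omega) (by omega), hm2.fr x hx (by omega), fr1 x (by omega)])
  have s4 := ((s1.trans s2).trans s3).trans (show LeT τ 11 _ X from le_rfl)
  exact s4.mono (by simp [thrCmd]; omega)

end Refresh


/-! ## Potentials of the ideal process -/

/-- If `R j > M`, then `M / R j = 0` and the threshold is `M + 1`, which no score reaches; but at
most a quarter of the slots may be below it. This is why advancing terminates. -/
theorem Adv.le {Γ : Par} (hΓ : Γ.Ok) {j : ℕ} {a : ℕ → Slot} (ha : Adv Γ j a)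
    (hy : ∀ i < Γ.s, (a i).y ≤ Γ.M) : Γ.R j ≤ Γ.M := by
  by_contra hlt
  have hs := hΓ.hs
  have hl := hΓ.lmax_lt
  have h1 : cntLt Γ.s a (thr Γ.M (Γ.R j)) = Γ.s := by
    rw [thr, Nat.div_eq_of_lt (by omega), cntLt, Finset.filter_true_of_mem, Finset.card_range]
    intro i hi
    have := hy i (Finset.mem_range.1 hi)
    omega
  have := ha.1
  omega

open Classical in
/-- Discounted number of epochs that the slots are not fit for. -/
def hpot (Γ : Par) (a : ℕ → Slot) : ℝ≥0∞ :=
  ∑' j, if Adv Γ (j + 1) a then 0 else ((Γ.R j : ℕ) : ℝ≥0∞)⁻¹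

theorem hpot_anti {Γ : Par} {a a' : ℕ → Slot} (h : ∀ i, (a i).y ≤ (a' i).y) :
    hpot Γ a' ≤ hpot Γ a := by
  refine ENNReal.tsum_le_tsum fun j => ?_
  split_ifs with h1 h2 h2
  · exact le_rfl
  · exact zero_le
  · exact absurd (h2.mono h) h1
  · exact le_rfl

theorem le_hpot {Γ : Par} {a : ℕ → Slot} {j : ℕ} (h : ¬ Adv Γ (j + 1) a) :
    ((Γ.R j : ℕ) : ℝ≥0∞)⁻¹ ≤ hpot Γ a := by
  refine le_trans ?_ (ENNReal.le_tsum j)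
  rw [if_neg h]

/-- Expected reward of `n` units of the item `(e, w)`, where `c * hpot` is paid after each unit. -/
def Hop (Γ : Par) (e w : ℕ) (c : ℝ≥0∞) : ℕ → ((ℕ → Slot) → ℝ≥0∞) → (ℕ → Slot) → ℝ≥0∞
  | 0, f, a => f a
  | n + 1, f, a => expect (trials Γ.M e w (List.range Γ.s) a) fun a' =>
      c * hpot Γ a' + Hop Γ e w c n f a'

theorem Hop_add (Γ : Par) (e w : ℕ) (c : ℝ≥0∞) (n n' : ℕ) (f : (ℕ → Slot) → ℝ≥0∞) :
    Hop Γ e w c (n + n') f = Hop Γ e w c n (Hop Γ e w c n' f) := by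
  induction n with
  | zero => rw [Nat.zero_add]; rfl
  | succ n ih => rw [show n + 1 + n' = n + n' + 1 by ring]; funext a; simp only [Hop, ih]

theorem Hop_add_const (Γ : Par) (e w : ℕ) (c : ℝ≥0∞) (n : ℕ) (f : (ℕ → Slot) → ℝ≥0∞)
    (x : ℝ≥0∞) (a : ℕ → Slot) : Hop Γ e w c n (fun a => f a + x) a = Hop Γ e w c n f a + x := by
  induction n generalizing a with
  | zero => rfl
  | succ n ih =>
    simp only [Hop, ih]
    simp only [expect_add, expect_const, add_assoc]

/-- `hpot` never increases, so paying for all units of a piece with the potential at its end is no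
more than paying after each unit. -/
theorem expect_trials_le_Hop (Γ : Par) (e w : ℕ) (c : ℝ≥0∞) (n : ℕ) (F : (ℕ → Slot) → ℝ≥0∞)
    (a : ℕ → Slot) :
    expect (trials Γ.M e w (List.replicate n (List.range Γ.s)).flatten a)
      (fun a' => n * (c * hpot Γ a') + F a') ≤ Hop Γ e w c n F a := by
  induction n generalizing a with
  | zero => simp [trials, expect_pure, Hop]
  | succ n ih =>
    rw [List.replicate_succ, List.flatten_cons, trials_append, expect_bind, Hop]
    refine expect_mono _ fun a1 => ?_
    calc _ ≤ expect (trials Γ.M e w (List.replicate n (List.range Γ.s)).flatten a1)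
          (fun a' => c * hpot Γ a1 + (n * (c * hpot Γ a') + F a')) := by
          refine expect_mono_supp _ fun a' ha' => ?_
          have : c * hpot Γ a' ≤ c * hpot Γ a1 := by
            gcongr
            exact hpot_anti fun i => trials_support ha' i
          calc _ = c * hpot Γ a' + (n * (c * hpot Γ a') + F a') := by push_cast; ring
            _ ≤ _ := by gcongr
      _ ≤ _ := by
          rw [expect_add, expect_const]
          gcongr
          exact ih a1

/-- The last `cnt` of `cnt * (w + 1)` trials visit every position once, because the index is reduced
modulo `cnt`. -/
theorem trialList_block (π : ℕ → ℕ) (off cnt w : ℕ) :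
    (trialList π off cnt (cnt * (w + 1))).Perm
      ((List.range cnt).map (fun q => π (off + q)) ++ trialList π off cnt (cnt * w)) := by
  rw [Nat.mul_succ, trialList, List.range_add, List.map_append, List.reverse_append, List.map_map]
  refine List.Perm.append ((List.reverse_perm _).trans (List.Perm.of_eq ?_)) (List.Perm.refl _)
  refine List.map_congr_left fun q hq => ?_
  simp [Nat.mod_eq_of_lt (List.mem_range.1 hq)]

/-- Together the two groups perform `w` trials at every slot, which up to order are `w` units of the
ideal process. -/
theorem trialList_perm {s ℓ : ℕ} {π : ℕ → ℕ} (hℓ : ℓ ≤ s)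
    (hπ : ((List.range s).map π).Perm (List.range s)) (w : ℕ) :
    (trialList π 0 ℓ (ℓ * w) ++ trialList π ℓ (s - ℓ) ((s - ℓ) * w)).Perm
      (List.replicate w (List.range s)).flatten := by
  induction w with
  | zero => simp [trialList]
  | succ w ih =>
    rw [List.replicate_succ, List.flatten_cons]
    have hsplit : (List.range s).map π =
        (List.range ℓ).map (fun q => π (0 + q)) ++ (List.range (s - ℓ)).map fun q => π (ℓ + q) := by
      conv_lhs => rw [← Nat.add_sub_cancel' hℓ, List.range_add, List.map_append, List.map_map]
      simp [Function.comp_def]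
    refine List.Perm.trans ?_ (hπ.append ih)
    rw [hsplit]
    refine ((trialList_block π 0 ℓ w).append (trialList_block π ℓ (s - ℓ) w)).trans ?_
    rw [List.append_assoc, List.append_assoc]
    refine List.Perm.append_left _ ?_
    rw [← List.append_assoc, ← List.append_assoc]
    exact List.Perm.append_right _ List.perm_append_comm

/-! ## The main loop of the coordinator -/

def advPrep : List Cmd := [.op .mul 13 13 9, .const 30 0, .op .add 12 11 30]
def advBody : Cmd := block [block advPrep, refreshCmd]
def postCmd : List Cmd := [.const 27 0, .op .add 42 44 27]
def pieceTail : List Cmd := [block postCmd, block checkCmd, .loop 29 advBody, .rand 6 14, .rand 7 13]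
def pieceCmd : Cmd :=
  block (block lagPrep :: skipCmd :: block mainPrep :: skipCmd :: pieceTail)
def pieceLoop : Cmd := .loop 42 pieceCmd

/-- State of the coordinator between two pieces. -/
structure Bd (Γ : Par) (j : ℕ) (a : ℕ → Slot) (π : ℕ → ℕ) (Q : ℕ) (m : Mem) : Prop where
  rep : Rep Γ j a π m
  inv : Inv Γ j a π Q
  top : ¬ Adv Γ (j + 1) a

theorem Bd.congr {Γ : Par} {j : ℕ} {a : ℕ → Slot} {π : ℕ → ℕ} {Q : ℕ} {m m' : Mem}
    (h : Bd Γ j a π Q m) (hm : ∀ x, Pers x → m' x = m x) : Bd Γ j a π Q m' :=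
  { h with rep := h.rep.congr hm }

/-- Weight of the slots in the expected number of trials. -/
def Par.D (Γ : Par) : ℕ := Γ.s + Γ.lmax * Γ.lam

theorem covered_iff {M R : ℕ} {t : Slot} (h : thr M R ≤ t.y) : Covered M R t := by
  have := Nat.div_le_self M R
  unfold thr at h
  exact Or.inr (by omega)

/-! ### Advancing through epochs -/

section Main

variable {Γ : Par} {τ μ : ℝ≥0∞} {ψ : Mem → List (ℕ × List ℕ) → List Cmd → ℝ≥0∞}
  {o : List (ℕ × List ℕ)} {K : List Cmd}

/-- Every advance recomputes the order of the slots in time at most `130 * s`, paid by the growth of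
`pot`. The growth also releases `x`; if there is at least one advance, one such amount is handed to
the caller, to pay for the piece that ended the epoch. -/
theorem adv_spec (h : Loc Γ.b τ μ (64 + 5 * Γ.s) ψ) (hΓ : Γ.Ok) {pot : ℕ → ℝ≥0∞} {x : ℝ≥0∞}
    (hpot : ∀ j, pot j + (x + (130 * Γ.s : ℕ) * τ) ≤ pot (j + 1))
    (hτ : τ ≠ ∞) {a : ℕ → Slot} {f : ℝ≥0∞} {Q : ℕ} (d : ℕ) :
    ∀ {j : ℕ} {π : ℕ → ℕ} {m : Mem}, Γ.M - Γ.R j ≤ d → Rep Γ j a π m → Inv Γ j a π Q →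
    (Adv Γ (j + 1) a → m 29 = 1) → (¬ Adv Γ (j + 1) a → m 29 = 0) →
    (∀ j' π' m', j ≤ j' → Rep Γ j' a π' m' → Inv Γ j' a π' Q →
      ¬ Adv Γ (j' + 1) a → (∀ y < 64, y ≤ 7 ∨ 42 ≤ y → m' y = m y) →
      ψ m' o K + pot j' ≤ f) →
    (¬ Adv Γ (j + 1) a → ψ m o (.loop 29 advBody :: K) + pot j ≤ τ + f) ∧
    (Adv Γ (j + 1) a → ψ m o (.loop 29 advBody :: K) + pot j + x ≤ τ + f) := by
  induction d with
  | zero => ?_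
  | succ d ih => ?_
  all_goals
    intro j π m hd hm hI hf1 hf0 hK
    refine ⟨fun hA => ?_, fun hA => ?_⟩
    · have := (h.loop_neg (x := 29) (p := advBody) (o := o) (K := K) hm.zero (hf0 hA)).le
      calc _ ≤ (1 : ℕ) * τ + ψ m o K + pot j := by gcongr
        _ = τ + (ψ m o K + pot j) := by push_cast; ring
        _ ≤ _ := by
          gcongr
          exact hK j π m le_rfl hm hI hA fun _ _ _ => rfl
    have hRle := hA.le hΓ hI.hy
    -- `R` strictly increases but stays at most `M` while advancing, so `M - R j` serves as the
    -- measure; for `d = 0` no advance is possible.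
    have hRlt : Γ.R j < Γ.R (j + 1) := Nat.pow_lt_pow_right hΓ.ρ_two (by omega)
  · omega
  have hs := hΓ.hs
  have hL : 64 ≤ 64 + 5 * Γ.s := by omega
  have bs := hΓ.bs
  have hbρ := hΓ.bMρ
  have hl := hΓ.lmax_lt
  set ψ' : Mem → List (ℕ × List ℕ) → List Cmd → ℝ≥0∞ := fun m o K => ψ m o K + pot (j + 1)
    with hψ'
  have h' : Loc Γ.b τ μ (64 + 5 * Γ.s) ψ' := h.add_const _
  have s1 := h'.loop_pos (x := 29) (p := advBody) (o := o) (K := K) hm.zero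
    (by rw [hf1 hA]; decide)
  have s2 := h'.seg (l := advPrep) (rest := [refreshCmd]) (o := o)
    (K := .loop 29 advBody :: K) (by decide) hL hm.zero
  set m1 := runSeg Γ.b advPrep m with hm1
  have hz1 : Zero (64 + 5 * Γ.s) m1 := hm.zero.runSeg (by decide) hL
  have fr1 : ∀ x, x ≠ 12 → x ≠ 13 → x ≠ 30 → m1 x = m x := fun x h1 h2 h3 =>
    runSeg_frame (by simp [advPrep, destCell]; omega)
  have hR1 : Γ.R j * Γ.ρ = Γ.R (j + 1) := (pow_succ _ _).symm
  have v12 : m1 12 = Γ.lmax := by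
    simp [hm1, advPrep, runSeg, assign, Mem.write, BinOp.eval, hm.c11,
      Nat.mod_eq_of_lt (show Γ.lmax < 2 ^ Γ.b by omega)]
  have v13 : m1 13 = Γ.R (j + 1) := by
    simp [hm1, advPrep, runSeg, assign, Mem.write, BinOp.eval, hm.c13, hm.c9, hR1,
      Nat.mod_eq_of_lt (show Γ.R (j + 1) < 2 ^ Γ.b by omega)]
  have s3 := h'.cons (c := refreshCmd) (l := []) (o := o) (K := .loop 29 advBody :: K) hz1
  have s4 := refresh_spec h' hΓ (j := j + 1) (a := a) (m := m1) (o := o)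
    (K := block [] :: .loop 29 advBody :: K) hI.hy
    (hm.core.congr hz1 fun x hx => fr1 x (by omega) (by omega) (by omega))
    (by rw [v12, Par.ell, if_neg (by omega)]) v13 hRle (X := 2 * τ + f)
    (fun π' m' hm' hperm hcov hfr hf1' hf0' => by
      have t1 := (h'.nil (o := o) (K := .loop 29 advBody :: K) hm'.zero).le
      have hI' : Inv Γ (j + 1) a π' Q := {
        hR := hRle, perm := hperm
        cov := fun q hq hqs => covered_iff (hcov q (by
          rw [Par.ell, if_neg (by omega)] at hq
          exact hA.1.trans hq) hqs)
        covv := fun i hi => covered_iff (by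
          by_contra hlt
          have := cntLt_pos hi (a := a) (T := thr Γ.M (Γ.Rv (j + 1))) (by omega)
          have := hA.2
          omega)
        bot := Or.inr hA
        hy := hI.hy, hc := hI.hc }
      have := ih (j := j + 1) (π := π') (m := m') (by omega) hm' hI' hf1' hf0'
        (fun j' π'' m'' hj hr hi ht hfr' => hK j' π'' m'' (by omega) hr hi ht
          fun y hy hy' => by
            rw [hfr' y hy hy', hfr y hy hy', fr1 y (by omega) (by omega) (by omega)])
      have hle : ψ m' o (.loop 29 advBody :: K) + pot (j + 1) ≤ τ + f := by
        by_cases hA' : Adv Γ (j + 1 + 1) a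
        · exact le_trans (le_add_right le_rfl) (this.2 hA')
        · exact this.1 hA'
      refine t1.trans ?_
      calc _ ≤ (1 : ℕ) * τ + (τ + f) := by gcongr
        _ = _ := by push_cast; ring)
  have s5 := (((s1.trans s2).trans s3).trans s4).mono (m := 129 * Γ.s) (by
    simp [advPrep]; omega)
  have s6 : ψ m o (.loop 29 advBody :: K) + pot (j + 1) ≤
      (129 * Γ.s : ℕ) * τ + (2 * τ + f) := s5.le
  -- The price of the advance is added on both sides and cancelled at the end, which requires it to
  -- be finite.
  have h0 : ((130 * Γ.s : ℕ) : ℝ≥0∞) * τ ≠ ∞ := ENNReal.mul_ne_top (ENNReal.natCast_ne_top _) hτ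
  refine (ENNReal.add_le_add_iff_right h0).1 ?_
  calc _ = ψ m o (.loop 29 advBody :: K) + (pot j + (x + (130 * Γ.s : ℕ) * τ)) := by ring
    _ ≤ ψ m o (.loop 29 advBody :: K) + pot (j + 1) := by gcongr; exact hpot j
    _ ≤ _ := s6
    _ = τ + f + ((129 * Γ.s + 1 : ℕ) : ℝ≥0∞) * τ := by push_cast; ring
    _ ≤ _ := by gcongr; omega

end Main


/-- Price of a piece of weight `w` in epoch `j`. -/
def Par.price (Γ : Par) (τ : ℝ≥0∞) (j w : ℕ) : ℝ≥0∞ :=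
  τ * (Γ.D * w * ((Γ.R j : ℕ) : ℝ≥0∞)⁻¹)

/-- Reward per unit of weight. -/
def Par.gain (Γ : Par) (τ : ℝ≥0∞) : ℝ≥0∞ := 1800 * τ * Γ.D

/-- Bound for the future cost after `n` units, of which `w` in the current piece. -/
def pieceGoal (Γ : Par) (τ : ℝ≥0∞) (e w₀ n w : ℕ) (f : (ℕ → Slot) → ℝ≥0∞) (a : ℕ → Slot) : ℝ≥0∞ :=
  w * (Γ.gain τ * hpot Γ a) + Hop Γ e w₀ (Γ.gain τ) n f a

/-- The constants: `1200 + 600 = 1800`. If units remain after the piece, the piece is full and its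
price is `τ * D ≥ τ`, so it can also pay the constant overhead `600 * τ` of the next piece. -/
theorem price_le_gain {Γ : Par} (hΓ : Γ.Ok) (τ : ℝ≥0∞) {j n w : ℕ} (hw : w = min n (Γ.R j)) :
    1200 * Γ.price τ j w + (if n - Γ.R j = 0 then 0 else 600 * τ) ≤
      w * (Γ.gain τ * ((Γ.R j : ℕ) : ℝ≥0∞)⁻¹) := by
  have hR := hΓ.R_pos j
  have h1 : (if n - Γ.R j = 0 then 0 else 600 * τ) ≤ 600 * Γ.price τ j w := by
    split_ifs with h0
    · exact zero_le
    · have hwR : w = Γ.R j := by omega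
      have hD : (1 : ℝ≥0∞) ≤ Γ.D := by
        have := hΓ.hs
        exact_mod_cast (show 1 ≤ Γ.D by unfold Par.D; omega)
      unfold Par.price
      rw [hwR, mul_assoc (Γ.D : ℝ≥0∞), mul_comm (((Γ.R j : ℕ)) : ℝ≥0∞), inv_mul_cancel_nat hR,
        mul_one]
      gcongr
      exact le_mul_of_one_le_right zero_le hD
  calc _ ≤ 1200 * Γ.price τ j w + 600 * Γ.price τ j w := by gcongr
    _ = _ := by unfold Par.price Par.gain; ring

/-- A piece has at most `R j` units, so a single `gain`, released by a change of epoch, covers it.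
-/
theorem price_le (Γ : Par) (hΓ : Γ.Ok) (τ : ℝ≥0∞) {j n w : ℕ} (hw : w = min n (Γ.R j)) :
    1200 * Γ.price τ j w + (if n - Γ.R j = 0 then 0 else 600 * τ) ≤ Γ.gain τ := by
  refine (price_le_gain hΓ τ hw).trans ?_
  have h1 : (w : ℝ≥0∞) * ((Γ.R j : ℕ) : ℝ≥0∞)⁻¹ ≤ 1 := by
    have h2 : (w : ℝ≥0∞) ≤ (Γ.R j : ℕ) := by exact_mod_cast (by omega : w ≤ Γ.R j)
    calc _ ≤ ((Γ.R j : ℕ) : ℝ≥0∞) * ((Γ.R j : ℕ) : ℝ≥0∞)⁻¹ := by gcongr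
      _ = 1 := by rw [mul_comm, inv_mul_cancel_nat (hΓ.R_pos j)]
  calc _ = Γ.gain τ * (w * ((Γ.R j : ℕ) : ℝ≥0∞)⁻¹) := by ring
    _ ≤ Γ.gain τ * 1 := by gcongr
    _ = _ := mul_one _

/-- Laggards are tried `lam` times as often, but there are at most `lmax` of them: `ell * lam + (s -
ell) ≤ D`. The second half, without the constants, bounds the probability that a site sends a
message. -/
theorem avg_skipExp_le {Γ : Par} (hΓ : Γ.Ok) {τ : ℝ≥0∞} (hτ : τ ≠ ∞) (j w : ℕ) :
    avg (Γ.Rv j) (skipExp (250 * τ) (Γ.Rv j) (Γ.ell j * w)) +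
      avg (Γ.R j) (skipExp (250 * τ) (Γ.R j) ((Γ.s - Γ.ell j) * w)) ≤ 500 * Γ.price τ j w ∧
    (((Γ.ell j * w : ℕ) : ℝ≥0∞) * ((Γ.Rv j : ℕ) : ℝ≥0∞)⁻¹ +
      (((Γ.s - Γ.ell j) * w : ℕ) : ℝ≥0∞) * ((Γ.R j : ℕ) : ℝ≥0∞)⁻¹ ≤
        Γ.D * w * ((Γ.R j : ℕ) : ℝ≥0∞)⁻¹) := by
  have h250 : 250 * τ ≠ ∞ := ENNReal.mul_ne_top (by norm_num) hτ
  have hR := hΓ.R_pos j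
  have hv := hΓ.Rv_pos j
  have hinv : ((Γ.Rv j : ℕ) : ℝ≥0∞)⁻¹ ≤ Γ.lam * ((Γ.R j : ℕ) : ℝ≥0∞)⁻¹ := by
    have h1 : ((Γ.R j : ℕ) : ℝ≥0∞) ≤ (Γ.Rv j : ℕ) * Γ.lam := by exact_mod_cast (hΓ.Rv_two j).2.2
    calc ((Γ.Rv j : ℕ) : ℝ≥0∞)⁻¹ =
        ((Γ.Rv j : ℕ) : ℝ≥0∞)⁻¹ * (((Γ.R j : ℕ) : ℝ≥0∞)⁻¹ * (Γ.R j : ℕ)) := by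
          rw [inv_mul_cancel_nat hR, mul_one]
      _ ≤ ((Γ.Rv j : ℕ) : ℝ≥0∞)⁻¹ * (((Γ.R j : ℕ) : ℝ≥0∞)⁻¹ * ((Γ.Rv j : ℕ) * Γ.lam)) := by gcongr
      _ = (((Γ.Rv j : ℕ) : ℝ≥0∞)⁻¹ * (Γ.Rv j : ℕ)) * (Γ.lam * ((Γ.R j : ℕ) : ℝ≥0∞)⁻¹) := by ring
      _ = _ := by rw [inv_mul_cancel_nat hv, one_mul]
  have key : ((Γ.ell j * w : ℕ) : ℝ≥0∞) * ((Γ.Rv j : ℕ) : ℝ≥0∞)⁻¹ +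
      (((Γ.s - Γ.ell j) * w : ℕ) : ℝ≥0∞) * ((Γ.R j : ℕ) : ℝ≥0∞)⁻¹ ≤
        Γ.D * w * ((Γ.R j : ℕ) : ℝ≥0∞)⁻¹ := by
    have hD : Γ.ell j * w * Γ.lam + (Γ.s - Γ.ell j) * w ≤ Γ.D * w := by
      have h1 : Γ.ell j ≤ Γ.lmax := by unfold Par.ell; split_ifs <;> omega
      have h2 := Nat.mul_le_mul_right Γ.lam h1
      calc _ = (Γ.ell j * Γ.lam + (Γ.s - Γ.ell j)) * w := by ring
        _ ≤ _ := Nat.mul_le_mul_right _ (by unfold Par.D; omega)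
    calc _ ≤ ((Γ.ell j * w : ℕ) : ℝ≥0∞) * (Γ.lam * ((Γ.R j : ℕ) : ℝ≥0∞)⁻¹) +
          (((Γ.s - Γ.ell j) * w : ℕ) : ℝ≥0∞) * ((Γ.R j : ℕ) : ℝ≥0∞)⁻¹ := by gcongr
      _ = ((Γ.ell j * w * Γ.lam + (Γ.s - Γ.ell j) * w : ℕ) : ℝ≥0∞) *
          ((Γ.R j : ℕ) : ℝ≥0∞)⁻¹ := by push_cast; ring
      _ ≤ ((Γ.D * w : ℕ) : ℝ≥0∞) * ((Γ.R j : ℕ) : ℝ≥0∞)⁻¹ := by gcongr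
      _ = _ := by push_cast; ring
  refine ⟨?_, key⟩
  calc _ ≤ 250 * τ * (2 * (Γ.ell j * w : ℕ) * ((Γ.Rv j : ℕ) : ℝ≥0∞)⁻¹) +
        250 * τ * (2 * ((Γ.s - Γ.ell j) * w : ℕ) * ((Γ.R j : ℕ) : ℝ≥0∞)⁻¹) :=
        add_le_add (avg_skipExp h250 hv _) (avg_skipExp h250 hR _)
    _ = 500 * τ * (((Γ.ell j * w : ℕ) : ℝ≥0∞) * ((Γ.Rv j : ℕ) : ℝ≥0∞)⁻¹ +
      (((Γ.s - Γ.ell j) * w : ℕ) : ℝ≥0∞) * ((Γ.R j : ℕ) : ℝ≥0∞)⁻¹) := by ring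
    _ ≤ 500 * τ * (Γ.D * w * ((Γ.R j : ℕ) : ℝ≥0∞)⁻¹) := by gcongr
    _ = _ := by unfold Par.price; ring

/-- The two independent skips of a piece have the effect of all its trials. -/
theorem avg_avg_skipVal_le {Γ : Par} (hΓ : Γ.Ok) {j e w w' Q : ℕ} {a : ℕ → Slot} {π : ℕ → ℕ}
    (hI : Inv Γ j a π Q) (τ : ℝ≥0∞) (n : ℕ) (f : (ℕ → Slot) → ℝ≥0∞) :
    avg (Γ.R j) (fun UB => avg (Γ.Rv j) fun UA =>
      skipVal Γ.M e w (Γ.Rv j) (Γ.ell j) 0 π (Γ.ell j * w') UA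
        (skipVal Γ.M e w (Γ.R j) (Γ.s - Γ.ell j) (Γ.ell j) π ((Γ.s - Γ.ell j) * w') UB
          (pieceGoal Γ τ e w n w' f)) a) ≤ Hop Γ e w (Γ.gain τ) (w' + n) f a := by
  have hR := hΓ.R_pos j
  have hRM := hI.hR
  have hM : 0 < Γ.M := by omega
  have hell := hΓ.ell_lt j
  have hcM : Γ.Rv j ≤ Γ.M := (hΓ.Rv_two j).2.1.trans hRM
  rw [avg_congr fun UB _ => avg_skipVal (hΓ.Rv_pos j) hM (hΓ.two_dvd (hΓ.Rv_two j).1 hcM)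
    (fun q hq => hI.covv _ (hI.lt (by omega))) (fun h0 => Nat.pos_of_ne_zero fun h1 => h0 (by
      rw [h1, zero_mul])) _, expect_avg]
  refine (expect_mono_supp _ fun a1 ha1 => (avg_skipVal hR hM (hΓ.two_dvd (hΓ.R_two j) hRM)
    (fun q hq => (hI.cov _ (by omega) (by omega)).mono (trials_support ha1 _))
    (fun _ => by omega) _).le).trans ?_
  rw [← expect_bind, ← trials_append, trials_perm _ _ _ (trialList_perm hell.le hI.perm w'), Hop_add]
  exact expect_trials_le_Hop Γ e w _ w' _ a

/-! ### Amortized cost of the pieces of an item -/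

section Main

variable {Γ : Par} {τ μ : ℝ≥0∞} {ψ : Mem → List (ℕ × List ℕ) → List Cmd → ℝ≥0∞}
  {o : List (ℕ × List ℕ)} {K : List Cmd}

/-- Bound for the future cost when `n` units of the current item remain and the skips have just been
drawn. -/
def Fresh (Γ : Par) (τ : ℝ≥0∞) (ψ : Mem → List (ℕ × List ℕ) → List Cmd → ℝ≥0∞)
    (o : List (ℕ × List ℕ)) (K : List Cmd) (pot : ℕ → ℝ≥0∞) (f : (ℕ → Slot) → ℝ≥0∞)
    (j₀ e w r Qf n : ℕ) : Prop :=
  ∀ j a π Q m, Bd Γ j a π Q m → j₀ ≤ j → Q + Γ.s * n ≤ Qf → m 4 = e → m 5 = w → m 42 = n →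
    m 45 = r →
    avg (Γ.Rv j) (fun UA => avg (Γ.R j) fun UB =>
      ψ ((m.write Γ.b 6 UA).write Γ.b 7 UB) o (pieceLoop :: K)) + pot j ≤
      (if n = 0 then 21 * τ else 600 * τ) + Hop Γ e w (Γ.gain τ) n f a

/-- The added `1200 * price` anticipates the expected cost of the trials of the piece. If the epoch
ends here, it is paid by the `gain` contained in the growth of `pot`; otherwise the slots are unfit
for epoch `j + 1`, so `hpot ≥ 1 / R j` and the reward of the piece pays. -/
theorem tail_spec (h : Loc Γ.b τ μ (64 + 5 * Γ.s) ψ) (hΓ : Γ.Ok) {pot : ℕ → ℝ≥0∞}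
    (hpot : ∀ j, pot j + (Γ.gain τ + (130 * Γ.s : ℕ) * τ) ≤ pot (j + 1)) (hτ : τ ≠ ∞)
    {f : (ℕ → Slot) → ℝ≥0∞} {j₀ e w r Qf n j Q : ℕ} {a : ℕ → Slot} {π : ℕ → ℕ} {m : Mem}
    (hF : Fresh Γ τ ψ o K pot f j₀ e w r Qf (n - Γ.R j))
    (hm : Rep Γ j a π m) (hI : Inv Γ j a π Q) (hj : j₀ ≤ j) (hQ : Q + Γ.s * (n - Γ.R j) ≤ Qf)
    (h4 : m 4 = e) (h5 : m 5 = w) (h44 : m 44 = n - Γ.R j) (h45 : m 45 = r) (hn : n < 2 ^ Γ.b) :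
    ψ m o (block pieceTail :: pieceLoop :: K) + pot j + 1200 * Γ.price τ j (min n (Γ.R j)) ≤
      45 * τ + pieceGoal Γ τ e w (n - Γ.R j) (min n (Γ.R j)) f a := by
  have hL : 64 ≤ 64 + 5 * Γ.s := by omega
  have bs := hΓ.bs
  set n' := n - Γ.R j with hn'
  set C : ℝ≥0∞ := if n' = 0 then 21 * τ else 600 * τ with hC
  have s1 := h.seg (l := postCmd) (rest := [block checkCmd, .loop 29 advBody, .rand 6 14,
    .rand 7 13]) (o := o) (K := pieceLoop :: K) (by decide) hL hm.zero
  set m1 := runSeg Γ.b postCmd m with hm1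
  have fr1 : ∀ x, x ≠ 27 → x ≠ 42 → m1 x = m x := fun x h1 h2 =>
    runSeg_frame (by simp [postCmd, destCell]; omega)
  have v42 : m1 42 = n' := by
    simp [hm1, postCmd, runSeg, assign, Mem.write, BinOp.eval, h44,
      Nat.mod_eq_of_lt (show n' < 2 ^ Γ.b by omega)]
  have hrep1 : Rep Γ j a π m1 := hm.congr fun x hx => fr1 x (by unfold Pers at hx; omega)
    (by unfold Pers at hx; omega)
  obtain ⟨m2, s2, hrep2, fr2, p1, p0⟩ := check_spec h hΓ hrep1 (o := o) (K := pieceLoop :: K)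
    (rest := [.loop 29 advBody, .rand 6 14, .rand 7 13])
  have s3 := h.cons (c := .loop 29 advBody) (l := [.rand 6 14, .rand 7 13]) (o := o)
    (K := pieceLoop :: K) hrep2.zero
  have hx : Γ.gain τ ≠ ∞ := by
    unfold Par.gain
    exact ENNReal.mul_ne_top (ENNReal.mul_ne_top (by norm_num) hτ) (ENNReal.natCast_ne_top _)
  have fr2' : ∀ x, x ≠ 27 → x ≠ 29 → x ≠ 30 → x ≠ 42 → m2 x = m x := fun x h1 h2 h3 h4 => by
    rw [fr2 x h2 h3, fr1 x h1 h4]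
  have key := adv_spec (o := o) (K := block [.rand 6 14, .rand 7 13] :: pieceLoop :: K) h hΓ hpot
    hτ (a := a) (Q := Q) (f := 5 * τ + (C + Hop Γ e w (Γ.gain τ) n' f a)) _ le_rfl hrep2 hI p1 p0
    (fun j' π' m3 hj' hrep3 hI3 htop hfr => by
      have t1 := h.brand (a := 6) (x := 14) (rest := [.rand 7 13]) (o := o) (K := pieceLoop :: K)
        hrep3.zero
      rw [hrep3.c14, max_eq_left (by have := hΓ.Rv_pos j'; omega)] at t1
      have t2 : ∀ UA < Γ.Rv j', LeT τ 3 (ψ (m3.write Γ.b 6 UA) o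
          (block [.rand 7 13] :: pieceLoop :: K)) (avg (Γ.R j') fun UB =>
            ψ ((m3.write Γ.b 6 UA).write Γ.b 7 UB) o (pieceLoop :: K)) := by
        intro UA _
        have hz : Zero (64 + 5 * Γ.s) (m3.write Γ.b 6 UA) := hrep3.zero.write (by omega)
        have t3 := h.brand (a := 7) (x := 13) (rest := []) (o := o) (K := pieceLoop :: K) hz
        have h13 : (m3.write Γ.b 6 UA) 13 = Γ.R j' := by
          rw [Mem.write, Function.update_of_ne (by omega), hrep3.c13]
        rw [h13, max_eq_left (by have := hΓ.R_pos j'; omega)] at t3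
        exact t3.trans (LeT.avg fun UB _ => h.nil (hz.write (by omega)))
      have t4 := t1.trans (LeT.avg t2)
      have t5 := hF j' a π' Q m3 ⟨hrep3, hI3, htop⟩ (by omega) hQ
        (by rw [hfr 4 (by omega) (by omega), fr2' 4 (by omega) (by omega) (by omega) (by omega), h4])
        (by rw [hfr 5 (by omega) (by omega), fr2' 5 (by omega) (by omega) (by omega) (by omega), h5])
        (by rw [hfr 42 (by omega) (by omega), fr2 42 (by omega) (by omega), v42])
        (by rw [hfr 45 (by omega) (by omega), fr2' 45 (by omega) (by omega) (by omega) (by omega),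
          h45])
      calc _ ≤ _ + pot j' := add_le_add_left t4.le _
        _ ≤ _ := by
          rw [add_assoc]
          exact add_le_add (by norm_num) t5)
  have s4 := (s1.trans s2).trans s3
  have hCe : C ≤ 21 * τ + (if n' = 0 then 0 else 600 * τ) := by
    rw [hC]; split_ifs <;> simp
  have hgoal : ψ m2 o (.loop 29 advBody :: block [.rand 6 14, .rand 7 13] :: pieceLoop :: K) +
      pot j + 1200 * Γ.price τ j (min n (Γ.R j)) ≤
        27 * τ + pieceGoal Γ τ e w n' (min n (Γ.R j)) f a := by
    by_cases hA : Adv Γ (j + 1) a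
    · have := key.2 hA
      refine (ENNReal.add_le_add_iff_right hx).1 ?_
      calc _ = (ψ m2 o (.loop 29 advBody :: block [.rand 6 14, .rand 7 13] :: pieceLoop :: K) +
            pot j + Γ.gain τ) + 1200 * Γ.price τ j (min n (Γ.R j)) := by ring
        _ ≤ (τ + (5 * τ + (21 * τ + (if n' = 0 then 0 else 600 * τ) +
            Hop Γ e w (Γ.gain τ) n' f a))) + 1200 * Γ.price τ j (min n (Γ.R j)) := by
            exact add_le_add (this.trans (by gcongr)) le_rfl
        _ = 27 * τ + Hop Γ e w (Γ.gain τ) n' f a + (1200 * Γ.price τ j (min n (Γ.R j)) +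
            (if n' = 0 then 0 else 600 * τ)) := by ring
        _ ≤ 27 * τ + Hop Γ e w (Γ.gain τ) n' f a + Γ.gain τ := by
            gcongr; exact price_le Γ hΓ τ rfl
        _ ≤ _ := by
            unfold pieceGoal
            gcongr
            exact le_add_left le_rfl
    · have := key.1 hA
      calc _ ≤ (τ + (5 * τ + (21 * τ + (if n' = 0 then 0 else 600 * τ) +
            Hop Γ e w (Γ.gain τ) n' f a))) + 1200 * Γ.price τ j (min n (Γ.R j)) := by
            exact add_le_add (this.trans (by gcongr)) le_rfl
        _ = 27 * τ + ((1200 * Γ.price τ j (min n (Γ.R j)) +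
            (if n' = 0 then 0 else 600 * τ)) + Hop Γ e w (Γ.gain τ) n' f a) := by ring
        _ ≤ _ := by
            unfold pieceGoal
            gcongr
            refine (price_le_gain hΓ τ rfl).trans ?_
            gcongr
            exact le_hpot hA
  have s5 : ψ m o (block pieceTail :: pieceLoop :: K) ≤ (17 : ℕ) * τ +
    ψ m2 o (.loop 29 advBody :: block [.rand 6 14, .rand 7 13] :: pieceLoop :: K) :=
    (s4.mono (by simp [postCmd])).le
  calc _ ≤ (17 : ℕ) * τ + ψ m2 o (.loop 29 advBody :: block [.rand 6 14, .rand 7 13] ::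
        pieceLoop :: K) + pot j + 1200 * Γ.price τ j (min n (Γ.R j)) := by gcongr
    _ = (17 : ℕ) * τ + (ψ m2 o (.loop 29 advBody :: block [.rand 6 14, .rand 7 13] ::
        pieceLoop :: K) + pot j + 1200 * Γ.price τ j (min n (Γ.R j))) := by ring
    _ ≤ (17 : ℕ) * τ + (27 * τ + pieceGoal Γ τ e w n' (min n (Γ.R j)) f a) := by gcongr
    _ = 44 * τ + pieceGoal Γ τ e w n' (min n (Γ.R j)) f a := by push_cast; ring
    _ ≤ _ := by gcongr; norm_num

/-- The draws `UA` and `UB` are given here, as they may come from the message of a site. The terms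
`skipExp` become comparable with the price only after averaging. -/
theorem piece_spec (h : Loc Γ.b τ μ (64 + 5 * Γ.s) ψ) (hΓ : Γ.Ok) {pot : ℕ → ℝ≥0∞}
    (hpot : ∀ j, pot j + (Γ.gain τ + (130 * Γ.s : ℕ) * τ) ≤ pot (j + 1)) (hτ : τ ≠ ∞)
    {f : (ℕ → Slot) → ℝ≥0∞} {j₀ e w r Qf n j Q UA UB : ℕ} {a : ℕ → Slot} {π : ℕ → ℕ} {m : Mem}
    (hF : Fresh Γ τ ψ o K pot f j₀ e w r Qf (n - Γ.R j))
    (hm : Rep Γ j a π m) (hI : Inv Γ j a π Q) (hj : j₀ ≤ j) (hQ : Q + Γ.s * n ≤ Qf)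
    (hQf : Qf < 2 ^ Γ.b)
    (h4 : m 4 = e) (h5 : m 5 = w) (he : e < 2 ^ Γ.b) (hw : w < 2 ^ Γ.b) (h6 : m 6 = UA)
    (h7 : m 7 = UB) (hUA : UA < Γ.Rv j) (hUB : UB < Γ.R j) (h42 : m 42 = n) (h45 : m 45 = r)
    (hn0 : n ≠ 0) (hn : n < 2 ^ Γ.b) :
    ψ m o (pieceLoop :: K) + pot j + 1200 * Γ.price τ j (min n (Γ.R j)) ≤
      590 * τ + skipExp (250 * τ) (Γ.Rv j) (Γ.ell j * min n (Γ.R j)) UA +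
        skipExp (250 * τ) (Γ.R j) ((Γ.s - Γ.ell j) * min n (Γ.R j)) UB +
        skipVal Γ.M e w (Γ.Rv j) (Γ.ell j) 0 π (Γ.ell j * min n (Γ.R j)) UA
          (skipVal Γ.M e w (Γ.R j) (Γ.s - Γ.ell j) (Γ.ell j) π
            ((Γ.s - Γ.ell j) * min n (Γ.R j)) UB
            (pieceGoal Γ τ e w (n - Γ.R j) (min n (Γ.R j)) f)) a := by
  set w' := min n (Γ.R j) with hw'
  have hsn : Γ.s * w' + Γ.s * (n - Γ.R j) = Γ.s * n := by
    rw [← mul_add]; congr 1; omega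
  set ψ' : Mem → List (ℕ × List ℕ) → List Cmd → ℝ≥0∞ :=
    fun m o K => ψ m o K + (pot j + 1200 * Γ.price τ j w') with hψ'
  have h' : Loc Γ.b τ μ (64 + 5 * Γ.s) ψ' := h.add_const _
  have s1 := h'.loop_pos (x := 42) (p := pieceCmd) (o := o) (K := K) hm.zero (by rw [h42]; exact hn0)
  have s2 := stages_spec h' hΓ hm hI h4 h5 he hw h42 h6 h7 hUA hUB hn hw' (by omega) (o := o)
    (K := pieceLoop :: K) (rest := pieceTail)
    (fun a' => 45 * τ + pieceGoal Γ τ e w (n - Γ.R j) w' f a')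
    (fun a' m' hm' hI' h44 hfr => by
      simp only [hψ', ← add_assoc]
      exact tail_spec h hΓ hpot hτ hF hm' hI' hj (by omega)
        (by rw [hfr 4 (by omega) (by omega), h4]) (by rw [hfr 5 (by omega) (by omega), h5]) h44
        (by rw [hfr 45 (by omega) (by omega), h45]) hn)
  have e1 : ∀ UB, skipVal Γ.M e w (Γ.R j) (Γ.s - Γ.ell j) (Γ.ell j) π ((Γ.s - Γ.ell j) * w') UB
      (fun a' => 45 * τ + pieceGoal Γ τ e w (n - Γ.R j) w' f a') = fun a' => 45 * τ +
        skipVal Γ.M e w (Γ.R j) (Γ.s - Γ.ell j) (Γ.ell j) π ((Γ.s - Γ.ell j) * w') UB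
          (pieceGoal Γ τ e w (n - Γ.R j) w' f) a' := fun UB => by
    funext a'
    exact skipVal_add_const (hΓ.R_pos j) _ _ _ _ _ _
  rw [e1, skipVal_add_const (hΓ.Rv_pos j)] at s2
  have s3 := (s1.trans_le s2).le
  rw [hψ'] at s3
  simp only at s3
  rw [add_assoc]
  refine s3.trans ?_
  generalize skipVal _ _ _ _ _ _ _ _ _ _ _ = v
  calc _ = 586 * τ + skipExp (250 * τ) (Γ.Rv j) (Γ.ell j * w') UA +
        skipExp (250 * τ) (Γ.R j) ((Γ.s - Γ.ell j) * w') UB + v := by push_cast; ring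
    _ ≤ _ := by gcongr; norm_num

/-- Strong induction on the remaining units, the epoch and the slots being arbitrary. Averaging
`piece_spec` over both draws turns the costs of the skips into at most `500` prices, which the
`1200` prices on the other side absorb. -/
theorem fresh_spec (h : Loc Γ.b τ μ (64 + 5 * Γ.s) ψ) (hΓ : Γ.Ok) {pot : ℕ → ℝ≥0∞}
    (hpot : ∀ j, pot j + (Γ.gain τ + (130 * Γ.s : ℕ) * τ) ≤ pot (j + 1)) (hτ : τ ≠ ∞)
    {f : (ℕ → Slot) → ℝ≥0∞} {j₀ e w r Qf : ℕ} (hQf : Qf < 2 ^ Γ.b) (he : e < 2 ^ Γ.b)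
    (hw : w < 2 ^ Γ.b)
    (hK : ∀ j a π m, j₀ ≤ j → Bd Γ j a π Qf m → m 45 = r → ψ m o K + pot j ≤ 20 * τ + f a)
    (n : ℕ) : Fresh Γ τ ψ o K pot f j₀ e w r Qf n := by
  induction n using Nat.strong_induction_on with
  | _ n ih =>
  intro j a π Q m hm hj hQ h4 h5 h42 h45
  have hR := hΓ.R_pos j
  have hv := hΓ.Rv_pos j
  have bs := hΓ.bs
  have hMb : Γ.M < 2 ^ Γ.b := by have := hΓ.bMρ; omega
  have hRM := hm.inv.hR
  have hvR := (hΓ.Rv_two j).2.1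
  have hne : ∀ UA UB x, x ≠ 6 → x ≠ 7 → ((m.write Γ.b 6 UA).write Γ.b 7 UB) x = m x :=
    fun UA UB x h1 h2 => by
      rw [Mem.write, Function.update_of_ne h2, Mem.write, Function.update_of_ne h1]
  have hbd : ∀ UA UB, Bd Γ j a π Q ((m.write Γ.b 6 UA).write Γ.b 7 UB) := fun UA UB =>
    hm.congr fun x hx => hne UA UB x (by unfold Pers at hx; omega) (by unfold Pers at hx; omega)
  rcases Nat.eq_zero_or_pos n with rfl | hn
  · rw [if_pos rfl]
    have : ∀ UA UB, ψ ((m.write Γ.b 6 UA).write Γ.b 7 UB) o (pieceLoop :: K) + pot j ≤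
        21 * τ + f a := by
      intro UA UB
      have hb := hbd UA UB
      have s1 := h.loop_neg (x := 42) (p := pieceCmd) (o := o) (K := K) hb.rep.zero
        (by rw [hne UA UB 42 (by omega) (by omega), h42])
      calc _ ≤ (1 : ℕ) * τ + ψ ((m.write Γ.b 6 UA).write Γ.b 7 UB) o K + pot j := by
            gcongr; exact s1.le
        _ = τ + (ψ ((m.write Γ.b 6 UA).write Γ.b 7 UB) o K + pot j) := by push_cast; ring
        _ ≤ τ + (20 * τ + f a) := by
            exact add_le_add le_rfl (hK j a π _ hj { hb with inv := hb.inv.mono (by omega) }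
              (by rw [hne UA UB 45 (by omega) (by omega), h45]))
        _ = _ := by ring
    have h2 : avg (Γ.Rv j) (fun UA => avg (Γ.R j) fun UB =>
      ψ ((m.write Γ.b 6 UA).write Γ.b 7 UB) o (pieceLoop :: K) + pot j) ≤ 21 * τ + f a :=
      (avg_mono fun UA _ => (avg_mono fun UB _ => this UA UB).trans (avg_const_le _ _)).trans
        (avg_const_le _ _)
    simp only [avg_add, avg_const hR, avg_const hv] at h2
    exact h2
  rw [if_neg hn.ne']
  have hnb : n < 2 ^ Γ.b := by
    have := Nat.le_mul_of_pos_left n (show 0 < Γ.s from hΓ.hs)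
    omega
  set w' := min n (Γ.R j) with hw'
  have hpc := fun UA (hA : UA < Γ.Rv j) UB (hB : UB < Γ.R j) =>
    piece_spec h hΓ hpot hτ (UA := UA) (UB := UB) (ih (n - Γ.R j) (by omega)) (hbd UA UB).rep
      (hbd UA UB).inv hj hQ hQf (by rw [hne UA UB 4 (by omega) (by omega), h4])
      (by rw [hne UA UB 5 (by omega) (by omega), h5]) he hw
      (by rw [Mem.write, Function.update_of_ne (by omega), Mem.write, Function.update_self,
        Nat.mod_eq_of_lt (by omega)])
      (by rw [Mem.write, Function.update_self, Nat.mod_eq_of_lt (by omega)]) hA hB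
      (by rw [hne UA UB 42 (by omega) (by omega), h42])
      (by rw [hne UA UB 45 (by omega) (by omega), h45]) hn.ne' hnb
  have hPf : 1200 * Γ.price τ j w' ≠ ∞ := by
    unfold Par.price
    refine ENNReal.mul_ne_top (by norm_num) (ENNReal.mul_ne_top hτ (ENNReal.mul_ne_top
      (ENNReal.mul_ne_top (ENNReal.natCast_ne_top _) (ENNReal.natCast_ne_top _)) ?_))
    exact ENNReal.inv_ne_top.2 (by exact_mod_cast hR.ne')
  refine (ENNReal.add_le_add_iff_right hPf).1 ?_
  -- The inner average must run over the draw for the laggards, since the value of the second stage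
  -- is the reward of the first.
  rw [avg_comm]
  have hval := avg_avg_skipVal_le hΓ (e := e) (w := w) (w' := w') hm.inv τ (n - Γ.R j) f
  rw [show w' + (n - Γ.R j) = n by omega] at hval
  calc _ = avg (Γ.R j) (fun UB => avg (Γ.Rv j) fun UA =>
        ψ ((m.write Γ.b 6 UA).write Γ.b 7 UB) o (pieceLoop :: K) + pot j +
          1200 * Γ.price τ j w') := by
        simp only [avg_add, avg_const hR, avg_const hv]
    _ ≤ _ := avg_mono fun UB hB => avg_mono fun UA hA => hpc UA hA UB hB
    _ = 590 * τ + (avg (Γ.Rv j) (skipExp (250 * τ) (Γ.Rv j) (Γ.ell j * w')) +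
      avg (Γ.R j) (skipExp (250 * τ) (Γ.R j) ((Γ.s - Γ.ell j) * w'))) + avg (Γ.R j) (fun UB =>
        avg (Γ.Rv j) fun UA => skipVal Γ.M e w (Γ.Rv j) (Γ.ell j) 0 π (Γ.ell j * w') UA
        (skipVal Γ.M e w (Γ.R j) (Γ.s - Γ.ell j) (Γ.ell j) π ((Γ.s - Γ.ell j) * w') UB
          (pieceGoal Γ τ e w (n - Γ.R j) w' f)) a) := by
        simp only [avg_add, avg_const hR, avg_const hv]
        ring
    _ ≤ 600 * τ + 1200 * Γ.price τ j w' + Hop Γ e w (Γ.gain τ) n f a := by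
        gcongr
        · norm_num
        · exact (avg_skipExp_le hΓ hτ j w').1.trans (by gcongr; norm_num)
    _ = _ := by ring

end Main


/-! ## Broadcast and handling of a message -/

/-- The payload arrives in cells `4` to `8` of a site. Its first two words are fillers for the cells
of an item; the number of laggards and the two inverse rates follow in cells `6`, `7` and `8`. -/
def bcBody : Cmd := block [block [.op .sub 32 32 3], .send 32 [0, 0, 12, 13, 14]]
def bcSend : Cmd := block [block [.const 27 0, .op .add 32 0 27], .loop 32 bcBody]
def bcast : Cmd := block [block [.op .eq 29 13 45], .branch 29 .skip bcSend]

/-- Messages that announce epoch `j` to the sites `n - 1, …, 0`. -/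
def bcList (Γ : Par) (j n : ℕ) : List (ℕ × List ℕ) :=
  (List.range n).reverse.map fun i => (i, [Γ.k, Γ.k, Γ.ell j, Γ.R j, Γ.Rv j])

theorem bcList_succ (Γ : Par) (j n : ℕ) :
    bcList Γ j (n + 1) = (n, [Γ.k, Γ.k, Γ.ell j, Γ.R j, Γ.Rv j]) :: bcList Γ j n := by
  simp [bcList, List.range_succ]

def msgPrep : List Cmd := [.const 27 0, .op .add 42 5 27, .op .add 45 13 27]
def msgMain : List Cmd := [block msgPrep, pieceLoop, bcast]

/-- Price of a broadcast. -/
def Par.bcCost (Γ : Par) (τ μ : ℝ≥0∞) : ℝ≥0∞ := (30 * Γ.k : ℕ) * τ + Γ.k * μ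

section Msg

variable {Γ : Par} {τ μ : ℝ≥0∞} {ψ : Mem → List (ℕ × List ℕ) → List Cmd → ℝ≥0∞}
  {o : List (ℕ × List ℕ)} {K : List Cmd}

theorem bc_loop_spec (h : Loc Γ.b τ μ (64 + 5 * Γ.s) ψ) (hΓ : Γ.Ok) {j : ℕ} {a : ℕ → Slot}
    {π : ℕ → ℕ} {X : ℝ≥0∞} (i : ℕ) : ∀ {m : Mem} {o : List (ℕ × List ℕ)}, Rep Γ j a π m →
      m 32 = i → i ≤ Γ.k → (∀ m', Rep Γ j a π m' → ψ m' (o ++ bcList Γ j i) K ≤ X) →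
      ψ m o (.loop 32 bcBody :: K) ≤ (8 * i + 1 : ℕ) * τ + i * μ + X := by
  have hL : 64 ≤ 64 + 5 * Γ.s := by omega
  induction i with
  | zero =>
    intro m o hm h32 _ hK
    have s1 := (h.loop_neg (p := bcBody) (o := o) (K := K) hm.zero h32).le
    refine s1.trans ?_
    have := hK m hm
    simp only [bcList, List.range_zero, List.reverse_nil, List.map_nil, List.append_nil] at this
    simpa using add_le_add le_rfl this
  | succ i ih =>
    intro m o hm h32 hi hK
    have hbk := hΓ.bk
    have s1 := h.loop_pos (x := 32) (p := bcBody) (o := o) (K := K) hm.zero (by omega)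
    have s2 := h.seg (l := [.op .sub 32 32 3]) (rest := [.send 32 [0, 0, 12, 13, 14]]) (o := o)
      (K := .loop 32 bcBody :: K) (by decide) hL hm.zero
    set m1 := runSeg Γ.b [.op .sub 32 32 3] m with hm1
    have fr1 : ∀ x, x ≠ 32 → m1 x = m x := fun x h1 => runSeg_frame (by simp [destCell]; omega)
    have v32 : m1 32 = i := by
      simp [hm1, runSeg, assign, Mem.write, BinOp.eval, h32, hm.c3,
        Nat.mod_eq_of_lt (show i < 2 ^ Γ.b by omega)]
    have hm1r : Rep Γ j a π m1 := hm.congr fun x hx => fr1 x (by unfold Pers at hx; omega)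
    have s3 := h.cons (c := .send 32 [0, 0, 12, 13, 14]) (l := []) (o := o)
      (K := .loop 32 bcBody :: K) hm1r.zero
    have s4 := h.send (d := 32) (l := [0, 0, 12, 13, 14]) (o := o)
      (K := block [] :: .loop 32 bcBody :: K) hm1r.zero
    simp only [List.map_cons, List.map_nil, hm1r.c0, hm1r.c12, hm1r.c13, hm1r.c14, v32] at s4
    have s5 := (h.nil (o := o ++ [(i, [Γ.k, Γ.k, Γ.ell j, Γ.R j, Γ.Rv j])])
      (K := .loop 32 bcBody :: K) hm1r.zero).le
    have s6 := ih (m := m1) (o := o ++ [(i, [Γ.k, Γ.k, Γ.ell j, Γ.R j, Γ.Rv j])]) hm1r v32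
      (by omega) (fun m' hm' => by
        have := hK m' hm'
        rw [List.append_assoc, List.singleton_append, ← bcList_succ]
        exact this)
    refine (((s1.trans s2).trans s3).trans s4).le.trans ?_
    calc _ ≤ ((1 + (2 * 1 + 2) + 1 + 1 : ℕ) : ℝ≥0∞) * τ +
          (μ + ((1 : ℕ) * τ + ((8 * i + 1 : ℕ) * τ + i * μ + X))) := by
          gcongr
          · simp
          · exact s5.trans (add_le_add le_rfl s6)
      _ = _ := by push_cast; ring

theorem bcast_spec (h : Loc Γ.b τ μ (64 + 5 * Γ.s) ψ) (hΓ : Γ.Ok) {j j₀ : ℕ} {a : ℕ → Slot}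
    {π : ℕ → ℕ} {m : Mem} (hm : Rep Γ j a π m) (h45 : m 45 = Γ.R j₀) {X : ℝ≥0∞}
    (hK : ∀ m', Rep Γ j a π m' → ψ m' (if j = j₀ then [] else bcList Γ j Γ.k) [] ≤ X) :
    ψ m [] [block [bcast]] ≤ 12 * τ + (if j = j₀ then 0 else Γ.bcCost τ μ) + X := by
  have hL : 64 ≤ 64 + 5 * Γ.s := by omega
  have bs := hΓ.bs
  have s0 := h.cons (c := bcast) (l := []) (o := []) (K := []) hm.zero
  have s1 := h.seg (l := [.op .eq 29 13 45]) (rest := [.branch 29 .skip bcSend]) (o := [])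
    (K := [block []]) (by decide) hL hm.zero
  set m1 := runSeg Γ.b [.op .eq 29 13 45] m with hm1
  have fr1 : ∀ x, x ≠ 29 → m1 x = m x := fun x h1 => runSeg_frame (by simp [destCell]; omega)
  have hm1r : Rep Γ j a π m1 := hm.congr fun x hx => fr1 x (by unfold Pers at hx; omega)
  have s2 := h.cons (c := .branch 29 .skip bcSend) (l := []) (o := []) (K := [block []]) hm1r.zero
  have v29 : m1 29 = if j = j₀ then 1 else 0 := by
    -- Comparing the inverse rates detects a change of epoch, as `R` is injective.
    have hinj : Γ.R j = Γ.R j₀ ↔ j = j₀ :=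
      (Nat.pow_right_injective hΓ.ρ_two).eq_iff
    simp only [hm1, runSeg, assign, Mem.write, BinOp.eval, hm.c13, h45, hinj, Function.update_self]
    exact Nat.mod_eq_of_lt (by split_ifs <;> omega)
  by_cases hj : j = j₀
  · simp only [if_pos hj] at v29 hK ⊢
    have s3 := h.branch_pos (x := 29) (p := .skip) (q := bcSend) (o := [])
      (K := [block [], block []]) hm1r.zero (by rw [v29]; decide)
    have s4 := h.skip (o := []) (K := [block [], block []]) hm1r.zero
    have s5 := h.nil (o := []) (K := [block []]) hm1r.zero
    have s6 := h.nil (o := []) (K := []) hm1r.zero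
    have := (((((((s0.trans s1).trans s2).trans s3).trans s4).trans s5).trans s6).trans_le
      (hK m1 hm1r)).mono (m := 12) (by simp)
    rw [add_zero]
    exact this.le.trans (by norm_num)
  · simp only [if_neg hj] at v29 hK ⊢
    have s3 := h.branch_neg (x := 29) (p := .skip) (q := bcSend) (o := [])
      (K := [block [], block []]) hm1r.zero v29
    have s4 := h.seg (l := [.const 27 0, .op .add 32 0 27]) (rest := [.loop 32 bcBody]) (o := [])
      (K := [block [], block []]) (by decide) hL hm1r.zero
    set m2 := runSeg Γ.b [.const 27 0, .op .add 32 0 27] m1 with hm2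
    have fr2 : ∀ x, x ≠ 27 → x ≠ 32 → m2 x = m1 x := fun x h1 h2 =>
      runSeg_frame (by simp [destCell]; omega)
    have hm2r : Rep Γ j a π m2 := hm1r.congr fun x hx => fr2 x (by unfold Pers at hx; omega)
      (by unfold Pers at hx; omega)
    have v32 : m2 32 = Γ.k := by
      simp [hm2, runSeg, assign, Mem.write, BinOp.eval, hm1r.c0, Nat.mod_eq_of_lt hΓ.bk]
    have s5 := h.cons (c := .loop 32 bcBody) (l := []) (o := []) (K := [block [], block []])
      hm2r.zero
    have s6 := bc_loop_spec h hΓ (K := [block [], block [], block []]) (X := 3 * τ + X) Γ.k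
      (m := m2) (o := []) hm2r v32 le_rfl (fun m' hm' => by
        rw [List.nil_append]
        have t1 := h.nil (o := bcList Γ j Γ.k) (K := [block [], block []]) hm'.zero
        have t2 := h.nil (o := bcList Γ j Γ.k) (K := [block []]) hm'.zero
        have t3 := h.nil (o := bcList Γ j Γ.k) (K := []) hm'.zero
        exact (((t1.trans t2).trans t3).trans_le (hK m' hm')).le.trans (by norm_num))
    have s7 := (((((s0.trans s1).trans s2).trans s3).trans s4).trans s5).le
    refine (s7.trans (add_le_add le_rfl s6)).trans ?_
    unfold Par.bcCost
    have hk := hΓ.hk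
    calc _ = ((8 * Γ.k + 18 : ℕ) : ℝ≥0∞) * τ + Γ.k * μ + X := by
          simp only [List.length_cons, List.length_nil]; push_cast; ring
      _ ≤ ((12 + 30 * Γ.k : ℕ) : ℝ≥0∞) * τ + Γ.k * μ + X := by gcongr ?_ * _ + _ + _; norm_cast; omega
      _ = _ := by push_cast; ring

/-- Handling of a message, the coordinator being initialized. -/
theorem msg_spec (h : Loc Γ.b τ μ (64 + 5 * Γ.s) ψ) (hΓ : Γ.Ok) {κ y : ℝ≥0∞} (hκ' : κ ≠ ∞)
    (hκ : Γ.gain τ + (130 * Γ.s : ℕ) * τ + (Γ.bcCost τ μ + y) ≤ κ) (hτ : τ ≠ ∞) (hμ : μ ≠ ∞)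
    (hy : y ≠ ∞)
    {f : (ℕ → Slot) → ℝ≥0∞} {e w j Q UA UB : ℕ} {a : ℕ → Slot} {π : ℕ → ℕ} {m : Mem}
    (hm : Bd Γ j a π Q m) (hQ : Q + Γ.s * w < 2 ^ Γ.b)
    (h4 : m 4 = e) (h5 : m 5 = w) (he : e < 2 ^ Γ.b) (h6 : m 6 = UA)
    (h7 : m 7 = UB) (hUA : UA < Γ.Rv j) (hUB : UB < Γ.R j) (hw0 : w ≠ 0)
    (hK : ∀ j' a' π' m', j ≤ j' → Bd Γ j' a' π' (Q + Γ.s * w) m' →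
      ψ m' (if j' = j then [] else bcList Γ j' Γ.k) [] + κ * j' ≤
        f a' + if j' = j then 0 else y) :
    ψ m [] [block msgMain] + κ * j + 1200 * Γ.price τ j (min w (Γ.R j)) ≤
      600 * τ + skipExp (250 * τ) (Γ.Rv j) (Γ.ell j * min w (Γ.R j)) UA +
        skipExp (250 * τ) (Γ.R j) ((Γ.s - Γ.ell j) * min w (Γ.R j)) UB +
        skipVal Γ.M e w (Γ.Rv j) (Γ.ell j) 0 π (Γ.ell j * min w (Γ.R j)) UA
          (skipVal Γ.M e w (Γ.R j) (Γ.s - Γ.ell j) (Γ.ell j) π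
            ((Γ.s - Γ.ell j) * min w (Γ.R j)) UB
            (pieceGoal Γ τ e w (w - Γ.R j) (min w (Γ.R j)) f)) a := by
  have hL : 64 ≤ 64 + 5 * Γ.s := by omega
  have bs := hΓ.bs
  set bc := Γ.bcCost τ μ + y with hbc
  have hbcf : bc ≠ ∞ := by
    rw [hbc]; unfold Par.bcCost
    exact ENNReal.add_ne_top.2 ⟨ENNReal.add_ne_top.2 ⟨ENNReal.mul_ne_top
      (ENNReal.natCast_ne_top _) hτ, ENNReal.mul_ne_top (ENNReal.natCast_ne_top _) hμ⟩, hy⟩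
  have hwb : w < 2 ^ Γ.b := by
    have := Nat.le_mul_of_pos_left w (show 0 < Γ.s from hΓ.hs)
    omega
  -- The price of the broadcast is reserved while the epoch is still `j` and is freed by the first
  -- advance, so that it is paid once however many epochs are skipped.
  set pot : ℕ → ℝ≥0∞ := fun i => κ * i + if i ≤ j then bc else 0 with hpotdef
  have hpot : ∀ i, pot i + (Γ.gain τ + (130 * Γ.s : ℕ) * τ) ≤ pot (i + 1) := by
    intro i
    simp only [hpotdef]
    have hle : (if i ≤ j then bc else 0) ≤ bc := by split_ifs <;> simp
    calc _ ≤ κ * i + bc + (Γ.gain τ + (130 * Γ.s : ℕ) * τ) := by gcongr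
      _ = κ * i + (Γ.gain τ + (130 * Γ.s : ℕ) * τ + bc) := by ring
      _ ≤ κ * i + κ := by gcongr
      _ = κ * (i + 1 : ℕ) := by push_cast; ring
      _ ≤ _ := le_add_right le_rfl
  have s1 := h.seg (l := msgPrep) (rest := [pieceLoop, bcast]) (o := []) (K := []) (by decide) hL
    hm.rep.zero
  set m1 := runSeg Γ.b msgPrep m with hm1
  have fr1 : ∀ x, x ≠ 27 → x ≠ 42 → x ≠ 45 → m1 x = m x := fun x h1 h2 h3 =>
    runSeg_frame (by simp [msgPrep, destCell]; omega)
  have hRb : Γ.R j < 2 ^ Γ.b := by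
    have := hΓ.bMρ
    have := hm.inv.hR
    omega
  have vals : m1 42 = w ∧ m1 45 = Γ.R j := by
    constructor <;>
    simp [hm1, msgPrep, runSeg, assign, Mem.write, BinOp.eval, h5, hm.rep.c13,
      Nat.mod_eq_of_lt hwb, Nat.mod_eq_of_lt hRb]
  have hm1r : Rep Γ j a π m1 := hm.rep.congr fun x hx => fr1 x (by unfold Pers at hx; omega)
    (by unfold Pers at hx; omega) (by unfold Pers at hx; omega)
  have s2 := h.cons (c := pieceLoop) (l := [bcast]) (o := []) (K := []) hm1r.zero
  have hF := fresh_spec h hΓ hpot hτ (o := []) (K := [block [bcast]]) (f := fun a => f a + bc)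
    (j₀ := j) (e := e) (w := w) (r := Γ.R j) (Qf := Q + Γ.s * w) hQ he hwb
    (fun j' a' π' m' hj' hb h45 => by
      have hk := fun m'' (hm'' : Rep Γ j' a' π' m'') =>
        hK j' a' π' m'' hj' { hb with rep := hm'' }
      -- The target is a truncated difference; the bound `hfk` below shows that nothing is lost when
      -- `κ * j'` is added back.
      have t2 := bcast_spec h hΓ (X := f a' + (if j' = j then 0 else y) - κ * j') hb.rep h45
        fun m'' hm'' => ENNReal.le_sub_of_add_le_right
          (ENNReal.mul_ne_top hκ' (ENNReal.natCast_ne_top _)) (hk m'' hm'')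
      have hfk : κ * j' ≤ f a' + (if j' = j then 0 else y) :=
        le_trans (le_add_left le_rfl) (hk m' hb.rep)
      simp only [hpotdef]
      calc _ ≤ 12 * τ + (if j' = j then 0 else Γ.bcCost τ μ) +
            (f a' + (if j' = j then 0 else y) - κ * j') +
            (κ * j' + if j' ≤ j then bc else 0) := by gcongr
        _ = 12 * τ + ((if j' = j then 0 else Γ.bcCost τ μ) + (if j' ≤ j then bc else 0)) +
            (f a' + (if j' = j then 0 else y) - κ * j' + κ * j') := by ring
        _ = 12 * τ + ((if j' = j then 0 else Γ.bcCost τ μ) + (if j' = j then 0 else y) +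
            (if j' ≤ j then bc else 0)) + f a' := by
            rw [tsub_add_cancel_of_le hfk]; ring
        _ ≤ 12 * τ + bc + f a' := by
            gcongr
            rcases hj'.eq_or_lt with rfl | hlt
            · simp
            · rw [if_neg (by omega), if_neg (by omega), if_neg (by omega), add_zero]
        _ ≤ 20 * τ + (f a' + bc) := by
            rw [add_assoc, add_comm bc]
            gcongr
            norm_num)
  have s3 := piece_spec h hΓ hpot hτ (hF (w - Γ.R j)) hm1r hm.inv le_rfl le_rfl hQ
    (by rw [fr1 4 (by omega) (by omega) (by omega), h4])
    (by rw [fr1 5 (by omega) (by omega) (by omega), h5]) he hwb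
    (by rw [fr1 6 (by omega) (by omega) (by omega), h6])
    (by rw [fr1 7 (by omega) (by omega) (by omega), h7]) hUA hUB vals.1 vals.2 hw0 hwb
  have e1 : pieceGoal Γ τ e w (w - Γ.R j) (min w (Γ.R j)) (fun a => f a + bc) =
      fun a => bc + pieceGoal Γ τ e w (w - Γ.R j) (min w (Γ.R j)) f a := by
    funext a
    unfold pieceGoal
    rw [Hop_add_const]
    ring
  have e2 : ∀ F, skipVal Γ.M e w (Γ.R j) (Γ.s - Γ.ell j) (Γ.ell j) π
      ((Γ.s - Γ.ell j) * min w (Γ.R j)) UB (fun a' => bc + F a') = fun a' => bc +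
        skipVal Γ.M e w (Γ.R j) (Γ.s - Γ.ell j) (Γ.ell j) π
          ((Γ.s - Γ.ell j) * min w (Γ.R j)) UB F a' := fun F => by
    funext a'
    exact skipVal_add_const (hΓ.R_pos j) _ _ _ _ _ _
  rw [e1, e2, skipVal_add_const (hΓ.Rv_pos j)] at s3
  generalize skipVal _ _ _ _ _ _ _ _ _ _ _ = v at s3 ⊢
  have s4 := (s1.trans s2).le
  refine (ENNReal.add_le_add_iff_right hbcf).1 ?_
  calc _ ≤ ((2 * msgPrep.length + 2 + 1 : ℕ) * τ + ψ m1 [] [pieceLoop, block [bcast]]) + κ * j +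
        1200 * Γ.price τ j (min w (Γ.R j)) + bc := by gcongr; exact s4
    _ = 9 * τ + (ψ m1 [] [pieceLoop, block [bcast]] + pot j +
        1200 * Γ.price τ j (min w (Γ.R j))) := by
        simp only [hpotdef, if_pos le_rfl, msgPrep, List.length_cons, List.length_nil]
        push_cast
        ring
    _ ≤ _ := add_le_add le_rfl s3
    _ = 599 * τ + skipExp (250 * τ) (Γ.Rv j) (Γ.ell j * min w (Γ.R j)) UA +
        skipExp (250 * τ) (Γ.R j) ((Γ.s - Γ.ell j) * min w (Γ.R j)) UB + v + bc := by ring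
    _ ≤ _ := by gcongr; norm_num

end Msg


/-! ## Initialization of the coordinator -/

/-- `2 ^ rhoExp k s` is the least power of two `ρ ≥ 2` with `k ≤ ρ ^ 4 * s`, about `(k / s) ^
(1/4)`. The fourth power leaves room: `s * ρ ^ 2` is still `O(s + k)`, while `log ρ` loses only a
constant factor. -/
def rhoExp (k s : ℕ) : ℕ := sInf {q | 1 ≤ q ∧ k ≤ (2 ^ q) ^ 4 * s}
def lamExp (s : ℕ) : ℕ := sInf {l | s < 2 ^ (2 ^ l)}

theorem rhoExp_mem (k : ℕ) {s : ℕ} (hs : 1 ≤ s) :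
    1 ≤ rhoExp k s ∧ k ≤ (2 ^ rhoExp k s) ^ 4 * s := by
  refine Nat.sInf_mem (s := {q | 1 ≤ q ∧ k ≤ (2 ^ q) ^ 4 * s}) ⟨k + 1, by omega, ?_⟩
  have h1 : k + 1 < 2 ^ (k + 1) := Nat.lt_two_pow_self
  calc k ≤ 2 ^ (k + 1) := by omega
    _ ≤ (2 ^ (k + 1)) ^ 4 := Nat.le_self_pow (by norm_num) _
    _ ≤ _ := Nat.le_mul_of_pos_right _ hs

theorem lt_of_lt_rhoExp {k s q : ℕ} (hq : 1 ≤ q) (h : q < rhoExp k s) : (2 ^ q) ^ 4 * s < k := by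
  by_contra hlt
  exact Nat.notMem_of_lt_sInf h ⟨hq, by omega⟩

theorem lamExp_mem (s : ℕ) : s < 2 ^ (2 ^ lamExp s) := by
  refine Nat.sInf_mem (s := {l | s < 2 ^ (2 ^ l)}) ⟨s, ?_⟩
  exact (Nat.lt_two_pow_self).trans_le (Nat.pow_le_pow_right (by norm_num) Nat.lt_two_pow_self.le)

theorem le_of_lt_lamExp {s l : ℕ} (h : l < lamExp s) : 2 ^ (2 ^ l) ≤ s := by
  by_contra hlt
  exact Nat.notMem_of_lt_sInf h (by simpa using hlt)

def rhoTest : List Cmd := [.op .mul 31 9 9, .op .mul 31 31 31, .op .mul 31 31 1, .op .lt 32 31 0]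
def setupStart : List Cmd := [.const 3 1, .const 30 8, .op .div 30 2 30, .op .shl 8 3 30,
  .const 9 2] ++ rhoTest
def rhoBody : List Cmd := .op .add 9 9 9 :: rhoTest
def lamStart : List Cmd := [.const 10 1, .op .shr 31 1 10]
def lamBody : List Cmd := [.op .add 10 10 10, .op .shr 31 1 10]
def setupEnd : List Cmd := [.op .shr 11 1 9, .const 12 0, .const 13 1, .op .add 20 1 1,
  .const 30 64, .op .add 20 20 30, .op .add 21 20 1, .op .add 22 21 1]
def setupCmd : Cmd := block [block setupStart, .loop 32 (block rhoBody), block lamStart,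
  .loop 31 (block lamBody), block setupEnd, refreshCmd]

/-- The slots before the first item. -/
def emptySlots : ℕ → Slot := fun _ => ⟨0, 0, 0, 0⟩

/-- The parameters that the coordinator computes. -/
structure Par.Std (Γ : Par) : Prop extends Γ.Ok where
  M_eq : Γ.M = 2 ^ (Γ.b / 8)
  ρ_eq : Γ.ρ = 2 ^ rhoExp Γ.k Γ.s
  lam_eq : Γ.lam = 2 ^ lamExp Γ.s
  bρ4 : Γ.ρ ^ 4 * Γ.s < 2 ^ Γ.b

section Setup

variable {Γ : Par} {τ μ : ℝ≥0∞} {ψ : Mem → List (ℕ × List ℕ) → List Cmd → ℝ≥0∞}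
  (h : Loc Γ.b τ μ (64 + 5 * Γ.s) ψ) {o : List (ℕ × List ℕ)} {K : List Cmd}

theorem rhoTest_val {k s b q : ℕ} {m : Mem} (h0 : m 0 = k) (h1 : m 1 = s) (h9 : m 9 = 2 ^ q)
    (hs : 1 ≤ s) (hq : (2 ^ q) ^ 4 * s < 2 ^ b) (hb : 1 < 2 ^ b) :
    runSeg b rhoTest m 32 = if (2 ^ q) ^ 4 * s < k then 1 else 0 := by
  have p1 : 1 ≤ 2 ^ q := Nat.one_le_two_pow
  have e1 : 2 ^ q * 2 ^ q * (2 ^ q * 2 ^ q) * s = (2 ^ q) ^ 4 * s := by ring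
  have b3 : 2 ^ q * 2 ^ q * (2 ^ q * 2 ^ q) * s < 2 ^ b := by rw [e1]; exact hq
  have b2 : 2 ^ q * 2 ^ q * (2 ^ q * 2 ^ q) < 2 ^ b :=
    lt_of_le_of_lt (Nat.le_mul_of_pos_right _ hs) b3
  have b1 : 2 ^ q * 2 ^ q < 2 ^ b := lt_of_le_of_lt (Nat.le_mul_of_pos_right _ (by positivity)) b2
  simp only [rhoTest, runSeg, assign, Mem.write, BinOp.eval, Function.update_apply, reduceIte, h0,
    h1, h9, Nat.mod_eq_of_lt b1, Nat.mod_eq_of_lt b2, Nat.mod_eq_of_lt b3, Nat.reduceEqDiff, e1,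
    Nat.mod_eq_of_lt hq]
  exact Nat.mod_eq_of_lt (by split_ifs <;> omega)

include h

theorem rho_loop_spec (hΓ : Γ.Std) (d : ℕ) : ∀ {q : ℕ} {m : Mem} {X : ℝ≥0∞}, 1 ≤ q →
    q + d = rhoExp Γ.k Γ.s → Zero (64 + 5 * Γ.s) m → m 0 = Γ.k → m 1 = Γ.s → m 9 = 2 ^ q →
    (m 32 = if (2 ^ q) ^ 4 * Γ.s < Γ.k then 1 else 0) →
    (∀ m', Zero (64 + 5 * Γ.s) m' → m' 9 = Γ.ρ → (∀ x, x ≠ 9 → x ≠ 31 → x ≠ 32 → m' x = m x) →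
      ψ m' o K ≤ X) →
    LeT τ (15 * d + 1) (ψ m o (.loop 32 (block rhoBody) :: K)) X := by
  have hL : 64 ≤ 64 + 5 * Γ.s := by omega
  have hmem := rhoExp_mem Γ.k hΓ.hs
  have b1 : 1 < 2 ^ Γ.b := by have := hΓ.bs; omega
  induction d with
  | zero =>
    intro q m X hq hqd hz h0 h1 h9 h32 hK
    rw [← hqd, add_zero] at hmem
    rw [if_neg (by omega)] at h32
    refine (h.loop_neg hz h32).trans_le (hK m hz ?_ fun _ _ _ _ => rfl)
    rw [h9, hΓ.ρ_eq, ← hqd, add_zero]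
  | succ d ih =>
    intro q m X hq hqd hz h0 h1 h9 h32 hK
    rw [if_pos (lt_of_lt_rhoExp hq (by omega))] at h32
    have s1 := h.loop_pos (x := 32) (p := block rhoBody) (o := o) (K := K) hz (by omega)
    have s2 := h.regs (l := rhoBody) (o := o) (K := .loop 32 (block rhoBody) :: K) (by decide) hL hz
    set m1 := runSeg Γ.b rhoBody m with hm1
    have fr1 : ∀ x, x ≠ 9 → x ≠ 31 → x ≠ 32 → m1 x = m x := fun x h1 h2 h3 =>
      runSeg_frame (by simp [rhoBody, rhoTest, destCell]; omega)
    have e1 : 2 ^ q + 2 ^ q = 2 ^ (q + 1) := by ring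
    have hle : (2 ^ (q + 1)) ^ 4 * Γ.s < 2 ^ Γ.b := by
      refine lt_of_le_of_lt (Nat.mul_le_mul_right _ (Nat.pow_le_pow_left ?_ 4)) hΓ.bρ4
      rw [hΓ.ρ_eq]
      exact Nat.pow_le_pow_right (by norm_num) (by omega)
    have hq1 : 2 ^ (q + 1) < 2 ^ Γ.b :=
      lt_of_le_of_lt ((Nat.le_self_pow (by norm_num) _).trans (Nat.le_mul_of_pos_right _ hΓ.hs)) hle
    set m0 := m.write Γ.b 9 (m 9 + m 9) with hm0
    have f0 : ∀ x, x ≠ 9 → m0 x = m x := fun x hx => by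
      rw [hm0, Mem.write, Function.update_of_ne hx]
    have v9' : m0 9 = 2 ^ (q + 1) := by
      rw [hm0, Mem.write, Function.update_self, h9, e1, Nat.mod_eq_of_lt hq1]
    have v32 : m1 32 = if (2 ^ (q + 1)) ^ 4 * Γ.s < Γ.k then 1 else 0 :=
      rhoTest_val (m := m0) (by rw [f0 0 (by omega), h0]) (by rw [f0 1 (by omega), h1]) v9' hΓ.hs
        hle b1
    have v9 : m1 9 = 2 ^ (q + 1) := by
      rw [← v9']
      exact runSeg_frame (l := rhoTest) (m := m0) (by decide)
    have s3 := ih (m := m1) (X := X) (by omega) (by omega) (hz.runSeg (by decide) hL)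
      (by rw [fr1 0 (by omega) (by omega) (by omega), h0])
      (by rw [fr1 1 (by omega) (by omega) (by omega), h1]) v9 v32 fun m' hz' h9' hf' =>
        hK m' hz' h9' fun x hx1 hx2 hx3 => by rw [hf' x hx1 hx2 hx3, fr1 x hx1 hx2 hx3]
    exact ((s1.trans s2).trans s3).mono (by simp [rhoBody, rhoTest]; omega)

theorem lam_loop_spec (hΓ : Γ.Std) (d : ℕ) : ∀ {l : ℕ} {m : Mem} {X : ℝ≥0∞},
    l + d = lamExp Γ.s → Zero (64 + 5 * Γ.s) m → m 1 = Γ.s → m 10 = 2 ^ l →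
    m 31 = Γ.s / 2 ^ (2 ^ l) →
    (∀ m', Zero (64 + 5 * Γ.s) m' → m' 10 = Γ.lam → (∀ x, x ≠ 10 → x ≠ 31 → m' x = m x) →
      ψ m' o K ≤ X) →
    LeT τ (10 * d + 1) (ψ m o (.loop 31 (block lamBody) :: K)) X := by
  have hL : 64 ≤ 64 + 5 * Γ.s := by omega
  have bs := hΓ.bs
  have hmem := lamExp_mem Γ.s
  induction d with
  | zero =>
    intro l m X hqd hz h1 h10 h31 hK
    rw [← hqd, add_zero] at hmem
    rw [Nat.div_eq_of_lt hmem] at h31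
    refine (h.loop_neg hz h31).trans_le (hK m hz ?_ fun _ _ _ => rfl)
    rw [h10, hΓ.lam_eq, ← hqd, add_zero]
  | succ d ih =>
    intro l m X hqd hz h1 h10 h31 hK
    have hpos : 0 < Γ.s / 2 ^ (2 ^ l) := Nat.div_pos (le_of_lt_lamExp (by omega)) (by positivity)
    have s1 := h.loop_pos (x := 31) (p := block lamBody) (o := o) (K := K) hz (by omega)
    have s2 := h.regs (l := lamBody) (o := o) (K := .loop 31 (block lamBody) :: K) (by decide) hL hz
    set m1 := runSeg Γ.b lamBody m with hm1
    have fr1 : ∀ x, x ≠ 10 → x ≠ 31 → m1 x = m x := fun x h1 h2 =>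
      runSeg_frame (by simp [lamBody, destCell]; omega)
    have e1 : 2 ^ l + 2 ^ l = 2 ^ (l + 1) := by ring
    have hle : 2 ^ (l + 1) < 2 ^ Γ.b := by
      refine lt_of_le_of_lt ?_ hΓ.blam
      rw [hΓ.lam_eq]
      exact Nat.pow_le_pow_right (by norm_num) (by omega)
    have v10 : m1 10 = 2 ^ (l + 1) := by
      simp [hm1, lamBody, runSeg, assign, Mem.write, BinOp.eval, h10, e1, Nat.mod_eq_of_lt hle]
    have v31 : m1 31 = Γ.s / 2 ^ (2 ^ (l + 1)) := by
      have hlt : Γ.s / 2 ^ (2 ^ (l + 1)) < 2 ^ Γ.b :=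
        lt_of_le_of_lt (Nat.div_le_self _ _) (by omega)
      simp [hm1, lamBody, runSeg, assign, Mem.write, BinOp.eval, h10, h1, e1, Nat.mod_eq_of_lt hle,
        Nat.mod_eq_of_lt hlt]
    have s3 := ih (m := m1) (X := X) (by omega) (hz.runSeg (by decide) hL)
      (by rw [fr1 1 (by omega) (by omega), h1]) v10 v31 fun m' hz' h10' hf' =>
        hK m' hz' h10' fun x hx1 hx2 => by rw [hf' x hx1 hx2, fr1 x hx1 hx2]
    exact ((s1.trans s2).trans s3).mono (by simp [lamBody]; omega)

/-- The search for `ρ` and `lam` doubles a candidate and takes `O(log ρ + log lam)` steps. In epoch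
`0` both rates are one, so all slots are covered although they are empty, and the empty slots are
not fit for epoch `1`. -/
theorem setup_spec (hΓ : Γ.Std) {m : Mem} (h0 : m 0 = Γ.k) (h1 : m 1 = Γ.s) (h2 : m 2 = Γ.b)
    (hz : ∀ x, 8 ≤ x → m x = 0) {X : ℝ≥0∞}
    (hK : ∀ π m', Bd Γ 0 emptySlots π 0 m' → (∀ x, 4 ≤ x → x ≤ 7 → m' x = m x) → ψ m' o K ≤ X) :
    LeT τ (200 * (Γ.s + Γ.ρ + Γ.lam)) (ψ m o (setupCmd :: K)) X := by
  have hL : 64 ≤ 64 + 5 * Γ.s := by omega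
  have bs := hΓ.bs
  have hs := hΓ.hs
  have hlm := hΓ.lmax_lt
  have hbρ := hΓ.bMρ
  have hzero : Zero (64 + 5 * Γ.s) m := fun x hx => hz x (by omega)
  have b1 : 1 < 2 ^ Γ.b := by omega
  have hρb : 2 < 2 ^ Γ.b := by omega
  -- number of possible scores and of epochs
  have s1 := h.seg (l := setupStart) (rest := [.loop 32 (block rhoBody), block lamStart,
    .loop 31 (block lamBody), block setupEnd, refreshCmd]) (o := o) (K := K) (by decide) hL hzero
  set m1 := runSeg Γ.b setupStart m with hm1
  have hz1 : Zero (64 + 5 * Γ.s) m1 := hzero.runSeg (by decide) hL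
  have fr1 : ∀ x, x ≠ 3 → x ≠ 8 → x ≠ 9 → x < 30 ∨ 32 < x → m1 x = m x := fun x h1 h2 h3 h4 =>
    runSeg_frame (by simp [setupStart, rhoTest, destCell]; omega)
  set m0 := runSeg Γ.b [.const 3 1, .const 30 8, .op .div 30 2 30, .op .shl 8 3 30, .const 9 2] m
    with hm0
  have f0 : ∀ x, x ≠ 3 → x ≠ 8 → x ≠ 9 → x ≠ 30 → m0 x = m x := fun x h1 h2 h3 h4 =>
    runSeg_frame (by simp [destCell]; omega)
  have hm10 : m1 = runSeg Γ.b rhoTest m0 := rfl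
  have vals : m0 3 = 1 ∧ m0 8 = Γ.M ∧ m0 9 = 2 ^ 1 := by
    have hb : Γ.b / 8 < 2 ^ Γ.b := lt_of_le_of_lt (Nat.div_le_self _ _) Nat.lt_two_pow_self
    have hM : 2 ^ (Γ.b / 8) < 2 ^ Γ.b := by rw [← hΓ.M_eq]; omega
    have h8 : 8 < 2 ^ Γ.b := by omega
    refine ⟨?_, ?_, ?_⟩ <;>
    simp [hm0, runSeg, assign, Mem.write, BinOp.eval, h2, Nat.mod_eq_of_lt, b1, hb, hM, h8, hρb,
      hΓ.M_eq]
  obtain ⟨v3, v8, v9⟩ := vals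
  have hρ2 := hΓ.ρ_two
  have h16 : (2 ^ 1) ^ 4 * Γ.s < 2 ^ Γ.b :=
    lt_of_le_of_lt (Nat.mul_le_mul_right _ (Nat.pow_le_pow_left hρ2 4)) hΓ.bρ4
  have v32 : m1 32 = if (2 ^ 1) ^ 4 * Γ.s < Γ.k then 1 else 0 :=
    rhoTest_val (m := m0) (by rw [f0 0 (by omega) (by omega) (by omega) (by omega), h0])
      (by rw [f0 1 (by omega) (by omega) (by omega) (by omega), h1]) v9 hs h16 b1
  have g1 : ∀ x, x < 31 ∨ 32 < x → m1 x = m0 x := fun x hx => by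
    rw [hm10]; exact runSeg_frame (by simp [rhoTest, destCell]; omega)
  have s2 := h.cons (c := .loop 32 (block rhoBody)) (l := [block lamStart,
    .loop 31 (block lamBody), block setupEnd, refreshCmd]) (o := o) (K := K) hz1
  have hρe := rhoExp_mem Γ.k hs
  have hρlt : rhoExp Γ.k Γ.s < Γ.ρ := by rw [hΓ.ρ_eq]; exact Nat.lt_two_pow_self
  have hlamlt : lamExp Γ.s < Γ.lam := by rw [hΓ.lam_eq]; exact Nat.lt_two_pow_self
  have s3 := rho_loop_spec h hΓ (rhoExp Γ.k Γ.s - 1) (q := 1) (m := m1) (o := o)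
    (K := block [block lamStart, .loop 31 (block lamBody), block setupEnd, refreshCmd] :: K)
    (X := (10 * lamExp Γ.s + 110 * Γ.s + 40 : ℕ) * τ + X) le_rfl (by omega) hz1
    (by rw [fr1 0 (by omega) (by omega) (by omega) (by omega), h0])
    (by rw [fr1 1 (by omega) (by omega) (by omega) (by omega), h1])
    (by rw [g1 9 (by omega), v9]) v32 (fun m2 hz2 h29 hf2 => by
      have t1 := h.seg (l := lamStart) (rest := [.loop 31 (block lamBody), block setupEnd,
        refreshCmd]) (o := o) (K := K) (by decide) hL hz2
      set m3 := runSeg Γ.b lamStart m2 with hm3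
      have hz3 : Zero (64 + 5 * Γ.s) m3 := hz2.runSeg (by decide) hL
      have fr3 : ∀ x, x ≠ 10 → x ≠ 31 → m3 x = m2 x := fun x h1 h2 =>
        runSeg_frame (by simp [lamStart, destCell]; omega)
      have e21 : m2 1 = Γ.s := by
        rw [hf2 1 (by omega) (by omega) (by omega),
          fr1 1 (by omega) (by omega) (by omega) (by omega), h1]
      have v10 : m3 10 = 2 ^ 0 := by
        simp [hm3, lamStart, runSeg, assign, Mem.write, BinOp.eval, Nat.mod_eq_of_lt b1]
      have v31 : m3 31 = Γ.s / 2 ^ (2 ^ 0) := by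
        have hlt : Γ.s / 2 < 2 ^ Γ.b := lt_of_le_of_lt (Nat.div_le_self _ _) (by omega)
        simp [hm3, lamStart, runSeg, assign, Mem.write, BinOp.eval, Nat.mod_eq_of_lt b1, e21,
          Nat.mod_eq_of_lt hlt]
      have t2 := h.cons (c := .loop 31 (block lamBody)) (l := [block setupEnd, refreshCmd]) (o := o)
        (K := K) hz3
      have t3 := lam_loop_spec h hΓ (lamExp Γ.s) (l := 0) (m := m3) (o := o)
        (K := block [block setupEnd, refreshCmd] :: K)
        (X := (110 * Γ.s + 21 : ℕ) * τ + X) (by omega) hz3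
        (by rw [fr3 1 (by omega) (by omega), e21]) v10 v31 (fun m4 hz4 h410 hf4 => by
          have u1 := h.seg (l := setupEnd) (rest := [refreshCmd]) (o := o)
            (K := K) (by decide) hL hz4
          set m5 := runSeg Γ.b setupEnd m4 with hm5
          have hz5 : Zero (64 + 5 * Γ.s) m5 := hz4.runSeg (by decide) hL
          have fr5 : ∀ x, x < 11 ∨ (13 < x ∧ x < 20) ∨ (22 < x ∧ x ≠ 30) → m5 x = m4 x :=
            fun x hx => runSeg_frame (by simp [setupEnd, destCell]; omega)
          have g4 : ∀ x, x ≠ 9 → x ≠ 10 → x < 31 ∨ 32 < x → m4 x = m0 x := fun x h1 h2 h3 => by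
            rw [hf4 x (by omega) (by omega), fr3 x (by omega) (by omega),
              hf2 x (by omega) (by omega) (by omega), g1 x (by omega)]
          have e1 : m4 1 = Γ.s := by
            rw [g4 1 (by omega) (by omega) (by omega),
              f0 1 (by omega) (by omega) (by omega) (by omega), h1]
          have e9 : m4 9 = Γ.ρ := by
            rw [hf4 9 (by omega) (by omega), fr3 9 (by omega) (by omega), h29]
          have vals : m5 11 = Γ.lmax ∧ m5 12 = 0 ∧ m5 13 = 1 ∧ m5 20 = 64 + 2 * Γ.s ∧
              m5 21 = 64 + 3 * Γ.s ∧ m5 22 = 64 + 4 * Γ.s := by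
            have c1 : Γ.lmax < 2 ^ Γ.b := by omega
            have c2 : Γ.s + Γ.s < 2 ^ Γ.b := by omega
            have c3 : Γ.s + Γ.s + 64 = 64 + 2 * Γ.s := by omega
            have c4 : 64 + 2 * Γ.s < 2 ^ Γ.b := by omega
            have c5 : 64 + 2 * Γ.s + Γ.s = 64 + 3 * Γ.s := by omega
            have c6 : 64 + 3 * Γ.s < 2 ^ Γ.b := by omega
            have c7 : 64 + 3 * Γ.s + Γ.s = 64 + 4 * Γ.s := by omega
            have c8 : 64 + 4 * Γ.s < 2 ^ Γ.b := by omega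
            have c9 : 64 < 2 ^ Γ.b := by omega
            refine ⟨?_, ?_, ?_, ?_, ?_, ?_⟩ <;>
            simp [hm5, setupEnd, runSeg, assign, Mem.write, BinOp.eval, e1, e9, ← hΓ.hlmax,
              Nat.mod_eq_of_lt, c1, c2, c3, c4, c5, c6, c7, c8, c9, b1]
          obtain ⟨w11, w12, w13, w20, w21, w22⟩ := vals
          have gz : ∀ x, 64 ≤ x → m5 x = 0 := fun x hx => by
            rw [fr5 x (by omega), g4 x (by omega) (by omega) (by omega),
              f0 x (by omega) (by omega) (by omega) (by omega), hz x (by omega)]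
          have hcore : Core Γ emptySlots m5 := {
            zero := hz5
            c0 := by rw [fr5 0 (by omega), g4 0 (by omega) (by omega) (by omega),
              f0 0 (by omega) (by omega) (by omega) (by omega), h0]
            c1 := by rw [fr5 1 (by omega), e1]
            c3 := by rw [fr5 3 (by omega), g4 3 (by omega) (by omega) (by omega), v3]
            c8 := by rw [fr5 8 (by omega), g4 8 (by omega) (by omega) (by omega), v8]
            c9 := by rw [fr5 9 (by omega), e9]
            c10 := by rw [fr5 10 (by omega), h410]
            c11 := w11, c20 := w20, c21 := w21, c22 := w22
            id := fun i hi => gz _ (by omega), w := fun i hi => gz _ (by omega)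
            y := fun i hi => gz _ (by omega), c := fun i hi => gz _ (by omega) }
          have u2 := h.cons (c := refreshCmd) (l := []) (o := o) (K := K) hz5
          have hM1 : 1 ≤ Γ.M := by rw [hΓ.M_eq]; exact Nat.one_le_two_pow
          have u3 := refresh_spec h hΓ.toOk (j := 0) (a := emptySlots) (m := m5) (o := o)
            (K := block [] :: K) (X := (1 : ℕ) * τ + X) (fun i _ => Nat.zero_le _) hcore
            (by rw [w12, Par.ell, if_pos rfl]) (by rw [w13, Par.R, pow_zero])
            (by rw [Par.R, pow_zero]; exact hM1) (fun π m' hm' hperm _ hfr _ _ => by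
              have hcnt : cntLt Γ.s emptySlots (thr Γ.M (Γ.R (0 + 1))) = Γ.s := by
                rw [cntLt, Finset.filter_true_of_mem, Finset.card_range]
                intro i _
                exact Nat.succ_pos _
              refine (h.nil hm'.zero).le.trans (add_le_add le_rfl (hK π m' ⟨hm', {
                hR := by rw [Par.R, pow_zero]; exact hM1
                perm := hperm
                cov := fun q _ _ => Or.inl (by rw [Par.R, pow_zero])
                covv := fun q _ => Or.inl ?_
                bot := Or.inl rfl
                hy := fun i _ => Nat.zero_le _
                hc := fun i _ => le_rfl }, fun hA => ?_⟩ fun x hx hx' => ?_))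
              · have := hΓ.Rv_pos 0
                have h2 := (hΓ.Rv_two 0).2.1
                rw [Par.R, pow_zero] at h2
                omega
              · have := hA.1
                rw [hcnt] at this
                omega
              · rw [hfr x (by omega) (by omega), fr5 x (by omega),
                  g4 x (by omega) (by omega) (by omega),
                  f0 x (by omega) (by omega) (by omega) (by omega)])
          have u4 := ((u1.trans u2).trans u3).trans (show LeT τ 1 _ X from le_rfl)
          exact (u4.mono (m := 110 * Γ.s + 21) (by simp [setupEnd]; omega)).le)
      have t4 := ((t1.trans t2).trans t3).trans (show LeT τ (110 * Γ.s + 21) _ X from le_rfl)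
      exact (t4.mono (m := 10 * lamExp Γ.s + 110 * Γ.s + 40) (by simp [lamStart]; omega)).le)
  have s4 := ((s1.trans s2).trans s3).trans
    (show LeT τ (10 * lamExp Γ.s + 110 * Γ.s + 40) _ X from le_rfl)
  exact s4.mono (by simp [setupStart, rhoTest]; omega)

end Setup


/-! ## The protocol -/

def siteTrial : List Cmd := [.op .mul 9 6 5, .op .sub 10 1 6, .op .mul 10 10 5]
def siteTest : List Cmd := [.op .lt 13 11 9, .op .lt 14 12 10, .op .add 13 13 14]
def siteItem : Cmd := block [block siteTrial, .rand 11 8, .rand 12 7, block siteTest,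
  .branch 13 (.send 0 [4, 5, 11, 12]) .skip]

/-- The algorithm. -/
def protocol : Protocol where
  onItem := siteItem
  onReply := .skip
  onMsg := block (.branch 3 .skip setupCmd :: msgMain)
  sampleAddr := 64

/-- Condition under which a site forwards an item of weight `w`. -/
def Sends (Γ : Par) (j w UA UB : ℕ) : Prop :=
  UA < Γ.ell j * w ∨ UB < (Γ.s - Γ.ell j) * w

/-- Memory of a site that has been informed of epoch `j`. -/
structure SiteOk (Γ : Par) (j : ℕ) (m : Mem) : Prop where
  zero : Zero 64 m
  c1 : m 1 = Γ.s
  c6 : m 6 = Γ.ell j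
  c7 : max (m 7) 1 = Γ.R j
  c8 : max (m 8) 1 = Γ.Rv j

theorem SiteOk.congr {Γ : Par} {j : ℕ} {m m' : Mem} (h : SiteOk Γ j m) (hz : Zero 64 m')
    (h1 : m' 1 = m 1) (h6 : m' 6 = m 6) (h7 : m' 7 = m 7) (h8 : m' 8 = m 8) : SiteOk Γ j m' :=
  ⟨hz, by rw [h1, h.c1], by rw [h6, h.c6], by rw [h7, h.c7], by rw [h8, h.c8]⟩

-- A site draws both first skips before it decides, in constant time whatever the weight. The cells
-- of the rates are zero before the first broadcast, and a draw below zero behaves like a draw below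
-- one; hence the `max` in `SiteOk`.
open Classical in
theorem site_spec {Γ : Par} {τ μ : ℝ≥0∞} {ψ : Mem → List (ℕ × List ℕ) → List Cmd → ℝ≥0∞}
    (h : Loc Γ.b τ μ 64 ψ) (hΓ : Γ.Ok) {j e w : ℕ} {m : Mem} (hm : SiteOk Γ j m) (h4 : m 4 = e)
    (h5 : m 5 = w) (hw : Γ.s * w < 2 ^ Γ.b) (hRM : Γ.R j ≤ Γ.M) {X : ℕ → ℕ → ℝ≥0∞}
    (hK1 : ∀ UA < Γ.Rv j, ∀ UB < Γ.R j, Sends Γ j w UA UB → ∀ d m', SiteOk Γ j m' →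
      μ + ψ m' [(d, [e, w, UA, UB])] [] ≤ X UA UB)
    (hK0 : ∀ UA < Γ.Rv j, ∀ UB < Γ.R j, ¬ Sends Γ j w UA UB → ∀ m', SiteOk Γ j m' →
      ψ m' [] [] ≤ X UA UB) :
    ψ m [] [siteItem] ≤ 40 * τ + avg (Γ.Rv j) fun UA => avg (Γ.R j) fun UB => X UA UB := by
  have bs := hΓ.bs
  have hell := hΓ.ell_lt j
  have hMb : Γ.M < 2 ^ Γ.b := by have := hΓ.bMρ; omega
  have hvR := (hΓ.Rv_two j).2.1
  have s1 := h.seg (l := siteTrial) (rest := [.rand 11 8, .rand 12 7, block siteTest,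
    .branch 13 (.send 0 [4, 5, 11, 12]) .skip]) (o := []) (K := []) (by decide) le_rfl hm.zero
  set m1 := runSeg Γ.b siteTrial m with hm1
  have hz1 : Zero 64 m1 := hm.zero.runSeg (by decide) le_rfl
  have fr1 : ∀ x, x ≠ 9 → x ≠ 10 → m1 x = m x := fun x h1 h2 =>
    runSeg_frame (by simp [siteTrial, destCell]; omega)
  have vals : m1 9 = Γ.ell j * w ∧ m1 10 = (Γ.s - Γ.ell j) * w := by
    have b1 : Γ.ell j * w < 2 ^ Γ.b := lt_of_le_of_lt (Nat.mul_le_mul_right _ hell.le) hw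
    have b2 : (Γ.s - Γ.ell j) * w < 2 ^ Γ.b :=
      lt_of_le_of_lt (Nat.mul_le_mul_right _ (Nat.sub_le _ _)) hw
    have b3 : Γ.s - Γ.ell j < 2 ^ Γ.b := by omega
    constructor <;>
    simp [hm1, siteTrial, runSeg, assign, Mem.write, BinOp.eval, h5, hm.c6, hm.c1,
      Nat.mod_eq_of_lt, b1, b2, b3]
  obtain ⟨v9, v10⟩ := vals
  have s2 := h.brand (a := 11) (x := 8) (rest := [.rand 12 7, block siteTest,
    .branch 13 (.send 0 [4, 5, 11, 12]) .skip]) (o := []) (K := []) hz1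
  rw [fr1 8 (by omega) (by omega), hm.c8] at s2
  have s3 : ∀ UA < Γ.Rv j, LeT τ 22 (ψ (m1.write Γ.b 11 UA) [] [block [.rand 12 7, block siteTest,
      .branch 13 (.send 0 [4, 5, 11, 12]) .skip]]) (avg (Γ.R j) fun UB => X UA UB) := by
    intro UA hUA
    set m2 := m1.write Γ.b 11 UA with hm2
    have hz2 : Zero 64 m2 := hz1.write (by omega)
    have fr2 : ∀ x, x ≠ 11 → m2 x = m1 x := fun x hx => by
      rw [hm2, Mem.write, Function.update_of_ne hx]
    have t1 := h.brand (a := 12) (x := 7) (rest := [block siteTest,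
      .branch 13 (.send 0 [4, 5, 11, 12]) .skip]) (o := []) (K := []) hz2
    rw [fr2 7 (by omega), fr1 7 (by omega) (by omega), hm.c7] at t1
    refine (t1.trans (LeT.avg (n := 20) fun UB hUB => ?_))
    set m3 := m2.write Γ.b 12 UB with hm3
    have hz3 : Zero 64 m3 := hz2.write (by omega)
    have fr3 : ∀ x, x ≠ 12 → m3 x = m2 x := fun x hx => by
      rw [hm3, Mem.write, Function.update_of_ne hx]
    have w11 : m3 11 = UA := by
      rw [fr3 11 (by omega), hm2, Mem.write, Function.update_self, Nat.mod_eq_of_lt (by omega)]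
    have w12 : m3 12 = UB := by
      rw [hm3, Mem.write, Function.update_self, Nat.mod_eq_of_lt (by omega)]
    have w9 : m3 9 = Γ.ell j * w := by rw [fr3 9 (by omega), fr2 9 (by omega), v9]
    have w10 : m3 10 = (Γ.s - Γ.ell j) * w := by rw [fr3 10 (by omega), fr2 10 (by omega), v10]
    have t2 := h.seg (l := siteTest) (rest := [.branch 13 (.send 0 [4, 5, 11, 12]) .skip]) (o := [])
      (K := []) (by decide) le_rfl hz3
    set m4 := runSeg Γ.b siteTest m3 with hm4
    have hz4 : Zero 64 m4 := hz3.runSeg (by decide) le_rfl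
    have fr4 : ∀ x, x ≠ 13 → x ≠ 14 → m4 x = m3 x := fun x h1 h2 =>
      runSeg_frame (by simp [siteTest, destCell]; omega)
    have g : ∀ x, x ≤ 8 → m4 x = m x := fun x hx => by
      rw [fr4 x (by omega) (by omega), fr3 x (by omega), fr2 x (by omega),
        fr1 x (by omega) (by omega)]
    have hok : SiteOk Γ j m4 := hm.congr hz4 (g 1 (by omega)) (g 6 (by omega)) (g 7 (by omega))
      (g 8 (by omega))
    have w13 : m4 13 = (if UA < Γ.ell j * w then 1 else 0) +
        (if UB < (Γ.s - Γ.ell j) * w then 1 else 0) := by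
      have q1 : (if UA < Γ.ell j * w then 1 else 0) ≤ 1 := by split_ifs <;> omega
      have q2 : (if UB < (Γ.s - Γ.ell j) * w then 1 else 0) ≤ 1 := by split_ifs <;> omega
      simp only [hm4, siteTest, runSeg, assign, Mem.write, BinOp.eval, Function.update_apply,
        reduceIte, w11, w12, w9, w10, Nat.reduceEqDiff]
      rw [Nat.mod_eq_of_lt (a := if UA < _ then 1 else 0) (by omega),
        Nat.mod_eq_of_lt (a := if UB < _ then 1 else 0) (by omega), Nat.mod_eq_of_lt (by omega)]
    have t3 := h.cons (c := .branch 13 (.send 0 [4, 5, 11, 12]) .skip) (l := []) (o := []) (K := [])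
      hz4
    by_cases hs : Sends Γ j w UA UB
    · have t4 := h.branch_pos (x := 13) (p := .send 0 [4, 5, 11, 12]) (q := .skip) (o := [])
        (K := [block []]) hz4 (by
          rw [w13]
          rcases hs with hs | hs
          · rw [if_pos hs]; omega
          · rw [if_pos hs]; omega)
      have t5 := h.send (d := 0) (l := [4, 5, 11, 12]) (o := []) (K := [block []]) hz4
      simp only [List.map_cons, List.map_nil, g 4 (by omega), g 5 (by omega), h4, h5,
        fr4 11 (by omega) (by omega), fr4 12 (by omega) (by omega), w11, w12, List.nil_append] at t5
      have t6 := h.nil (o := [(m4 0, [e, w, UA, UB])]) (K := []) hz4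
      have t7 := hK1 UA hUA UB hUB hs (m4 0) m4 hok
      have t8 := ((((t2.trans t3).trans t4).trans t5).le)
      change _ ≤ _
      refine t8.trans ?_
      calc _ ≤ ((2 * siteTest.length + 2 + 1 + 1 + 1 : ℕ) : ℝ≥0∞) * τ + (μ + ((1 : ℕ) * τ +
            ψ m4 [(m4 0, [e, w, UA, UB])] [])) := by gcongr; exact t6.le
        _ = 12 * τ + (μ + ψ m4 [(m4 0, [e, w, UA, UB])] []) := by
            simp only [siteTest, List.length_cons, List.length_nil]; push_cast; ring
        _ ≤ _ := by gcongr; norm_num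
    · have hs' := hs
      rw [Sends, not_or] at hs'
      have t4 := h.branch_neg (x := 13) (p := .send 0 [4, 5, 11, 12]) (q := .skip) (o := [])
        (K := [block []]) hz4 (by rw [w13, if_neg hs'.1, if_neg hs'.2])
      have t5 := h.skip (o := []) (K := [block []]) hz4
      have t6 := h.nil (o := []) (K := []) hz4
      exact (((((t2.trans t3).trans t4).trans t5).trans t6).trans_le
        (hK0 UA hUA UB hUB hs m4 hok)).mono (by simp [siteTest])
  exact ((s1.trans s2).trans (LeT.avg s3)).mono (m := 40) (by simp [siteTrial]) |>.le.trans
    (by norm_num)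


/-! ## The whole system -/

/-- Global state with memory `cm` of the coordinator and `sm i` of site `i`. -/
def glob {k : ℕ} (cm : Mem) (sm : Fin k → Mem) (t : Option (Fin k) → ℕ) (act : Option (Fin k))
    (K : List Cmd) (ph : Phase) (up : List (List ℕ)) (dn : List (Fin k × List ℕ))
    (σ : List (Arrival k)) (n : ℕ) : State k :=
  ⟨fun p => p.elim cm sm, t, act, K, ph, up, dn, σ, n⟩

/-- Worst value over all clocks and message counters. -/
def worst {k : ℕ} (b : ℕ) (α β : ℝ≥0∞) (F : State k → ℝ≥0∞) (cm : Mem) (sm : Fin k → Mem)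
    (act : Option (Fin k)) (K : List Cmd) (ph : Phase) (up : List (List ℕ))
    (dn : List (Fin k × List ℕ)) (σ : List (Arrival k)) : ℝ≥0∞ :=
  ⨆ (t : Option (Fin k) → ℕ) (n : ℕ), totalVal protocol b α β F (glob cm sm t act K ph up dn σ n)

/-- The messages that reach a site. -/
def routed (k : ℕ) (o : List (ℕ × List ℕ)) : List (Fin k × List ℕ) :=
  o.filterMap fun x => if h : x.1 < k then some (⟨x.1, h⟩, x.2) else none

/-- A reward that does not decrease in expectation in states that respect the memory bounds. -/
def Sub {k : ℕ} (s b : ℕ) (F : State k → ℝ≥0∞) : Prop :=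
  ∀ g : State k, Zero (64 + 5 * s) (g.mem none) → (∀ i, Zero 64 (g.mem (some i))) →
    F g ≤ expect (g.step protocol b) F

theorem elim_update_none {k : ℕ} (cm m : Mem) (sm : Fin k → Mem) :
    Function.update (fun p : Option (Fin k) => p.elim cm sm) none m = fun p => p.elim m sm := by
  funext p
  cases p <;> simp [Function.update_apply]

theorem elim_update_some {k : ℕ} (cm m : Mem) (sm : Fin k → Mem) (i : Fin k) :
    Function.update (fun p : Option (Fin k) => p.elim cm sm) (some i) m =
      fun p => p.elim cm (Function.update sm i m) := by
  funext p
  cases p <;> simp [Function.update_apply]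

/-! ### From the logic of one processor to the whole network -/

section System

variable {k s b : ℕ} {α β : ℝ≥0∞} {F : State k → ℝ≥0∞} {cm : Mem} {sm : Fin k → Mem}
  {act : Option (Fin k)} {ph : Phase} {up : List (List ℕ)} {dn : List (Fin k × List ℕ)}
  {σ : List (Arrival k)}

theorem totalVal_le_worst (K : List Cmd) (t : Option (Fin k) → ℕ) (n : ℕ) :
    totalVal protocol b α β F (glob cm sm t act K ph up dn σ n) ≤
      worst b α β F cm sm act K ph up dn σ :=
  le_iSup₂ (f := fun t n => totalVal protocol b α β F (glob cm sm t act K ph up dn σ n)) t n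

theorem worst_le (hF : Sub s b F) (hc : Zero (64 + 5 * s) cm) (hs : ∀ i, Zero 64 (sm i))
    {K : List Cmd} {X : ℝ≥0∞}
    (h : ∀ t n, stepCost α β (glob cm sm t act K ph up dn σ n) +
      expect ((glob cm sm t act K ph up dn σ n).step protocol b) (totalVal protocol b α β F) ≤ X) :
    worst b α β F cm sm act K ph up dn σ ≤ X :=
  iSup₂_le fun t n => (totalVal_le _ _ _ _ _ _ (hF _ hc hs)).trans (h t n)

/-- The supremum over clocks and counters makes the value a function of memory, sent messages and
code alone, as `Loc` demands. Instructions and messages both cost `α` here. -/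
theorem loc_coordinator (hF : Sub s b F) (hs : ∀ i, Zero 64 (sm i)) :
    Loc b α α (64 + 5 * s) fun m o K =>
      worst b α β F m sm none K ph up (dn ++ routed k o) σ where
  step m o c K hz := by
    refine worst_le hF hz hs fun t n => ?_
    simp only [State.step, glob, expect_map]
    refine add_le_add le_rfl (expect_mono _ fun r => ?_)
    rw [elim_update_none]
    rcases hr : r.out with _ | ⟨d, l⟩
    · simp only [State.transmit, Option.toList_none, List.append_nil]
      exact totalVal_le_worst _ _ _
    · simp only [State.transmit, Option.toList_some]
      have : dn ++ routed k (o ++ [(d, l)]) =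
          if h : d < k then dn ++ routed k o ++ [(⟨d, h⟩, l)] else dn ++ routed k o := by
        split_ifs with h <;> simp [routed, h]
      rw [this]
      exact totalVal_le_worst _ _ _

/-- As for the coordinator, but an instruction costs `β` and a message `α`; the destination cell is
ignored. -/
theorem loc_site (hF : Sub s b F) (hc : Zero (64 + 5 * s) cm) (hs : ∀ i, Zero 64 (sm i))
    (i : Fin k) :
    Loc b β α 64 fun m o K =>
      worst b α β F cm (Function.update sm i m) (some i) K ph (up ++ o.map Prod.snd) dn σ where
  step m o c K hz := by
    refine worst_le hF hc (fun j => ?_) fun t n => ?_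
    · by_cases hj : j = i
      · subst hj; simpa using hz
      · rw [Function.update_of_ne hj]; exact hs j
    simp only [State.step, glob, expect_map]
    have e : (some i : Option (Fin k)).elim cm (Function.update sm i m) = m := by simp
    rw [e]
    refine add_le_add le_rfl (expect_mono _ fun r => ?_)
    rw [elim_update_some, Function.update_idem]
    rcases hr : r.out with _ | ⟨d, l⟩
    · simp only [State.transmit, Option.toList_none, List.append_nil]
      exact totalVal_le_worst _ _ _
    · simp only [State.transmit, Option.toList_some, List.map_append, List.map_cons, List.map_nil,
        ← List.append_assoc]
      exact totalVal_le_worst _ _ _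

theorem stepCost_idle (g : State k) (h : g.code = []) : stepCost α β g ≤ β := by
  unfold stepCost
  rw [h]
  simp only
  split_ifs
  · exact zero_le
  · exact le_rfl

variable (hF : Sub s b F) (hc : Zero (64 + 5 * s) cm) (hs : ∀ i, Zero 64 (sm i))
include hF hc hs

theorem worst_message (l : List ℕ) :
    worst b α β F cm sm act [] .coordinator (l :: up) dn σ ≤
      β + worst b α β F (cm.receive l) sm none [protocol.onMsg] .coordinator up dn σ := by
  refine worst_le hF hc hs fun t n => add_le_add (stepCost_idle _ rfl) ?_
  simp only [State.step, glob, expect_pure, State.dispatch, State.start, elim_update_none]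
  exact totalVal_le_worst _ _ _

theorem worst_sites :
    worst b α β F cm sm act [] .coordinator [] dn σ ≤
      β + worst b α β F cm sm act [] .sites [] dn σ := by
  refine worst_le hF hc hs fun t n => add_le_add (stepCost_idle _ rfl) ?_
  simp only [State.step, glob, expect_pure, State.dispatch]
  exact totalVal_le_worst _ _ _

theorem worst_reply (i : Fin k) (l : List ℕ) :
    worst b α β F cm sm act [] .sites up ((i, l) :: dn) σ ≤
      β + worst b α β F cm (Function.update sm i ((sm i).receive l)) (some i) [protocol.onReply]
        .sites up dn σ := by
  refine worst_le hF hc hs fun t n => add_le_add (stepCost_idle _ rfl) ?_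
  simp only [State.step, glob, expect_pure, State.dispatch, State.start, elim_update_some]
  exact totalVal_le_worst _ _ _

theorem worst_item (x : Arrival k) :
    worst b α β F cm sm act [] .sites up [] (x :: σ) ≤
      β + worst b α β F cm (Function.update sm x.site ((sm x.site).receive [x.ident, x.weight]))
        (some x.site) [protocol.onItem] .coordinator up [] σ := by
  refine worst_le hF hc hs fun t n => add_le_add (stepCost_idle _ rfl) ?_
  simp only [State.step, glob, expect_pure, State.dispatch, State.start, elim_update_some]
  exact totalVal_le_worst _ _ _

omit hF hc hs in
theorem worst_done {X : ℝ≥0∞} (h : ∀ t n, F (glob cm sm t act [] .sites up [] [] n) ≤ X) :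
    worst b α β F cm sm act [] .sites up [] [] ≤ X := by
  refine iSup₂_le fun t n => iSup_le fun N => ?_
  rw [val_of_done ⟨rfl, rfl, rfl, rfl⟩]
  exact h t n

end System

theorem receive_of_lt (m : Mem) (l : List ℕ) {x : ℕ} (hx : x < 4) : m.receive l x = m x := by
  unfold Mem.receive; rw [if_neg (by omega)]

theorem receive_of_ge (m : Mem) (l : List ℕ) {x : ℕ} (hx : 4 + l.length ≤ x) :
    m.receive l x = m x := by
  unfold Mem.receive
  split_ifs
  · rw [List.getD_eq_default _ _ (by omega)]
  · rfl

theorem Zero.receive {L : ℕ} {m : Mem} (h : Zero L m) {l : List ℕ} (hl : 4 + l.length ≤ L) :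
    Zero L (m.receive l) := fun x hx => by rw [receive_of_ge _ _ (by omega), h x hx]

section Broadcast

variable {Γ : Par} {α β : ℝ≥0∞} {F : State Γ.k → ℝ≥0∞} {cm : Mem} {σ : List (Arrival Γ.k)}

/-- The sites handle a broadcast. -/
theorem broadcast_spec (hΓ : Γ.Ok) (hF : Sub Γ.s Γ.b F) (hc : Zero (64 + 5 * Γ.s) cm) {j : ℕ}
    {X c : ℝ≥0∞} (hX : ∀ sm act, (∀ i, SiteOk Γ j (sm i)) →
      worst Γ.b α β F cm sm act [] .sites [] [] σ + c ≤ X)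
    (n : ℕ) : ∀ {sm : Fin Γ.k → Mem} {act : Option (Fin Γ.k)}, n ≤ Γ.k →
      (∀ i, Zero 64 (sm i) ∧ sm i 1 = Γ.s) → (∀ i, n ≤ i.1 → SiteOk Γ j (sm i)) →
      worst Γ.b α β F cm sm act [] .sites [] (routed Γ.k (bcList Γ j n)) σ + c ≤
        2 * n * β + X := by
  induction n with
  | zero =>
    intro sm act _ _ h
    simpa [bcList, routed] using hX sm act fun i => h i (Nat.zero_le _)
  | succ n ih =>
    intro sm act hn hz h
    have hrt : routed Γ.k (bcList Γ j (n + 1)) =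
        (⟨n, by omega⟩, [Γ.k, Γ.k, Γ.ell j, Γ.R j, Γ.Rv j]) :: routed Γ.k (bcList Γ j n) := by
      rw [bcList_succ]
      simp [routed, show n < Γ.k by omega]
    rw [hrt]
    set i : Fin Γ.k := ⟨n, by omega⟩ with hi
    set m := (sm i).receive [Γ.k, Γ.k, Γ.ell j, Γ.R j, Γ.Rv j] with hm
    have hmz : Zero 64 m := (hz i).1.receive (by simp)
    have hok : SiteOk Γ j m := ⟨hmz, by rw [hm, receive_of_lt _ _ (by omega), (hz i).2],
      by simp [hm, Mem.receive],
      by simpa [hm, Mem.receive] using Nat.succ_le_of_lt (hΓ.R_pos j),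
      by simpa [hm, Mem.receive] using Nat.succ_le_of_lt (hΓ.Rv_pos j)⟩
    have hz' : ∀ i', Zero 64 (Function.update sm i m i') ∧ Function.update sm i m i' 1 = Γ.s := by
      intro i'
      by_cases hj : i' = i
      · subst hj; simpa using ⟨hok.zero, hok.c1⟩
      · rw [Function.update_of_ne hj]; exact hz i'
    have h1 := worst_reply (α := α) (β := β) (act := act) (up := [])
      (dn := routed Γ.k (bcList Γ j n)) (σ := σ) hF hc
      (fun i => (hz i).1) i [Γ.k, Γ.k, Γ.ell j, Γ.R j, Γ.Rv j]
    have h2 := ((loc_site (α := α) (β := β) (ph := .sites) (up := [])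
      (dn := routed Γ.k (bcList Γ j n)) (σ := σ) hF hc
      (fun i => (hz i).1) i).skip (m := m) (o := []) (K := []) hmz).le
    simp only [List.map_nil, List.append_nil] at h2
    have h3 := ih (sm := Function.update sm i m) (act := some i) (by omega) hz' (fun i' hi' => by
      by_cases hj : i' = i
      · subst hj; simpa using hok
      · rw [Function.update_of_ne hj]
        refine h i' ?_
        have : i'.1 ≠ n := fun h => hj (Fin.ext h)
        omega)
    calc _ ≤ β + ((1 : ℕ) * β + worst Γ.b α β F cm (Function.update sm i m) (some i) [] .sites []
            (routed Γ.k (bcList Γ j n)) σ) + c :=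
          add_le_add (h1.trans (add_le_add le_rfl h2)) le_rfl
      _ = 2 * β + (worst Γ.b α β F cm (Function.update sm i m) (some i) [] .sites []
            (routed Γ.k (bcList Γ j n)) σ + c) := by push_cast; ring
      _ ≤ 2 * β + (2 * n * β + X) := add_le_add le_rfl h3
      _ = _ := by push_cast; ring

end Broadcast


/-! ## Rounds -/

/-- Reward of the ideal process for a stream of items. -/
def streamVal (Γ : Par) {k : ℕ} (c : ℝ≥0∞) : List (Arrival k) → ((ℕ → Slot) → ℝ≥0∞) →
    (ℕ → Slot) → ℝ≥0∞
  | [], f => f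
  | x :: σ, f => Hop Γ x.ident x.weight c x.weight (streamVal Γ c σ f)

/-- Number of epochs that the slots are fit for. -/
def epochs (Γ : Par) (a : ℕ → Slot) : ℝ≥0∞ :=
  open Classical in ∑' j, if Adv Γ (j + 1) a then 1 else 0

/-- Price of an epoch. -/
def Par.epochCost (Γ : Par) (α β : ℝ≥0∞) : ℝ≥0∞ :=
  Γ.gain α + (130 * Γ.s : ℕ) * α + (Γ.bcCost α α + 2 * Γ.k * β)

theorem thr_mono {M X Y : ℕ} (hX : 0 < X) (hXY : X ≤ Y) : thr M X ≤ thr M Y := by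
  have := Nat.div_le_div_left (c := X) (a := M) hXY hX
  unfold thr
  omega

theorem cntLt_mono {s T T' : ℕ} (h : T ≤ T') (a : ℕ → Slot) : cntLt s a T ≤ cntLt s a T' := by
  unfold cntLt
  refine Finset.card_le_card fun i hi => ?_
  rw [Finset.mem_filter] at hi ⊢
  exact ⟨hi.1, hi.2.trans_le h⟩

theorem Par.Ok.R_mono {Γ : Par} (hΓ : Γ.Ok) {i j : ℕ} (h : i ≤ j) : Γ.R i ≤ Γ.R j :=
  Nat.pow_le_pow_right (by have := hΓ.ρ_two; omega) h

theorem Par.Ok.Rv_mono {Γ : Par} (hΓ : Γ.Ok) {i j : ℕ} (h : i ≤ j) : Γ.Rv i ≤ Γ.Rv j := by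
  have h1 := hΓ.R_mono h
  have h2 := Nat.div_le_div_right (c := Γ.lam) h1
  obtain ⟨l, hl⟩ := hΓ.hlam
  have h0 : 0 < Γ.lam := by rw [hl]; positivity
  unfold Par.Rv
  by_cases hi : Γ.R i < Γ.lam
  · rw [if_pos hi, Nat.div_eq_of_lt hi]
    split_ifs with hj
    · exact Nat.le_add_right _ _
    · have := Nat.div_pos (not_lt.1 hj) h0
      omega
  · rw [if_neg hi, if_neg (by omega)]
    omega

/-- A lower rate needs higher scores, so fitness for an epoch implies fitness for all earlier ones.
-/
theorem Adv.anti {Γ : Par} (hΓ : Γ.Ok) {i j : ℕ} {a : ℕ → Slot} (ha : Adv Γ j a) (h : i ≤ j) :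
    Adv Γ i a :=
  ⟨(cntLt_mono (thr_mono (hΓ.R_pos i) (hΓ.R_mono h)) a).trans ha.1,
    Nat.le_zero.1 ((cntLt_mono (thr_mono (hΓ.Rv_pos i) (hΓ.Rv_mono h)) a).trans ha.2.le)⟩

/-- Converts the potential `κ * j` at the end of the run into a reward that depends only on the
slots. -/
theorem le_epochs {Γ : Par} (hΓ : Γ.Ok) {j : ℕ} {a : ℕ → Slot} (h : j = 0 ∨ Adv Γ j a) :
    (j : ℝ≥0∞) ≤ epochs Γ a := by
  rcases h with rfl | h
  · simp
  · unfold epochs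
    refine le_trans ?_ (ENNReal.sum_le_tsum (Finset.range j))
    rw [Finset.sum_congr rfl (g := fun _ => (1 : ℝ≥0∞))]
    · simp
    · intro i hi
      rw [if_pos (h.anti hΓ (Finset.mem_range.1 hi))]

/-! ### One round of the system -/

section Item

variable {Γ : Par} {α β : ℝ≥0∞} {F : State Γ.k → ℝ≥0∞} {cm : Mem} {σ : List (Arrival Γ.k)}

open Classical in
/-- The first half of a round. -/
theorem item_spec (hΓ : Γ.Ok) (hF : Sub Γ.s Γ.b F) (hc : Zero (64 + 5 * Γ.s) cm) {j : ℕ}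
    (hRM : Γ.R j ≤ Γ.M) {x : Arrival Γ.k} (hw : Γ.s * x.weight < 2 ^ Γ.b) {X : ℕ → ℕ → ℝ≥0∞}
    {c : ℝ≥0∞}
    (h1 : ∀ UA < Γ.Rv j, ∀ UB < Γ.R j, Sends Γ j x.weight UA UB → ∀ sm, (∀ i, SiteOk Γ j (sm i)) →
      α + worst Γ.b α β F (cm.receive [x.ident, x.weight, UA, UB]) sm none [protocol.onMsg]
        .coordinator [] [] σ + c ≤ X UA UB)
    (h0 : ∀ UA < Γ.Rv j, ∀ UB < Γ.R j, ¬ Sends Γ j x.weight UA UB → ∀ sm act,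
      (∀ i, SiteOk Γ j (sm i)) → worst Γ.b α β F cm sm act [] .sites [] [] σ + c ≤ X UA UB)
    {sm : Fin Γ.k → Mem} {act : Option (Fin Γ.k)} (hs : ∀ i, SiteOk Γ j (sm i)) :
    worst Γ.b α β F cm sm act [] .sites [] [] (x :: σ) + c ≤
      42 * β + avg (Γ.Rv j) fun UA => avg (Γ.R j) fun UB => X UA UB := by
  have hsz : ∀ i, Zero 64 (sm i) := fun i => (hs i).zero
  have s1 := worst_item (α := α) (β := β) (act := act) (up := []) (σ := σ) hF hc hsz x
  set m := (sm x.site).receive [x.ident, x.weight] with hm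
  have hok : SiteOk Γ j m := (hs x.site).congr ((hsz _).receive (by simp))
    (receive_of_lt _ _ (by omega)) (receive_of_ge _ _ (by simp)) (receive_of_ge _ _ (by simp))
    (receive_of_ge _ _ (by simp))
  have hupd : ∀ m', SiteOk Γ j m' → ∀ i, SiteOk Γ j (Function.update sm x.site m' i) := by
    intro m' hm' i
    by_cases hi : i = x.site
    · subst hi; simpa using hm'
    · rw [Function.update_of_ne hi]; exact hs i
  have hloc := (loc_site (α := α) (β := β) (ph := .coordinator) (up := []) (dn := []) (σ := σ)
    hF hc hsz x.site).add_const c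
  have s2 := site_spec hloc hΓ hok (e := x.ident) (w := x.weight) (by simp [hm, Mem.receive])
    (by simp [hm, Mem.receive]) hw hRM (X := fun UA UB => X UA UB + β)
    (fun UA hUA UB hUB hsend d m' hm' => by
      have t1 := worst_message (α := α) (β := β) (act := some x.site) (up := []) (dn := []) (σ := σ)
        hF hc (fun i => (hupd m' hm' i).zero) [x.ident, x.weight, UA, UB]
      have t2 := h1 UA hUA UB hUB hsend _ (hupd m' hm')
      simp only [List.map_cons, List.map_nil, List.nil_append]
      calc _ ≤ α + (β + worst Γ.b α β F (cm.receive [x.ident, x.weight, UA, UB])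
            (Function.update sm x.site m') none [protocol.onMsg] .coordinator [] [] σ + c) := by
            gcongr
        _ = α + worst Γ.b α β F (cm.receive [x.ident, x.weight, UA, UB])
            (Function.update sm x.site m') none [protocol.onMsg] .coordinator [] [] σ + c + β := by
            ring
        _ ≤ _ := by gcongr)
    (fun UA hUA UB hUB hsend m' hm' => by
      have t1 := worst_sites (α := α) (β := β) (act := some x.site) (dn := []) (σ := σ)
        hF hc (fun i => (hupd m' hm' i).zero)
      have t2 := h0 UA hUA UB hUB hsend _ (some x.site) (hupd m' hm')
      simp only [List.map_nil, List.append_nil]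
      calc _ ≤ β + worst Γ.b α β F cm
            (Function.update sm x.site m') (some x.site) [] .sites [] [] σ + c := by
            gcongr
        _ = worst Γ.b α β F cm
            (Function.update sm x.site m') (some x.site) [] .sites [] [] σ + c + β := by
            ring
        _ ≤ _ := by gcongr)
  simp only [List.map_nil, List.append_nil] at s2
  simp only [avg_add, avg_const (hΓ.R_pos j), avg_const (hΓ.Rv_pos j)] at s2
  calc _ ≤ β + (worst Γ.b α β F cm (Function.update sm x.site m) (some x.site) [siteItem]
          .coordinator [] [] σ + c) := by rw [← add_assoc]; exact add_le_add s1 le_rfl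
    _ ≤ β + (40 * β + ((avg (Γ.Rv j) fun UA => avg (Γ.R j) fun UB => X UA UB) + β)) :=
      add_le_add le_rfl s2
    _ = _ := by ring

/-- Bound for the cost of a message, if the skips are `UA` and `UB`. -/
def msgGoal (Γ : Par) (α : ℝ≥0∞) (j e w : ℕ) (π : ℕ → ℕ) (f : (ℕ → Slot) → ℝ≥0∞) (a : ℕ → Slot)
    (UA UB : ℕ) : ℝ≥0∞ :=
  skipExp (250 * α) (Γ.Rv j) (Γ.ell j * min w (Γ.R j)) UA +
    skipExp (250 * α) (Γ.R j) ((Γ.s - Γ.ell j) * min w (Γ.R j)) UB +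
    skipVal Γ.M e w (Γ.Rv j) (Γ.ell j) 0 π (Γ.ell j * min w (Γ.R j)) UA
      (skipVal Γ.M e w (Γ.R j) (Γ.s - Γ.ell j) (Γ.ell j) π
        ((Γ.s - Γ.ell j) * min w (Γ.R j)) UB
        (pieceGoal Γ α e w (w - Γ.R j) (min w (Γ.R j)) f)) a

/-- The draws of the site have the same law as fresh ones, so the whole item has the effect of `w`
units of the ideal process. -/
theorem avg_msgGoal_le (hΓ : Γ.Ok) (hα : α ≠ ∞) {j e w Q : ℕ} {π : ℕ → ℕ} {a : ℕ → Slot}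
    (hI : Inv Γ j a π Q) (f : (ℕ → Slot) → ℝ≥0∞) :
    avg (Γ.Rv j) (fun UA => avg (Γ.R j) fun UB => msgGoal Γ α j e w π f a UA UB) ≤
      500 * Γ.price α j (min w (Γ.R j)) + Hop Γ e w (Γ.gain α) w f a := by
  have h1 := avg_avg_skipVal_le hΓ (e := e) (w := w) (w' := min w (Γ.R j)) hI α (w - Γ.R j) f
  rw [avg_comm, show min w (Γ.R j) + (w - Γ.R j) = w by omega] at h1
  have h2 := (avg_skipExp_le hΓ hα j (min w (Γ.R j))).1
  unfold msgGoal
  simp only [avg_add, avg_const (hΓ.R_pos j), avg_const (hΓ.Rv_pos j)]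
  exact add_le_add h2 h1

-- Union bound over the two groups: a uniform draw below `R` lies below the number of trials `N`
-- with probability at most `N / R`.
open Classical in
theorem avg_sends_le (hΓ : Γ.Ok) (hα : α ≠ ∞) (c : ℕ) (j w : ℕ) :
    avg (Γ.Rv j) (fun UA => avg (Γ.R j) fun UB => if Sends Γ j w UA UB then c * α else 0) ≤
      c * Γ.price α j w := by
  have h2 := (avg_skipExp_le hΓ hα j w).2
  have h3 : ∀ UA UB, (if Sends Γ j w UA UB then c * α else 0) ≤
      (if UA < Γ.ell j * w then c * α else 0) + if UB < (Γ.s - Γ.ell j) * w then c * α else 0 := by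
    intro UA UB
    by_cases hA : UA < Γ.ell j * w
    · rw [if_pos hA]
      refine le_add_right ?_
      split_ifs <;> simp
    · by_cases hB : UB < (Γ.s - Γ.ell j) * w
      · rw [if_pos hB]
        refine le_add_left ?_
        split_ifs <;> simp
      · rw [if_neg (by unfold Sends; tauto)]
        exact zero_le
  refine (avg_mono fun UA _ => avg_mono fun UB _ => h3 UA UB).trans ?_
  simp only [avg_add, avg_const (hΓ.R_pos j), avg_const (hΓ.Rv_pos j)]
  calc _ ≤ c * α * ((Γ.ell j * w : ℕ) * ((Γ.Rv j : ℕ) : ℝ≥0∞)⁻¹) +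
        c * α * (((Γ.s - Γ.ell j) * w : ℕ) * ((Γ.R j : ℕ) : ℝ≥0∞)⁻¹) :=
        add_le_add (avg_lt_le _ _) (avg_lt_le _ _)
    _ = c * α * (((Γ.ell j * w : ℕ) : ℝ≥0∞) * ((Γ.Rv j : ℕ) : ℝ≥0∞)⁻¹ +
        (((Γ.s - Γ.ell j) * w : ℕ) : ℝ≥0∞) * ((Γ.R j : ℕ) : ℝ≥0∞)⁻¹) := by ring
    _ ≤ c * α * (Γ.D * w * ((Γ.R j : ℕ) : ℝ≥0∞)⁻¹) := by gcongr
    _ = _ := by unfold Par.price; ring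

theorem Par.Ok.price_ne_top (hΓ : Γ.Ok) (hα : α ≠ ∞) (j w : ℕ) : Γ.price α j w ≠ ∞ := by
  unfold Par.price
  refine ENNReal.mul_ne_top hα (ENNReal.mul_ne_top (ENNReal.mul_ne_top (ENNReal.natCast_ne_top _)
    (ENNReal.natCast_ne_top _)) (ENNReal.inv_ne_top.2 ?_))
  exact_mod_cast (hΓ.R_pos j).ne'

theorem Par.epochCost_ne_top (Γ : Par) (hα : α ≠ ∞) (hβ : β ≠ ∞) : Γ.epochCost α β ≠ ∞ := by
  unfold Par.epochCost Par.gain Par.bcCost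
  have h : ∀ (n : ℕ), (n : ℝ≥0∞) * α ≠ ∞ := fun n => ENNReal.mul_ne_top (ENNReal.natCast_ne_top _) hα
  refine ENNReal.add_ne_top.2 ⟨ENNReal.add_ne_top.2 ⟨?_, h _⟩, ENNReal.add_ne_top.2
    ⟨ENNReal.add_ne_top.2 ⟨h _, h _⟩, ?_⟩⟩
  · exact ENNReal.mul_ne_top (ENNReal.mul_ne_top (by norm_num) hα) (ENNReal.natCast_ne_top _)
  · exact ENNReal.mul_ne_top (ENNReal.mul_ne_top (by norm_num) (ENNReal.natCast_ne_top _)) hβ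

/-- The second half of a round in which a message was sent. -/
theorem forward_spec (hΓ : Γ.Ok) (hF : Sub Γ.s Γ.b F) (hα : α ≠ ∞) (hβ : β ≠ ∞)
    {f : (ℕ → Slot) → ℝ≥0∞} {j e w Q UA UB : ℕ} {a : ℕ → Slot} {π : ℕ → ℕ} {m : Mem}
    (hm : Bd Γ j a π Q m) (hQ : Q + Γ.s * w < 2 ^ Γ.b)
    (h4 : m 4 = e) (h5 : m 5 = w) (he : e < 2 ^ Γ.b) (h6 : m 6 = UA)
    (h7 : m 7 = UB) (hUA : UA < Γ.Rv j) (hUB : UB < Γ.R j) (hw0 : w ≠ 0)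
    (hnext : ∀ j' a' π' m' sm act, Bd Γ j' a' π' (Q + Γ.s * w) m' → (∀ i, SiteOk Γ j' (sm i)) →
      worst Γ.b α β F m' sm act [] .sites [] [] σ + Γ.epochCost α β * j' ≤ f a')
    {sm : Fin Γ.k → Mem} (hs : ∀ i, SiteOk Γ j (sm i)) :
    worst Γ.b α β F m sm none [block msgMain] .coordinator [] [] σ + Γ.epochCost α β * j +
        1200 * Γ.price α j (min w (Γ.R j)) ≤
      600 * α + msgGoal Γ α j e w π (fun a => f a + β) a UA UB := by
  have hloc := loc_coordinator (α := α) (β := β) (ph := .coordinator) (up := []) (dn := []) (σ := σ)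
    hF (fun i => (hs i).zero)
  have := msg_spec hloc hΓ (Γ.epochCost_ne_top hα hβ) (y := 2 * Γ.k * β) (f := fun a => f a + β)
    le_rfl hα hα (ENNReal.mul_ne_top (ENNReal.mul_ne_top (by norm_num) (ENNReal.natCast_ne_top _)) hβ)
    hm hQ h4 h5 he h6 h7 hUA hUB hw0 (fun j' a' π' m' hj hm' => by
      have hz := hm'.rep.zero
      have t1 := worst_sites (α := α) (β := β) (act := none) (σ := σ)
        (dn := routed Γ.k (if j' = j then [] else bcList Γ j' Γ.k)) hF hz (fun i => (hs i).zero)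
      rw [List.nil_append]
      by_cases hjj : j' = j
      · subst hjj
        simp only [reduceIte, add_zero] at t1 ⊢
        have t2 := hnext j' a' π' m' sm none hm' hs
        calc _ ≤ β + worst Γ.b α β F m' sm none [] .sites [] [] σ + Γ.epochCost α β * j' :=
              add_le_add t1 le_rfl
          _ = worst Γ.b α β F m' sm none [] .sites [] [] σ + Γ.epochCost α β * j' + β := by ring
          _ ≤ _ := by gcongr
      · simp only [if_neg hjj] at t1 ⊢
        have t2 := broadcast_spec (α := α) (β := β) (σ := σ) hΓ hF hz (j := j')
          (fun sm act h => hnext j' a' π' m' sm act hm' h) Γ.k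
          (sm := sm) (act := none) le_rfl (fun i => ⟨(hs i).zero, (hs i).c1⟩)
          (fun i hi => absurd i.2 (by omega))
        calc _ ≤ β + worst Γ.b α β F m' sm none [] .sites [] (routed Γ.k (bcList Γ j' Γ.k)) σ +
              Γ.epochCost α β * j' := add_le_add t1 le_rfl
          _ = worst Γ.b α β F m' sm none [] .sites [] (routed Γ.k (bcList Γ j' Γ.k)) σ +
              Γ.epochCost α β * j' + β := by ring
          _ ≤ 2 * Γ.k * β + f a' + β := add_le_add t2 le_rfl
          _ = _ := by ring)
  exact this.trans (le_of_eq (by unfold msgGoal; ring))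

end Item


/-! ### The whole stream -/

section Rounds

variable {Γ : Par} {α β : ℝ≥0∞} {F : State Γ.k → ℝ≥0∞}

/-- For a weight above `R j` the first piece alone already triggers a message, as `UB < R j`. So the
probability of a message can be bounded by the price of the first piece. -/
theorem Sends.min {j w UA UB : ℕ} (hΓ : Γ.Ok) (hUB : UB < Γ.R j) (h : Sends Γ j w UA UB) :
    Sends Γ j (min w (Γ.R j)) UA UB := by
  rcases le_or_gt w (Γ.R j) with hw | hw
  · rwa [min_eq_left hw]
  · rw [min_eq_right hw.le]
    have := hΓ.ell_lt j
    exact Or.inr (hUB.trans_le (Nat.le_mul_of_pos_left _ (by omega)))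

/-- Silence has the exact effect of the trials, since none of them can hit. The reward of the units,
with `hpot ≥ 1 / R j`, even supplies the prices that were added on the other side. -/
theorem msgGoal_of_not_sends (hΓ : Γ.Ok) {j e w UA UB : ℕ} {π : ℕ → ℕ} {a : ℕ → Slot}
    (htop : ¬ Adv Γ (j + 1) a) (hUA : UA < Γ.Rv j) (hUB : UB < Γ.R j)
    (h : ¬ Sends Γ j w UA UB) (f : (ℕ → Slot) → ℝ≥0∞) :
    f a + 1200 * Γ.price α j (min w (Γ.R j)) ≤ msgGoal Γ α j e w π f a UA UB := by
  rw [Sends, not_or, not_lt, not_lt] at h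
  have hl := hΓ.ell_lt j
  have hwU : w ≤ UB := (Nat.le_mul_of_pos_left w (show 0 < Γ.s - Γ.ell j by omega)).trans h.2
  have hmin : min w (Γ.R j) = w := by omega
  unfold msgGoal
  rw [hmin, skipVal_of_le _ h.1 hUA, skipVal_of_le _ h.2 hUB, show w - Γ.R j = 0 by omega, pieceGoal]
  have h1 := price_le_gain hΓ α (j := j) (n := w) hmin.symm
  rw [if_pos (by omega), add_zero] at h1
  have h2 : (w : ℝ≥0∞) * (Γ.gain α * ((Γ.R j : ℕ) : ℝ≥0∞)⁻¹) ≤ w * (Γ.gain α * hpot Γ a) := by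
    gcongr
    exact le_hpot htop
  refine le_add_left ?_
  rw [add_comm]
  exact add_le_add (h1.trans h2) le_rfl

theorem onMsg_spec (hF : Sub Γ.s Γ.b F) {σ : List (Arrival Γ.k)} {m : Mem} {sm : Fin Γ.k → Mem}
    (hs : ∀ i, Zero 64 (sm i)) (hz : Zero (64 + 5 * Γ.s) m) (h3 : m 3 ≠ 0) :
    worst Γ.b α β F m sm none [protocol.onMsg] .coordinator [] [] σ ≤
      3 * α + worst Γ.b α β F m sm none [block msgMain] .coordinator [] [] σ := by
  have h := loc_coordinator (α := α) (β := β) (ph := .coordinator) (up := []) (dn := []) (σ := σ)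
    hF hs
  have s := ((h.cons (c := .branch 3 .skip setupCmd) (l := msgMain) (o := []) (K := []) hz).trans
    (h.branch_pos (x := 3) (p := .skip) (q := setupCmd) (o := []) (K := [block msgMain]) hz h3)).trans
    (h.skip (o := []) (K := [block msgMain]) hz)
  simp only [routed, List.filterMap_nil, List.append_nil] at s
  exact s.le.trans (by norm_num)

open Classical in
/-- A round in which the coordinator is already set up. -/
theorem round_spec (hΓ : Γ.Ok) (hF : Sub Γ.s Γ.b F) (hα : α ≠ ∞) (hβ : β ≠ ∞)
    {fend : (ℕ → Slot) → ℝ≥0∞}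
    (hend : ∀ {j a π Q cm sm}, Bd Γ j a π Q cm → (∀ i, SiteOk Γ j (sm i)) → ∀ t act n,
      F (glob cm sm t act [] .sites [] [] [] n) ≤ fend a) (σ : List (Arrival Γ.k)) :
    ∀ {j a π Q cm sm act}, (∀ x ∈ σ, 1 ≤ x.weight ∧ x.ident < 2 ^ Γ.b) → Bd Γ j a π Q cm →
      (∀ i, SiteOk Γ j (sm i)) → Q + Γ.s * totalWeight σ < 2 ^ Γ.b →
      worst Γ.b α β F cm sm act [] .sites [] [] σ + Γ.epochCost α β * j ≤ 50 * β * σ.length +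
        streamVal Γ (Γ.gain α) σ (fun a => Γ.epochCost α β * epochs Γ a + fend a) a := by
  induction σ with
  | nil =>
    intro j a π Q cm sm act _ hm hs _
    have h1 : worst Γ.b α β F cm sm act [] .sites [] [] [] ≤ fend a :=
      worst_done fun t n => hend hm hs t act n
    have h2 := le_epochs hΓ hm.inv.bot
    rw [streamVal, add_comm]
    refine le_add_left ?_
    gcongr
  | cons x σ ih =>
    intro j a π Q cm sm act hx hm hs hQ
    obtain ⟨hw1, he⟩ := hx x (by simp)
    have htw : totalWeight (x :: σ) = x.weight + totalWeight σ := by simp [totalWeight]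
    rw [htw, mul_add, ← add_assoc] at hQ
    have hx' : ∀ y ∈ σ, 1 ≤ y.weight ∧ y.ident < 2 ^ Γ.b := fun y hy => hx y (by simp [hy])
    have hz := hm.rep.zero
    set w := x.weight
    set f : (ℕ → Slot) → ℝ≥0∞ := fun a => 50 * β * σ.length +
      streamVal Γ (Γ.gain α) σ (fun a => Γ.epochCost α β * epochs Γ a + fend a) a with hf
    set p := Γ.price α j (min w (Γ.R j)) with hp
    have key := item_spec (α := α) (β := β) (σ := σ) hΓ hF hz hm.inv.hR (x := x)
      (show Γ.s * w < _ by omega)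
      -- The `604` units are the message itself, three instructions that enter the handler, and the
      -- `600` of `forward_spec`; they are due only if a message is sent.
      (X := fun UA UB => (if Sends Γ j (min w (Γ.R j)) UA UB then (604 : ℕ) * α else 0) +
        msgGoal Γ α j x.ident w π (fun a => f a + β) a UA UB)
      (c := Γ.epochCost α β * j + 1200 * p)
      (fun UA hUA UB hUB hsend sm hs => by
        have hm' : Bd Γ j a π Q (cm.receive [x.ident, w, UA, UB]) := hm.congr fun y hy => by
          unfold Pers at hy
          rcases lt_or_ge y 4 with h | h
          · exact receive_of_lt _ _ h
          · exact receive_of_ge _ _ (by simp; omega)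
        rw [if_pos (hsend.min hΓ hUB)]
        have t1 := onMsg_spec (α := α) (β := β) (σ := σ) hF (fun i => (hs i).zero) hm'.rep.zero
          (by rw [hm'.rep.c3]; omega)
        have t2 := forward_spec hΓ hF hα hβ (σ := σ) (f := f) hm' (e := x.ident) (w := w) (UA := UA)
          (UB := UB) (by omega) (by simp [Mem.receive]) (by simp [Mem.receive]) he
          (by simp [Mem.receive]) (by simp [Mem.receive]) hUA hUB (by omega)
          (fun j' a' π' m' sm act hm' hs => ih hx' hm' hs hQ) hs
        calc _ ≤ α + (3 * α + worst Γ.b α β F (cm.receive [x.ident, w, UA, UB]) sm none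
              [block msgMain] .coordinator [] [] σ) + (Γ.epochCost α β * j + 1200 * p) :=
              add_le_add (add_le_add le_rfl t1) le_rfl
          _ = 4 * α + (worst Γ.b α β F (cm.receive [x.ident, w, UA, UB]) sm none
              [block msgMain] .coordinator [] [] σ + Γ.epochCost α β * j + 1200 * p) := by ring
          _ ≤ 4 * α + (600 * α + msgGoal Γ α j x.ident w π (fun a => f a + β) a UA UB) :=
              add_le_add le_rfl t2
          _ = _ := by push_cast; ring)
      (fun UA hUA UB hUB hsend sm act hs => by
        have t1 := ih (act := act) hx' hm hs (by omega)
        have t2 := msgGoal_of_not_sends (α := α) (e := x.ident) (π := π) hΓ hm.top hUA hUB hsend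
          (fun a => f a + β)
        calc _ = worst Γ.b α β F cm sm act [] .sites [] [] σ + Γ.epochCost α β * j + 1200 * p := by
              ring
          _ ≤ f a + 1200 * p := add_le_add t1 le_rfl
          _ ≤ f a + β + 1200 * p := by gcongr; exact le_add_right le_rfl
          _ ≤ _ := le_add_left t2) (act := act) hs
    simp only [avg_add] at key
    have k1 := avg_sends_le hΓ hα 604 j (min w (Γ.R j))
    have k2 := avg_msgGoal_le hΓ hα (e := x.ident) (w := w) hm.inv (fun a => f a + β)
    rw [Hop_add_const] at k2
    have k3 : Hop Γ x.ident w (Γ.gain α) w f a = streamVal Γ (Γ.gain α) (x :: σ)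
        (fun a => Γ.epochCost α β * epochs Γ a + fend a) a + 50 * β * σ.length := by
      rw [streamVal, ← Hop_add_const]
      simp only [hf, add_comm (50 * β * (σ.length : ℝ≥0∞))]
      rfl
    rw [k3] at k2
    -- The expected cost is `604 + 500 = 1104` prices, less than the `1200` that are cancelled.
    have hfin : 1200 * p ≠ ∞ := ENNReal.mul_ne_top (by norm_num) (hΓ.price_ne_top hα _ _)
    refine (ENNReal.add_le_add_iff_right hfin).1 ?_
    rw [List.length_cons]
    calc _ = worst Γ.b α β F cm sm act [] .sites [] [] (x :: σ) +
          (Γ.epochCost α β * j + 1200 * p) := by ring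
      _ ≤ 42 * β + (((604 : ℕ) : ℝ≥0∞) * p + (500 * p + (streamVal Γ (Γ.gain α) (x :: σ)
        (fun a => Γ.epochCost α β * epochs Γ a + fend a) a + 50 * β * σ.length + β))) :=
          key.trans (add_le_add le_rfl (add_le_add k1 k2))
      _ = 43 * β + 50 * β * σ.length + 1104 * p + streamVal Γ (Γ.gain α) (x :: σ)
        (fun a => Γ.epochCost α β * epochs Γ a + fend a) a := by push_cast; ring
      _ ≤ 50 * β + 50 * β * σ.length + 1200 * p + streamVal Γ (Γ.gain α) (x :: σ)
        (fun a => Γ.epochCost α β * epochs Γ a + fend a) a := by gcongr <;> norm_num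
      _ = _ := by push_cast; ring

open Classical in
/-- The whole run. -/
theorem stream_spec (hΓ : Γ.Std) (hF : Sub Γ.s Γ.b F) (hα : α ≠ ∞) (hβ : β ≠ ∞)
    {fend : (ℕ → Slot) → ℝ≥0∞}
    (hend : ∀ {j a π Q cm sm}, Bd Γ j a π Q cm → (∀ i, SiteOk Γ j (sm i)) → ∀ t act n,
      F (glob cm sm t act [] .sites [] [] [] n) ≤ fend a) {σ : List (Arrival Γ.k)} (hσ : σ ≠ [])
    (hx : ∀ x ∈ σ, 1 ≤ x.weight ∧ x.ident < 2 ^ Γ.b)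
    (hQ : Γ.s * totalWeight σ < 2 ^ Γ.b) :
    totalVal protocol Γ.b α β F (State.init Γ.k Γ.s Γ.b σ) ≤
      (200 * (Γ.s + Γ.ρ + Γ.lam) + 610 : ℕ) * α + 50 * β * σ.length +
        streamVal Γ (Γ.gain α) σ (fun a => Γ.epochCost α β * epochs Γ a + fend a) emptySlots := by
  obtain ⟨x, σ, rfl⟩ := List.exists_cons_of_ne_nil hσ
  have hΓ' := hΓ.toOk
  obtain ⟨hw1, he⟩ := hx x (by simp)
  have htw : totalWeight (x :: σ) = x.weight + totalWeight σ := by simp [totalWeight]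
  rw [htw, mul_add] at hQ
  have hx' : ∀ y ∈ σ, 1 ≤ y.weight ∧ y.ident < 2 ^ Γ.b := fun y hy => hx y (by simp [hy])
  have bs := hΓ.bs
  have bk := hΓ.bk
  have bb : Γ.b < 2 ^ Γ.b := Nat.lt_two_pow_self
  have hs := hΓ.hs
  have R0 : Γ.R 0 = 1 := by rw [Par.R, pow_zero]
  have Rv0 : Γ.Rv 0 = 1 := by
    have h1 := hΓ'.Rv_pos 0
    have h2 := (hΓ'.Rv_two 0).2.1
    omega
  have ell0 : Γ.ell 0 = 0 := by rw [Par.ell, if_pos rfl]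
  have hM1 : 1 ≤ Γ.M := by rw [hΓ.M_eq]; exact Nat.one_le_two_pow
  set cm := initMem Γ.k Γ.s Γ.b none with hcm
  have hcz : ∀ y, 3 ≤ y → cm y = 0 := by
    intro y hy
    obtain ⟨d, rfl⟩ := Nat.exists_eq_add_of_le' hy
    cases d <;> rfl
  have hz : Zero (64 + 5 * Γ.s) cm := fun y hy => hcz y (by omega)
  set sm : Fin Γ.k → Mem := fun i => initMem Γ.k Γ.s Γ.b (some i) with hsm
  have hsz : ∀ i y, 4 ≤ y → sm i y = 0 := by
    intro i y hy
    obtain ⟨d, rfl⟩ := Nat.exists_eq_add_of_le' hy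
    rfl
  have hok : ∀ i, SiteOk Γ 0 (sm i) := fun i => by
    refine ⟨fun y hy => hsz i y (by omega), Nat.mod_eq_of_lt (by omega), ?_, ?_, ?_⟩
    · rw [hsz i 6 (by omega), ell0]
    · rw [hsz i 7 (by omega), R0]; rfl
    · rw [hsz i 8 (by omega), Rv0]; rfl
  have hinit : State.init Γ.k Γ.s Γ.b (x :: σ) =
      glob cm sm (fun _ => 0) none [] .sites [] [] (x :: σ) 0 := by
    unfold State.init glob
    congr 1
    funext p
    cases p <;> rfl
  rw [hinit]
  refine (totalVal_le_worst [] (fun _ => 0) 0).trans ?_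
  set w := x.weight with hw
  set f : (ℕ → Slot) → ℝ≥0∞ := fun a => 50 * β * σ.length +
    streamVal Γ (Γ.gain α) σ (fun a => Γ.epochCost α β * epochs Γ a + fend a) a with hf
  set G := streamVal Γ (Γ.gain α) (x :: σ)
    (fun a => Γ.epochCost α β * epochs Γ a + fend a) emptySlots with hG
  have k3 : Hop Γ x.ident w (Γ.gain α) w f emptySlots = G + 50 * β * σ.length := by
    rw [hG, streamVal, ← Hop_add_const]
    simp only [hf, add_comm (50 * β * (σ.length : ℝ≥0∞))]
    rfl
  -- In epoch `0` both draws are below one, so they are zero and there is nothing to average.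
  have hone : ∀ Y : ℕ → ℕ → ℝ≥0∞,
      avg (Γ.Rv 0) (fun UA => avg (Γ.R 0) fun UB => Y UA UB) = Y 0 0 := by
    intro Y; simp [avg, R0, Rv0]
  have key := item_spec (α := α) (β := β) (σ := σ) hΓ' hF hz (by rw [R0]; exact hM1) (x := x)
    (show Γ.s * w < _ by omega) (c := 0)
    (X := fun _ _ => (200 * (Γ.s + Γ.ρ + Γ.lam) + 610 : ℕ) * α + (G + 50 * β * σ.length + β))
    (fun UA hUA UB hUB _ sm hs => by
      have hUA0 : UA = 0 := by omega
      have hUB0 : UB = 0 := by omega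
      subst hUA0 hUB0
      set m := cm.receive [x.ident, w, 0, 0] with hm
      have hmz : Zero (64 + 5 * Γ.s) m := hz.receive (by simp; omega)
      have h := loc_coordinator (α := α) (β := β) (ph := .coordinator) (up := []) (dn := []) (σ := σ)
        hF fun i => (hs i).zero
      have s1 := h.cons (c := .branch 3 .skip setupCmd) (l := msgMain) (o := []) (K := []) hmz
      have s2 := h.branch_neg (x := 3) (p := .skip) (q := setupCmd) (o := []) (K := [block msgMain])
        hmz (by rw [hm, receive_of_lt _ _ (by omega), hcz 3 (by omega)])
      have s3 := setup_spec h hΓ (o := []) (K := [block msgMain]) (m := m)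
        (X := 600 * α + (G + 50 * β * σ.length + β))
        (by rw [hm, receive_of_lt _ _ (by omega)]; exact Nat.mod_eq_of_lt bk)
        (by rw [hm, receive_of_lt _ _ (by omega)]; exact Nat.mod_eq_of_lt (by omega))
        (by rw [hm, receive_of_lt _ _ (by omega)]; exact Nat.mod_eq_of_lt bb)
        (fun y hy => by rw [hm, receive_of_ge _ _ (by simpa using hy), hcz y (by omega)])
        (fun π m' hm' hf' => by
          have t := forward_spec hΓ' hF hα hβ (σ := σ) (f := f) hm' (e := x.ident) (w := w)
            (UA := 0) (UB := 0) (by omega) (by rw [hf' 4 (by omega) (by omega)]; simp [hm, Mem.receive])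
            (by rw [hf' 5 (by omega) (by omega)]; simp [hm, Mem.receive]) he
            (by rw [hf' 6 (by omega) (by omega)]; simp [hm, Mem.receive])
            (by rw [hf' 7 (by omega) (by omega)]; simp [hm, Mem.receive]) hUA hUB (by omega)
            (fun j' a' π' m' sm act hm' hs => round_spec hΓ' hF hα hβ hend σ hx' hm' hs (by omega)) hs
          have t2 := avg_msgGoal_le hΓ' hα (e := x.ident) (w := w) hm'.inv (fun a => f a + β)
          rw [hone, Hop_add_const, k3] at t2
          have hfin : 1200 * Γ.price α 0 (min w (Γ.R 0)) ≠ ∞ :=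
            ENNReal.mul_ne_top (by norm_num) (hΓ'.price_ne_top hα _ _)
          simp only [routed, List.filterMap_nil, List.append_nil]
          refine (ENNReal.add_le_add_iff_right hfin).1 ?_
          simp only [Nat.cast_zero, mul_zero, add_zero] at t
          refine t.trans ((add_le_add le_rfl t2).trans ?_)
          calc _ = 500 * Γ.price α 0 (min w (Γ.R 0)) + (600 * α + (G + 50 * β * σ.length + β)) := by
                ring
            _ ≤ 1200 * Γ.price α 0 (min w (Γ.R 0)) + (600 * α + (G + 50 * β * σ.length + β)) := by
                gcongr
                norm_num
            _ = _ := by ring)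
      have s := ((s1.trans s2).trans s3).le
      simp only [routed, List.filterMap_nil, List.append_nil] at s
      rw [add_zero]
      calc _ ≤ α + _ := add_le_add le_rfl s
        _ = (200 * (Γ.s + Γ.ρ + Γ.lam) + 603 : ℕ) * α + (G + 50 * β * σ.length + β) := by
          push_cast; ring
        _ ≤ _ := by gcongr; omega)
    -- The first item is always forwarded: there are no laggards, `UB = 0`, and `s * w` is positive.
    -- So the coordinator is set up in the first round.
    (fun UA hUA UB hUB hsend => absurd (Or.inr (by
      rw [ell0]
      have := Nat.le_mul_of_pos_left x.weight hs
      simp only [Nat.sub_zero]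
      omega)) hsend) (act := none) hok
  rw [hone, add_zero] at key
  refine key.trans ?_
  rw [List.length_cons]
  calc _ = (200 * (Γ.s + Γ.ρ + Γ.lam) + 610 : ℕ) * α + (43 * β + 50 * β * σ.length) + G := by ring
    _ ≤ (200 * (Γ.s + Γ.ρ + Γ.lam) + 610 : ℕ) * α + (50 * β + 50 * β * σ.length) + G := by
      gcongr; norm_num
    _ = _ := by push_cast; ring

end Rounds


/-! ## Law of the ideal process -/

/-- A slot after the arrivals of the units of a list. -/
def chain (M : ℕ) : List (ℕ × ℕ) → Slot → PMF Slot
  | [], t => PMF.pure t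
  | u :: l, t => (unitS M u.1 u.2 M t).bind (chain M l)

theorem chain_append (M : ℕ) (l l' : List (ℕ × ℕ)) (t : Slot) :
    chain M (l ++ l') t = (chain M l t).bind (chain M l') := by
  induction l generalizing t with
  | nil => simp [chain, PMF.pure_bind]
  | cons u l ih =>
    simp only [List.cons_append, chain, PMF.bind_bind]
    congr 1
    funext t'
    exact ih t'

/-- Multiplicity of the score `z ≥ y` after the arrival of a unit of this score. -/
def tie (y c z : ℕ) : ℕ := (if y = z then c else 0) + 1

/-- Expectation of `G` on the event that the sampled unit is kept. -/
def keepOp (M : ℕ) (G : ℕ → ℕ → ℝ≥0∞) (y c : ℕ) : ℝ≥0∞ :=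
  avg M fun r => if M - r < y then G y c else
    ((tie y c (M - r) - 1 : ℕ) : ℝ≥0∞) / (tie y c (M - r) : ℕ) * G (M - r) (tie y c (M - r))

/-- Expectation of `G` on the event that the sampled unit is replaced. -/
def replOp (M : ℕ) (G : ℕ → ℕ → ℝ≥0∞) (y c : ℕ) : ℝ≥0∞ :=
  avg M fun r => if M - r < y then 0 else
    ((1 : ℕ) : ℝ≥0∞) / (tie y c (M - r) : ℕ) * G (M - r) (tie y c (M - r))

/-- Given the score, the new unit replaces the sample with probability one over the multiplicity,
independently of what the sample is. So the identity of the sample factors out. -/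
theorem expect_unitS_mul {M : ℕ} (hM : 0 < M) (e w : ℕ) (φ : ℕ × ℕ → ℝ≥0∞) (G : ℕ → ℕ → ℝ≥0∞)
    (t : Slot) :
    expect (unitS M e w M t) (fun t' => φ (t'.id, t'.w) * G t'.y t'.c) =
      φ (t.id, t.w) * keepOp M G t.y t.c + φ (e, w) * replOp M G t.y t.c := by
  rw [expect_unitS hM, keepOp, replOp, ← avg_const_mul, ← avg_const_mul, ← avg_add]
  refine avg_congr fun r _ => ?_
  unfold hitS
  split_ifs with h
  · simp [expect_pure]
  · rw [expect_map, expect_uniformBelow]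
    have ht : t.ties (M - r) = tie t.y t.c (M - r) := rfl
    have hpos : 1 ≤ tie t.y t.c (M - r) := by unfold tie; omega
    rw [ht, max_eq_left hpos, avg_congr (g := fun v => if v < 1 then
      φ (e, w) * G (M - r) (tie t.y t.c (M - r)) else
      φ (t.id, t.w) * G (M - r) (tie t.y t.c (M - r))), avg_ite hpos]
    · ring
    · intro v _
      unfold Slot.next
      by_cases hv : v = 0
      · simp [hv, ht]
      · simp [hv, ht]

theorem tie_tie_self (y c z : ℕ) : tie z (tie y c z) z = tie y c z + 1 := by
  rw [tie, if_pos rfl]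

theorem tie_of_ne {y z : ℕ} (c : ℕ) (h : y ≠ z) : tie y c z = 1 := by
  rw [tie, if_neg h]

/-- The arrivals of two units commute. -/
theorem replOp_comm (M : ℕ) (G : ℕ → ℕ → ℝ≥0∞) (y c : ℕ) :
    keepOp M (replOp M G) y c + replOp M (replOp M G) y c = replOp M (keepOp M G) y c := by
  have h1 : keepOp M (replOp M G) y c + replOp M (replOp M G) y c =
      avg M fun r => if M - r < y then replOp M G y c else
        replOp M G (M - r) (tie y c (M - r)) := by
    rw [keepOp, show replOp M (replOp M G) y c = avg M fun r => if M - r < y then 0 else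
      ((1 : ℕ) : ℝ≥0∞) / (tie y c (M - r) : ℕ) * replOp M G (M - r) (tie y c (M - r)) from rfl,
      ← avg_add]
    refine avg_congr fun r _ => ?_
    split_ifs with h
    · simp
    · rw [← add_mul, ← ENNReal.add_div, ← Nat.cast_add,
        Nat.sub_add_cancel (by unfold tie; omega), ENNReal.div_self, one_mul]
      · exact_mod_cast (by unfold tie; omega : tie y c (M - r) ≠ 0)
      · exact ENNReal.natCast_ne_top _
  rw [h1]
  have h2 : ∀ r, (if M - r < y then replOp M G y c else replOp M G (M - r) (tie y c (M - r))) =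
      avg M fun r' => if M - r < y then (if M - r' < y then 0 else
        ((1 : ℕ) : ℝ≥0∞) / (tie y c (M - r') : ℕ) * G (M - r') (tie y c (M - r'))) else
        (if M - r' < M - r then 0 else ((1 : ℕ) : ℝ≥0∞) / (tie (M - r) (tie y c (M - r)) (M - r') : ℕ) *
          G (M - r') (tie (M - r) (tie y c (M - r)) (M - r'))) := by
    intro r
    split_ifs <;> rfl
  have h3 : replOp M (keepOp M G) y c = avg M fun r' => avg M fun r => if M - r' < y then 0 else
      ((1 : ℕ) : ℝ≥0∞) / (tie y c (M - r') : ℕ) * (if M - r < M - r' then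
        G (M - r') (tie y c (M - r')) else
        ((tie (M - r') (tie y c (M - r')) (M - r) - 1 : ℕ) : ℝ≥0∞) /
          (tie (M - r') (tie y c (M - r')) (M - r) : ℕ) *
          G (M - r) (tie (M - r') (tie y c (M - r')) (M - r))) := by
    rw [replOp]
    refine avg_congr fun r' hr' => ?_
    split_ifs with h
    · rw [avg_const (by omega)]
    · rw [avg_const_mul]
      rfl
  rw [h3, avg_comm]
  refine avg_congr fun r _ => ?_
  rw [h2]
  refine avg_congr fun r' _ => ?_
  -- `z` is the score of the unit that is not selected and `z'` that of the selected one. The two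
  -- orders of arrival are compared according to which scores are smaller; for equal scores the
  -- factors `1 / (t + 1)` and `1 / t * (t / (t + 1))` agree.
  generalize M - r = z
  generalize M - r' = z'
  have tpos : ∀ a b d, ((tie a b d : ℕ) : ℝ≥0∞) ≠ 0 := fun a b d => by
    exact_mod_cast (by unfold tie; omega : tie a b d ≠ 0)
  by_cases hz : z < y
  · rw [if_pos hz]
    by_cases hz' : z' < y
    · rw [if_pos hz', if_pos hz']
    · rw [if_neg hz', if_neg hz', if_pos (by omega)]
  · rw [if_neg hz]
    rcases lt_trichotomy z' z with hlt | rfl | hlt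
    · rw [if_pos hlt]
      split_ifs with h1 h2
      · rfl
      · omega
      · rw [tie_of_ne (tie y c z') (by omega : z' ≠ z)]
        simp
    · rw [if_neg (lt_irrefl _), if_neg hz, if_neg (lt_irrefl _), tie_tie_self,
        Nat.add_sub_cancel, ← mul_assoc, ← mul_div_assoc]
      congr 2
      rw [ENNReal.div_mul_cancel (tpos _ _ _) (ENNReal.natCast_ne_top _)]
    · rw [if_neg (by omega), if_neg (by omega), if_pos hlt, tie_of_ne (tie y c z) (by omega),
        tie_of_ne c (by omega : y ≠ z')]

/-- The sampled unit is uniform and independent of the scores. -/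
theorem expect_chain_keepOp {M : ℕ} (hM : 0 < M) (φ : ℕ × ℕ → ℝ≥0∞) (l : List (ℕ × ℕ)) :
    ∀ G, expect (chain M l ⟨0, 0, 0, 0⟩) (fun t => φ (t.id, t.w) * keepOp M G t.y t.c) =
      (l.map φ).sum * expect (chain M l ⟨0, 0, 0, 0⟩) fun t => replOp M G t.y t.c := by
  induction l using List.reverseRecOn with
  | nil =>
    intro G
    simp only [chain, expect_pure, List.map_nil, List.sum_nil, zero_mul]
    have : keepOp M G 0 0 = 0 := by
      unfold keepOp
      rw [avg_congr (g := fun _ => 0), avg_const hM]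
      intro r hr
      rw [if_neg (by omega), tie_of_ne 0 (by omega : 0 ≠ M - r)]
      simp
    rw [this, mul_zero]
  | append_singleton l u ih =>
    intro G
    have hsplit : ∀ (ψ : ℕ × ℕ → ℝ≥0∞) H, expect (chain M (l ++ [u]) ⟨0, 0, 0, 0⟩)
        (fun t => ψ (t.id, t.w) * H t.y t.c) =
        expect (chain M l ⟨0, 0, 0, 0⟩) (fun t => ψ (t.id, t.w) * keepOp M H t.y t.c) +
          ψ u * expect (chain M l ⟨0, 0, 0, 0⟩) fun t => replOp M H t.y t.c := by
      intro ψ H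
      rw [chain_append, expect_bind, ← expect_const_mul, ← expect_add]
      congr 1
      funext t
      rw [chain]
      have : chain M [] = PMF.pure := rfl
      rw [this, PMF.bind_pure, expect_unitS_mul hM]
    have h1 := hsplit (fun _ => 1) (replOp M G)
    simp only [one_mul] at h1
    -- The old units are handled by the induction hypothesis for `keepOp M G`; the new unit gets the
    -- same coefficient because of `replOp_comm`.
    rw [hsplit, ih, h1, ← expect_add, List.map_append, List.sum_append, List.map_singleton,
      List.sum_singleton, ← add_mul]
    simp only [replOp_comm]

/-- After one more arrival every unit has the same coefficient `x`; the constant function `1` shows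
that `x` is one over the number of units. -/
theorem expect_chain {M : ℕ} (hM : 0 < M) {l : List (ℕ × ℕ)} (hl : l ≠ []) (φ : ℕ × ℕ → ℝ≥0∞) :
    expect (chain M l ⟨0, 0, 0, 0⟩) (fun t => φ (t.id, t.w)) = (l.map φ).sum / l.length := by
  obtain ⟨l, u, rfl⟩ := List.eq_nil_or_concat l |>.resolve_left hl
  set x := expect (chain M l ⟨0, 0, 0, 0⟩) fun t => replOp M (fun _ _ => 1) t.y t.c with hx
  have key : ∀ ψ : ℕ × ℕ → ℝ≥0∞, expect (chain M (l ++ [u]) ⟨0, 0, 0, 0⟩) (fun t => ψ (t.id, t.w)) =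
      ((l ++ [u]).map ψ).sum * x := by
    intro ψ
    rw [chain_append, expect_bind, List.map_append, List.sum_append, List.map_singleton,
      List.sum_singleton, add_mul, hx, ← expect_chain_keepOp hM, ← expect_const_mul, ← expect_add]
    congr 1
    funext t
    have : chain M [] = PMF.pure := rfl
    rw [chain, this, PMF.bind_pure]
    simpa using expect_unitS_mul hM u.1 u.2 ψ (fun _ _ => 1) t
  have h1 := key fun _ => 1
  rw [expect_const, List.map_const', List.sum_replicate, nsmul_eq_mul, mul_one] at h1
  rw [List.concat_eq_append, key, ENNReal.eq_inv_of_mul_eq_one_left ((mul_comm _ _).trans h1.symm)]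
  rfl

/-! ### Independence of the slots -/

section Product

/-- As the list has no repetitions, each slot receives its own independent arrival. -/
theorem expect_trials_prod (M e w s : ℕ) (φ : ℕ → Slot → ℝ≥0∞) (l : List ℕ) (hl : l.Nodup)
    (hs : ∀ i ∈ l, i < s) (a : ℕ → Slot) :
    expect (trials M e w l a) (fun a => ∏ i ∈ Finset.range s, φ i (a i)) =
      ∏ i ∈ Finset.range s, if i ∈ l then expect (unitS M e w M (a i)) (φ i) else φ i (a i) := by
  induction l generalizing a with
  | nil => simp [trials, expect_pure]
  | cons i l ih =>
    rw [List.nodup_cons] at hl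
    have hi : i ∈ Finset.range s := Finset.mem_range.2 (hs i (by simp))
    rw [trials, expect_bind]
    simp only [ih hl.2 fun i hi => hs i (by simp [hi])]
    rw [hitA, expect_map, ← Finset.mul_prod_erase _ _ hi]
    simp only [← Finset.mul_prod_erase _ _ hi, Function.update_self, if_neg hl.1]
    rw [if_pos (by simp), mul_comm, ← expect_const_mul]
    congr 1
    funext t
    rw [mul_comm]
    congr 1
    refine Finset.prod_congr rfl fun i' hi' => ?_
    have hne := Finset.ne_of_mem_erase hi'
    rw [Function.update_of_ne hne]
    simp [hne]

/-- The units of a stream. -/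
def units {k : ℕ} (σ : List (Arrival k)) : List (ℕ × ℕ) :=
  σ.flatMap fun x => List.replicate x.weight (x.ident, x.weight)

theorem length_units {k : ℕ} (σ : List (Arrival k)) : (units σ).length = totalWeight σ := by
  simp [units, totalWeight, List.length_flatMap]

theorem Hop_prod (Γ : Par) (e w n : ℕ) (φ : ℕ → Slot → ℝ≥0∞) (a : ℕ → Slot) :
    Hop Γ e w 0 n (fun a => ∏ i ∈ Finset.range Γ.s, φ i (a i)) a =
      ∏ i ∈ Finset.range Γ.s, expect (chain Γ.M (List.replicate n (e, w)) (a i)) (φ i) := by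
  induction n generalizing a with
  | zero => simp [Hop, chain, expect_pure]
  | succ n ih =>
    rw [Hop]
    simp only [zero_mul, zero_add, ih]
    rw [expect_trials_prod _ _ _ _ (fun i t => expect (chain Γ.M (List.replicate n (e, w)) t) (φ i))
      _ List.nodup_range fun i hi => List.mem_range.1 hi]
    refine Finset.prod_congr rfl fun i hi => ?_
    rw [if_pos (List.mem_range.2 (Finset.mem_range.1 hi)), List.replicate_succ, chain, expect_bind]

theorem streamVal_prod (Γ : Par) {k : ℕ} (σ : List (Arrival k)) (φ : ℕ → Slot → ℝ≥0∞)
    (a : ℕ → Slot) :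
    streamVal Γ 0 σ (fun a => ∏ i ∈ Finset.range Γ.s, φ i (a i)) a =
      ∏ i ∈ Finset.range Γ.s, expect (chain Γ.M (units σ) (a i)) (φ i) := by
  induction σ generalizing a with
  | nil => simp [streamVal, units, chain, expect_pure]
  | cons x σ ih =>
    rw [streamVal, funext ih,
      Hop_prod Γ _ _ _ (fun i t => expect (chain Γ.M (units σ) t) (φ i))]
    refine Finset.prod_congr rfl fun i _ => ?_
    rw [← expect_bind, ← chain_append]
    rfl

theorem streamVal_add (Γ : Par) {k : ℕ} (σ : List (Arrival k)) (f g : (ℕ → Slot) → ℝ≥0∞)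
    (a : ℕ → Slot) :
    streamVal Γ 0 σ (fun a => f a + g a) a = streamVal Γ 0 σ f a + streamVal Γ 0 σ g a := by
  have hop : ∀ (e w n : ℕ) (f g : (ℕ → Slot) → ℝ≥0∞) a,
      Hop Γ e w 0 n (fun a => f a + g a) a = Hop Γ e w 0 n f a + Hop Γ e w 0 n g a := by
    intro e w n f g
    induction n with
    | zero => intro a; rfl
    | succ n ih => intro a; simp only [Hop, ih, zero_mul, zero_add, expect_add]
  induction σ generalizing a with
  | nil => rfl
  | cons x σ ih => simp only [streamVal, funext ih, hop]

end Product


/-! ## Correctness of the sample and memory bounds -/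

theorem toOuterMeasure_eq_expect {α : Type*} (p : PMF α) (S : Set α) :
    p.toOuterMeasure S = expect p (S.indicator 1) := by
  rw [PMF.toOuterMeasure_apply, expect]
  refine tsum_congr fun x => ?_
  by_cases hx : x ∈ S <;> simp [hx]

/-- The sample in the slots. -/
def drawn (s : ℕ) (a : ℕ → Slot) : Fin s → ℕ × ℕ := fun i => ((a i).id, (a i).w)

theorem sum_units {k : ℕ} (σ : List (Arrival k)) (φ : ℕ × ℕ → ℝ≥0∞) :
    ((units σ).map φ).sum = (σ.map fun x => (x.weight : ℝ≥0∞) * φ (x.ident, x.weight)).sum := by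
  induction σ with
  | nil => simp [units]
  | cons x σ ih =>
    have : units (x :: σ) = List.replicate x.weight (x.ident, x.weight) ++ units σ := rfl
    rw [this, List.map_append, List.sum_append, ih]
    simp

open Classical in
theorem expect_chain_units {k M : ℕ} (hM : 0 < M) {σ : List (Arrival k)} (hσ : 0 < totalWeight σ)
    (x : ℕ × ℕ) :
    expect (chain M (units σ) ⟨0, 0, 0, 0⟩) (fun t => if (t.id, t.w) = x then 1 else 0) =
      singleProb σ x := by
  have hl : units σ ≠ [] := fun h => by
    have := length_units σ
    rw [h] at this
    simp at this
    omega
  rw [expect_chain hM hl fun u => if u = x then 1 else 0, length_units, sum_units, singleProb,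
    div_eq_mul_inv, ← List.sum_map_mul_right]
  congr 1
  refine List.map_congr_left fun y _ => ?_
  split_ifs <;> simp [div_eq_mul_inv]

-- The indicator of a given sample is a product over the slots, so its value is a product of
-- single-slot laws. Starting from empty slots is harmless: the first unit always wins.
open Classical in
theorem streamVal_drawn {Γ : Par} (hM : 0 < Γ.M) {k : ℕ} {σ : List (Arrival k)}
    (hσ : 0 < totalWeight σ) (x : Fin Γ.s → ℕ × ℕ) :
    streamVal Γ 0 σ (fun a => Set.indicator {x} 1 (drawn Γ.s a)) emptySlots = swrProb σ Γ.s x := by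
  have h1 : (fun a => Set.indicator {x} (1 : (Fin Γ.s → ℕ × ℕ) → ℝ≥0∞) (drawn Γ.s a)) = fun a =>
      ∏ i ∈ Finset.range Γ.s, (fun i (t : Slot) => if h : i < Γ.s then
        (if (t.id, t.w) = x ⟨i, h⟩ then (1 : ℝ≥0∞) else 0) else 1) i (a i) := by
    funext a
    rw [Finset.prod_range]
    simp only [Fin.is_lt, dite_true, Fin.eta]
    rw [Finset.prod_ite_zero, Set.indicator_apply]
    simp only [drawn, Set.mem_singleton_iff, funext_iff, Pi.one_apply, Finset.mem_univ, true_imp_iff,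
      Finset.prod_const_one]
  rw [h1, streamVal_prod Γ σ (fun i (t : Slot) => if h : i < Γ.s then
        (if (t.id, t.w) = x ⟨i, h⟩ then (1 : ℝ≥0∞) else 0) else 1), swrProb, Finset.prod_range]
  refine Finset.prod_congr rfl fun i _ => ?_
  simp only [Fin.is_lt, dite_true, Fin.eta]
  exact expect_chain_units hM hσ (x i)

theorem streamVal_const (Γ : Par) {k : ℕ} (σ : List (Arrival k)) (c : ℝ≥0∞) (a : ℕ → Slot) :
    streamVal Γ 0 σ (fun _ => c) a = c := by
  have hop : ∀ (e w n : ℕ) a, Hop Γ e w 0 n (fun _ => c) a = c := by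
    intro e w n
    induction n with
    | zero => intro a; rfl
    | succ n ih => intro a; simp only [Hop, ih, zero_mul, zero_add, expect_const]
  induction σ generalizing a with
  | nil => rfl
  | cons x σ ih => simp only [streamVal, funext ih, hop]

/-! ### Sample and memory along the actual run -/

section Run

variable {Γ : Par} (hΓ : Γ.Std) {σ : List (Arrival Γ.k)} (hσ : σ ≠ [])
  (hx : ∀ x ∈ σ, 1 ≤ x.weight ∧ x.ident < 2 ^ Γ.b) (hQ : Γ.s * totalWeight σ < 2 ^ Γ.b)

include hΓ hσ hx hQ

/-- With prices zero, both the gain and the price of epochs vanish, and only the reward under the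
law of the ideal process remains. -/
theorem expect_run_le {F : State Γ.k → ℝ≥0∞} (hF : Sub Γ.s Γ.b F)
    {fend : (ℕ → Slot) → ℝ≥0∞}
    (hend : ∀ {j a π Q cm sm}, Bd Γ j a π Q cm → (∀ i, SiteOk Γ j (sm i)) → ∀ t act n,
      F (glob cm sm t act [] .sites [] [] [] n) ≤ fend a) (N : ℕ) :
    expect (run protocol Γ.s Γ.b σ N) F ≤ streamVal Γ 0 σ fend emptySlots := by
  refine (expect_run_le_val protocol Γ.s Γ.b σ 0 0 F N).trans ?_
  refine (le_iSup (fun N => val protocol Γ.b 0 0 F N _) N).trans ?_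
  have := stream_spec hΓ hF (α := 0) (β := 0) (by simp) (by simp) hend hσ hx hQ
  change totalVal protocol Γ.b 0 0 F _ ≤ _
  have hg : Γ.gain 0 = 0 := by simp [Par.gain]
  have hκ : Γ.epochCost 0 0 = 0 := by simp [Par.epochCost, Par.bcCost, hg]
  simpa only [hg, hκ, mul_zero, zero_mul, zero_add] using this

-- The indicator of a violation has value zero at the start. The condition `Sub` is trivial for it,
-- since it is imposed only in states without violation, where the indicator vanishes.
open Classical in
theorem memory_bound (N : ℕ) {g : State Γ.k} (hg : g ∈ (run protocol Γ.s Γ.b σ N).support) :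
    Zero (64 + 5 * Γ.s) (g.mem none) ∧ ∀ i, Zero 64 (g.mem (some i)) := by
  set F : State Γ.k → ℝ≥0∞ := fun g =>
    if Zero (64 + 5 * Γ.s) (g.mem none) ∧ ∀ i, Zero 64 (g.mem (some i)) then 0 else 1 with hF
  have h0 := expect_run_le hΓ hσ hx hQ (F := F) (fend := fun _ => 0)
    (fun g h1 h2 => by simp only [hF]; rw [if_pos ⟨h1, h2⟩]; exact zero_le)
    (fun hm hs t act n => by
      simp only [hF]
      rw [if_pos ⟨hm.rep.zero, fun i => (hs i).zero⟩]) N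
  rw [streamVal_const] at h0
  have h1 := le_antisymm h0 zero_le
  unfold expect at h1
  rw [ENNReal.tsum_eq_zero] at h1
  by_contra hbad
  have := h1 g
  simp only [hF] at this
  rw [if_neg hbad, mul_one] at this
  exact (PMF.mem_support_iff _ _).1 hg this

/-- Finished states are absorbing, so the indicator of a finished run with sample in `S` is an
admissible reward. At a regular end the stored sample is the one in the slots. -/
theorem sample_le (S : Set (Fin Γ.s → ℕ × ℕ)) (N : ℕ) :
    expect (run protocol Γ.s Γ.b σ N)
      (Set.indicator {g | g.Done ∧ g.sample protocol Γ.s ∈ S} 1) ≤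
      streamVal Γ 0 σ (fun a => S.indicator 1 (drawn Γ.s a)) emptySlots := by
  refine expect_run_le hΓ hσ hx hQ (fun g _ _ => ?_) (fun {j a π Q cm sm} hm hs t act n => ?_) N
  · by_cases hg : g.Done
    · rw [step_of_done hg, expect_pure]
    · rw [Set.indicator_of_notMem (by simp [hg])]
      exact zero_le
  · have hsamp : (glob cm sm t act [] .sites [] [] ([] : List (Arrival Γ.k)) n).sample protocol Γ.s =
        drawn Γ.s a := by
      funext i
      exact Prod.ext (hm.rep.id i i.2) (hm.rep.w i i.2)
    by_cases h : drawn Γ.s a ∈ S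
    · rw [Set.indicator_of_mem h]
      exact Set.indicator_le_self _ _ _
    · rw [Set.indicator_of_notMem h, Set.indicator_of_notMem]
      rintro ⟨-, h'⟩
      rw [hsamp] at h'
      exact h h'

/-- Upper bounds suffice: those for `{x}` and its complement add up to one, and the probability of
being unfinished after `N` steps is `O(1 / N)`, so the probability of `x` is squeezed. -/
theorem sample_tendsto (hM : 0 < Γ.M) (hW : 0 < totalWeight σ) {B : ℝ≥0∞} (hB : B ≠ ∞)
    (hN : totalVal protocol Γ.b 1 1 0 (State.init Γ.k Γ.s Γ.b σ) ≤ B)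
    (x : Fin Γ.s → ℕ × ℕ) :
    Tendsto (fun N => (run protocol Γ.s Γ.b σ N).toOuterMeasure
      {g | g.Done ∧ g.sample protocol Γ.s = x}) atTop (𝓝 (swrProb σ Γ.s x)) := by
  set q := swrProb σ Γ.s x with hq
  simp only [toOuterMeasure_eq_expect]
  have h1 : ∀ N, expect (run protocol Γ.s Γ.b σ N)
      (Set.indicator {g | g.Done ∧ g.sample protocol Γ.s = x} 1) ≤ q := by
    intro N
    rw [hq, ← streamVal_drawn hM hW]
    exact sample_le hΓ hσ hx hQ {x} N
  -- The summand `1` keeps the numerator nonzero, so that the quotient is infinite, and the claim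
  -- trivial, for `N = 0`.
  have h2 : ∀ N : ℕ, q ≤ expect (run protocol Γ.s Γ.b σ N)
      (Set.indicator {g | g.Done ∧ g.sample protocol Γ.s = x} 1) + (B + 1) / N := by
    intro N
    set p := run protocol Γ.s Γ.b σ N
    have hr := sample_le hΓ hσ hx hQ {x}ᶜ N
    set q' := streamVal Γ 0 σ (fun a => Set.indicator {x}ᶜ 1 (drawn Γ.s a)) emptySlots with hq'
    have hqq : q + q' = 1 := by
      rw [hq, ← streamVal_drawn hM hW, hq', ← streamVal_add]
      refine Eq.trans ?_ (streamVal_const Γ σ 1 emptySlots)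
      congr 1
      funext a
      exact congrFun (Set.indicator_self_add_compl {x} (1 : (Fin Γ.s → ℕ × ℕ) → ℝ≥0∞))
        (drawn Γ.s a)
    have hd : expect p (Set.indicator {g | ¬ g.Done} 1) ≤ (B + 1) / N := by
      rw [ENNReal.le_div_iff_mul_le (Or.inr (by simp)) (Or.inl (ENNReal.natCast_ne_top _)), mul_comm]
      exact (expect_notDone_le protocol Γ.s Γ.b σ N).trans
        ((le_iSup (fun N => val protocol Γ.b 1 1 0 N _) N).trans (hN.trans (le_add_right le_rfl)))
    have hsum : 1 ≤ expect p (Set.indicator {g | g.Done ∧ g.sample protocol Γ.s = x} 1) +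
        expect p (Set.indicator {g | g.Done ∧ g.sample protocol Γ.s ∈ ({x}ᶜ : Set _)} 1) +
        expect p (Set.indicator {g | ¬ g.Done} 1) := by
      rw [← expect_add, ← expect_add]
      refine (expect_const p 1).ge.trans (expect_mono _ fun g => ?_)
      by_cases hg : g.Done
      · by_cases hgx : g.sample protocol Γ.s = x <;> simp [hg, hgx]
      · simp [hg]
    have hq'fin : q' ≠ ∞ := ne_top_of_le_ne_top ENNReal.one_ne_top (hqq ▸ le_add_left le_rfl)
    refine (ENNReal.add_le_add_iff_right hq'fin).1 ?_
    rw [hqq]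
    calc 1 ≤ _ := hsum
      _ ≤ expect p (Set.indicator {g | g.Done ∧ g.sample protocol Γ.s = x} 1) + q' + (B + 1) / N :=
        add_le_add (add_le_add le_rfl hr) hd
      _ = _ := by ring
  have hqfin : q ≠ ∞ := by
    have h3 : q ≤ 1 + (B + 1) / (1 : ℕ) := by
      refine (h2 1).trans (add_le_add ?_ le_rfl)
      refine (expect_mono _ fun g => ?_).trans (expect_const _ _).le
      exact Set.indicator_le_self _ _ _
    refine ne_top_of_le_ne_top ?_ h3
    simp [hB]
  have hlim : Tendsto (fun N : ℕ => q - (B + 1) / N) atTop (𝓝 q) := by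
    have h3 : Tendsto (fun N : ℕ => (B + 1) / (N : ℝ≥0∞)) atTop (𝓝 0) := by
      have h4 := ENNReal.Tendsto.const_mul (a := B + 1) ENNReal.tendsto_inv_nat_nhds_zero
        (Or.inr (by simp [hB]))
      simpa [div_eq_mul_inv] using h4
    have := ENNReal.Tendsto.sub (tendsto_const_nhds (x := q)) h3 (Or.inl hqfin)
    simpa using this
  exact tendsto_of_tendsto_of_tendsto_of_le_of_le hlim tendsto_const_nhds
    (fun N => tsub_le_iff_right.2 (h2 N)) h1

end Run


/-! ## Expected potentials -/

/-- The slots after the arrivals of the units of a list. -/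
def law (Γ : Par) : List (ℕ × ℕ) → (ℕ → Slot) → PMF (ℕ → Slot)
  | [], a => PMF.pure a
  | u :: l, a => (trials Γ.M u.1 u.2 (List.range Γ.s) a).bind (law Γ l)

theorem law_append (Γ : Par) (l l' : List (ℕ × ℕ)) (a : ℕ → Slot) :
    law Γ (l ++ l') a = (law Γ l a).bind (law Γ l') := by
  induction l generalizing a with
  | nil => simp [law, PMF.pure_bind]
  | cons u l ih =>
    simp only [List.cons_append, law, PMF.bind_bind]
    congr 1
    funext a'
    exact ih a'

theorem expect_law_append_singleton (Γ : Par) (l : List (ℕ × ℕ)) (u : ℕ × ℕ) (a : ℕ → Slot)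
    (f : (ℕ → Slot) → ℝ≥0∞) : expect (law Γ (l ++ [u]) a) f =
      expect (law Γ l a) fun a' => expect (trials Γ.M u.1 u.2 (List.range Γ.s) a') f := by
  rw [law_append, expect_bind]
  congr 1
  funext a'
  have : law Γ [] = PMF.pure := rfl
  rw [law, this, PMF.bind_pure]

theorem expect_sum {α ι : Type*} (p : PMF α) (s : Finset ι) (f : ι → α → ℝ≥0∞) :
    expect p (fun a => ∑ i ∈ s, f i a) = ∑ i ∈ s, expect p (f i) := by
  unfold expect
  simp only [Finset.mul_sum]
  rw [Summable.tsum_finsetSum fun _ _ => ENNReal.summable]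

theorem expect_tsum {α : Type*} (p : PMF α) (f : ℕ → α → ℝ≥0∞) :
    expect p (fun a => ∑' i, f i a) = ∑' i, expect p (f i) := by
  unfold expect
  simp only [← ENNReal.tsum_mul_left]
  rw [ENNReal.tsum_comm]

/-- The marginal law of one slot: the product formula with all other factors equal to one. -/
theorem expect_trials_slot {M e w s i : ℕ} (hi : i < s) (φ : Slot → ℝ≥0∞) (a : ℕ → Slot) :
    expect (trials M e w (List.range s) a) (fun a => φ (a i)) =
      expect (unitS M e w M (a i)) φ := by
  have hi' : i ∈ Finset.range s := Finset.mem_range.2 hi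
  have h := expect_trials_prod M e w s (fun i' t => if i' = i then φ t else 1) (List.range s)
    List.nodup_range (fun i hi => List.mem_range.1 hi) a
  have h1 : ∀ a : ℕ → Slot, (∏ i' ∈ Finset.range s, if i' = i then φ (a i') else 1) = φ (a i) := by
    intro a
    rw [Finset.prod_eq_single i (fun j _ hj => if_neg hj) (fun h => absurd hi' h), if_pos rfl]
  simp only [h1] at h
  rw [h, Finset.prod_eq_single i (fun j hj hji => ?_) (fun h => absurd hi' h), if_pos (by simpa using hi)]
  · simp
  · rw [if_pos (by simpa using hj)]
    simp only [if_neg hji, expect_const]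

/-- A slot stays below the threshold only if the new score is not among the `M / R` largest ones; as
`R` divides `M`, this has probability exactly `stay R`. -/
theorem expect_unitS_low {M e w R : ℕ} (hR : 0 < R) (hM : 0 < M) (hd : R ∣ M) (t : Slot) :
    expect (unitS M e w M t) (fun t => if t.y < thr M R then 1 else 0) ≤
      stay R * if t.y < thr M R then 1 else 0 := by
  rw [expect_unitS hM]
  split_ifs with ht
  · refine (avg_mono (g := fun r => if r < M / R then 0 else 1) fun r hr => ?_).trans ?_
    · split_ifs with h
      · refine (expect_mono_supp _ (g := fun _ => 0) fun t' ht' => ?_).trans (expect_const _ _).le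
        rw [if_neg]
        have := Nat.div_le_self M R
        rcases hitS_support ht' with ⟨rfl, hlt⟩ | ⟨hle, r', rfl⟩
        · unfold thr; omega
        · rw [Slot.next_y]; unfold thr; omega
      · refine (expect_mono _ (g := fun _ => 1) fun t' => ?_).trans (expect_const _ _).le
        split_ifs <;> simp
    · rw [avg_ite (Nat.div_le_self M R), mul_zero, zero_add, mul_one, mul_one]
      obtain ⟨X, rfl⟩ := hd
      have hX : 0 < X := Nat.pos_of_mul_pos_left hM
      rw [Nat.mul_div_cancel_left _ hR, stay]
      have : R * X - X = (R - 1) * X := by rw [Nat.sub_mul, one_mul]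
      rw [this, Nat.cast_mul, Nat.cast_mul, ENNReal.mul_div_mul_right _ _ (by exact_mod_cast hX.ne')
        (ENNReal.natCast_ne_top _)]
  · rw [mul_zero, avg_congr (g := fun _ => 0) fun r hr => ?_, avg_const hM]
    refine le_antisymm ((expect_mono_supp _ (g := fun _ => 0) fun t' ht' => ?_).trans
      (expect_const _ _).le) zero_le
    rw [if_neg]
    rcases hitS_support ht' with ⟨rfl, hlt⟩ | ⟨hle, r', rfl⟩
    · exact ht
    · rw [Slot.next_y]; omega

/-- Here neither divisibility nor `R ≤ M` is needed: the probability of a score among the `M / R`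
largest ones is at most `1 / R` in any case. -/
theorem expect_unitS_high {M e w R : ℕ} (hM : 0 < M) (t : Slot) :
    expect (unitS M e w M t) (fun t => if thr M R ≤ t.y then 1 else 0) ≤
      (if thr M R ≤ t.y then 1 else 0) + (R : ℝ≥0∞)⁻¹ := by
  rw [expect_unitS hM]
  split_ifs with ht
  · refine le_add_right ((avg_mono (g := fun _ => 1) fun r _ => ?_).trans (avg_const hM _).le)
    refine (expect_mono _ (g := fun _ => 1) fun t' => ?_).trans (expect_const _ _).le
    split_ifs <;> simp
  · refine le_add_left ((avg_mono (g := fun r => if r < M / R then 1 else 0) fun r hr => ?_).trans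
      ((avg_lt_le _ _).trans ?_))
    · split_ifs with h
      · refine (expect_mono _ (g := fun _ => 1) fun t' => ?_).trans (expect_const _ _).le
        split_ifs <;> simp
      · refine (expect_mono_supp _ (g := fun _ => 0) fun t' ht' => ?_).trans (expect_const _ _).le
        rw [if_neg]
        rcases hitS_support ht' with ⟨rfl, hlt⟩ | ⟨hle, r', rfl⟩
        · exact ht
        · rw [Slot.next_y]; unfold thr; omega
    · rcases Nat.eq_zero_or_pos R with rfl | hR
      · simp
      have h1 : ((M / R : ℕ) : ℝ≥0∞) * R ≤ M := by exact_mod_cast Nat.div_mul_le_self M R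
      calc 1 * (((M / R : ℕ) : ℝ≥0∞) * (M : ℝ≥0∞)⁻¹) =
          ((M / R : ℕ) : ℝ≥0∞) * (M : ℝ≥0∞)⁻¹ * ((R : ℝ≥0∞)⁻¹ * R) := by
            rw [inv_mul_cancel_nat hR, one_mul, mul_one]
        _ = (((M / R : ℕ) : ℝ≥0∞) * R) * (M : ℝ≥0∞)⁻¹ * (R : ℝ≥0∞)⁻¹ := by ring
        _ ≤ M * (M : ℝ≥0∞)⁻¹ * (R : ℝ≥0∞)⁻¹ := by gcongr
        _ = _ := by rw [mul_comm (M : ℝ≥0∞), inv_mul_cancel_nat hM, one_mul]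

theorem cntLt_cast (s T : ℕ) (a : ℕ → Slot) :
    (cntLt s a T : ℝ≥0∞) = ∑ i ∈ Finset.range s, if (a i).y < T then 1 else 0 := by
  rw [cntLt, Finset.card_filter]
  push_cast
  rfl

theorem expect_law_cntLt {Γ : Par} {R : ℕ} (hR : 0 < R) (hM : 0 < Γ.M) (hd : R ∣ Γ.M)
    (l : List (ℕ × ℕ)) : expect (law Γ l emptySlots) (fun a => (cntLt Γ.s a (thr Γ.M R) : ℝ≥0∞)) ≤
      Γ.s * stay R ^ l.length := by
  induction l using List.reverseRecOn with
  | nil =>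
    rw [law, expect_pure]
    simp only [List.length_nil, pow_zero, mul_one]
    exact_mod_cast cntLt_le _ _ _
  | append_singleton l u ih =>
    rw [expect_law_append_singleton, List.length_append, List.length_singleton, pow_succ, ← mul_assoc]
    calc _ ≤ expect (law Γ l emptySlots) (fun a => stay R * (cntLt Γ.s a (thr Γ.M R) : ℝ≥0∞)) := by
          refine expect_mono _ fun a => ?_
          simp only [cntLt_cast, expect_sum, Finset.mul_sum]
          refine Finset.sum_le_sum fun i hi => ?_
          rw [expect_trials_slot (Finset.mem_range.1 hi) (fun t => if t.y < thr Γ.M R then 1 else 0)]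
          exact expect_unitS_low hR hM hd _
      _ ≤ _ := by
          rw [expect_const_mul, mul_comm]
          gcongr

theorem expect_law_high {Γ : Par} (R : ℕ) (hM : 0 < Γ.M) (l : List (ℕ × ℕ)) :
    expect (law Γ l emptySlots) (fun a => ∑ i ∈ Finset.range Γ.s,
      if thr Γ.M R ≤ (a i).y then 1 else 0) ≤ l.length * (Γ.s * (R : ℝ≥0∞)⁻¹) := by
  induction l using List.reverseRecOn with
  | nil =>
    rw [law, expect_pure, Finset.sum_eq_zero]
    · simp
    · intro i _
      rw [if_neg]
      unfold thr emptySlots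
      simp
  | append_singleton l u ih =>
    rw [expect_law_append_singleton]
    calc _ ≤ expect (law Γ l emptySlots) (fun a => (∑ i ∈ Finset.range Γ.s,
          if thr Γ.M R ≤ (a i).y then 1 else 0) + Γ.s * (R : ℝ≥0∞)⁻¹) := by
          refine expect_mono _ fun a => ?_
          rw [expect_sum]
          refine (Finset.sum_le_sum (g := fun i => (if thr Γ.M R ≤ (a i).y then 1 else 0) +
            (R : ℝ≥0∞)⁻¹) fun i hi => ?_).trans (le_of_eq ?_)
          · rw [expect_trials_slot (Finset.mem_range.1 hi) (fun t => if thr Γ.M R ≤ t.y then 1 else 0)]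
            exact expect_unitS_high hM _
          · rw [Finset.sum_add_distrib]
            simp
      _ ≤ l.length * (Γ.s * (R : ℝ≥0∞)⁻¹) + Γ.s * (R : ℝ≥0∞)⁻¹ := by
          rw [expect_add, expect_const]
          exact add_le_add ih le_rfl
      _ = _ := by rw [List.length_append, List.length_singleton]; push_cast; ring

theorem sum_stay_le {R : ℕ} (hR : 0 < R) (n : ℕ) : ∑ t ∈ Finset.range n, stay R ^ t ≤ R := by
  have h := sum_stay hR n
  rw [← Finset.mul_sum] at h
  calc _ = R * ((R : ℝ≥0∞)⁻¹ * ∑ t ∈ Finset.range n, stay R ^ t) := by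
        rw [← mul_assoc, mul_comm (R : ℝ≥0∞), inv_mul_cancel_nat hR, one_mul]
    _ ≤ R * 1 := by gcongr; rw [← h]; exact le_add_right le_rfl
    _ = R := mul_one _

/-- The first `R * n` terms are at most one. After that `2 ^ n * stay R ^ (R * n) ≤ 1`, and a
geometric series with sum at most `R` remains. -/
theorem sum_min_stay_le {R : ℕ} (hR : 0 < R) (n W : ℕ) :
    ∑ T ∈ Finset.range W, min 1 (2 ^ n * stay R ^ (T + 1)) ≤ ((n + 1 : ℕ) : ℝ≥0∞) * R := by
  have h1 : ∑ T ∈ Finset.range W, min 1 (2 ^ n * stay R ^ (T + 1)) ≤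
      ∑ T ∈ Finset.range (R * n + W), min 1 (2 ^ n * stay R ^ (T + 1)) :=
    Finset.sum_le_sum_of_subset (Finset.range_subset_range.2 (by omega))
  rw [Finset.sum_range_add] at h1
  have h2 : ∑ T ∈ Finset.range (R * n), min 1 (2 ^ n * stay R ^ (T + 1)) ≤ R * n := by
    refine (Finset.sum_le_sum fun T _ => min_le_left _ _).trans ?_
    simp
  have h3 : ∑ T ∈ Finset.range W, min 1 (2 ^ n * stay R ^ (R * n + T + 1)) ≤ R := by
    refine (Finset.sum_le_sum fun T _ => (min_le_right _ _).trans ?_).trans (sum_stay_le hR W)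
    calc 2 ^ n * stay R ^ (R * n + T + 1) = 2 ^ n * (stay R ^ R) ^ n * stay R ^ T * stay R := by ring
      _ ≤ 2 ^ n * (2⁻¹) ^ n * stay R ^ T * 1 := by
        gcongr
        · exact stay_pow_self_le hR
        · exact stay_le_one hR
      _ = stay R ^ T := by
        rw [← mul_pow, ENNReal.mul_inv_cancel (by simp) (by simp), one_pow, one_mul, mul_one]
  calc _ ≤ (R * n : ℝ≥0∞) + R := h1.trans (add_le_add h2 h3)
    _ = _ := by push_cast; ring


/-- Bound for the probability that after `T` units the slots are not fit for epoch `j`. -/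
def late (Γ : Par) (j T : ℕ) : ℝ≥0∞ :=
  min 1 (if Γ.R j ≤ Γ.M then min 1 (2 ^ Γ.ρ * stay (Γ.R j) ^ T) + min 1 (2 ^ Γ.lam * stay (Γ.Rv j) ^ T)
    else 1)

/-- Bound for the expected potential after `T` units. -/
def hbound (Γ : Par) (T : ℕ) : ℝ≥0∞ := ∑' j, ((Γ.R j : ℕ) : ℝ≥0∞)⁻¹ * late Γ (j + 1) T

/-! ### Expected potential and expected number of epochs -/

section Potential

variable {Γ : Par} (hΓ : Γ.Ok)
include hΓ

theorem Par.Ok.M_pos : 0 < Γ.M := by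
  obtain ⟨n, hn⟩ := hΓ.hM
  rw [hn]; positivity

-- Markov's inequality for the number of slots below each of the two thresholds. The factor `2 ^ ρ`
-- arises from `s / (lmax + 1)`, and `2 ^ lam` from bounding `s` itself.
open Classical in
theorem expect_law_not_adv (j : ℕ) (l : List (ℕ × ℕ)) :
    expect (law Γ l emptySlots) (fun a => if Adv Γ j a then 0 else 1) ≤ late Γ j l.length := by
  have hM := hΓ.M_pos
  have hle1 : ∀ (P : (ℕ → Slot) → Prop) [DecidablePred P],
      expect (law Γ l emptySlots) (fun a => if P a then 0 else 1) ≤ 1 := fun P _ =>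
    (expect_mono _ (g := fun _ => 1) fun a => by split_ifs <;> simp).trans (expect_const _ _).le
  refine le_min (hle1 _) ?_
  split_ifs with hRM
  · have hR := hΓ.R_pos j
    have hv := hΓ.Rv_pos j
    have hdR := hΓ.two_dvd (hΓ.R_two j) hRM
    have hdv := hΓ.two_dvd (hΓ.Rv_two j).1 ((hΓ.Rv_two j).2.1.trans hRM)
    have h1 : expect (law Γ l emptySlots)
        (fun a => if cntLt Γ.s a (thr Γ.M (Γ.R j)) ≤ Γ.lmax then 0 else 1) ≤
          2 ^ Γ.ρ * stay (Γ.R j) ^ l.length := by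
      calc _ ≤ expect (law Γ l emptySlots) (fun a => ((Γ.lmax + 1 : ℕ) : ℝ≥0∞)⁻¹ *
            (cntLt Γ.s a (thr Γ.M (Γ.R j)) : ℝ≥0∞)) := by
            refine expect_mono _ fun a => ?_
            split_ifs with h
            · exact zero_le
            · rw [← inv_mul_cancel_nat (Nat.succ_pos Γ.lmax)]
              gcongr
              omega
        _ ≤ ((Γ.lmax + 1 : ℕ) : ℝ≥0∞)⁻¹ * (Γ.s * stay (Γ.R j) ^ l.length) := by
            rw [expect_const_mul]
            gcongr
            exact expect_law_cntLt hR hM hdR l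
        _ ≤ ((Γ.lmax + 1 : ℕ) : ℝ≥0∞)⁻¹ * (((Γ.lmax + 1) * 2 ^ Γ.ρ : ℕ) *
            stay (Γ.R j) ^ l.length) := by
            gcongr
            rw [hΓ.hlmax]
            -- Rounding down in `lmax` is harmless: `s < (s / 2 ^ ρ + 1) * 2 ^ ρ`.
            have := Nat.lt_div_mul_add (a := Γ.s) (Nat.two_pow_pos Γ.ρ)
            linarith
        _ = ((Γ.lmax + 1 : ℕ) : ℝ≥0∞)⁻¹ * (Γ.lmax + 1 : ℕ) *
            (2 ^ Γ.ρ * stay (Γ.R j) ^ l.length) := by push_cast; ring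
        _ = _ := by rw [inv_mul_cancel_nat (Nat.succ_pos _), one_mul]
    have h2 : expect (law Γ l emptySlots)
        (fun a => if cntLt Γ.s a (thr Γ.M (Γ.Rv j)) = 0 then 0 else 1) ≤
          2 ^ Γ.lam * stay (Γ.Rv j) ^ l.length := by
      calc _ ≤ expect (law Γ l emptySlots) (fun a => (cntLt Γ.s a (thr Γ.M (Γ.Rv j)) : ℝ≥0∞)) := by
            refine expect_mono _ fun a => ?_
            split_ifs with h
            · exact zero_le
            · exact_mod_cast Nat.one_le_iff_ne_zero.2 h
        _ ≤ Γ.s * stay (Γ.Rv j) ^ l.length := expect_law_cntLt hv hM hdv l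
        _ ≤ _ := by
            gcongr
            exact_mod_cast hΓ.hslam.le
    refine le_trans ?_ (add_le_add (le_min (hle1 _) h1) (le_min (hle1 _) h2))
    rw [← expect_add]
    refine expect_mono _ fun a => ?_
    unfold Adv
    split_ifs <;> simp_all
  · exact hle1 _

theorem expect_law_hpot (l : List (ℕ × ℕ)) :
    expect (law Γ l emptySlots) (hpot Γ) ≤ hbound Γ l.length := by
  classical
  unfold hpot hbound
  rw [expect_tsum]
  refine ENNReal.tsum_le_tsum fun j => ?_
  calc _ = expect (law Γ l emptySlots)
        (fun a => ((Γ.R j : ℕ) : ℝ≥0∞)⁻¹ * if Adv Γ (j + 1) a then 0 else 1) := by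
        congr 1
        funext a
        split_ifs <;> simp
    _ ≤ _ := by
        rw [expect_const_mul]
        gcongr
        exact expect_law_not_adv hΓ _ _

/-- The first condition is met after about `ρ * R j` units. The second takes about `lam * Rv j ≤ R
j` units, so the laggards never dominate. -/
theorem sum_late_le {j : ℕ} (hRM : Γ.R j ≤ Γ.M) (W : ℕ) :
    ∑ T ∈ Finset.range W, late Γ j (T + 1) ≤ 3 * Γ.ρ * Γ.R j := by
  have hR := hΓ.R_pos j
  have hv := hΓ.Rv_pos j
  have hρ := hΓ.ρ_two
  have h2 : ∑ T ∈ Finset.range W, min 1 (2 ^ Γ.lam * stay (Γ.Rv j) ^ (T + 1)) ≤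
      2 * (Γ.R j : ℕ) := by
    -- If `R j < lam`, then `Rv j = 1` and `stay 1 = 0`, so these terms vanish from the first unit
    -- on.
    by_cases hlt : Γ.R j < Γ.lam
    · have : Γ.Rv j = 1 := by rw [Par.Rv, if_pos hlt, Nat.div_eq_of_lt hlt]
      rw [this, Finset.sum_eq_zero]
      · exact zero_le
      · intro T _
        simp [stay]
    · refine (sum_min_stay_le hv _ _).trans ?_
      have h3 : Γ.Rv j = Γ.R j / Γ.lam := by rw [Par.Rv, if_neg hlt, zero_add]
      have h4 := Nat.div_mul_le_self (Γ.R j) Γ.lam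
      have h5 := Nat.div_le_self (Γ.R j) Γ.lam
      rw [h3]
      have h6 : (Γ.lam + 1) * (Γ.R j / Γ.lam) ≤ 2 * Γ.R j := by
        calc _ = Γ.R j / Γ.lam * Γ.lam + Γ.R j / Γ.lam := by ring
          _ ≤ _ := by omega
      exact_mod_cast h6
  calc _ ≤ ∑ T ∈ Finset.range W, (min 1 (2 ^ Γ.ρ * stay (Γ.R j) ^ (T + 1)) +
        min 1 (2 ^ Γ.lam * stay (Γ.Rv j) ^ (T + 1))) := by
        refine Finset.sum_le_sum fun T _ => ?_
        unfold late
        rw [if_pos hRM]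
        exact min_le_right _ _
    _ ≤ ((Γ.ρ + 1 : ℕ) : ℝ≥0∞) * (Γ.R j : ℕ) + 2 * (Γ.R j : ℕ) := by
        rw [Finset.sum_add_distrib]
        exact add_le_add (sum_min_stay_le hR _ _) h2
    _ = ((Γ.ρ + 3 : ℕ) : ℝ≥0∞) * (Γ.R j : ℕ) := by push_cast; ring
    _ ≤ ((3 * Γ.ρ : ℕ) : ℝ≥0∞) * (Γ.R j : ℕ) := by
        gcongr
        omega
    _ = _ := by push_cast; ring

theorem tsum_inv_R (J : ℕ) : ∑' j, ((Γ.R (j + J) : ℕ) : ℝ≥0∞)⁻¹ ≤ 2 * ((Γ.R J : ℕ) : ℝ≥0∞)⁻¹ := by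
  have hρ := hΓ.ρ_two
  calc _ ≤ ∑' j : ℕ, ((Γ.R J : ℕ) : ℝ≥0∞)⁻¹ * (2⁻¹ : ℝ≥0∞) ^ j := by
        refine ENNReal.tsum_le_tsum fun j => ?_
        unfold Par.R
        rw [pow_add, Nat.cast_mul, ENNReal.mul_inv (Or.inr (ENNReal.natCast_ne_top _))
          (Or.inl (ENNReal.natCast_ne_top _)), mul_comm]
        gcongr
        rw [← ENNReal.inv_pow, Nat.cast_pow]
        gcongr
        exact_mod_cast hρ
    _ = _ := by
        rw [ENNReal.tsum_mul_left, ENNReal.tsum_geometric, ENNReal.one_sub_inv_two, inv_inv, mul_comm]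

/-- Each of the first `J` epochs contributes at most `3 * ρ * R (j + 1) / R j = 3 * ρ ^ 2`. Later
ones are bounded trivially by `W / R j`, a geometric tail. -/
theorem sum_hbound_le {J : ℕ} (hJ : Γ.R J ≤ Γ.M) (W : ℕ) :
    ∑ T ∈ Finset.range W, hbound Γ (T + 1) ≤
      3 * Γ.ρ ^ 2 * J + 2 * W * ((Γ.R J : ℕ) : ℝ≥0∞)⁻¹ := by
  have h1 : ∑ T ∈ Finset.range W, hbound Γ (T + 1) =
      ∑' j, ((Γ.R j : ℕ) : ℝ≥0∞)⁻¹ * ∑ T ∈ Finset.range W, late Γ (j + 1) (T + 1) := by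
    unfold hbound
    rw [← Summable.tsum_finsetSum fun _ _ => ENNReal.summable]
    simp only [Finset.mul_sum]
  rw [h1, ← Summable.sum_add_tsum_nat_add' (k := J) ENNReal.summable]
  refine add_le_add ?_ ?_
  · calc _ ≤ ∑ j ∈ Finset.range J, (3 * Γ.ρ ^ 2 : ℝ≥0∞) := by
          refine Finset.sum_le_sum fun j hj => ?_
          have hj' : Γ.R (j + 1) ≤ Γ.M :=
            (hΓ.R_mono (Nat.succ_le_of_lt (Finset.mem_range.1 hj))).trans hJ
          have hRs : Γ.R (j + 1) = Γ.R j * Γ.ρ := by rw [Par.R, Par.R, pow_succ]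
          calc _ ≤ ((Γ.R j : ℕ) : ℝ≥0∞)⁻¹ * (3 * Γ.ρ * (Γ.R (j + 1) : ℕ)) := by
                gcongr
                exact sum_late_le hΓ hj' W
            _ = (((Γ.R j : ℕ) : ℝ≥0∞)⁻¹ * (Γ.R j : ℕ)) * (3 * Γ.ρ ^ 2) := by
                rw [hRs]; push_cast; ring
            _ = _ := by rw [inv_mul_cancel_nat (hΓ.R_pos j), one_mul]
      _ = _ := by simp; ring
  · calc _ ≤ ∑' j, (W : ℝ≥0∞) * ((Γ.R (j + J) : ℕ) : ℝ≥0∞)⁻¹ := by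
          refine ENNReal.tsum_le_tsum fun j => ?_
          rw [mul_comm]
          gcongr
          refine (Finset.sum_le_sum fun T _ => (min_le_left _ _ : late Γ (j + J + 1) (T + 1) ≤ 1)).trans ?_
          simp
      _ ≤ W * (2 * ((Γ.R J : ℕ) : ℝ≥0∞)⁻¹) := by
          rw [ENNReal.tsum_mul_left]
          gcongr
          exact tsum_inv_R hΓ J
      _ = _ := by ring

-- Fitness for epoch `j` requires at least half of the slots to have reached the threshold, whereas
-- each has done so with probability at most `T / R j` after `T` units; Markov's inequality gives
-- the factor two.
open Classical in
theorem expect_law_adv (j : ℕ) (l : List (ℕ × ℕ)) :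
    expect (law Γ l emptySlots) (fun a => if Adv Γ j a then 1 else 0) ≤
      2 * l.length * ((Γ.R j : ℕ) : ℝ≥0∞)⁻¹ := by
  have hs := hΓ.hs
  have hl := hΓ.lmax_lt
  calc _ ≤ expect (law Γ l emptySlots) (fun a => 2 * (Γ.s : ℝ≥0∞)⁻¹ * ∑ i ∈ Finset.range Γ.s,
        if thr Γ.M (Γ.R j) ≤ (a i).y then 1 else 0) := by
        refine expect_mono _ fun a => ?_
        split_ifs with h
        · have h1 : (∑ i ∈ Finset.range Γ.s, if thr Γ.M (Γ.R j) ≤ (a i).y then (1 : ℝ≥0∞) else 0) +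
              (cntLt Γ.s a (thr Γ.M (Γ.R j)) : ℝ≥0∞) = Γ.s := by
            rw [cntLt_cast, ← Finset.sum_add_distrib, Finset.sum_congr rfl (g := fun _ => 1)]
            · simp
            · intro i _
              by_cases hi : (a i).y < thr Γ.M (Γ.R j)
              · rw [if_pos hi, if_neg (by omega), zero_add]
              · rw [if_neg hi, if_pos (by omega), add_zero]
          set S := ∑ i ∈ Finset.range Γ.s, if thr Γ.M (Γ.R j) ≤ (a i).y then (1 : ℝ≥0∞) else 0
          have h2 : (Γ.s : ℝ≥0∞) + 2 * (cntLt Γ.s a (thr Γ.M (Γ.R j)) : ℝ≥0∞) ≤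
              2 * Γ.s := by
            have := h.1
            exact_mod_cast (by omega : Γ.s + 2 * cntLt Γ.s a (thr Γ.M (Γ.R j)) ≤ 2 * Γ.s)
          rw [← h1, mul_add] at h2
          have h3 : (Γ.s : ℝ≥0∞) ≤ 2 * S := by
            rw [h1] at h2
            exact (ENNReal.add_le_add_iff_right (ENNReal.mul_ne_top (by simp)
              (ENNReal.natCast_ne_top _))).1 h2
          calc (1 : ℝ≥0∞) = (Γ.s : ℝ≥0∞)⁻¹ * Γ.s := (inv_mul_cancel_nat hs).symm
            _ ≤ (Γ.s : ℝ≥0∞)⁻¹ * (2 * S) := by gcongr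
            _ = _ := by ring
        · exact zero_le
    _ ≤ 2 * (Γ.s : ℝ≥0∞)⁻¹ * (l.length * (Γ.s * ((Γ.R j : ℕ) : ℝ≥0∞)⁻¹)) := by
        rw [expect_const_mul]
        gcongr
        exact expect_law_high _ hΓ.M_pos l
    _ = 2 * l.length * ((Γ.R j : ℕ) : ℝ≥0∞)⁻¹ * ((Γ.s : ℝ≥0∞)⁻¹ * Γ.s) := by ring
    _ = _ := by rw [inv_mul_cancel_nat hs, mul_one]

/-- The first `J` epochs are counted fully, and the rest is a geometric tail. There is no
restriction to `R j ≤ M`, as Markov's inequality does not need it. -/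
theorem expect_law_epochs (J : ℕ) (l : List (ℕ × ℕ)) :
    expect (law Γ l emptySlots) (epochs Γ) ≤
      J + 4 * l.length * ((Γ.R (J + 1) : ℕ) : ℝ≥0∞)⁻¹ := by
  classical
  unfold epochs
  rw [expect_tsum, ← Summable.sum_add_tsum_nat_add' (k := J) ENNReal.summable]
  refine add_le_add ?_ ?_
  · refine (Finset.sum_le_sum (g := fun _ => (1 : ℝ≥0∞)) fun j _ => ?_).trans (by simp)
    exact (expect_mono _ (g := fun _ => 1) fun a => by split_ifs <;> simp).trans (expect_const _ _).le
  · calc _ ≤ ∑' j, 2 * (l.length : ℝ≥0∞) * ((Γ.R (j + (J + 1)) : ℕ) : ℝ≥0∞)⁻¹ :=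
          ENNReal.tsum_le_tsum fun j => expect_law_adv hΓ _ _
      _ ≤ 2 * (l.length : ℝ≥0∞) * (2 * ((Γ.R (J + 1) : ℕ) : ℝ≥0∞)⁻¹) := by
          rw [ENNReal.tsum_mul_left]
          gcongr
          exact tsum_inv_R hΓ _
      _ = _ := by ring

/-- Linearity: `hpot` is paid after every unit, and its expectation depends only on the number of
units so far, not on the items. -/
theorem expect_law_Hop (e w : ℕ) (c : ℝ≥0∞) (f : (ℕ → Slot) → ℝ≥0∞) (n : ℕ) :
    ∀ l, expect (law Γ l emptySlots) (Hop Γ e w c n f) ≤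
      c * (∑ T ∈ Finset.range n, hbound Γ (l.length + T + 1)) +
        expect (law Γ (l ++ List.replicate n (e, w)) emptySlots) f := by
  induction n with
  | zero => intro l; simp [Hop]
  | succ n ih =>
    intro l
    have h1 : expect (law Γ l emptySlots) (Hop Γ e w c (n + 1) f) =
        expect (law Γ (l ++ [(e, w)]) emptySlots) fun a => c * hpot Γ a + Hop Γ e w c n f a := by
      rw [expect_law_append_singleton]
      rfl
    rw [h1, expect_add, expect_const_mul, List.replicate_succ,
      show l ++ (e, w) :: List.replicate n (e, w) = l ++ [(e, w)] ++ List.replicate n (e, w) by simp,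
      Finset.sum_range_succ']
    have h2 := expect_law_hpot hΓ (l ++ [(e, w)])
    have h3 := ih (l ++ [(e, w)])
    rw [List.length_append, List.length_singleton] at h2 h3
    calc _ ≤ c * hbound Γ (l.length + 1) + (c * (∑ T ∈ Finset.range n,
          hbound Γ (l.length + 1 + T + 1)) +
          expect (law Γ (l ++ [(e, w)] ++ List.replicate n (e, w)) emptySlots) f) :=
          add_le_add (mul_le_mul_right h2 c) h3
      _ = _ := by
        rw [Finset.sum_congr rfl fun T _ => by rw [show l.length + 1 + T + 1 = l.length + (T + 1) + 1
          by ring]]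
        simp only [add_zero]
        ring

theorem expect_law_streamVal {k : ℕ} (c : ℝ≥0∞) (f : (ℕ → Slot) → ℝ≥0∞) (σ : List (Arrival k)) :
    ∀ l, expect (law Γ l emptySlots) (streamVal Γ c σ f) ≤
      c * (∑ T ∈ Finset.range (totalWeight σ), hbound Γ (l.length + T + 1)) +
        expect (law Γ (l ++ units σ) emptySlots) f := by
  induction σ with
  | nil => intro l; simp [streamVal, units]
  | cons x σ ih =>
    intro l
    have htw : totalWeight (x :: σ) = x.weight + totalWeight σ := by simp [totalWeight]
    have hu : l ++ units (x :: σ) =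
        l ++ List.replicate x.weight (x.ident, x.weight) ++ units σ := by simp [units]
    have h1 := expect_law_Hop hΓ x.ident x.weight c (streamVal Γ c σ f) x.weight l
    have h2 := ih (l ++ List.replicate x.weight (x.ident, x.weight))
    rw [List.length_append, List.length_replicate] at h2
    rw [htw, hu, Finset.sum_range_add, streamVal]
    refine h1.trans ((add_le_add le_rfl h2).trans (le_of_eq ?_))
    simp only [add_assoc, mul_add]

theorem streamVal_epochs_le {k : ℕ} {J : ℕ} (hJ : Γ.R J ≤ Γ.M) (c κ : ℝ≥0∞)
    (σ : List (Arrival k)) :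
    streamVal Γ c σ (fun a => κ * epochs Γ a) emptySlots ≤
      c * (3 * Γ.ρ ^ 2 * J + 2 * totalWeight σ * ((Γ.R J : ℕ) : ℝ≥0∞)⁻¹) +
        κ * (J + 4 * totalWeight σ * ((Γ.R (J + 1) : ℕ) : ℝ≥0∞)⁻¹) := by
  have h := expect_law_streamVal hΓ c (fun a => κ * epochs Γ a) σ []
  rw [law, expect_pure, List.nil_append, expect_const_mul] at h
  refine h.trans (add_le_add ?_ ?_)
  · gcongr
    simpa using sum_hbound_le hΓ hJ (totalWeight σ)
  · gcongr
    have := expect_law_epochs hΓ J (units σ)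
    rwa [length_units] at this

end Potential


/-! ## Estimates -/

theorem sq_le_two_pow_succ (n : ℕ) : n ^ 2 ≤ 2 ^ (n + 1) := by
  rcases lt_or_ge n 3 with h | h
  · interval_cases n <;> norm_num
  · induction n, h using Nat.le_induction with
    | base => norm_num
    | succ n hn ih => rw [pow_succ 2 (n + 1)]; nlinarith

theorem two_pow_rhoExp_le {k s : ℕ} (hk : 1 ≤ k) (hs : 1 ≤ s) : 2 ^ rhoExp k s ≤ 2 * k := by
  have h1 := (rhoExp_mem k hs).1
  rcases Nat.lt_or_ge 1 (rhoExp k s) with h | h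
  · obtain ⟨q, hq⟩ : ∃ q, rhoExp k s = q + 1 := ⟨rhoExp k s - 1, by omega⟩
    have h2 := lt_of_lt_rhoExp (k := k) (s := s) (q := q) (by omega) (by omega)
    have h3 : 2 ^ q ≤ (2 ^ q) ^ 4 * s :=
      (Nat.le_self_pow (by norm_num) _).trans (Nat.le_mul_of_pos_right _ hs)
    rw [hq, pow_succ]
    omega
  · rw [show rhoExp k s = 1 by omega]; omega

/-- If `ρ = 2 * x` with `x ≥ 2`, minimality gives `x ^ 4 * s < k`, and `ρ ^ 2 = 4 * x ^ 2 ≤ x ^ 4`.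
The term `4 * s` is for `ρ = 2`. -/
theorem sq_two_pow_rhoExp_le {k s : ℕ} (hs : 1 ≤ s) : s * (2 ^ rhoExp k s) ^ 2 ≤ 4 * s + k := by
  have h1 := (rhoExp_mem k hs).1
  rcases Nat.lt_or_ge 1 (rhoExp k s) with h | h
  · obtain ⟨q, hq⟩ : ∃ q, rhoExp k s = q + 1 := ⟨rhoExp k s - 1, by omega⟩
    have h2 := lt_of_lt_rhoExp (k := k) (s := s) (q := q) (by omega) (by omega)
    have h3 : 2 ≤ 2 ^ q := Nat.le_self_pow (by omega) 2
    rw [hq, pow_succ 2 q]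
    generalize 2 ^ q = x at *
    have h4 : 4 * x ^ 2 ≤ x ^ 4 := by
      calc 4 * x ^ 2 = 2 ^ 2 * x ^ 2 := by ring
        _ ≤ x ^ 2 * x ^ 2 := by gcongr
        _ = _ := by ring
    calc s * (x * 2) ^ 2 = (4 * x ^ 2) * s := by ring
      _ ≤ x ^ 4 * s := Nat.mul_le_mul_right _ h4
      _ ≤ _ := by omega
  · rw [show rhoExp k s = 1 by omega]; omega

theorem two_pow_lamExp_le {s : ℕ} (hs : 1 ≤ s) : 2 ^ lamExp s ≤ 2 * s := by
  rcases Nat.eq_zero_or_pos (lamExp s) with h | h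
  · rw [h]; omega
  · obtain ⟨l, hl⟩ : ∃ l, lamExp s = l + 1 := ⟨lamExp s - 1, by omega⟩
    have h2 := le_of_lt_lamExp (s := s) (l := l) (by omega)
    have h3 : 2 ^ l < 2 ^ 2 ^ l := Nat.lt_two_pow_self
    rw [hl, pow_succ]
    omega

/-- By minimality half of `lam` is at most `log₂ s`, unless `lam = 1`; and `2 / log 2 ≤ 3`. -/
theorem two_pow_lamExp_le_log {s : ℕ} (hs : 1 ≤ s) :
    ((2 ^ lamExp s : ℕ) : ℝ) ≤ 1 + 3 * Real.log s := by
  have hs' : (1 : ℝ) ≤ s := by exact_mod_cast hs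
  have hlog := Real.log_nonneg hs'
  rcases Nat.eq_zero_or_pos (lamExp s) with h | h
  · rw [h]; simp; linarith
  · obtain ⟨l, hl⟩ : ∃ l, lamExp s = l + 1 := ⟨lamExp s - 1, by omega⟩
    have h2 : ((2 : ℝ) ^ 2 ^ l) ≤ s := by exact_mod_cast le_of_lt_lamExp (s := s) (l := l) (by omega)
    have h3 := Real.log_le_log (by positivity) h2
    rw [Real.log_pow] at h3
    have h4 := Real.log_two_gt_d9
    rw [hl, pow_succ]
    push_cast at h3 ⊢
    have h5 : (0 : ℝ) ≤ 2 ^ l := by positivity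
    nlinarith

/-! ### Parameters compared with `k + s log s` and `log (2 + k / s)` -/

section Estimates

variable {k s W : ℕ} (hk : 1 ≤ k) (hs : 1 ≤ s) (hW : 2 ≤ W)

/-- The factor `k + s log s`. -/
def base (k s : ℕ) : ℝ := (k : ℝ) + s * Real.log s

include hs in
theorem le_base_left : (k : ℝ) ≤ base k s := by
  have : (0 : ℝ) ≤ s * Real.log s := by
    have hs' : (1 : ℝ) ≤ s := by exact_mod_cast hs
    have := Real.log_nonneg hs'
    positivity
  unfold base; linarith

include hk hs in
theorem le_base_right : (s : ℝ) ≤ 2 * base k s := by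
  have hk' : (1 : ℝ) ≤ k := by exact_mod_cast hk
  rcases Nat.lt_or_ge 1 s with h | h
  · have hs' : (2 : ℝ) ≤ s := by exact_mod_cast h
    have h1 := Real.log_le_log (by norm_num) hs'
    have h2 := Real.log_two_gt_d9
    unfold base
    nlinarith
  · have : s = 1 := by omega
    subst this
    unfold base
    simp
    linarith

include hs in
theorem log_ratio_pos : 0 < Real.log (2 + (k : ℝ) / s) := by
  refine Real.log_pos ?_
  have : (0 : ℝ) ≤ (k : ℝ) / s := by positivity
  linarith

include hs in
-- From `k / s ≤ ρ ^ 4` and `ρ ≥ 2` it follows that `2 + k / s ≤ ρ ^ 5`.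
theorem log_ratio_le : Real.log (2 + (k : ℝ) / s) ≤ 5 * Real.log (2 ^ rhoExp k s : ℕ) := by
  obtain ⟨h1, h2⟩ := rhoExp_mem k hs
  have hρ : 2 ≤ 2 ^ rhoExp k s := Nat.le_self_pow (by omega) 2
  generalize 2 ^ rhoExp k s = ρ at *
  have hs' : (0 : ℝ) < s := by exact_mod_cast hs
  have h3 : (k : ℝ) / s ≤ (ρ : ℝ) ^ 4 := by
    rw [div_le_iff₀ hs']
    exact_mod_cast h2
  have hρ' : (2 : ℝ) ≤ ρ := by exact_mod_cast hρ
  have h0 : (0 : ℝ) ≤ (k : ℝ) / s := by positivity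
  have h4 : 2 + (k : ℝ) / s ≤ (ρ : ℝ) ^ 5 := by
    have h5 : (2 : ℝ) ^ 4 ≤ (ρ : ℝ) ^ 4 := by gcongr
    nlinarith [mul_le_mul_of_nonneg_right hρ' (by positivity : (0 : ℝ) ≤ (ρ : ℝ) ^ 4)]
  have h6 := Real.log_le_log (by linarith) h4
  rw [Real.log_pow] at h6
  exact_mod_cast h6

include hk hs in
theorem mul_log_ratio_le : s * Real.log (2 + (k : ℝ) / s) ≤ 3 * base k s := by
  have hs' : (0 : ℝ) < s := by exact_mod_cast hs
  have h0 : (0 : ℝ) ≤ (k : ℝ) / s := by positivity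
  have h1 := Real.log_le_sub_one_of_pos (by linarith : 0 < 2 + (k : ℝ) / s)
  have h2 := le_base_left (k := k) hs
  have h3 := le_base_right hk hs
  calc s * Real.log (2 + (k : ℝ) / s) ≤ s * (2 + (k : ℝ) / s - 1) := by gcongr
    _ = s + k := by field_simp; ring
    _ ≤ _ := by linarith

-- The reason for tolerating only `s / 2 ^ ρ` laggards: with `ρ ^ 2 ≤ 2 ^ (ρ + 1)` their share `lmax
-- * ρ ^ 2` is at most `2 * s`, so the factor `lam` multiplies `s` but not `s * ρ ^ 2`.
include hk hs in
theorem mul_sq_le : ((s + s / 2 ^ 2 ^ rhoExp k s * 2 ^ lamExp s : ℕ) : ℝ) *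
    ((2 ^ rhoExp k s : ℕ) : ℝ) ^ 2 ≤ 18 * base k s := by
  have h1 : (s : ℝ) * ((2 ^ rhoExp k s : ℕ) : ℝ) ^ 2 ≤ 4 * s + k := by
    exact_mod_cast sq_two_pow_rhoExp_le (k := k) hs
  have h2 := two_pow_lamExp_le_log hs
  have h3 : ((s / 2 ^ 2 ^ rhoExp k s : ℕ) : ℝ) * ((2 ^ rhoExp k s : ℕ) : ℝ) ^ 2 ≤ 2 * s := by
    have h4 := sq_le_two_pow_succ (2 ^ rhoExp k s)
    have h5 := Nat.div_mul_le_self s (2 ^ 2 ^ rhoExp k s)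
    have h6 : s / 2 ^ 2 ^ rhoExp k s * (2 ^ rhoExp k s) ^ 2 ≤ 2 * s := by
      calc _ ≤ s / 2 ^ 2 ^ rhoExp k s * 2 ^ (2 ^ rhoExp k s + 1) := Nat.mul_le_mul_left _ h4
        _ = 2 * (s / 2 ^ 2 ^ rhoExp k s * 2 ^ 2 ^ rhoExp k s) := by ring
        _ ≤ _ := by omega
    exact_mod_cast h6
  have h7 := le_base_left (k := k) hs
  have h8 := le_base_right hk hs
  have hlog : 0 ≤ Real.log s := Real.log_nonneg (by exact_mod_cast hs)
  have hx : (0 : ℝ) ≤ ((s / 2 ^ 2 ^ rhoExp k s : ℕ) : ℝ) := Nat.cast_nonneg _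
  rw [Nat.cast_add, Nat.cast_mul]
  generalize ((2 ^ lamExp s : ℕ) : ℝ) = lam at *
  generalize ((2 ^ rhoExp k s : ℕ) : ℝ) = ρ at *
  generalize ((s / 2 ^ 2 ^ rhoExp k s : ℕ) : ℝ) = x at *
  calc (s + x * lam) * ρ ^ 2 = s * ρ ^ 2 + lam * (x * ρ ^ 2) := by ring
    _ ≤ 4 * s + k + lam * (x * ρ ^ 2) := by linarith
    _ ≤ 4 * s + k + (1 + 3 * Real.log s) * (2 * s) := by
      have : lam * (x * ρ ^ 2) ≤ (1 + 3 * Real.log s) * (2 * s) := by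
        gcongr
      linarith
    _ = 6 * s + k + 6 * (s * Real.log s) := by ring
    _ ≤ _ := by unfold base at *; nlinarith

end Estimates


/-- Total cost of the coordinator, if the epochs up to the `J`-th are treated separately. -/
def totalCost (k s W ρ lam D J : ℝ) (P P' : ℝ) : ℝ :=
  (200 * (s + ρ + lam) + 610) + 1800 * D * (3 * ρ ^ 2 * J + 2 * W * P⁻¹) +
    (1800 * D + 130 * s + 33 * k) * (J + 4 * W * P'⁻¹)

/-- The estimate of `totalCost` in abstract form. -/
theorem totalCost_le {k s W ρ lam D J P P' B ℓ m : ℝ} (hk : 1 ≤ k) (hs : 1 ≤ s) (hρ : 2 ≤ ρ)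
    (hlam : lam ≤ 2 * s) (hD : 0 ≤ D) (hJ : 0 ≤ J) (hℓ : 0 < ℓ) (hB1 : k ≤ B) (hB2 : s ≤ 2 * B)
    (hsℓ : s * ℓ ≤ 3 * B) (hsρ : s * ρ ^ 2 ≤ 4 * s + k) (hDρ : D * ρ ^ 2 ≤ 18 * B)
    (hW : 2 / 3 ≤ m * ℓ) (hℓρ : ℓ ≤ 5 * Real.log ρ) (hJm : J ≤ 5 * m)
    (hfirst : (1 ≤ J ∧ W * P⁻¹ ≤ ρ ∧ W * P'⁻¹ ≤ 1) ∨
      (J = 0 ∧ W * P⁻¹ ≤ 15 * ρ * m ∧ W * P'⁻¹ ≤ 15 * m)) :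
    totalCost k s W ρ lam D J P P' ≤ 4000000 * (B * m) := by
  have hB : 0 < B := by linarith
  have hm : 0 < m := by
    by_contra h
    push Not at h
    nlinarith
  have hDB : D ≤ 18 * B := by
    have : 1 ≤ ρ ^ 2 := by nlinarith
    nlinarith
  have hDρ1 : D * ρ ≤ 18 * B := by
    have : ρ ≤ ρ ^ 2 := by nlinarith
    nlinarith
  -- Here `m` stands for `log W / ℓ`. As `m * ℓ = log W ≥ 2 / 3`, a quantity `x` with `x * ℓ = O(B)`
  -- is `O(B * m)`, even if `m` itself is small.
  have hs' : s ≤ 5 * (B * m) := by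
    by_contra h
    push Not at h
    have h1 : 5 * (B * m) * ℓ ≤ 3 * B := (mul_le_mul_of_nonneg_right h.le hℓ.le).trans hsℓ
    have h2 : B * (2 / 3) ≤ B * (m * ℓ) := by gcongr
    nlinarith
  have hρ' : ρ ≤ 70 * (B * m) := by
    have hlog : Real.log ρ ≤ ρ := by
      have := Real.log_le_sub_one_of_pos (by linarith : 0 < ρ); linarith
    have h0 : ρ * ℓ ≤ 45 * B := by
      calc ρ * ℓ ≤ ρ * (5 * ρ) := by gcongr; linarith
        _ = 5 * (1 * ρ ^ 2) := by ring
        _ ≤ 5 * (s * ρ ^ 2) := by gcongr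
        _ ≤ _ := by linarith
    by_contra h
    push Not at h
    have h1 : 70 * (B * m) * ℓ ≤ 45 * B := (mul_le_mul_of_nonneg_right h.le hℓ.le).trans h0
    have h2 : B * (2 / 3) ≤ B * (m * ℓ) := by gcongr
    nlinarith
  have hE : 1800 * D + 130 * s + 33 * k ≤ 33000 * B := by linarith
  have hE0 : 0 ≤ 1800 * D + 130 * s + 33 * k := by linarith
  have hsetup : 200 * (s + ρ + lam) + 610 ≤ 21000 * (B * m) := by linarith
  unfold totalCost
  rcases hfirst with ⟨hJ1, hP, hP'⟩ | ⟨rfl, hP, hP'⟩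
  · have h1 : 3 * ρ ^ 2 * J + 2 * W * P⁻¹ ≤ 5 * ρ ^ 2 * J := by
      have : ρ ≤ ρ ^ 2 * J := by nlinarith [mul_nonneg hJ (sq_nonneg ρ)]
      nlinarith
    have h2 : J + 4 * W * P'⁻¹ ≤ 25 * m := by nlinarith
    have h3 : 1800 * D * (3 * ρ ^ 2 * J + 2 * W * P⁻¹) ≤ 810000 * (B * m) := by
      calc _ ≤ 1800 * D * (5 * ρ ^ 2 * J) := by gcongr
        _ = 9000 * (D * ρ ^ 2) * J := by ring
        _ ≤ 9000 * (18 * B) * (5 * m) := by gcongr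
        _ = _ := by ring
    have h4 : (1800 * D + 130 * s + 33 * k) * (J + 4 * W * P'⁻¹) ≤ 33000 * B * (25 * m) := by
      calc _ ≤ (1800 * D + 130 * s + 33 * k) * (25 * m) := by gcongr
        _ ≤ _ := by gcongr
    have : 0 ≤ B * m := by positivity
    nlinarith
  · have h2 : (0 : ℝ) + 4 * W * P'⁻¹ ≤ 60 * m := by nlinarith
    have h3 : 1800 * D * (3 * ρ ^ 2 * 0 + 2 * W * P⁻¹) ≤ 972000 * (B * m) := by
      calc _ ≤ 1800 * D * (2 * (15 * ρ * m)) := by gcongr; nlinarith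
        _ = 54000 * (D * ρ) * m := by ring
        _ ≤ 54000 * (18 * B) * m := by gcongr
        _ = _ := by ring
    have h4 : (1800 * D + 130 * s + 33 * k) * (0 + 4 * W * P'⁻¹) ≤ 33000 * B * (60 * m) := by
      calc _ ≤ (1800 * D + 130 * s + 33 * k) * (60 * m) := by gcongr
        _ ≤ _ := by gcongr
    have : 0 ≤ B * m := by positivity
    nlinarith

/-- The cut-off `J = ⌊log_ρ W⌋` is natural: before it the epochs are counted one by one, beyond it
the geometric tails are small because `W < ρ ^ (J + 1)`. -/
theorem totalCost_le_messageBound {k s W : ℕ} (hk : 1 ≤ k) (hs : 1 ≤ s) (hW : 2 ≤ W) :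
    totalCost k s W (2 ^ rhoExp k s : ℕ) (2 ^ lamExp s : ℕ)
      (s + s / 2 ^ 2 ^ rhoExp k s * 2 ^ lamExp s : ℕ) (Nat.log (2 ^ rhoExp k s) W : ℕ)
      ((2 ^ rhoExp k s : ℕ) ^ Nat.log (2 ^ rhoExp k s) W)
      ((2 ^ rhoExp k s : ℕ) ^ (Nat.log (2 ^ rhoExp k s) W + 1)) ≤
      4000000 * messageBound k s W := by
  have hℓ := log_ratio_pos (k := k) hs
  have hℓρ := log_ratio_le (k := k) hs
  have hB1 := le_base_left (k := k) hs
  have hB2 := le_base_right hk hs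
  have hsℓ := mul_log_ratio_le hk hs
  have hDρ := mul_sq_le hk hs
  have hsρ : (s : ℝ) * ((2 ^ rhoExp k s : ℕ) : ℝ) ^ 2 ≤ 4 * s + k := by
    exact_mod_cast sq_two_pow_rhoExp_le (k := k) hs
  have hlam : ((2 ^ lamExp s : ℕ) : ℝ) ≤ 2 * s := by exact_mod_cast two_pow_lamExp_le hs
  have hρ : 2 ≤ 2 ^ rhoExp k s := Nat.le_self_pow (by have := (rhoExp_mem k hs).1; omega) 2
  have hmb : messageBound k s W = base k s * (Real.log W / Real.log (2 + (k : ℝ) / s)) := rfl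
  rw [hmb]
  generalize hD : ((s + s / 2 ^ 2 ^ rhoExp k s * 2 ^ lamExp s : ℕ) : ℝ) = D at *
  have hD0 : 0 ≤ D := by rw [← hD]; exact Nat.cast_nonneg _
  generalize 2 ^ rhoExp k s = ρ at *
  generalize ((2 ^ lamExp s : ℕ) : ℝ) = lam at *
  generalize Real.log (2 + (k : ℝ) / s) = ℓ at *
  set J := Nat.log ρ W with hJ
  have hρ' : (2 : ℝ) ≤ ρ := by exact_mod_cast hρ
  have hW' : (2 : ℝ) ≤ W := by exact_mod_cast hW
  have hlogρ : 0 < Real.log ρ := Real.log_pos (by linarith)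
  have hlog2 := Real.log_two_gt_d9
  have hL : 2 / 3 ≤ Real.log W := by
    have := Real.log_le_log (by norm_num) hW'
    linarith
  have hpowW : ρ ^ J ≤ W := Nat.pow_log_le_self ρ (by omega)
  have hWpow : W < ρ ^ (J + 1) := Nat.lt_pow_succ_log_self hρ W
  have hml : Real.log W / ℓ * ℓ = Real.log W := div_mul_cancel₀ _ hℓ.ne'
  refine totalCost_le (ℓ := ℓ) (by exact_mod_cast hk) (by exact_mod_cast hs) hρ' hlam hD0
    (Nat.cast_nonneg _) hℓ hB1 hB2 hsℓ hsρ hDρ (by rw [hml]; exact hL) hℓρ ?_ ?_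
  · have h1 : (ρ : ℝ) ^ J ≤ W := by exact_mod_cast hpowW
    have h2 := Real.log_le_log (by positivity) h1
    rw [Real.log_pow] at h2
    rw [← mul_div_assoc, le_div_iff₀ hℓ]
    have hJ0 : (0 : ℝ) ≤ J := Nat.cast_nonneg _
    nlinarith
  · have hP1 : (W : ℝ) * ((ρ : ℝ) ^ (J + 1))⁻¹ ≤ 1 := by
      rw [← div_eq_mul_inv, div_le_one (by positivity)]
      exact_mod_cast hWpow.le
    -- If `W < ρ`, then `J = 0` cannot absorb constants, and the tails must be compared with `log W
    -- / ℓ`, which may be below one.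
    rcases Nat.eq_zero_or_pos J with h0 | h0
    · right
      rw [h0] at hWpow ⊢
      rw [zero_add, pow_one] at hWpow
      have hWρ : (W : ℝ) ≤ ρ := by exact_mod_cast hWpow.le
      -- Up to a constant this says that `x / log x` grows. It follows from `log x ≤ x - 1` at `x =
      -- ρ / W`, together with `log W ≥ 2 / 3`.
      have hWlog : (W : ℝ) * Real.log ρ ≤ 3 * ρ * Real.log W := by
        have h1 : Real.log ρ ≤ Real.log W + (ρ / W - 1) := by
          have h2 := Real.log_le_sub_one_of_pos (by positivity : 0 < (ρ : ℝ) / W)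
          rw [Real.log_div (by linarith) (by linarith)] at h2
          linarith
        calc (W : ℝ) * Real.log ρ ≤ W * (Real.log W + (ρ / W - 1)) := by gcongr
          _ = W * Real.log W + ρ - W := by field_simp; ring
          _ ≤ ρ * Real.log W + ρ * (3 / 2 * Real.log W) := by nlinarith
          _ ≤ _ := by nlinarith
      have hWm : (W : ℝ) ≤ 15 * ρ * (Real.log W / ℓ) := by
        rw [← mul_div_assoc, le_div_iff₀ hℓ]
        nlinarith
      refine ⟨by simp, by simpa using hWm, ?_⟩
      rw [zero_add, pow_one, ← div_eq_mul_inv, div_le_iff₀ (by linarith)]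
      linarith
    · left
      refine ⟨by exact_mod_cast h0, ?_, hP1⟩
      have h1 : (W : ℝ) * ((ρ : ℝ) ^ J)⁻¹ = ρ * (W * ((ρ : ℝ) ^ (J + 1))⁻¹) := by
        rw [pow_succ]; field_simp
      rw [h1]
      nlinarith

/-! ## Choice of the parameters -/

/-- Parameters for word length `b`. -/
def stdPar (k s b : ℕ) : Par where
  k := k
  s := s
  b := b
  M := 2 ^ (b / 8)
  ρ := 2 ^ rhoExp k s
  lam := 2 ^ lamExp s
  lmax := s / 2 ^ 2 ^ rhoExp k s

/-- With `t = b / 32`, every quantity in the input is below `2 ^ (t + 1) ≤ 2 ^ (2 * t)`. The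
exponent `32` leaves room for `M = 2 ^ (b / 8)`, for products such as `M * ρ`, and for `ρ ^ 4 * s`.
-/
theorem stdPar_spec {k s b n W : ℕ} (hk : 1 ≤ k) (hs : 1 ≤ s) (hn : 1 ≤ n) (hW : 1 ≤ W)
    (h : (2 * k * s * n * W) ^ 32 ≤ 2 ^ b) :
    (stdPar k s b).Std ∧ W ≤ 2 ^ (b / 8) ∧ s * W < 2 ^ b := by
  set X := 2 * k * s * n * W with hX
  have hXk : 2 * k ≤ X := by
    calc 2 * k = 2 * k * 1 * 1 * 1 := by ring
      _ ≤ _ := by rw [hX]; gcongr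
  have hXs : 2 * s * W ≤ X := by
    calc 2 * s * W = 2 * 1 * s * 1 * W := by ring
      _ ≤ _ := by rw [hX]; gcongr
  have hsW : s ≤ s * W := Nat.le_mul_of_pos_right s hW
  have hWs : W ≤ s * W := Nat.le_mul_of_pos_left W hs
  rw [mul_assoc] at hXs
  set t := b / 32 with ht
  have hXt : X < 2 ^ (t + 1) := by
    by_contra hcon
    have h1 : (2 ^ (t + 1)) ^ 32 ≤ 2 ^ b := (Nat.pow_le_pow_left (not_lt.1 hcon) 32).trans h
    rw [← pow_mul, Nat.pow_le_pow_iff_right (by norm_num)] at h1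
    omega
  have hb : 32 ≤ b := by
    have h1 : 2 ^ 32 ≤ 2 ^ b := (Nat.pow_le_pow_left (by omega : 2 ≤ X) 32).trans h
    rwa [Nat.pow_le_pow_iff_right (by norm_num)] at h1
  have ht1 : 1 ≤ t := by omega
  set Y := 2 ^ (2 * t) with hY
  have hXY : X ≤ Y := hXt.le.trans (Nat.pow_le_pow_right (by norm_num) (by omega))
  have hpow : ∀ {i j : ℕ}, i ≤ j → 2 ^ i ≤ 2 ^ j := fun h => Nat.pow_le_pow_right (by norm_num) h
  have hYM : Y ≤ 2 ^ (b / 8) := hpow (by omega)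
  have hY16 : Y ≤ 2 ^ (b - 4) := hpow (by omega)
  have hb16 : 2 ^ b = 16 * 2 ^ (b - 4) := by
    rw [show b = (b - 4) + 4 by omega, pow_add]; simp; ring
  have hbig : 2 ^ 28 ≤ 2 ^ (b - 4) := hpow (by omega)
  have hρ2k := two_pow_rhoExp_le hk hs
  have hlam2 := two_pow_lamExp_le hs
  refine ⟨{
    hk := hk, hs := hs, hM := ⟨_, rfl⟩, hρ := ⟨_, (rhoExp_mem k hs).1, rfl⟩, hlam := ⟨_, rfl⟩
    hslam := lamExp_mem s, hlmax := rfl, M_eq := rfl, ρ_eq := rfl, lam_eq := rfl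
    bMM := ?_, bMρ := ?_, bs := ?_, bk := ?_, blam := ?_, bρ4 := ?_ }, ?_, ?_⟩
  · simp only [stdPar]
    rw [← pow_add]
    exact Nat.pow_lt_pow_right (by norm_num) (by omega)
  · simp only [stdPar]
    have h1 : 2 ^ (b / 8) * 2 ^ rhoExp k s ≤ 2 ^ (b / 8) * Y := Nat.mul_le_mul_left _ (by omega)
    have h2 : 2 ^ (b / 8) * Y ≤ 2 ^ (b - 4) := by
      rw [hY, ← pow_add]; exact hpow (by omega)
    have h3 : 2 ^ (b / 8) ≤ 2 ^ (b - 4) := hpow (by omega)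
    omega
  · simp only [stdPar]; omega
  · simp only [stdPar]; omega
  · simp only [stdPar]; omega
  · simp only [stdPar]
    calc (2 ^ rhoExp k s) ^ 4 * s ≤ Y ^ 4 * Y :=
          Nat.mul_le_mul (Nat.pow_le_pow_left (by omega) 4) (by omega)
      _ = 2 ^ (10 * t) := by rw [hY, ← pow_succ, ← pow_mul]; congr 1; ring
      _ < 2 ^ b := Nat.pow_lt_pow_right (by norm_num) (by omega)
  · omega
  · omega


/-- The weight `β` is kept symbolic: `β = 0` isolates the coordinator and the messages, `β = 1` adds
the sites and the events at no more than `50` per item. The condition `W ≤ M` ensures `R J ≤ M` for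
the chosen `J`. -/
theorem totalVal_init_le {k s b : ℕ} {σ : List (Arrival k)} {β : ℝ≥0∞} (hβ : β ≤ 1)
    (hΓ : (stdPar k s b).Std) (hM : totalWeight σ ≤ 2 ^ (b / 8))
    (hQ : s * totalWeight σ < 2 ^ b) (hσ : σ ≠ []) (hW : 1 ≤ totalWeight σ)
    (hx : ∀ x ∈ σ, 1 ≤ x.weight ∧ x.ident < 2 ^ b) :
    totalVal protocol b 1 β 0 (State.init k s b σ) ≤
      ENNReal.ofReal (totalCost k s (totalWeight σ) (2 ^ rhoExp k s : ℕ) (2 ^ lamExp s : ℕ)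
        (s + s / 2 ^ 2 ^ rhoExp k s * 2 ^ lamExp s : ℕ)
        (Nat.log (2 ^ rhoExp k s) (totalWeight σ) : ℕ)
        ((2 ^ rhoExp k s : ℕ) ^ Nat.log (2 ^ rhoExp k s) (totalWeight σ))
        ((2 ^ rhoExp k s : ℕ) ^ (Nat.log (2 ^ rhoExp k s) (totalWeight σ) + 1))) +
        50 * β * σ.length := by
  set W := totalWeight σ with hWdef
  set Γ := stdPar k s b with hΓdef
  have h1 := stream_spec (Γ := Γ) (σ := σ) (α := 1) (β := β) (F := 0) (fend := fun _ => 0) hΓ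
    (fun g _ _ => zero_le) (by simp) (ne_top_of_le_ne_top ENNReal.one_ne_top hβ)
    (fun _ _ _ _ _ => le_rfl) hσ hx hQ
  simp only [add_zero] at h1
  set J := Nat.log (2 ^ rhoExp k s) W with hJ
  have h2 := streamVal_epochs_le hΓ.toOk (J := J)
    ((Nat.pow_log_le_self (2 ^ rhoExp k s) (by omega)).trans hM) (Γ.gain 1) (Γ.epochCost 1 β) σ
  have h3 : Γ.epochCost 1 β ≤ 1800 * Γ.D + 130 * s + 33 * k := by
    unfold Par.epochCost Par.gain Par.bcCost
    calc _ ≤ 1800 * 1 * (Γ.D : ℝ≥0∞) + (130 * Γ.s : ℕ) * 1 + ((30 * Γ.k : ℕ) * 1 + Γ.k * 1 +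
          2 * Γ.k * 1) := by gcongr
      _ = 1800 * (Γ.D : ℝ≥0∞) + 130 * (Γ.s : ℕ) + 33 * (Γ.k : ℕ) := by push_cast; ring
      _ = _ := rfl
  refine h1.trans ?_
  rw [add_right_comm]
  refine add_le_add ?_ le_rfl
  have hρ0 : ((2 ^ rhoExp k s : ℕ) : NNReal) ≠ 0 := by simp
  have h4 : ENNReal.ofReal (totalCost k s W (2 ^ rhoExp k s : ℕ) (2 ^ lamExp s : ℕ)
      (s + s / 2 ^ 2 ^ rhoExp k s * 2 ^ lamExp s : ℕ) J ((2 ^ rhoExp k s : ℕ) ^ J)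
      ((2 ^ rhoExp k s : ℕ) ^ (J + 1))) =
      (200 * (s + Γ.ρ + Γ.lam) + 610 : ℕ) * 1 + (Γ.gain 1 * (3 * Γ.ρ ^ 2 * J +
        2 * W * ((Γ.R J : ℕ) : ℝ≥0∞)⁻¹) + (1800 * Γ.D + 130 * s + 33 * k) * (J + 4 * W *
          ((Γ.R (J + 1) : ℕ) : ℝ≥0∞)⁻¹)) := by
    have hreal : totalCost k s W (2 ^ rhoExp k s : ℕ) (2 ^ lamExp s : ℕ)
      (s + s / 2 ^ 2 ^ rhoExp k s * 2 ^ lamExp s : ℕ) J ((2 ^ rhoExp k s : ℕ) ^ J)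
      ((2 ^ rhoExp k s : ℕ) ^ (J + 1)) = (((200 * (s + Γ.ρ + Γ.lam) + 610 : ℕ) * 1 +
        (1800 * Γ.D * (3 * Γ.ρ ^ 2 * J + 2 * W * (Γ.R J : NNReal)⁻¹) +
        (1800 * Γ.D + 130 * s + 33 * k) * (J + 4 * W * (Γ.R (J + 1) : NNReal)⁻¹)) : NNReal) : ℝ) := by
      simp only [totalCost, Par.R, Par.D, hΓdef, stdPar]
      push_cast
      ring
    rw [hreal, ENNReal.ofReal_coe_nnreal]
    have hR : ∀ j, (Γ.R j : NNReal) ≠ 0 := fun j => by exact_mod_cast (hΓ.toOk.R_pos j).ne'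
    unfold Par.gain
    push_cast [ENNReal.coe_inv (hR _)]
    ring
  rw [h4]
  refine add_le_add le_rfl (h2.trans (add_le_add le_rfl ?_))
  gcongr

end DistSampling
end

open DistSampling Filter

theorem corollary2p2 :
    ∃ (P : Protocol) (c C : ℕ), ∀ (k s b : ℕ) (σ : List (Arrival k)), 1 ≤ s → σ ≠ [] →
      (∀ a ∈ σ, 1 ≤ a.weight ∧ a.ident < 2 ^ b) →
      (2 * k * s * σ.length * totalWeight σ) ^ c ≤ 2 ^ b →
      -- the coordinator's sample is a weighted random sample with replacement of size `s`
      (∀ x : Fin s → ℕ × ℕ,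
        Tendsto (fun N => (run P s b σ N).toOuterMeasure {g | g.Done ∧ g.sample P s = x})
          atTop (𝓝 (swrProb σ s x))) ∧
      -- the coordinator uses at most `C * s` words and each site at most `C` words, at all times
      (∀ N, ∀ g ∈ (run P s b σ N).support,
        (∀ a, C * s ≤ a → g.mem none a = 0) ∧
        (∀ (i : Fin k) (a : ℕ), C ≤ a → g.mem (some i) a = 0)) ∧
      -- expected number of messages, expected total time of the coordinator, and expected time of
      -- the sites, amortized over the items
      (2 ≤ totalWeight σ → ∀ N,
        expect (run P s b σ N) (fun g => (g.sent : ℝ≥0∞)) ≤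
          ENNReal.ofReal (C * messageBound k s (totalWeight σ)) ∧
        expect (run P s b σ N) (fun g => (g.time none : ℝ≥0∞)) ≤
          ENNReal.ofReal (C * messageBound k s (totalWeight σ)) ∧
        expect (run P s b σ N) (fun g => ((∑ i : Fin k, g.time (some i) : ℕ) : ℝ≥0∞)) / σ.length ≤
          ENNReal.ofReal
            (C * (1 + 1 / (σ.length : ℝ) * messageBound k s (totalWeight σ)))) := by
  -- The constant `4000000` is that of `totalCost_le`; it also dominates the memory bounds `64 + 5 *
  -- s` and `64`, as well as the `50` steps per item.
  refine ⟨protocol, 32, 4000000, fun k s b σ hs hσ hx hb => ?_⟩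
  obtain ⟨x₀, σ', hcons⟩ := List.exists_cons_of_ne_nil hσ
  have hk : 1 ≤ k := by have := x₀.site.2; omega
  have hn : 1 ≤ σ.length := List.length_pos_iff.2 hσ
  have hW : 1 ≤ totalWeight σ := by
    have h1 := (hx x₀ (by simp [hcons])).1
    have h2 : totalWeight σ = x₀.weight + totalWeight σ' := by simp [totalWeight, hcons]
    omega
  obtain ⟨hΓ, hM, hQ⟩ := stdPar_spec hk hs hn hW hb
  have hval := fun (β : ℝ≥0∞) (hβ : β ≤ 1) => totalVal_init_le hβ hΓ hM hQ hσ hW hx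
  refine ⟨fun x => ?_, fun N g hg => ?_, fun hW2 N => ?_⟩
  · exact sample_tendsto hΓ hσ hx hQ (Nat.two_pow_pos _) hW
      (ENNReal.add_ne_top.2 ⟨ENNReal.ofReal_ne_top, by simp [ENNReal.mul_eq_top]⟩) (hval 1 le_rfl) x
  · obtain ⟨h1, h2⟩ := memory_bound hΓ hσ hx hQ N hg
    exact ⟨fun a ha => h1 a (by simp only [stdPar]; omega), fun i a ha => h2 i a (by omega)⟩
  · have hcost := ENNReal.ofReal_le_ofReal (totalCost_le_messageBound hk hs hW2)
    have hrun : ∀ β ≤ 1, expect (run protocol s b σ N) (expense 1 β) ≤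
        ENNReal.ofReal (4000000 * messageBound k s (totalWeight σ)) + 50 * β * σ.length := by
      intro β hβ
      refine (expect_expense_le protocol s b σ 1 β N).trans ?_
      refine (le_iSup (fun N => val protocol b 1 β 0 N (State.init k s b σ)) N).trans ?_
      exact (hval β hβ).trans (add_le_add hcost le_rfl)
    -- With `β = 0` neither sites nor events are charged, so the bound has no term proportional to
    -- the number of items.
    have h0 := hrun 0 zero_le
    simp only [mul_zero, zero_mul, add_zero] at h0
    push_cast
    refine ⟨(expect_mono _ fun g => ?_).trans h0, (expect_mono _ fun g => ?_).trans h0, ?_⟩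
    · unfold expense
      rw [one_mul, one_mul]
      exact le_add_left le_rfl
    · unfold expense
      rw [one_mul, one_mul, zero_mul, add_zero]
      exact le_add_right le_rfl
    · have h1 := hrun 1 le_rfl
      have hn' : (0 : ℝ) < σ.length := by exact_mod_cast hn
      have hmb : 0 ≤ messageBound k s (totalWeight σ) := by
        have h2 := log_ratio_pos (k := k) hs
        have h3 := (Nat.cast_nonneg k).trans (le_base_left (k := k) hs)
        have h4 : 0 ≤ Real.log (totalWeight σ) := Real.log_nonneg (by exact_mod_cast hW)
        exact mul_nonneg h3 (div_nonneg h4 h2.le)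
      have h2 : ENNReal.ofReal (4000000 * messageBound k s (totalWeight σ)) + 50 * 1 * σ.length =
          ENNReal.ofReal (4000000 * messageBound k s (totalWeight σ) + 50 * σ.length) := by
        rw [ENNReal.ofReal_add (by positivity) (by positivity), ENNReal.ofReal_mul (p := 50)
          (by norm_num), ENNReal.ofReal_natCast]
        norm_num
      rw [h2] at h1
      calc _ ≤ ENNReal.ofReal (4000000 * messageBound k s (totalWeight σ) + 50 * σ.length) /
            ENNReal.ofReal σ.length := by
            rw [ENNReal.ofReal_natCast]
            refine ENNReal.div_le_div_right (le_trans (expect_mono _ fun g => ?_) h1) _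
            unfold expense
            rw [one_mul, one_mul, one_mul]
            push_cast
            exact le_add_right (le_add_left le_rfl)
        _ = ENNReal.ofReal ((4000000 * messageBound k s (totalWeight σ) + 50 * σ.length) /
            σ.length) := (ENNReal.ofReal_div_of_pos hn').symm
        _ ≤ _ := by
            refine ENNReal.ofReal_le_ofReal ?_
            rw [add_div, mul_div_assoc, mul_div_assoc, div_self hn'.ne', div_eq_inv_mul, one_div]
            nlinarith
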